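/- **Setting.** Let $A$ be a finite alphabet with $|A|\ge 2$. A *right ideal* of $A^*$ is a set $R\subseteq A^*$ with $RA^*\subseteq R$; it is *essential* if it meets every non-empty right ideal. A *right-ideal isomorphism* is a bijection $\varphi:R_1\to R_2$ between right ideals with $\varphi(ux)=\varphi(u)x$ for all $u\in R_1$, $x\in A^*$. Let $\varphi: PA^*\to QA^*$ be an isomorphism between essential right ideals, where $P,Q$ are finite maximal prefix codes. Its *table* is the finite set $\{(p,\varphi(p)):p\in P\}$. Its *maximum extension* $\max\varphi$ is the greatest right-ideal isomorphism extending it. *Thompson's group* $V$ consists of the maximal (that is, not properly extendable) isomorphisms between finitely generated essential right ideals of $\{a,b\}^*$, with product $\varphi\cdot\psi=\max(\varphi\circ\psi)$ ($\psi$ is applied first). A finite sequence of such isomorphisms is *described* by a string in which each table is written as a sequence of slots closed by a bar. Each slot either holds one entry $u,v;$ of the table, where each of the two words may be followed by blanks, or is empty (blanks only, then ";"). Every entry of the table occurs in exactly one slot, in any order. Symbols are coded by bit blocks of a fixed length. Input lengths $n$ below are lengths of such bit strings. $\mathrm{AC}^k$ is the class of problems solved by log-space uniform families $(C_n)_n$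 of acyclic Boolean circuits with gates of unbounded fan-in, where $C_n$ handles the inputs of length $n$, has size polynomial in $n$, and has depth $O((\log n)^k)$. $\mathrm{DSpace}(s(n))$ is the class of languages decided by deterministic Turing machines, with a read-only input tape, in work space $O(s(n))$. **Theorem.** 1. For every finite alphabet $A$ with $|A|\ge2$, the composition problem is in $\mathrm{AC}^0$. Its input is a description of a pair $(\varphi,\psi)$ of isomorphisms $\varphi:P_1A^*\to Q_1A^*$ and $\psi:P_2A^*\to Q_2A^*$ between essential right ideals of $A^*$, with $P_1,Q_1,P_2,Q_2$ finite maximal prefix codes. Its output is a description of the composite $\psi\circ\varphi$ (as a partial map, $\varphi$ applied first, without extension). 2. The word problem of $V$ is in $\mathrm{AC}^1$. This is the set of all descriptions of sequences $(\psi_1,\dots,\psi_m)$, $m\ge 0$ variable, of isomorphisms between finitely generated essential right ideals of $\{a,b\}^*$, such that the product $\psi_1\cdots\psi_m$ of the elements of $V$ represented by the $\psi_i$ is the identity. 3. The word problem of $V$ is in $\mathrm{DSpace}((\log n)^2)$. -/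

import Mathlib

namespace Thompson

/-! ### Right ideals and prefix codes of the free monoid of words -/

section Words

variable {A : Type}

/-- A right ideal of the monoid of words over `A`. -/
def IsRightIdeal (R : Set (List A)) : Prop :=
  ∀ u ∈ R, ∀ x : List A, u ++ x ∈ R

/-- A right ideal that meets every (non-empty) right ideal. -/
def IsEssential (R : Set (List A)) : Prop :=
  IsRightIdeal R ∧ ∀ J : Set (List A), IsRightIdeal J → J.Nonempty → (R ∩ J).Nonempty

/-- No element is a strict prefix of another element. -/
def IsPrefixCode (P : Set (List A)) : Prop :=
  ∀ u ∈ P, ∀ v ∈ P, u <+: v → u = v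

/-- A prefix code that is not a strict subset of another prefix code. -/
def IsMaximalPrefixCode (P : Set (List A)) : Prop :=
  IsPrefixCode P ∧ ∀ Q : Set (List A), IsPrefixCode Q → P ⊆ Q → Q = P

/-- The right ideal `P A^*` generated by `P`. -/
def ideal (P : Set (List A)) : Set (List A) :=
  {w | ∃ p ∈ P, ∃ x : List A, w = p ++ x}

/-- Generated, as a right ideal, by a finite set. -/
def IsFinGen (R : Set (List A)) : Prop :=
  ∃ P : Set (List A), P.Finite ∧ R = ideal P

/-- The domain of a partial injection. -/
def dom (f : List A ≃. List A) : Set (List A) := {u | ∃ v, v ∈ f u}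

/-- The range of a partial injection. -/
def ran (f : List A ≃. List A) : Set (List A) := {v | ∃ u, v ∈ f u}

/-- Right-ideal isomorphisms, as partial injections of the set of words:
`φ (u x) = φ (u) x` for `u` in the domain and every word `x`.
The domain and the range are then right ideals (`IsIdealIso.dom`, `IsIdealIso.ran`). -/
def IsIdealIso (f : List A ≃. List A) : Prop :=
  ∀ u v x : List A, v ∈ f u → v ++ x ∈ f (u ++ x)

theorem IsIdealIso.dom {f : List A ≃. List A} (hf : IsIdealIso f) : IsRightIdeal (dom f) :=
  fun _ ⟨v, hv⟩ x => ⟨v ++ x, hf _ _ _ hv⟩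

theorem IsIdealIso.ran {f : List A ≃. List A} (hf : IsIdealIso f) : IsRightIdeal (ran f) :=
  fun _ ⟨u, hu⟩ x => ⟨u ++ x, hf _ _ _ hu⟩

theorem isRightIdeal_ideal (P : Set (List A)) : IsRightIdeal (ideal P) := by
  rintro _ ⟨p, hp, y, rfl⟩ x
  exact ⟨p, hp, y ++ x, by simp⟩

theorem isEssential_iff (R : Set (List A)) :
    IsEssential R ↔ IsRightIdeal R ∧ ∀ u, ∃ x, u ++ x ∈ R := by
  constructor
  · rintro ⟨h, h'⟩
    refine ⟨h, fun u => ?_⟩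
    obtain ⟨w, hw, p, hp, x, rfl⟩ := h' (ideal {u}) (isRightIdeal_ideal _) ⟨u, u, rfl, [], by simp⟩
    obtain rfl : p = u := hp
    exact ⟨x, hw⟩
  · rintro ⟨h, h'⟩
    refine ⟨h, fun J hJ ⟨u, hu⟩ => ?_⟩
    obtain ⟨x, hx⟩ := h' u
    exact ⟨_, hx, hJ u hu x⟩

/-- An intersection of finitely generated right ideals is finitely generated. -/
theorem IsFinGen.inter {R S : Set (List A)} (hR : IsFinGen R) (hS : IsFinGen S) :
    IsFinGen (R ∩ S) := by
  obtain ⟨P, hP, rfl⟩ := hR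
  obtain ⟨Q, hQ, rfl⟩ := hS
  refine ⟨(P ∪ Q) ∩ (ideal P ∩ ideal Q), (hP.union hQ).inter_of_left _, ?_⟩
  ext w
  constructor
  · rintro ⟨⟨p, hp, x, rfl⟩, ⟨q, hq, y, hy⟩⟩
    rcases List.append_eq_append_iff.1 hy with ⟨z, rfl, rfl⟩ | ⟨z, rfl, rfl⟩
    · exact ⟨p ++ z, ⟨Or.inr hq, ⟨p, hp, z, rfl⟩, ⟨_, hq, [], by simp⟩⟩, y, by simp⟩
    · exact ⟨q ++ z, ⟨Or.inl hp, ⟨_, hp, [], by simp⟩, ⟨q, hq, z, rfl⟩⟩, x, by simp⟩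
  · rintro ⟨p, ⟨-, h1, h2⟩, x, rfl⟩
    exact ⟨isRightIdeal_ideal _ _ h1 _, isRightIdeal_ideal _ _ h2 _⟩

/-- A right ideal that contains a finitely generated essential right ideal is finitely
generated, over a finite alphabet. -/
theorem IsFinGen.mono [Finite A] {R S : Set (List A)} (hR : IsFinGen R) (hE : IsEssential R)
    (hS : IsRightIdeal S) (hRS : R ⊆ S) : IsFinGen S := by
  obtain ⟨P, hP, rfl⟩ := hR
  obtain ⟨L, hL⟩ : ∃ L, ∀ p ∈ P, p.length ≤ L := by
    obtain ⟨L, hL⟩ := (hP.image List.length).bddAbove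
    exact ⟨L, fun p hp => hL ⟨p, hp, rfl⟩⟩
  refine ⟨P ∪ (S ∩ {w | w.length ≤ L}),
    hP.union ((List.finite_length_le A L).subset Set.inter_subset_right), ?_⟩
  ext w
  constructor
  · intro hw
    by_cases h : w.length ≤ L
    · exact ⟨w, Or.inr ⟨hw, h⟩, [], by simp⟩
    · obtain ⟨x, p, hp, y, hy⟩ := ((isEssential_iff _).1 hE).2 w
      have hpl := hL p hp
      rcases List.append_eq_append_iff.1 hy with ⟨z, rfl, rfl⟩ | ⟨z, rfl, rfl⟩
      · simp at hpl; omega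
      · exact ⟨p, Or.inl hp, z, rfl⟩
  · rintro ⟨p, hp | hp, x, rfl⟩
    · exact hS _ (hRS ⟨p, hp, [], by simp⟩) _
    · exact hS _ hp.1 _

end Words

/-! ### Isomorphisms between finitely generated essential right ideals -/

/-- An isomorphism between finitely generated essential right ideals of the words over `A`. -/
structure EssIso (A : Type) where
  map : List A ≃. List A
  iso : IsIdealIso map
  ess_dom : IsEssential (dom map)
  ess_ran : IsEssential (ran map)
  fg_dom : IsFinGen (dom map)
  fg_ran : IsFinGen (ran map)

namespace EssIso

variable {A : Type}

theorem ext {f g : EssIso A} (h : f.map = g.map) : f = g := by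
  cases f; cases g; cases h; rfl

/-- The identity map of the set of words. -/
protected def id (A : Type) : EssIso A := by
  have h1 : dom (PEquiv.refl (List A)) = Set.univ :=
    Set.eq_univ_of_forall fun u => ⟨u, rfl⟩
  have h2 : ran (PEquiv.refl (List A)) = Set.univ :=
    Set.eq_univ_of_forall fun u => ⟨u, rfl⟩
  have h3 : IsEssential (Set.univ : Set (List A)) :=
    ⟨fun _ _ _ => Set.mem_univ _, fun J _ h => by simpa using h⟩
  have h4 : IsFinGen (Set.univ : Set (List A)) :=
    ⟨{[]}, Set.finite_singleton _,
      (Set.eq_univ_of_forall fun u => (⟨[], rfl, u, rfl⟩ : u ∈ ideal {[]})).symm⟩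
  exact
    { map := PEquiv.refl (List A)
      iso := by
        rintro u v x h
        have h' : u = v := by simpa using h
        subst h'
        simp
      ess_dom := h1 ▸ h3
      ess_ran := h2 ▸ h3
      fg_dom := h1 ▸ h4
      fg_ran := h2 ▸ h4 }

theorem dom_symm (f : List A ≃. List A) : dom f.symm = ran f := by
  ext u; simp [dom, ran, PEquiv.eq_some_iff]

theorem ran_symm (f : List A ≃. List A) : ran f.symm = dom f := by
  ext u; simp [dom, ran, PEquiv.eq_some_iff]

/-- The inverse isomorphism. -/
def inv (f : EssIso A) : EssIso A where
  map := f.map.symm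
  iso u v x h := (f.map.mem_iff_mem).2 (f.iso _ _ _ ((f.map.mem_iff_mem).1 h))
  ess_dom := by rw [dom_symm]; exact f.ess_ran
  ess_ran := by rw [ran_symm]; exact f.ess_dom
  fg_dom := by rw [dom_symm]; exact f.fg_ran
  fg_ran := by rw [ran_symm]; exact f.fg_dom

theorem trans_iso {f g : List A ≃. List A} (hf : IsIdealIso f) (hg : IsIdealIso g) :
    IsIdealIso (f.trans g) := by
  intro u w x h
  obtain ⟨v, hv, hw⟩ := (PEquiv.mem_trans f g u w).1 h
  exact (PEquiv.mem_trans f g _ _).2 ⟨_, hf _ _ x hv, hg _ _ x hw⟩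

theorem trans_dom (f g : EssIso A) :
    IsEssential (dom (f.map.trans g.map)) ∧ IsFinGen (dom (f.map.trans g.map)) := by
  have hmem : ∀ u, u ∈ dom (f.map.trans g.map) ↔ ∃ v, v ∈ f.map u ∧ v ∈ dom g.map := by
    intro u
    constructor
    · rintro ⟨w, hw⟩
      obtain ⟨v, hv, hw⟩ := (PEquiv.mem_trans _ _ _ _).1 hw
      exact ⟨v, hv, w, hw⟩
    · rintro ⟨v, hv, w, hw⟩
      exact ⟨w, (PEquiv.mem_trans _ _ _ _).2 ⟨v, hv, hw⟩⟩
  constructor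
  · refine (isEssential_iff _).2 ⟨(trans_iso f.iso g.iso).dom, fun u => ?_⟩
    obtain ⟨x, v, hv⟩ := ((isEssential_iff _).1 f.ess_dom).2 u
    obtain ⟨y, hy⟩ := ((isEssential_iff _).1 g.ess_dom).2 v
    refine ⟨x ++ y, (hmem _).2 ⟨v ++ y, ?_, hy⟩⟩
    rw [← List.append_assoc]
    exact f.iso _ _ y hv
  · obtain ⟨P, hP, hPe⟩ := f.fg_ran.inter g.fg_dom
    refine ⟨{u | ∃ p ∈ P, p ∈ f.map u}, ?_, ?_⟩
    · refine Set.Finite.subset (hP.image fun p => (f.map.symm p).getD []) ?_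
      rintro u ⟨p, hp, hu⟩
      refine ⟨p, hp, ?_⟩
      have : f.map.symm p = some u := (f.map.mem_iff_mem).2 hu
      simp [this]
    · ext u
      constructor
      · intro hu
        obtain ⟨v, hv, hvg⟩ := (hmem u).1 hu
        have hv' : v ∈ ran f.map ∩ dom g.map := ⟨⟨u, hv⟩, hvg⟩
        rw [hPe] at hv'
        obtain ⟨p, hp, x, rfl⟩ := hv'
        have hp' : p ∈ ran f.map ∩ dom g.map := by
          rw [hPe]; exact ⟨p, hp, [], by simp⟩
        obtain ⟨⟨u', hu'⟩, -⟩ := hp'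
        exact ⟨u', ⟨p, hp, hu'⟩, x, f.map.inj hv (f.iso _ _ x hu')⟩
      · rintro ⟨u', ⟨p, hp, hu'⟩, x, rfl⟩
        have hp' : p ∈ ran f.map ∩ dom g.map := by
          rw [hPe]; exact ⟨p, hp, [], by simp⟩
        exact (trans_iso f.iso g.iso).dom _ ((hmem _).2 ⟨p, hu', hp'.2⟩) x

theorem trans_ran (f g : EssIso A) :
    IsEssential (ran (f.map.trans g.map)) ∧ IsFinGen (ran (f.map.trans g.map)) := by
  have h : ran (f.map.trans g.map) = dom (g.inv.map.trans f.inv.map) := by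
    rw [← dom_symm, PEquiv.symm_trans_rev]; rfl
  rw [h]
  exact trans_dom _ _

/-- The composite `g ∘ f` of partial maps (`f` is applied first), without any extension. -/
def comp (g f : EssIso A) : EssIso A where
  map := f.map.trans g.map
  iso := trans_iso f.iso g.iso
  ess_dom := (trans_dom f g).1
  ess_ran := (trans_ran f g).1
  fg_dom := (trans_dom f g).2
  fg_ran := (trans_ran f g).2

/-- The graph of the union of all extensions of `f` (see `isGreatest_maxMap`). -/
def MaxRel (f : EssIso A) (u v : List A) : Prop :=
  ∀ x, u ++ x ∈ dom f.map ∨ v ++ x ∈ ran f.map → v ++ x ∈ f.map (u ++ x)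

theorem MaxRel.fun_unique {f : EssIso A} {u v w : List A} (h : f.MaxRel u v)
    (h' : f.MaxRel u w) : v = w := by
  obtain ⟨x, hx⟩ := ((isEssential_iff _).1 f.ess_dom).2 u
  exact List.append_cancel_right (Option.mem_unique (h x (Or.inl hx)) (h' x (Or.inl hx)))

theorem MaxRel.inv_unique {f : EssIso A} {u u' v : List A} (h : f.MaxRel u v)
    (h' : f.MaxRel u' v) : u = u' := by
  obtain ⟨x, hx⟩ := ((isEssential_iff _).1 f.ess_ran).2 v
  exact List.append_cancel_right (f.map.inj (h x (Or.inr hx)) (h' x (Or.inr hx)))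

open Classical in
/-- The underlying partial injection of the maximum extension. -/
noncomputable def maxMap (f : EssIso A) : List A ≃. List A where
  toFun u := if h : ∃ v, f.MaxRel u v then some h.choose else none
  invFun v := if h : ∃ u, f.MaxRel u v then some h.choose else none
  inv u v := by
    constructor
    · intro h
      split_ifs at h with h1
      have h2 : f.MaxRel u v := by
        have := h1.choose_spec
        rwa [Option.some.inj h] at this
      have h3 : ∃ w, f.MaxRel u w := ⟨v, h2⟩
      rw [dif_pos h3, h3.choose_spec.fun_unique h2]
    · intro h
      split_ifs at h with h1
      have h2 : f.MaxRel u v := by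
        have := h1.choose_spec
        rwa [Option.some.inj h] at this
      have h3 : ∃ w, f.MaxRel w v := ⟨u, h2⟩
      rw [dif_pos h3, h3.choose_spec.inv_unique h2]

theorem mem_maxMap {f : EssIso A} {u v : List A} : v ∈ f.maxMap u ↔ f.MaxRel u v := by
  classical
  change (if h : ∃ v, f.MaxRel u v then some h.choose else none) = some v ↔ _
  constructor
  · intro h
    split_ifs at h with h1
    have := h1.choose_spec
    rwa [Option.some.inj h] at this
  · intro h
    have h3 : ∃ w, f.MaxRel u w := ⟨v, h⟩
    rw [dif_pos h3, h3.choose_spec.fun_unique h]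

/-- `maxMap f` is the maximum extension of `f`: the greatest right-ideal isomorphism that
extends `f` (`≤` between partial injections means that the second extends the first). -/
theorem isGreatest_maxMap (f : EssIso A) :
    IsGreatest {g : List A ≃. List A | IsIdealIso g ∧ f.map ≤ g} f.maxMap := by
  refine ⟨⟨?_, ?_⟩, ?_⟩
  · intro u v x h
    rw [mem_maxMap] at h ⊢
    intro y hy
    have := h (x ++ y)
    simp only [← List.append_assoc] at this
    exact this hy
  · refine PEquiv.le_def.2 fun u v h => mem_maxMap.2 fun x _ => f.iso _ _ x h
  · rintro g ⟨hg, hfg⟩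
    refine PEquiv.le_def.2 fun u v h => mem_maxMap.2 fun x hx => ?_
    have h1 := hg _ _ x h
    rcases hx with ⟨w, hw⟩ | ⟨w, hw⟩
    · have h2 := PEquiv.le_def.1 hfg _ _ hw
      rwa [Option.mem_unique h1 h2]
    · have h2 := PEquiv.le_def.1 hfg _ _ hw
      rwa [g.inj h1 h2]

theorem dom_mono {f g : List A ≃. List A} (h : f ≤ g) : dom f ⊆ dom g :=
  fun _ ⟨v, hv⟩ => ⟨v, PEquiv.le_def.1 h _ _ hv⟩

theorem ran_mono {f g : List A ≃. List A} (h : f ≤ g) : ran f ⊆ ran g :=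
  fun _ ⟨v, hv⟩ => ⟨v, PEquiv.le_def.1 h _ _ hv⟩

theorem _root_.Thompson.IsEssential.mono {R S : Set (List A)} (hR : IsEssential R)
    (hS : IsRightIdeal S) (h : R ⊆ S) : IsEssential S :=
  ⟨hS, fun J hJ hn => (hR.2 J hJ hn).mono (Set.inter_subset_inter_left _ h)⟩

/-- The maximum extension of an isomorphism between finitely generated essential right ideals. -/
noncomputable def max [Finite A] (f : EssIso A) : EssIso A where
  map := f.maxMap
  iso := (isGreatest_maxMap f).1.1
  ess_dom := f.ess_dom.mono (isGreatest_maxMap f).1.1.dom (dom_mono (isGreatest_maxMap f).1.2)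
  ess_ran := f.ess_ran.mono (isGreatest_maxMap f).1.1.ran (ran_mono (isGreatest_maxMap f).1.2)
  fg_dom := f.fg_dom.mono f.ess_dom (isGreatest_maxMap f).1.1.dom
    (dom_mono (isGreatest_maxMap f).1.2)
  fg_ran := f.fg_ran.mono f.ess_ran (isGreatest_maxMap f).1.1.ran
    (ran_mono (isGreatest_maxMap f).1.2)

/-- `f` has no strict extension. -/
def IsMaximal (f : EssIso A) : Prop :=
  ∀ g : List A ≃. List A, IsIdealIso g → f.map ≤ g → g = f.map

section

variable [Finite A]

theorem isMaximal_max (f : EssIso A) : f.max.IsMaximal := fun g hg h =>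
  le_antisymm ((isGreatest_maxMap f).2 ⟨hg, (isGreatest_maxMap f).1.2.trans h⟩) h

theorem le_max (f : EssIso A) : f.map ≤ f.max.map := (isGreatest_maxMap f).1.2

theorem IsMaximal.max_eq {f : EssIso A} (h : f.IsMaximal) : f.max = f :=
  ext (h _ f.max.iso f.le_max)

theorem max_eq_of_le {f g : EssIso A} (h : f.map ≤ g.map) : f.max = g.max :=
  ext (g.isMaximal_max f.max.map f.max.iso
    ((isGreatest_maxMap f).2 ⟨g.max.iso, h.trans g.le_max⟩))

end

theorem comp_mono {f f' g g' : EssIso A} (h : f.map ≤ f'.map) (h' : g.map ≤ g'.map) :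
    (f.comp g).map ≤ (f'.comp g').map := by
  refine PEquiv.le_def.2 fun u w hw => ?_
  obtain ⟨v, hv, hw⟩ := (PEquiv.mem_trans _ _ _ _).1 hw
  exact (PEquiv.mem_trans _ _ _ _).2 ⟨v, PEquiv.le_def.1 h' _ _ hv, PEquiv.le_def.1 h _ _ hw⟩

theorem isMaximal_id : (EssIso.id A).IsMaximal := fun _ _ h =>
  le_antisymm (PEquiv.le_def.2 fun u v hv => by
    have h1 := PEquiv.le_def.1 h u u rfl
    obtain rfl := Option.mem_unique h1 hv
    exact rfl) h

theorem IsMaximal.inv {f : EssIso A} (h : f.IsMaximal) : f.inv.IsMaximal := fun g hg hle => by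
  have h1 : g.symm = f.map := by
    refine h g.symm (fun u v x hx => (g.mem_iff_mem).2 (hg _ _ _ ((g.mem_iff_mem).1 hx))) ?_
    refine PEquiv.le_def.2 fun u v hv => (g.mem_iff_mem).2 ?_
    exact PEquiv.le_def.1 hle _ _ ((f.map.mem_iff_mem).2 hv)
  change g = f.map.symm
  rw [← h1, PEquiv.symm_symm]

end EssIso

/-- The Higman-Thompson group of all maximal isomorphisms between finitely generated essential
right ideals of the words over `A`. -/
def MaxIso (A : Type) [Finite A] : Type := {f : EssIso A // f.IsMaximal}

/-- The element of the group that is represented by a (not necessarily maximal) isomorphism. -/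
noncomputable def EssIso.toMaxIso {A : Type} [Finite A] (f : EssIso A) : MaxIso A :=
  ⟨f.max, f.isMaximal_max⟩

/-- The product of `f` and `g` is the maximum extension of `f ∘ g` (`g` is applied first). -/
noncomputable instance (A : Type) [Finite A] : Group (MaxIso A) where
  mul f g := (f.1.comp g.1).toMaxIso
  one := ⟨EssIso.id A, EssIso.isMaximal_id⟩
  inv f := ⟨f.1.inv, f.2.inv⟩
  mul_assoc f g h := by
    refine Subtype.ext ?_
    change ((f.1.comp g.1).max.comp h.1).max = (f.1.comp (g.1.comp h.1).max).max
    rw [← EssIso.max_eq_of_le (EssIso.comp_mono (EssIso.le_max (f.1.comp g.1)) (le_refl h.1.map)),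
      ← EssIso.max_eq_of_le (EssIso.comp_mono (le_refl f.1.map) (EssIso.le_max (g.1.comp h.1)))]
    exact congrArg EssIso.max (EssIso.ext (PEquiv.trans_assoc _ _ _).symm)
  one_mul f := by
    refine Subtype.ext ?_
    change ((EssIso.id A).comp f.1).max = f.1
    rw [show (EssIso.id A).comp f.1 = f.1 from EssIso.ext (PEquiv.trans_refl _), f.2.max_eq]
  mul_one f := by
    refine Subtype.ext ?_
    change (f.1.comp (EssIso.id A)).max = f.1
    rw [show f.1.comp (EssIso.id A) = f.1 from EssIso.ext (PEquiv.refl_trans _), f.2.max_eq]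
  inv_mul_cancel f := by
    refine Subtype.ext ?_
    change (f.1.inv.comp f.1).max = EssIso.id A
    rw [← (EssIso.isMaximal_id (A := A)).max_eq]
    refine EssIso.max_eq_of_le (PEquiv.le_def.2 fun u w hw => ?_)
    obtain ⟨v, hv, hw⟩ := (PEquiv.mem_trans _ _ _ _).1 hw
    obtain rfl := f.1.map.inj hv ((f.1.map.mem_iff_mem).1 hw)
    exact rfl

/-- The Thompson group `V`, over the two-letter alphabet (`a = 0`, `b = 1`). -/
abbrev V : Type := MaxIso (Fin 2)

/-! ### Tables, and their representation by strings -/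

/-- `l` lists, in some order and without repetition, the table `{(p, φ(p)) : p ∈ P}` of `f`,
where `P` is the maximal prefix code with `dom f = P A^*`. -/
def IsTable {A : Type} (l : List (List A × List A)) (f : EssIso A) : Prop :=
  l.Nodup ∧ ∃ P : Set (List A), IsMaximalPrefixCode P ∧ dom f.map = ideal P ∧
    ∀ u v, (u, v) ∈ l ↔ u ∈ P ∧ v ∈ f.map u

/-- The symbols used to write tables over an alphabet of `q` letters. -/
inductive Symb (q : ℕ) : Type
  | letter (i : Fin q)
  | blank
  | comma
  | semi
  | bar

/-- The number of a symbol, less than `q + 4`. -/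
def Symb.code {q : ℕ} : Symb q → ℕ
  | .letter i => i
  | .blank => q
  | .comma => q + 1
  | .semi => q + 2
  | .bar => q + 3

/-- Symbols are written in binary as blocks of length `q + 4` (one-hot). -/
def Symb.bits {q : ℕ} (s : Symb q) : List Bool :=
  (List.range (q + 4)).map fun j => decide (j = s.code)

/-- The binary form of a string of symbols. -/
def toBits {q : ℕ} (s : List (Symb q)) : List Bool := s.flatMap Symb.bits

/-- `s` is the word `w`, followed by any number of blanks. -/
def WritesWord {q : ℕ} (s : List (Symb q)) (w : List (Fin q)) : Prop :=
  ∃ k, s = w.map Symb.letter ++ List.replicate k Symb.blank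

/-- `s` is a slot: either `u , v ;` for an entry `(u, v)` of a table, or empty (blanks and `;`). -/
def WritesSlot {q : ℕ} (s : List (Symb q)) : Option (List (Fin q) × List (Fin q)) → Prop
  | some (u, v) => ∃ s₁ s₂, WritesWord s₁ u ∧ WritesWord s₂ v ∧
      s = s₁ ++ [Symb.comma] ++ s₂ ++ [Symb.semi]
  | none => ∃ k, s = List.replicate k Symb.blank ++ [Symb.semi]

/-- `s` is a sequence of slots, closed by a bar, such that the non-empty slots list the table
of `f`. -/
def WritesTable {q : ℕ} (s : List (Symb q)) (f : EssIso (Fin q)) : Prop :=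
  ∃ (slots : List (Option (List (Fin q) × List (Fin q)))) (strs : List (List (Symb q))),
    IsTable slots.reduceOption f ∧ List.Forall₂ WritesSlot strs slots ∧
      s = strs.flatten ++ [Symb.bar]

/-- The bit string `x` is a description by finite tables of the sequence `fs`. -/
def Describes {q : ℕ} (x : List Bool) (fs : List (EssIso (Fin q))) : Prop :=
  ∃ strs : List (List (Symb q)), List.Forall₂ WritesTable strs fs ∧ x = toBits strs.flatten

/-- The composition problem, as the relation between inputs and correct outputs: if the input
describes `(φ, ψ)` then the output has to describe `ψ ∘ φ`. -/
def CompositionProblem (q : ℕ) (x y : List Bool) : Prop :=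
  ∀ φ ψ : EssIso (Fin q), Describes x [φ, ψ] → Describes y [ψ.comp φ]

/-- The word problem of `V`: the descriptions by finite tables of sequences `(ψ₁, …, ψₙ)` with
`ψ₁ ⋯ ψₙ = 1` in `V`. -/
def wordProblem : Set (List Bool) :=
  {x | ∃ ψs : List (EssIso (Fin 2)), Describes x ψs ∧
    (ψs.map fun ψ => (ψ.toMaxIso : V)).prod = 1}

end Thompson

/-! ### Space-bounded Turing machines and circuits -/

namespace Complexity

/-- The answer of a decision procedure for `L` on input `x`: one bit. -/
noncomputable def answer (L : Set (List Bool)) (x : List Bool) : List Bool :=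
  open Classical in [decide (x ∈ L)]

/-- Content of a cell of the input tape: an input symbol or one of the two end markers. -/
inductive InCell (α : Type) : Type
  | leftEnd
  | sym (a : α)
  | rightEnd

/-- Head movements. -/
inductive Move : Type
  | left
  | stay
  | right

/-- Deterministic Turing machines with a two-way read-only input tape (with end markers),
finitely many one-way infinite work tapes, and a one-way write-only output tape.
The transition function returns `none` to halt; otherwise it gives the new state, the move of
the input head, for each work tape the symbol to write and the move of the head, and possibly
an output symbol. -/
structure Machine (α β : Type) where
  State : Type
  finite_state : Finite State
  start : State
  tapes : ℕ
  Sym : Type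
  finite_sym : Finite Sym
  blank : Sym
  delta : State → InCell α → (Fin tapes → Sym) →
    Option (State × Move × (Fin tapes → Sym × Move) × Option β)

/-- Configurations of a machine; the cells of the work tapes are numbered from `0`. -/
structure Config {α β : Type} (M : Machine α β) where
  state : M.State
  inPos : ℕ
  work : Fin M.tapes → ℕ → M.Sym
  head : Fin M.tapes → ℕ
  out : List β

namespace Machine

variable {α β : Type} (M : Machine α β)

/-- The cells of the input tape: `0` and `x.length + 1` hold the end markers. -/
def inCell (x : List α) : ℕ → InCell α
  | 0 => .leftEnd
  | p + 1 => match x[p]? with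
    | some a => .sym a
    | none => .rightEnd

/-- The input head does not leave the cells `0, …, n + 1`. -/
def moveIn (n p : ℕ) : Move → ℕ
  | .left => p - 1
  | .stay => p
  | .right => min (p + 1) (n + 1)

/-- A work head stays at cell `0` when it is told to move left from there. -/
def moveWork (p : ℕ) : Move → ℕ
  | .left => p - 1
  | .stay => p
  | .right => p + 1

/-- The initial configuration. -/
def startConfig : Config M where
  state := M.start
  inPos := 0
  work := fun _ _ => M.blank
  head := fun _ => 0
  out := []

/-- The next configuration on input `x`, or `none` if the machine halts. -/
def next (x : List α) (c : Config M) : Option (Config M) :=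
  (M.delta c.state (inCell x c.inPos) fun i => c.work i (c.head i)).map fun r =>
    { state := r.1
      inPos := moveIn x.length c.inPos r.2.1
      work := fun i => Function.update (c.work i) (c.head i) (r.2.2.1 i).1
      head := fun i => moveWork (c.head i) (r.2.2.1 i).2
      out := c.out ++ r.2.2.2.toList }

/-- `c` occurs in the computation on input `x`. -/
def Reaches (x : List α) (c : Config M) : Prop :=
  Relation.ReflTransGen (fun c₁ c₂ => M.next x c₁ = some c₂) M.startConfig c

/-- On input `x` the machine halts with output `y`, and never visits more than the first `s`
cells of a work tape. -/
def OutputsInSpace (x : List α) (y : List β) (s : ℕ) : Prop :=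
  (∃ c, M.Reaches x c ∧ M.next x c = none ∧ c.out = y) ∧
    ∀ c, M.Reaches x c → ∀ i, c.head i < s

end Machine

/-- Functions computable by a deterministic Turing machine in work space `O(s(n))`, where `n` is
the input length. -/
def ComputableInSpace {α β : Type} (s : ℕ → ℕ) (f : List α → List β) : Prop :=
  ∃ (M : Machine α β) (c : ℕ), ∀ x, M.OutputsInSpace x (f x) (c * s x.length + c)

/-- The class `DSpace(s(n))`, of languages decidable in work space `O(s(n))`. -/
def DSpace (s : ℕ → ℕ) : Set (Set (List Bool)) :=
  {L | ComputableInSpace s (answer L)}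

/-- Gates of a circuit: input bits, negation, and conjunction and disjunction of unbounded
fan-in. The arguments of a gate are given by the numbers of gates. -/
inductive Gate : Type
  | input (i : ℕ)
  | not (j : ℕ)
  | and (js : List ℕ)
  | or (js : List ℕ)

/-- A boolean circuit: the list of its gates (numbered from `0`) and the list of the gates
whose values form the output. -/
structure Circuit where
  gates : List Gate
  outputs : List ℕ

/-- The gate can be number `k` of an acyclic circuit with `n` inputs: its arguments are earlier
gates. -/
def Gate.WellFormed (n k : ℕ) : Gate → Prop
  | .input i => i < n
  | .not j => j < k
  | .and js => ∀ j ∈ js, j < k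
  | .or js => ∀ j ∈ js, j < k

/-- The value of a gate, from the input and the values of the earlier gates. -/
def Gate.value (x vals : List Bool) : Gate → Bool
  | .input i => x.getD i false
  | .not j => !vals.getD j false
  | .and js => js.all fun j => vals.getD j false
  | .or js => js.any fun j => vals.getD j false

/-- The depth of a gate, from the depths of the earlier gates. -/
def Gate.depth (depths : List ℕ) : Gate → ℕ
  | .input _ => 0
  | .not j => depths.getD j 0 + 1
  | .and js => (js.map fun j => depths.getD j 0).foldr max 0 + 1
  | .or js => (js.map fun j => depths.getD j 0).foldr max 0 + 1

/-- The number of incoming wires of a gate. -/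
def Gate.fanIn : Gate → ℕ
  | .input _ => 0
  | .not _ => 1
  | .and js => js.length
  | .or js => js.length

namespace Circuit

/-- The circuit is acyclic, with `n` inputs. -/
def WellFormed (n : ℕ) (C : Circuit) : Prop :=
  (∀ (k : ℕ) (g : Gate), C.gates[k]? = some g → g.WellFormed n k) ∧ ∀ j ∈ C.outputs, j < C.gates.length

/-- The values of all gates on input `x`. -/
def values (C : Circuit) (x : List Bool) : List Bool :=
  C.gates.foldl (fun vals g => vals ++ [g.value x vals]) []

/-- The output on input `x`. -/
def eval (C : Circuit) (x : List Bool) : List Bool :=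
  C.outputs.map fun j => (C.values x).getD j false

/-- The depths of all gates. -/
def depths (C : Circuit) : List ℕ :=
  C.gates.foldl (fun ds g => ds ++ [g.depth ds]) []

/-- The length of a longest path. -/
def depth (C : Circuit) : ℕ := C.depths.foldr max 0

/-- The number of gates, wires and outputs. -/
def size (C : Circuit) : ℕ :=
  C.gates.length + (C.gates.map Gate.fanIn).sum + C.outputs.length

end Circuit

/-- Self-delimiting code of a number. -/
def encodeNat (k : ℕ) : List Bool := List.replicate k true ++ [false]

/-- Self-delimiting code of a list: each item is preceded by `true`, and `false` is the end. -/
def encodeList {α : Type} (e : α → List Bool) (l : List α) : List Bool :=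
  (l.flatMap fun a => true :: e a) ++ [false]

/-- Self-delimiting code of a gate. -/
def Gate.encode : Gate → List Bool
  | .input i => [false, false] ++ encodeNat i
  | .not j => [false, true] ++ encodeNat j
  | .and js => [true, false] ++ encodeList encodeNat js
  | .or js => [true, true] ++ encodeList encodeNat js

/-- The description of a circuit as a bit string. -/
def Circuit.encode (C : Circuit) : List Bool :=
  encodeList Gate.encode C.gates ++ encodeList encodeNat C.outputs

/-- Log-space uniformity: a deterministic Turing machine computes the description of the `n`-th
circuit from `n` in unary, in work space `O(log n)`. -/
def LogspaceUniform (C : ℕ → Circuit) : Prop :=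
  ComputableInSpace (fun n => Nat.log 2 n) fun x : List Unit => (C x.length).encode

/-- The problems in `AC^k`: `R x y` says that `y` is a correct output on input `x`. There are
log-space uniform circuits (one for each input length `n`) of unbounded fan-in, of size
polynomial in `n` and depth `O((log n)^k)`, which compute a correct output on every input. -/
def InAC (k : ℕ) (R : List Bool → List Bool → Prop) : Prop :=
  ∃ C : ℕ → Circuit, LogspaceUniform C ∧
    (∃ c : ℕ, ∀ n, (C n).WellFormed n ∧ (C n).size ≤ n ^ c + c ∧
      (C n).depth ≤ c * Nat.log 2 n ^ k + c) ∧
    ∀ x : List Bool, R x ((C x.length).eval x)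

/-- The decision problems (languages) in `AC^k`. -/
def AC (k : ℕ) : Set (Set (List Bool)) :=
  {L | InAC k fun x y => y = answer L x}

end Complexity

/-! The table of a composite is first-order definable from the two tables. Entries (p₁, q₁) of φ and
(p₂, q₂) of ψ contribute to ψ ∘ φ exactly if q₁ and p₂ are comparable for the prefix order: they
give (p₁, q₂ z) if q₁ = p₂ z, and (p₁ z, q₂) if p₂ = q₁ z with z non-empty
(`EssIso.entry_comp_iff`). Since the middle words come from prefix codes, the longer one determines
the shorter one. So an entry of the composite can inherit the number of the entry with the longer
middle word, and the slot positions of the input go on numbering all entries (`Lists.comp`). Nothing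
has to be counted or sorted. As the format tolerates blanks and empty slots, the output has slots of
one fixed width, and composition is in AC⁰.

For the word problem, the isomorphisms are multiplied along a balanced binary tree. Each level at
most doubles the lengths of words and creates no new entry numbers (`Level.step`), so after O(log n)
levels the tables still have polynomial size. Maximum extensions are never computed: the product is
1 if and only if the unextended composite is a restriction of the identity, and any table shows this
(`EssIso.toMaxIso_eq_one_iff`). One fixed definable operator on relations between polynomially
bounded numbers reads the tables and performs a level (`roundMap`, `exists_level`); O(log n)
iterations give AC¹. Well-formed inputs are recognised by a first-order condition as well
(`valid_iff`), because a table is a finite non-empty set of pairs whose two components run through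
prefix codes that branch completely (`IsTableSet`).

On the side of complexity, bounded first-order formulas become constant-depth layers of NOR gates
(`Definable`, `definable_of_extend`), and an iteration becomes a stack of copies of one network
(`exists_net_iter`). Uniformity holds because sizes and edges lie in `LF`, a class closed under
polynomially bounded primitive recursion; its members have register programs, which are compiled to
Turing machines with binary counters (`computableInSpace_of_exec`). For the space bound, a network
of depth O(log n) is evaluated depth first with a stack of O(log n) gate numbers of O(log n) bits
each (`Net.run_eval`, `mem_dspace_of_net`). -/

namespace Complexity

/-! ### A small programming language with registers -/

/-- Programs over natural-number registers, with access to the input head and the output tape. -/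
inductive Cmd (α β : Type) : Type
  | skip
  | inc (r : ℕ)
  | emit (b : β)
  | move (m : Move)
  | seq (c d : Cmd α β)
  | loop (r : ℕ) (c : Cmd α β)
  | whileIn (p : InCell α → Bool) (c : Cmd α β)

/-- States of a program: registers, position of the input head, and output. -/
structure PState (β : Type) where
  reg : ℕ → ℕ
  pos : ℕ
  out : List β

namespace PState

variable {β : Type}

theorem ext {σ τ : PState β} (h1 : ∀ i, σ.reg i = τ.reg i) (h2 : σ.pos = τ.pos)
    (h3 : σ.out = τ.out) : σ = τ := by
  cases σ; cases τ; simp only [mk.injEq]; exact ⟨funext h1, h2, h3⟩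

/-- Assign a value to a register. -/
def set (σ : PState β) (r v : ℕ) : PState β := { σ with reg := Function.update σ.reg r v }

@[simp] theorem set_pos (σ : PState β) (r v : ℕ) : (σ.set r v).pos = σ.pos := rfl
@[simp] theorem set_out (σ : PState β) (r v : ℕ) : (σ.set r v).out = σ.out := rfl
theorem set_reg (σ : PState β) (r v i : ℕ) :
    (σ.set r v).reg i = if i = r then v else σ.reg i := by
  simp [set, Function.update_apply]

theorem set_set (σ : PState β) (r v w : ℕ) : (σ.set r v).set r w = σ.set r w := by
  refine ext (fun i => ?_) rfl rfl
  simp only [set_reg]; split_ifs <;> rfl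

theorem set_self (σ : PState β) (r : ℕ) : σ.set r (σ.reg r) = σ := by
  refine ext (fun i => ?_) rfl rfl
  simp only [set_reg]; split_ifs with h <;> simp [h]

end PState

/-- Big-step semantics on input `x`; every assigned register value is at most `B`. -/
inductive Exec {α β : Type} (x : List α) (B : ℕ) : Cmd α β → PState β → PState β → Prop
  | skip (σ) : Exec x B .skip σ σ
  | inc (σ) (r) : σ.reg r + 1 ≤ B → Exec x B (.inc r) σ (σ.set r (σ.reg r + 1))
  | emit (σ) (b) : Exec x B (.emit b) σ { σ with out := σ.out ++ [b] }
  | move (σ) (m) : Exec x B (.move m) σ { σ with pos := Machine.moveIn x.length σ.pos m }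
  | seq {c d σ τ υ} : Exec x B c σ τ → Exec x B d τ υ → Exec x B (.seq c d) σ υ
  | loop_zero {r c σ} : σ.reg r = 0 → Exec x B (.loop r c) σ σ
  | loop_succ {r c σ τ υ v} : σ.reg r = v + 1 → Exec x B c (σ.set r v) τ →
      Exec x B (.loop r c) τ υ → Exec x B (.loop r c) σ υ
  | whileIn_false {p c σ} : p (Machine.inCell x σ.pos) = false → Exec x B (.whileIn p c) σ σ
  | whileIn_true {p c σ τ υ} : p (Machine.inCell x σ.pos) = true → Exec x B c σ τ →
      Exec x B (.whileIn p c) τ υ → Exec x B (.whileIn p c) σ υ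

/-! ### Compilation to Turing machines -/

/-- Tape symbols: blank, the marker of the first cell, and bits. -/
abbrev TSym : Type := Option (Option Bool)

/-- A part of a machine, with two exits. -/
structure Frag (α β : Type) (k : ℕ) where
  Q : Type
  fin : Finite Q
  start : Q
  δ : Q → InCell α → (Fin k → TSym) →
    (Q ⊕ Bool) × Move × (Fin k → TSym × Move) × Option β

/-- A configuration without the state. -/
structure Mem (β : Type) (k : ℕ) where
  inPos : ℕ
  work : Fin k → ℕ → TSym
  head : Fin k → ℕ
  out : List β

namespace Frag

variable {α β : Type} {k : ℕ}

/-- One step. -/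
def step (F : Frag α β k) (x : List α) (q : F.Q) (c : Mem β k) : (F.Q ⊕ Bool) × Mem β k :=
  let r := F.δ q (Machine.inCell x c.inPos) fun i => c.work i (c.head i)
  (r.1,
    { inPos := Machine.moveIn x.length c.inPos r.2.1
      work := fun i => Function.update (c.work i) (c.head i) (r.2.2.1 i).1
      head := fun i => Machine.moveWork (c.head i) (r.2.2.1 i).2
      out := c.out ++ r.2.2.2.toList })

/-- The computation from state `q` and `c` leaves through exit `b` with `c'`, and the heads stay
in the first `s` cells. -/
inductive Exits (F : Frag α β k) (x : List α) (s : ℕ) :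
    F.Q → Mem β k → Bool → Mem β k → Prop
  | done {q c b c'} : (∀ i, c.head i < s) → F.step x q c = (.inr b, c') → Exits F x s q c b c'
  | more {q c q' c' b c''} : (∀ i, c.head i < s) → F.step x q c = (.inl q', c') →
      Exits F x s q' c' b c'' → Exits F x s q c b c''

/-- Sequential composition. -/
def seq (F G : Frag α β k) : Frag α β k where
  Q := F.Q ⊕ G.Q
  fin := by have := F.fin; have := G.fin; infer_instance
  start := .inl F.start
  δ q a w := match q with
    | .inl q => let r := F.δ q a w
      (match r.1 with
        | .inl q' => .inl (.inl q')
        | .inr _ => .inl (.inr G.start), r.2)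
    | .inr q => let r := G.δ q a w
      (match r.1 with
        | .inl q' => .inl (.inr q')
        | .inr b => .inr b, r.2)

/-- Both runs are transported along the inclusions of the states, and either exit of `F` turns into
a step to the start of `G`. -/
theorem Exits.seq {F G : Frag α β k} {x s c b c' b' c''} (hF : F.Exits x s F.start c b c')
    (hG : G.Exits x s G.start c' b' c'') :
    (F.seq G).Exits x s (F.seq G).start c b' c'' := by
  have hG' : ∀ q c b c', G.Exits x s q c b c' → (F.seq G).Exits x s (.inr q) c b c' := by
    intro q c b c' h
    induction h with
    | done h1 h2 =>
      refine .done h1 ?_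
      simp only [step, Prod.mk.injEq] at h2
      simp [step, Frag.seq, h2.1, ← h2.2]
    | more h1 h2 _ ih =>
      refine .more h1 ?_ ih
      simp only [step, Prod.mk.injEq] at h2
      simp [step, Frag.seq, h2.1, ← h2.2]
  have hF' : ∀ q c b c', F.Exits x s q c b c' → ∀ b' c'', G.Exits x s G.start c' b' c'' →
      (F.seq G).Exits x s (.inl q) c b' c'' := by
    intro q c b c' h
    induction h with
    | done h1 h2 =>
      intro b' c'' h3
      refine .more h1 ?_ (hG' _ _ _ _ h3)
      simp only [step, Prod.mk.injEq] at h2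
      simp [step, Frag.seq, h2.1, ← h2.2]
    | more h1 h2 _ ih =>
      intro b' c'' h3
      refine .more h1 ?_ (ih _ _ h3)
      simp only [step, Prod.mk.injEq] at h2
      simp [step, Frag.seq, h2.1, ← h2.2]
  exact hF' _ _ _ _ hF _ _ hG

/-- Repeat `G` as long as the test `F` leaves through the exit `true`. -/
def iterate (F G : Frag α β k) : Frag α β k where
  Q := F.Q ⊕ G.Q
  fin := by have := F.fin; have := G.fin; infer_instance
  start := .inl F.start
  δ q a w := match q with
    | .inl q => let r := F.δ q a w
      (match r.1 with
        | .inl q' => .inl (.inl q')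
        | .inr true => .inl (.inr G.start)
        | .inr false => .inr true, r.2)
    | .inr q => let r := G.δ q a w
      (match r.1 with
        | .inl q' => .inl (.inr q')
        | .inr _ => .inl (.inl F.start), r.2)

theorem Exits.iterate_false {F G : Frag α β k} {x s c c'} (hF : F.Exits x s F.start c false c') :
    (F.iterate G).Exits x s (F.iterate G).start c true c' := by
  have hF' : ∀ q c b c', F.Exits x s q c b c' → b = false →
      (F.iterate G).Exits x s (.inl q) c true c' := by
    intro q c b c' h
    induction h with
    | done h1 h2 =>
      intro hb
      refine .done h1 ?_
      simp only [step, Prod.mk.injEq] at h2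
      simp [step, Frag.iterate, h2.1, ← h2.2, hb]
    | more h1 h2 _ ih =>
      intro hb
      refine .more h1 ?_ (ih hb)
      simp only [step, Prod.mk.injEq] at h2
      simp [step, Frag.iterate, h2.1, ← h2.2]
  exact hF' _ _ _ _ hF rfl

theorem Exits.iterate_true {F G : Frag α β k} {x s c c' b' c'' b c'''}
    (hF : F.Exits x s F.start c true c') (hG : G.Exits x s G.start c' b' c'')
    (h : (F.iterate G).Exits x s (F.iterate G).start c'' b c''') :
    (F.iterate G).Exits x s (F.iterate G).start c b c''' := by
  have hG' : ∀ q c b' c', G.Exits x s q c b' c' →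
      (F.iterate G).Exits x s (.inl F.start) c' b c''' →
      (F.iterate G).Exits x s (.inr q) c b c''' := by
    intro q c b c' h
    induction h with
    | done h1 h2 =>
      intro h3
      refine .more h1 ?_ h3
      simp only [step, Prod.mk.injEq] at h2
      simp [step, Frag.iterate, h2.1, ← h2.2]
    | more h1 h2 _ ih =>
      intro h3
      refine .more h1 ?_ (ih h3)
      simp only [step, Prod.mk.injEq] at h2
      simp [step, Frag.iterate, h2.1, ← h2.2]
  have hF' : ∀ q c b1 c', F.Exits x s q c b1 c' → b1 = true →
      (F.iterate G).Exits x s (.inr G.start) c' b c''' →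
      (F.iterate G).Exits x s (.inl q) c b c''' := by
    intro q c b c' h
    induction h with
    | done h1 h2 =>
      intro hb h3
      refine .more h1 ?_ h3
      simp only [step, Prod.mk.injEq] at h2
      simp [step, Frag.iterate, h2.1, ← h2.2, hb]
    | more h1 h2 _ ih =>
      intro hb h3
      refine .more h1 ?_ (ih hb h3)
      simp only [step, Prod.mk.injEq] at h2
      simp [step, Frag.iterate, h2.1, ← h2.2]
  exact hF' _ _ _ _ hF rfl (hG' _ _ _ _ hG h)

/-- Leave the work tapes unchanged. -/
def still (w : Fin k → TSym) : Fin k → TSym × Move := fun i => (w i, .stay)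

/-- Act on one work tape. -/
def act (r : Fin k) (w : Fin k → TSym) (a : TSym) (m : Move) : Fin k → TSym × Move :=
  fun i => if i = r then (a, m) else (w i, .stay)

/-- Do one step that does not use the work tapes. -/
def one (f : InCell α → Bool) (m : Move) (b : Option β) : Frag α β k where
  Q := Unit
  fin := inferInstance
  start := ()
  δ _ a w := (.inr (f a), m, still w, b)

theorem exits_one {f : InCell α → Bool} {m : Move} {b : Option β} {x : List α} {s : ℕ}
    {c : Mem β k} (h : ∀ i, c.head i < s) :
    (one f m b : Frag α β k).Exits x s (one f m b : Frag α β k).start c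
      (f (Machine.inCell x c.inPos))
      { c with inPos := Machine.moveIn x.length c.inPos m, out := c.out ++ b.toList } := by
  refine .done h ?_
  simp [step, one, still, Machine.moveWork]

/-- The contents of a tape that holds the bits `l`. -/
def tape (l : List Bool) : ℕ → TSym
  | 0 => some none
  | i + 1 => l[i]?.map some

/-- The marker occurs in cell `0` only, which is how a head travelling left knows that it has
arrived. -/
theorem tape_succ_ne (l : List Bool) (i : ℕ) : tape l (i + 1) ≠ some none := by
  simp [tape]

theorem update_tape_set (l : List Bool) (i : ℕ) (b : Bool) (h : i < l.length) :
    Function.update (tape l) (i + 1) (some (some b)) = tape (l.set i b) := by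
  funext j
  rcases j with _ | j
  · simp [tape]
  · by_cases hj : j = i
    · subst hj; simp [tape, h]
    · simp [tape, hj, List.getElem?_set_ne (Ne.symm hj)]

theorem update_tape_append (l : List Bool) (b : Bool) :
    Function.update (tape l) (l.length + 1) (some (some b)) = tape (l ++ [b]) := by
  funext j
  rcases j with _ | j
  · simp [tape]
  · rcases lt_trichotomy j l.length with hj | hj | hj
    · simp [tape, hj.ne, List.getElem?_append_left hj]
    · subst hj; simp [tape]
    · have h1 : l.length ≤ j := hj.le
      have h2 : j - l.length ≠ 0 := by omega
      simp only [tape, ne_eq, Nat.add_right_cancel_iff, hj.ne', not_false_eq_true,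
        Function.update_of_ne, List.getElem?_append_right h1]
      rw [List.getElem?_eq_none h1, List.getElem?_eq_none (by simp; omega)]

theorem update_tape_mark (l : List Bool) :
    Function.update (tape l) 0 (some none) = tape l := by
  rw [Function.update_eq_self_iff]; rfl

/-- Replace the contents and the head position of one work tape. -/
def _root_.Complexity.Mem.put (c : Mem β k) (r : Fin k) (t : ℕ → TSym) (p : ℕ) : Mem β k :=
  { c with work := Function.update c.work r t, head := Function.update c.head r p }

theorem put_head_lt {c : Mem β k} {s : ℕ} (h : ∀ i, c.head i < s) (r : Fin k) (t : ℕ → TSym)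
    {p : ℕ} (hp : p < s) (i : Fin k) : (c.put r t p).head i < s := by
  by_cases hi : i = r
  · subst hi; simpa [Mem.put] using hp
  · simpa [Mem.put, hi] using h i

/-- For fragments that act on a single tape, a step can be computed from the one cell under that
head, whatever the other tapes contain. -/
theorem step_put {F : Frag α β k} {x : List α} {q : F.Q} {c : Mem β k} {r : Fin k}
    {t : ℕ → TSym} {p : ℕ} {o : F.Q ⊕ Bool} {a : TSym} {m : Move}
    (h : ∀ w : Fin k → TSym, w r = t p →
      F.δ q (Machine.inCell x c.inPos) w = (o, .stay, act r w a m, none)) :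
    F.step x q (c.put r t p) = (o, c.put r (Function.update t p a) (Machine.moveWork p m)) := by
  have h1 := h (fun i => (c.put r t p).work i ((c.put r t p).head i)) (by simp [Mem.put])
  have h2 : (c.put r t p).inPos = c.inPos := rfl
  simp only [step, h2, h1, Prod.mk.injEq, true_and]
  simp only [Mem.put, Mem.mk.injEq, Machine.moveIn, true_and, Option.toList_none,
    List.append_nil, and_true]
  constructor
  · funext i
    by_cases hi : i = r
    · subst hi; simp [act]
    · simp [act, hi]
  · funext i
    by_cases hi : i = r
    · subst hi; simp [act]
    · simp [act, hi, Machine.moveWork]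

/-- The number with given binary digits, the lowest first. -/
def val : List Bool → ℕ
  | [] => 0
  | b :: l => b.toNat + 2 * val l

/-- Binary successor. -/
def incBits : List Bool → List Bool
  | [] => [true]
  | false :: l => true :: l
  | true :: l => false :: incBits l

theorem val_incBits (l : List Bool) : val (incBits l) = val l + 1 := by
  induction l with
  | nil => simp [val, incBits]
  | cons b l ih => cases b <;> simp [val, incBits, ih] <;> omega

/-- A new digit appears only by overflow from all ones. Hence a bound on the value keeps bounding
the number of digits, although leading zeros are never removed. -/
theorem length_incBits (l : List Bool) :
    (incBits l).length = l.length ∨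
      ((incBits l).length = l.length + 1 ∧ val l + 1 = 2 ^ l.length) := by
  induction l with
  | nil => simp [val, incBits]
  | cons b l ih =>
    cases b
    · simp [incBits]
    · rcases ih with ih | ⟨ih, ih'⟩
      · simp [incBits, ih]
      · right; simp only [incBits, List.length_cons, ih, val, pow_succ, Bool.toNat_true, true_and]
        omega

/-- Binary predecessor. -/
def decBits : List Bool → Option (List Bool)
  | [] => none
  | true :: l => some (false :: l)
  | false :: l => (decBits l).map (true :: ·)

theorem decBits_none {l : List Bool} (h : decBits l = none) :
    l = List.replicate l.length false ∧ val l = 0 := by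
  induction l with
  | nil => simp [val]
  | cons b l ih =>
    cases b
    · simp only [decBits, Option.map_eq_none_iff] at h
      have := ih h
      simp only [List.length_cons, List.replicate_succ, List.cons.injEq, true_and]
      exact ⟨this.1, by simp [val, this.2]⟩
    · simp [decBits] at h

theorem decBits_some {l l' : List Bool} (h : decBits l = some l') :
    l'.length = l.length ∧ val l' + 1 = val l := by
  induction l generalizing l' with
  | nil => simp [decBits] at h
  | cons b l ih =>
    cases b
    · simp only [decBits, Option.map_eq_some_iff] at h
      obtain ⟨l1, h1, rfl⟩ := h
      have := ih h1
      simp [val, this.1]; omega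
    · simp only [decBits, Option.some.injEq] at h
      subst h; simp [val]; omega

/-- Increment the number on tape `r`. -/
@[reducible] def incr (r : Fin k) : Frag α β k where
  Q := Fin 3
  fin := inferInstance
  start := 0
  δ q _ w := match q with
    | 0 => (.inl 1, .stay, act r w (some none) .right, none)
    | 1 => match w r with
      | some (some true) => (.inl 1, .stay, act r w (some (some false)) .right, none)
      | _ => (.inl 2, .stay, act r w (some (some true)) .left, none)
    | 2 => match w r with
      | some none => (.inr true, .stay, act r w (some none) .stay, none)
      | _ => (.inl 2, .stay, act r w (w r) .left, none)

theorem incr_back {x : List α} {s : ℕ} {c : Mem β k} (h : ∀ i, c.head i < s) (r : Fin k)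
    (l : List Bool) (p : ℕ) (hp : p < s) :
    (incr r : Frag α β k).Exits x s (2 : Fin 3) (c.put r (tape l) p) true
      (c.put r (tape l) 0) := by
  induction p with
  | zero =>
    refine .done (put_head_lt h _ _ hp) ?_
    rw [step_put (F := incr r) (o := .inr true) (a := some none) (m := .stay) (by
      intro w hw; simp [incr, hw, tape])]
    rw [update_tape_mark]; rfl
  | succ p ih =>
    refine .more (q' := (2 : Fin 3)) (put_head_lt h _ _ hp) ?_ (ih (by omega))
    rw [step_put (F := incr r) (o := .inl (2 : Fin 3)) (a := tape l (p + 1)) (m := .left)]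
    · rw [Function.update_eq_self]; rfl
    · intro w hw
      have := tape_succ_ne l p
      rw [← hw] at this ⊢
      simp only [incr]

theorem exits_incr {x : List α} {s : ℕ} {c : Mem β k} (h : ∀ i, c.head i < s) (r : Fin k)
    (l : List Bool) (hs : l.length + 1 < s) :
    (incr r : Frag α β k).Exits x s (incr r : Frag α β k).start (c.put r (tape l) 0) true
      (c.put r (tape (incBits l)) 0) := by
  -- Invariant of the carry: `j` ones have already become zeros, and the head is on the lowest digit
  -- of `rest`.
  have key : ∀ (rest : List Bool) (j : ℕ), j + rest.length + 1 < s →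
      (incr r : Frag α β k).Exits x s (1 : Fin 3)
        (c.put r (tape (List.replicate j false ++ rest)) (j + 1)) true
        (c.put r (tape (List.replicate j false ++ incBits rest)) 0) := by
    intro rest
    induction rest with
    | nil =>
      intro j hj
      refine .more (q' := (2 : Fin 3)) (put_head_lt h _ _ (by omega)) ?_
        (incr_back h r _ j (by omega))
      rw [step_put (F := incr r) (o := .inl (2 : Fin 3)) (a := some (some true)) (m := .left)]
      · have := update_tape_append (List.replicate j false) true
        simp only [List.length_replicate] at this
        simp [incBits, this, Machine.moveWork]
      · intro w hw
        simp [tape] at hw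
        simp [incr, hw]
    | cons b rest ih =>
      intro j hj
      simp only [List.length_cons] at hj
      cases b
      · refine .more (q' := (2 : Fin 3)) (put_head_lt h _ _ (by omega)) ?_
          (incr_back h r _ j (by omega))
        rw [step_put (F := incr r) (o := .inl (2 : Fin 3)) (a := some (some true)) (m := .left)]
        · rw [update_tape_set _ _ _ (by simp)]
          simp [incBits, Machine.moveWork]
        · intro w hw
          simp [tape] at hw
          simp [incr, hw]
      · refine .more (q' := (1 : Fin 3)) (put_head_lt h _ _ (by omega)) ?_
          (?_ : Exits _ _ _ _ (c.put r (tape (List.replicate (j + 1) false ++ rest)) (j + 1 + 1))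
            _ _)
        · rw [step_put (F := incr r) (o := .inl (1 : Fin 3)) (a := some (some false)) (m := .right)]
          · rw [update_tape_set _ _ _ (by simp)]
            simp [Machine.moveWork, List.replicate_succ', List.append_assoc]
          · intro w hw
            simp [tape] at hw
            simp [incr, hw]
        · have := ih (j + 1) (by omega)
          simpa [incBits, List.replicate_succ', List.append_assoc] using this
  refine .more (q' := (1 : Fin 3)) (put_head_lt h _ _ (by omega)) ?_
    (key l 0 (by omega))
  rw [step_put (F := incr r) (o := .inl (1 : Fin 3)) (a := some none) (m := .right)]
  · rw [update_tape_mark]; rfl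
  · intro w hw; rfl

/-- Decrement the number on tape `r`, or leave through the exit `false` if it is zero. -/
@[reducible] def decr (r : Fin k) : Frag α β k where
  Q := Fin 4
  fin := inferInstance
  start := 0
  δ q _ w := match q with
    | 0 => (.inl 1, .stay, act r w (some none) .right, none)
    | 1 => match w r with
      | some (some true) => (.inl 2, .stay, act r w (some (some false)) .left, none)
      | some (some false) => (.inl 1, .stay, act r w (some (some true)) .right, none)
      | _ => (.inl 3, .stay, act r w none .left, none)
    | 2 => match w r with
      | some none => (.inr true, .stay, act r w (some none) .stay, none)
      | _ => (.inl 2, .stay, act r w (w r) .left, none)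
    | 3 => match w r with
      | some none => (.inr false, .stay, act r w (some none) .stay, none)
      | _ => (.inl 3, .stay, act r w (some (some false)) .left, none)

theorem decr_back {x : List α} {s : ℕ} {c : Mem β k} (h : ∀ i, c.head i < s) (r : Fin k)
    (l : List Bool) (p : ℕ) (hp : p < s) :
    (decr r : Frag α β k).Exits x s (2 : Fin 4) (c.put r (tape l) p) true
      (c.put r (tape l) 0) := by
  induction p with
  | zero =>
    refine .done (put_head_lt h _ _ hp) ?_
    rw [step_put (F := decr r) (o := .inr true) (a := some none) (m := .stay) (by
      intro w hw; simp [decr, hw, tape])]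
    rw [update_tape_mark]; rfl
  | succ p ih =>
    refine .more (q' := (2 : Fin 4)) (put_head_lt h _ _ hp) ?_ (ih (by omega))
    rw [step_put (F := decr r) (o := .inl (2 : Fin 4)) (a := tape l (p + 1)) (m := .left)]
    · rw [Function.update_eq_self]; rfl
    · intro w hw
      have := tape_succ_ne l p
      rw [← hw] at this ⊢
      simp only [decr]

/-- A decrement of zero has turned every digit into a one before it meets the end of the number. The
way back restores the zeros, so a failed test leaves the tape as it was. -/
theorem decr_back_zero {x : List α} {s : ℕ} {c : Mem β k} (h : ∀ i, c.head i < s) (r : Fin k)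
    (p n : ℕ) (hp : p < s) :
    (decr r : Frag α β k).Exits x s (3 : Fin 4)
      (c.put r (tape (List.replicate p true ++ List.replicate n false)) p) false
      (c.put r (tape (List.replicate (p + n) false)) 0) := by
  induction p generalizing n with
  | zero =>
    refine .done (put_head_lt h _ _ hp) ?_
    rw [step_put (F := decr r) (o := .inr false) (a := some none) (m := .stay) (by
      intro w hw; simp [decr, hw, tape])]
    rw [update_tape_mark]
    simp [Machine.moveWork]
  | succ p ih =>
    have h1 := ih (n + 1) (by omega)
    rw [show p + (n + 1) = p + 1 + n by omega] at h1
    refine .more (q' := (3 : Fin 4)) (put_head_lt h _ _ hp) ?_ h1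
    rw [step_put (F := decr r) (o := .inl (3 : Fin 4)) (a := some (some false)) (m := .left)]
    · rw [update_tape_set _ _ _ (by simp; omega)]
      simp [Machine.moveWork, List.replicate_succ' (n := p),
        List.replicate_succ (n := n), List.append_assoc]
    · intro w hw
      have := tape_succ_ne (List.replicate (p + 1) true ++ List.replicate n false) p
      rw [← hw] at this
      simp only [decr]

theorem exits_decr {x : List α} {s : ℕ} {c : Mem β k} (h : ∀ i, c.head i < s) (r : Fin k)
    (l : List Bool) (hs : l.length + 1 < s) :
    (decr r : Frag α β k).Exits x s (decr r : Frag α β k).start (c.put r (tape l) 0)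
      (decBits l).isSome (c.put r (tape ((decBits l).getD l)) 0) := by
  -- Invariant of the borrow: `j` zeros have already become ones. If no one is found, the digits are
  -- reset to zeros.
  have key : ∀ (rest : List Bool) (j : ℕ), j + rest.length + 1 < s →
      (decr r : Frag α β k).Exits x s (1 : Fin 4)
        (c.put r (tape (List.replicate j true ++ rest)) (j + 1)) (decBits rest).isSome
        (c.put r (tape (match decBits rest with
          | some l => List.replicate j true ++ l
          | none => List.replicate (j + rest.length) false)) 0) := by
    intro rest
    induction rest with
    | nil =>
      intro j hj
      refine .more (q' := (3 : Fin 4)) (put_head_lt h _ _ (by omega)) ?_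
        (decr_back_zero h r j 0 (by omega))
      rw [step_put (F := decr r) (o := .inl (3 : Fin 4)) (a := none) (m := .left)]
      · simp only [List.append_nil, Machine.moveWork, Nat.add_sub_cancel, List.replicate_zero]
        rw [Function.update_eq_self_iff.2]
        simp [tape]
      · intro w hw
        simp [tape] at hw
        simp [decr, hw]
    | cons b rest ih =>
      intro j hj
      simp only [List.length_cons] at hj
      cases b
      · refine .more (q' := (1 : Fin 4)) (put_head_lt h _ _ (by omega)) ?_
          (?_ : Exits _ _ _ _ (c.put r (tape (List.replicate (j + 1) true ++ rest)) (j + 1 + 1))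
            _ _)
        · rw [step_put (F := decr r) (o := .inl (1 : Fin 4)) (a := some (some true)) (m := .right)]
          · rw [update_tape_set _ _ _ (by simp)]
            simp [Machine.moveWork, List.replicate_succ', List.append_assoc]
          · intro w hw
            simp [tape] at hw
            simp [decr, hw]
        · have := ih (j + 1) (by omega)
          cases hd : decBits rest with
          | none =>
            rw [hd] at this
            simpa [decBits, hd, Nat.add_assoc, Nat.add_comm 1] using this
          | some l' =>
            rw [hd] at this
            simpa [decBits, hd, List.replicate_succ', List.append_assoc] using this
      · refine .more (q' := (2 : Fin 4)) (put_head_lt h _ _ (by omega)) ?_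
          (decr_back h r _ j (by omega))
        rw [step_put (F := decr r) (o := .inl (2 : Fin 4)) (a := some (some false)) (m := .left)]
        · rw [update_tape_set _ _ _ (by simp)]
          simp [decBits, Machine.moveWork]
        · intro w hw
          simp [tape] at hw
          simp [decr, hw]
  refine .more (q' := (1 : Fin 4)) (put_head_lt h _ _ (by omega)) ?_
    (?_ : Exits _ _ _ _ (c.put r (tape l) (0 + 1)) _ _)
  · rw [step_put (F := decr r) (o := .inl (1 : Fin 4)) (a := some none) (m := .right)]
    · rw [update_tape_mark]; rfl
    · intro w hw; rfl
  · have := key l 0 (by omega)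
    cases hd : decBits l with
    | none =>
      rw [hd] at this
      have h1 := (decBits_none hd).1
      simp only [List.replicate_zero, List.nil_append, Nat.zero_add, ← h1] at this
      simpa using this
    | some l' =>
      rw [hd] at this
      simpa using this

end Frag

/-- Compilation of programs with the registers `0, …, k`. -/
def Cmd.compile {α β : Type} (k : ℕ) : Cmd α β → Frag α β (k + 1)
  | .skip => .one (fun _ => true) .stay none
  | .inc r => .incr (Fin.ofNat (k + 1) r)
  | .emit b => .one (fun _ => true) .stay (some b)
  | .move m => .one (fun _ => true) m none
  | .seq c d => (c.compile k).seq (d.compile k)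
  | .loop r c => (Frag.decr (Fin.ofNat (k + 1) r)).iterate (c.compile k)
  | .whileIn p c => (Frag.one p .stay none).iterate (c.compile k)

/-- A bound for the registers of a program. -/
def Cmd.regs {α β : Type} : Cmd α β → ℕ
  | .skip => 0
  | .inc r => r
  | .emit _ => 0
  | .move _ => 0
  | .seq c d => max c.regs d.regs
  | .loop r c => max r c.regs
  | .whileIn _ c => c.regs

/-- The memory `c` represents the program state `σ`. -/
structure Represents {β : Type} {k : ℕ} (L : ℕ) (σ : PState β) (c : Mem β (k + 1)) : Prop where
  pos : c.inPos = σ.pos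
  out : c.out = σ.out
  head : ∀ i, c.head i = 0
  work : ∀ i : Fin (k + 1), ∃ l : List Bool, c.work i = Frag.tape l ∧ l.length ≤ L ∧
    Frag.val l = σ.reg i

theorem Represents.put {β : Type} {k L : ℕ} {σ : PState β} {c : Mem β (k + 1)}
    (h : Represents L σ c) {r v : ℕ} (hr : r ≤ k) {l : List Bool} (hl : l.length ≤ L)
    (hv : Frag.val l = v) :
    Represents L (σ.set r v) (c.put (Fin.ofNat (k + 1) r) (Frag.tape l) 0) where
  pos := h.pos
  out := h.out
  head i := by
    by_cases hi : i = Fin.ofNat (k + 1) r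
    · subst hi; simp [Mem.put]
    · simp only [Mem.put, ne_eq, hi, not_false_eq_true, Function.update_of_ne]; exact h.head i
  work i := by
    have hval : (Fin.ofNat (k + 1) r).val = r := Nat.mod_eq_of_lt (by omega)
    by_cases hi : i = Fin.ofNat (k + 1) r
    · subst hi
      refine ⟨l, by simp [Mem.put], hl, ?_⟩
      rw [PState.set_reg, if_pos hval, hv]
    · have hi' : i.val ≠ r := fun e => hi (Fin.ext (by rw [hval, e]))
      obtain ⟨l', h1, h2, h3⟩ := h.work i
      refine ⟨l', ?_, h2, ?_⟩
      · simp only [Mem.put, ne_eq, hi, not_false_eq_true, Function.update_of_ne]; exact h1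
      · rw [PState.set_reg, if_neg hi', h3]

theorem Represents.eq_put {β : Type} {k L : ℕ} {σ : PState β} {c : Mem β (k + 1)}
    (h : Represents L σ c) {r : ℕ} (hr : r ≤ k) :
    ∃ l : List Bool, l.length ≤ L ∧ Frag.val l = σ.reg r ∧
      c = c.put (Fin.ofNat (k + 1) r) (Frag.tape l) 0 := by
  have hval : (Fin.ofNat (k + 1) r).val = r := Nat.mod_eq_of_lt (by omega)
  obtain ⟨l, h1, h2, h3⟩ := h.work (Fin.ofNat (k + 1) r)
  refine ⟨l, h2, by rw [h3, hval], ?_⟩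
  have h4 := h.head (Fin.ofNat (k + 1) r)
  generalize Fin.ofNat (k + 1) r = i at *
  rw [← h1, ← h4, Mem.put, Function.update_eq_self, Function.update_eq_self]

/-- Values below `2 ^ L` fit into `L` digits. With the marker before them and the blank cell after
them, the heads use `L + 2` cells. -/
theorem Exec.exits {α β : Type} {x : List α} {B k L : ℕ} (hB : B < 2 ^ L) {c : Cmd α β}
    {σ τ : PState β} (he : Exec x B c σ τ) (hk : c.regs ≤ k) (m : Mem β (k + 1))
    (hm : Represents L σ m) :
    ∃ b m', (c.compile k).Exits x (L + 2) (c.compile k).start m b m' ∧ Represents L τ m' := by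
  induction he generalizing m with
  | skip =>
    refine ⟨_, _, Frag.exits_one (fun i => by rw [hm.head]; omega), ?_⟩
    exact ⟨by simpa [Machine.moveIn] using hm.pos, by simpa using hm.out, hm.head, hm.work⟩
  | inc σ r h =>
    simp only [Cmd.regs] at hk
    obtain ⟨l, hl, hv, hc⟩ := hm.eq_put hk
    have h1 := Frag.exits_incr (α := α) (x := x) (s := L + 2) (c := m)
      (fun i => by rw [hm.head]; omega) (Fin.ofNat (k + 1) r) l (by omega)
    rw [← hc] at h1
    refine ⟨_, _, h1, hm.put hk ?_ (by rw [Frag.val_incBits, hv])⟩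
    -- If the number grows by a digit, then its new value is a power of two that is at most `B < 2 ^
    -- L`, so there was room for the digit.
    rcases Frag.length_incBits l with h2 | ⟨h2, h3⟩
    · omega
    · have h4 : 2 ^ l.length < 2 ^ L := by omega
      have := (Nat.pow_lt_pow_iff_right (by norm_num : 1 < 2)).1 h4
      omega
  | emit σ b =>
    refine ⟨_, _, Frag.exits_one (fun i => by rw [hm.head]; omega), ?_⟩
    exact ⟨by simpa [Machine.moveIn] using hm.pos, by simp [hm.out], hm.head, hm.work⟩
  | move σ d =>
    refine ⟨_, _, Frag.exits_one (fun i => by rw [hm.head]; omega), ?_⟩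
    exact ⟨by simp [hm.pos], by simpa using hm.out, hm.head, hm.work⟩
  | seq _ _ ih1 ih2 =>
    simp only [Cmd.regs, max_le_iff] at hk
    obtain ⟨b, m1, h1, h2⟩ := ih1 hk.1 m hm
    obtain ⟨b', m2, h3, h4⟩ := ih2 hk.2 m1 h2
    exact ⟨b', m2, h1.seq h3, h4⟩
  | @loop_zero r c σ h =>
    simp only [Cmd.regs, max_le_iff] at hk
    obtain ⟨l, hl, hv, hc⟩ := hm.eq_put hk.1
    have h1 := Frag.exits_decr (α := α) (x := x) (s := L + 2) (c := m)
      (fun i => by rw [hm.head]; omega) (Fin.ofNat (k + 1) r) l (by omega)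
    have h2 : Frag.decBits l = none := by
      cases hd : Frag.decBits l with
      | none => rfl
      | some l' => have := (Frag.decBits_some hd).2; omega
    rw [h2, Option.getD_none, ← hc] at h1
    exact ⟨true, m, h1.iterate_false, hm⟩
  | @loop_succ r c σ τ υ v h _ _ ih1 ih2 =>
    have hk' := hk
    simp only [Cmd.regs, max_le_iff] at hk
    obtain ⟨l, hl, hv, hc⟩ := hm.eq_put hk.1
    have h1 := Frag.exits_decr (α := α) (x := x) (s := L + 2) (c := m)
      (fun i => by rw [hm.head]; omega) (Fin.ofNat (k + 1) r) l (by omega)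
    cases hd : Frag.decBits l with
    | none => have := (Frag.decBits_none hd).2; omega
    | some l' =>
      have hl' := Frag.decBits_some hd
      rw [hd, Option.getD_some, ← hc] at h1
      obtain ⟨b, m1, h2, h3⟩ := ih1 hk.2 _ (hm.put (v := v) hk.1 (l := l') (by omega) (by omega))
      obtain ⟨b', m2, h4, h5⟩ := ih2 hk' m1 h3
      exact ⟨b', m2, h1.iterate_true h2 h4, h5⟩
  | @whileIn_false p c σ h =>
    have h1 := Frag.exits_one (f := p) (m := .stay) (b := (none : Option β)) (x := x) (s := L + 2)
      (c := m) (fun i => by rw [hm.head]; omega)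
    rw [hm.pos, h] at h1
    refine ⟨_, _, h1.iterate_false, ?_⟩
    exact ⟨by simp [Machine.moveIn], by simpa using hm.out, hm.head, hm.work⟩
  | @whileIn_true p c σ τ υ h _ _ ih1 ih2 =>
    have hk' := hk
    simp only [Cmd.regs] at hk
    have h1 := Frag.exits_one (f := p) (m := .stay) (b := (none : Option β)) (x := x) (s := L + 2)
      (c := m) (fun i => by rw [hm.head]; omega)
    rw [hm.pos, h] at h1
    obtain ⟨b, m1, h2, h3⟩ := ih1 hk _
      (⟨by simp [Machine.moveIn], by simpa using hm.out, hm.head, hm.work⟩ :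
        Represents L σ { m with
          inPos := Machine.moveIn x.length σ.pos .stay, out := m.out ++ (none : Option β).toList })
    obtain ⟨b', m2, h4, h5⟩ := ih2 hk' m1 h3
    exact ⟨b', m2, h1.iterate_true h2 h4, h5⟩

/-- The machine that marks the first cells of its tapes and then runs `F`. -/
def Frag.toMachine {α β : Type} {k : ℕ} (F : Frag α β k) : Machine α β where
  State := Option (Option F.Q)
  finite_state := by have := F.fin; infer_instance
  start := none
  tapes := k
  Sym := TSym
  finite_sym := inferInstance
  blank := none
  delta q a w := match q with
    | none => some (some (some F.start), .stay, fun _ => (some none, .stay), none)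
    | some none => none
    | some (some q) => let r := F.δ q a w
      some (match r.1 with
        | .inl q' => some (some q')
        | .inr _ => some none, r.2)

/-- The configuration of the machine of `F` with given state and memory. -/
def Frag.config {α β : Type} {k : ℕ} (F : Frag α β k) (q : Option F.Q) (c : Mem β k) :
    Config F.toMachine where
  state := some q
  inPos := c.inPos
  work := c.work
  head := c.head
  out := c.out

theorem Frag.next_halt {α β : Type} {k : ℕ} (F : Frag α β k) (x : List α) (c : Mem β k) :
    F.toMachine.next x (F.config none c) = none := rfl

theorem Frag.next_config {α β : Type} {k : ℕ} (F : Frag α β k) (x : List α) (q : F.Q)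
    (c : Mem β k) : F.toMachine.next x (F.config (some q) c) =
      some (F.config (match (F.step x q c).1 with
        | .inl q' => some q'
        | .inr _ => none) (F.step x q c).2) := by
  simp only [Machine.next, toMachine, config, step, Option.map_some, Option.some.injEq]
  cases (F.δ q (Machine.inCell x c.inPos) fun i => c.work i (c.head i)).1 <;> rfl

theorem Frag.Exits.halts {α β : Type} {k : ℕ} {F : Frag α β k} {x : List α} {s : ℕ} {q : F.Q}
    {c : Mem β k} {b : Bool} {c' : Mem β k} (h : F.Exits x s q c b c') :
    Relation.ReflTransGen (fun c₁ c₂ => F.toMachine.next x c₁ = some c₂) (F.config (some q) c)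
      (F.config none c') := by
  induction h with
  | @done q c b c' h1 h2 =>
    refine .single ?_
    rw [F.next_config, h2]
  | @more q c q' c' b c'' h1 h2 _ ih =>
    refine .head ?_ ih
    rw [F.next_config, h2]

/-- The machine is deterministic, so every configuration that it reaches lies on the recorded run,
or is its final configuration. -/
theorem Frag.Exits.heads {α β : Type} {k : ℕ} {F : Frag α β k} {x : List α} {s : ℕ} {q : F.Q}
    {c : Mem β k} {b : Bool} {c' : Mem β k} (h : F.Exits x s q c b c')
    (hc' : ∀ i, c'.head i < s) (d : Config F.toMachine)
    (hd : Relation.ReflTransGen (fun c₁ c₂ => F.toMachine.next x c₁ = some c₂)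
      (F.config (some q) c) d) (i : Fin k) : d.head i < s := by
  induction h with
  | @done q c b c' h1 h2 =>
    rcases hd.cases_head with rfl | ⟨e, he, hd⟩
    · exact h1 i
    · rw [F.next_config, h2] at he
      obtain rfl := Option.some.inj he
      rcases hd.cases_head with rfl | ⟨e', he', -⟩
      · exact hc' i
      · rw [F.next_halt] at he'; simp at he'
  | @more q c q' c' b c'' h1 h2 _ ih =>
    rcases hd.cases_head with rfl | ⟨e, he, hd⟩
    · exact h1 i
    · rw [F.next_config, h2] at he
      obtain rfl := Option.some.inj he
      exact ih hc' hd

/-- A function that is computed by a program with registers below `2 ^ (d * s(n) + d)` is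
computable in space `O(s(n))`. -/
theorem computableInSpace_of_exec {α β : Type} {s : ℕ → ℕ} {f : List α → List β}
    (c : Cmd α β) (d : ℕ)
    (h : ∀ x, ∃ B, B < 2 ^ (d * s x.length + d) ∧ ∃ τ : PState β, τ.out = f x ∧
      Exec x B c ⟨fun _ => 0, 0, []⟩ τ) :
    ComputableInSpace s f := by
  -- The summand `2` in `d + 2` pays for the marker cell and for the blank cell behind the digits.
  refine ⟨(c.compile c.regs).toMachine, d + 2, fun x => ?_⟩
  obtain ⟨B, hB, τ, hτ, he⟩ := h x
  set F := c.compile c.regs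
  let m0 : Mem β (c.regs + 1) := ⟨0, fun _ => Frag.tape [], fun _ => 0, []⟩
  have hm0 : Represents (d * s x.length + d) ⟨fun _ => 0, 0, []⟩ m0 :=
    ⟨rfl, rfl, fun _ => rfl, fun _ => ⟨[], rfl, by simp, rfl⟩⟩
  obtain ⟨b, m', h1, h2⟩ := he.exits hB le_rfl m0 hm0
  have hle : d * s x.length + d + 2 ≤ (d + 2) * s x.length + (d + 2) := by
    have : d * s x.length ≤ (d + 2) * s x.length := Nat.mul_le_mul_right _ (by omega)
    omega
  have hstart : F.toMachine.next x F.toMachine.startConfig =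
      some (F.config (some F.start) m0) := by
    simp only [Machine.next, Frag.toMachine, Machine.startConfig, Frag.config, Option.map_some,
      Option.some.injEq, Config.mk.injEq, true_and]
    refine ⟨rfl, ?_, rfl, rfl⟩
    funext i j
    rcases j with _ | j
    · simp [m0, Frag.tape]
    · simp [m0, Frag.tape]
  refine ⟨⟨F.config none m', .head hstart h1.halts, F.next_halt x m', ?_⟩, ?_⟩
  · rw [← hτ, ← h2.out]; rfl
  · intro e he i
    rcases he.cases_head with rfl | ⟨e', he', hd⟩
    · change 0 < _; omega
    · rw [hstart] at he'
      obtain rfl := Option.some.inj he'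
      exact (h1.heads (fun i => by rw [h2.head]; omega) e hd i).trans_le hle


/-! ### Numerical functions computable in logarithmic space -/

/-- Replace all registers. -/
def PState.withReg {β : Type} (σ : PState β) (f : ℕ → ℕ) : PState β := { σ with reg := f }

@[simp] theorem PState.withReg_reg {β : Type} (σ : PState β) (f : ℕ → ℕ) :
    (σ.withReg f).reg = f := rfl

/-! ### Basic register programs: counted loops, clearing, moving, copying -/

section Macros

variable {α β : Type} {x : List α} {B : ℕ}

/-- The state `τ i` is the one after `i` passes. The counter is decremented before the body runs, so
the body starts with the counter `N - i - 1`. -/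
theorem Exec.loop_chain {r N : ℕ} {c : Cmd α β} (τ : ℕ → PState β)
    (h1 : ∀ i ≤ N, (τ i).reg r = N - i)
    (h2 : ∀ i < N, Exec x B c ((τ i).set r (N - i - 1)) (τ (i + 1))) :
    Exec x B (.loop r c) (τ 0) (τ N) := by
  have key : ∀ j ≤ N, Exec x B (.loop r c) (τ (N - j)) (τ N) := by
    intro j hj
    induction j with
    | zero => exact .loop_zero (by simpa using h1 N le_rfl)
    | succ j ih =>
      have e : N - j = N - (j + 1) + 1 := by omega
      have h3 := h2 (N - (j + 1)) (by omega)
      rw [← e] at h3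
      refine .loop_succ (v := j) ?_ ?_ (ih (by omega))
      · rw [h1 _ (by omega)]; omega
      · convert h3 using 2; omega
  simpa using key N le_rfl

/-- Set a register to zero. -/
abbrev Cmd.clear (r : ℕ) : Cmd α β := .loop r .skip

theorem Exec.clear (σ : PState β) (r : ℕ) : Exec x B (.clear r) σ (σ.set r 0) := by
  have := Exec.loop_chain (x := x) (B := B) (c := .skip) (r := r) (N := σ.reg r)
    (fun i => σ.set r (σ.reg r - i)) (fun i _ => by simp [PState.set_reg]) (fun i _ => by
      rw [PState.set_set, Nat.sub_sub]; exact .skip _)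
  simpa [PState.set_self] using this

/-- Add a register to another one, and set it to zero. -/
abbrev Cmd.mv (a b : ℕ) : Cmd α β := .loop a (.inc b)

theorem Exec.mv (σ : PState β) {a b : ℕ} (h : a ≠ b) (hB : σ.reg b + σ.reg a ≤ B) :
    Exec x B (.mv a b) σ ((σ.set a 0).set b (σ.reg b + σ.reg a)) := by
  have := Exec.loop_chain (x := x) (B := B) (c := .inc b) (r := a) (N := σ.reg a)
    (fun i => (σ.set a (σ.reg a - i)).set b (σ.reg b + i))
    (fun i _ => by simp [PState.set_reg, h]) (fun i hi => by
      have h1 : ((((σ.set a (σ.reg a - i)).set b (σ.reg b + i)).set a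
          (σ.reg a - i - 1)).reg b) = σ.reg b + i := by simp [PState.set_reg, h.symm]
      have h2 := Exec.inc (x := x) (B := B)
        (((σ.set a (σ.reg a - i)).set b (σ.reg b + i)).set a (σ.reg a - i - 1)) b
        (by rw [h1]; omega)
      rw [h1] at h2
      convert h2 using 1
      refine PState.ext (fun j => ?_) rfl rfl
      simp only [PState.set_reg]
      split_ifs <;> omega)
  convert this using 1
  · refine PState.ext (fun j => ?_) rfl rfl
    simp only [PState.set_reg]
    split_ifs <;> simp_all
  · simp

/-- Copy a register to the register `t`; the registers from `t` on have to be zero. -/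
abbrev Cmd.copy (a t : ℕ) : Cmd α β :=
  .seq (.loop a (.seq (.inc t) (.inc (t + 1)))) (.mv (t + 1) a)

/-- A loop over a register destroys it. Two copies are therefore made at once, and the second one is
moved back. -/
theorem Exec.copy (σ : PState β) {a t : ℕ} (h : a < t) (h0 : ∀ j, t ≤ j → σ.reg j = 0)
    (hB : σ.reg a ≤ B) : Exec x B (.copy a t) σ (σ.set t (σ.reg a)) := by
  have h1 := h0 t le_rfl
  have h2 := h0 (t + 1) (by omega)
  have := Exec.loop_chain (x := x) (B := B) (c := .seq (.inc t) (.inc (t + 1))) (r := a)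
    (N := σ.reg a) (fun i => ((σ.set a (σ.reg a - i)).set t i).set (t + 1) i)
    (fun i _ => by simp [PState.set_reg, h.ne, (h.trans (Nat.lt_succ_self t)).ne])
    (fun i hi => by
      refine .seq (.inc _ _ ?_) ?_
      · simp [PState.set_reg, h.ne']; omega
      · have h3 := Exec.inc (x := x) (B := B) (((((σ.set a (σ.reg a - i)).set t i).set (t + 1)
            i).set a (σ.reg a - i - 1)).set t (i + 1)) (t + 1) (by
              rw [PState.set_reg, PState.set_reg, PState.set_reg, if_neg (by omega),
                if_neg (by omega), if_pos rfl]
              omega)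
        convert h3 using 1
        · congr 1
          simp [PState.set_reg, h.ne']
        · refine PState.ext (fun j => ?_) rfl rfl
          simp only [PState.set_reg]
          split_ifs <;> omega)
  refine .seq (τ := ((σ.set a 0).set t (σ.reg a)).set (t + 1) (σ.reg a)) ?_ ?_
  · convert this using 1
    · refine PState.ext (fun j => ?_) rfl rfl
      simp only [PState.set_reg]
      split_ifs <;> simp_all
    · simp
  · have h3 := Exec.mv (x := x) (B := B) (((σ.set a 0).set t (σ.reg a)).set (t + 1) (σ.reg a))
      (a := t + 1) (b := a) (by omega) (by
        simp [PState.set_reg, h.ne, (h.trans (Nat.lt_succ_self t)).ne, hB])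
    convert h3 using 1
    refine PState.ext (fun j => ?_) rfl rfl
    simp only [PState.set_reg]
    split_ifs <;> first | omega | simp_all

end Macros

/-- Functions of natural numbers with a program whose registers are polynomially bounded. -/
def LF {k : ℕ} (f : (Fin k → ℕ) → ℕ) : Prop :=
  ∃ d, (∀ v, f v ≤ (2 + ∑ i, v i) ^ d) ∧
    ∀ (α β : Type) (as : Fin k → ℕ) (t : ℕ), (∀ i, as i < t) → ∃ c : Cmd α β,
      ∀ (x : List α) (σ : PState β), (∀ j, t ≤ j → σ.reg j = 0) →
        ∀ B, (2 + ∑ i, σ.reg (as i)) ^ d ≤ B →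
          Exec x B c σ (σ.set t (f fun i => σ.reg (as i)))

theorem LF.congr {k : ℕ} {f g : (Fin k → ℕ) → ℕ} (h : LF f) (e : ∀ v, f v = g v) : LF g := by
  rwa [← funext e]

theorem LF.poly {k : ℕ} {f : (Fin k → ℕ) → ℕ} (h : LF f) :
    ∃ d, ∀ v, f v ≤ (2 + ∑ i, v i) ^ d :=
  h.imp fun _ h => h.1

theorem pow_le_pow_of_two {S a b : ℕ} (hS : 2 ≤ S) (h : a ≤ b) : S ^ a ≤ S ^ b :=
  Nat.pow_le_pow_right (by omega) h

theorem LF.zero {k : ℕ} : LF (fun _ : Fin k → ℕ => 0) := by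
  refine ⟨0, fun v => Nat.zero_le _, fun α β as t _ => ⟨.skip, fun x σ h0 B _ => ?_⟩⟩
  rw [← h0 t le_rfl, PState.set_self]
  exact .skip _

theorem LF.var {k : ℕ} (i : Fin k) : LF (fun v : Fin k → ℕ => v i) := by
  have hle : ∀ v : Fin k → ℕ, v i ≤ (2 + ∑ i, v i) ^ 1 := fun v => by
    have := Finset.single_le_sum (f := v) (fun _ _ => Nat.zero_le _) (Finset.mem_univ i)
    rw [pow_one]; omega
  exact ⟨1, hle, fun α β as t ht => ⟨.copy (as i) t, fun x σ h0 B hB =>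
    .copy σ (ht i) h0 ((hle fun i => σ.reg (as i)).trans hB)⟩⟩

theorem LF.succ {k : ℕ} {f : (Fin k → ℕ) → ℕ} (hf : LF f) : LF (fun v => f v + 1) := by
  obtain ⟨d, h1, h2⟩ := hf
  have hle : ∀ v : Fin k → ℕ, f v + 1 ≤ (2 + ∑ i, v i) ^ (d + 1) := fun v => by
    have h3 : (2 + ∑ i, v i) ^ d * 2 ≤ (2 + ∑ i, v i) ^ (d + 1) := by
      rw [pow_succ]; exact Nat.mul_le_mul_left _ (by omega)
    have h4 : 1 ≤ (2 + ∑ i, v i) ^ d := Nat.one_le_pow _ _ (by omega)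
    have := h1 v
    omega
  refine ⟨d + 1, hle, fun α β as t ht => ?_⟩
  obtain ⟨c, hc⟩ := h2 α β as t ht
  refine ⟨.seq c (.inc t), fun x σ h0 B hB => ?_⟩
  refine .seq (hc x σ h0 B ((pow_le_pow_of_two (by omega) (by omega)).trans hB)) ?_
  have := Exec.inc (x := x) (B := B) (σ.set t (f fun i => σ.reg (as i))) t (by
    rw [PState.set_reg, if_pos rfl]
    exact (hle fun i => σ.reg (as i)).trans hB)
  rwa [PState.set_set, PState.set_reg, if_pos rfl] at this

theorem LF.const {k : ℕ} (n : ℕ) : LF (fun _ : Fin k → ℕ => n) := by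
  induction n with
  | zero => exact .zero
  | succ n ih => exact ih.succ

/-- This evaluates the inner functions of a composition, one after the other, into the registers
from `t` on. The counter `n` is independent of `m` to allow induction; passes beyond `m` do nothing.
-/
theorem exec_many {α β : Type} {k m t : ℕ} {h : Fin m → (Fin k → ℕ) → ℕ} {as : Fin k → ℕ}
    (ht : ∀ i, as i < t) {d : Fin m → ℕ}
    (hc : ∀ i, ∀ t' ≥ t, ∃ c : Cmd α β, ∀ (x : List α) (σ : PState β),
      (∀ j, t' ≤ j → σ.reg j = 0) → ∀ B, (2 + ∑ i, σ.reg (as i)) ^ d i ≤ B →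
        Exec x B c σ (σ.set t' (h i fun i => σ.reg (as i)))) (n : ℕ) :
    ∃ c : Cmd α β, ∀ (x : List α) (σ : PState β), (∀ j, t ≤ j → σ.reg j = 0) →
      ∀ B, (2 + ∑ i, σ.reg (as i)) ^ (∑ i, d i) ≤ B →
        Exec x B c σ (σ.withReg fun j =>
          if hj : t ≤ j ∧ j < t + n ∧ j - t < m then h ⟨j - t, hj.2.2⟩ fun i => σ.reg (as i)
          else σ.reg j) := by
  induction n with
  | zero =>
    refine ⟨.skip, fun x σ h0 B hB => ?_⟩
    convert Exec.skip (x := x) (B := B) σ using 1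
    refine PState.ext (fun j => ?_) rfl rfl
    exact dif_neg (by omega)
  | succ n ih =>
    obtain ⟨c, hc'⟩ := ih
    by_cases hn : n < m
    · obtain ⟨c2, hc2⟩ := hc ⟨n, hn⟩ (t + n) (by omega)
      refine ⟨.seq c c2, fun x σ h0 B hB => .seq (hc' x σ h0 B hB) ?_⟩
      have hreg : ∀ i, (if hj : t ≤ as i ∧ as i < t + n ∧ as i - t < m then
          h ⟨as i - t, hj.2.2⟩ fun i => σ.reg (as i) else σ.reg (as i)) = σ.reg (as i) :=
        fun i => dif_neg (by have := ht i; omega)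
      have := hc2 x (σ.withReg fun j =>
          if hj : t ≤ j ∧ j < t + n ∧ j - t < m then h ⟨j - t, hj.2.2⟩ fun i => σ.reg (as i)
          else σ.reg j) (fun j hj => by
            simp only [PState.withReg_reg]
            rw [dif_neg (by omega)]; exact h0 j (by omega)) B (by
          simp only [hreg, PState.withReg_reg]
          refine le_trans (pow_le_pow_of_two (by omega) ?_) hB
          exact Finset.single_le_sum (f := d) (fun _ _ => Nat.zero_le _) (Finset.mem_univ _))
      convert this using 1
      refine PState.ext (fun j => ?_) rfl rfl
      simp only [PState.set_reg, hreg, PState.withReg_reg]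
      by_cases hj : j = t + n
      · subst hj
        simp [hn]
      · simp only [hj, if_false]
        by_cases h4 : t ≤ j ∧ j < t + n ∧ j - t < m
        · rw [dif_pos h4, dif_pos (by omega)]
        · rw [dif_neg h4, dif_neg (by omega)]
    · refine ⟨c, fun x σ h0 B hB => ?_⟩
      convert hc' x σ h0 B hB using 1
      refine PState.ext (fun j => ?_) rfl rfl
      simp only [PState.withReg_reg]
      by_cases h4 : t ≤ j ∧ j < t + n ∧ j - t < m
      · rw [dif_pos h4, dif_pos (by omega)]
      · rw [dif_neg h4, dif_neg (by omega)]

theorem exec_clearMany {α β : Type} (t n : ℕ) :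
    ∃ c : Cmd α β, ∀ (x : List α) (B : ℕ) (σ : PState β),
      Exec x B c σ (σ.withReg fun j => if t ≤ j ∧ j < t + n then 0 else σ.reg j) := by
  induction n with
  | zero =>
    refine ⟨.skip, fun x B σ => ?_⟩
    convert Exec.skip (x := x) (B := B) σ using 1
    refine PState.ext (fun j => ?_) rfl rfl
    exact if_neg (by omega)
  | succ n ih =>
    obtain ⟨c, hc⟩ := ih
    refine ⟨.seq c (.clear (t + n)), fun x B σ => .seq (hc x B σ) ?_⟩
    convert Exec.clear (x := x) (B := B) _ _ using 1
    refine PState.ext (fun j => ?_) rfl rfl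
    simp only [PState.set_reg, PState.withReg_reg]
    split_ifs <;> omega

theorem LF.comp {k m : ℕ} {g : (Fin m → ℕ) → ℕ} {h : Fin m → (Fin k → ℕ) → ℕ} (hg : LF g)
    (hh : ∀ i, LF (h i)) : LF (fun v => g fun i => h i v) := by
  obtain ⟨dg, hg1, hg2⟩ := hg
  choose d hd1 hd2 using hh
  -- The sum of `m` polynomially bounded values is absorbed by the factor `m + 2 ≤ 2 ^ (m + 1)`, and
  -- `2` is at most the base.
  have hsum : ∀ v, 2 + ∑ i, h i v ≤ (2 + ∑ i, v i) ^ (m + 1 + ∑ i, d i) := by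
    intro v
    have h1 : ∑ i, h i v ≤ m * (2 + ∑ i, v i) ^ (∑ i, d i) := by
      refine (Finset.sum_le_card_nsmul Finset.univ _ ((2 + ∑ i, v i) ^ (∑ i, d i))
        fun i _ => (hd1 i v).trans (pow_le_pow_of_two (by omega) ?_)).trans (by simp)
      exact Finset.single_le_sum (f := d) (fun _ _ => Nat.zero_le _) (Finset.mem_univ _)
    have h2 : m + 2 ≤ (2 + ∑ i, v i) ^ (m + 1) := by
      refine le_trans ?_ (Nat.pow_le_pow_left (show 2 ≤ 2 + ∑ i, v i by omega) _)
      have := Nat.lt_two_pow_self (n := m)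
      rw [pow_succ]; omega
    have h3 : 1 ≤ (2 + ∑ i, v i) ^ (∑ i, d i) := Nat.one_le_pow _ _ (by omega)
    rw [pow_add]
    calc _ ≤ (m + 2) * (2 + ∑ i, v i) ^ (∑ i, d i) := by rw [add_mul]; omega
      _ ≤ _ := Nat.mul_le_mul_right _ h2
  have hbd : ∀ v, (2 + ∑ i, h i v) ^ dg ≤ (2 + ∑ i, v i) ^ ((m + 1 + ∑ i, d i) * (dg + 1)) := by
    intro v
    refine (Nat.pow_le_pow_left (hsum v) dg).trans ?_
    rw [← pow_mul]
    exact pow_le_pow_of_two (by omega) (Nat.mul_le_mul_left _ (by omega))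
  refine ⟨(m + 1 + ∑ i, d i) * (dg + 1), fun v => (hg1 _).trans (hbd v), ?_⟩
  intro α β as t ht
  obtain ⟨c1, hc1⟩ := exec_many (α := α) (β := β) (h := h) ht (d := d)
    (fun i t' ht' => hd2 i α β as t' fun j => (ht j).trans_le ht') m
  obtain ⟨c2, hc2⟩ := hg2 α β (fun i => t + i) (t + m + 1) (fun i => by omega)
  obtain ⟨c3, hc3⟩ := exec_clearMany (α := α) (β := β) t m
  -- The inner values occupy `t, …, t + m - 1`, and the result is first put into `t + m + 1`. The
  -- gap keeps the source and the target of the final move distinct when `m = 0`.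
  refine ⟨.seq c1 (.seq c2 (.seq c3 (.mv (t + m + 1) t))), fun x σ h0 B hB => ?_⟩
  set V : Fin k → ℕ := fun i => σ.reg (as i) with hV
  refine .seq (hc1 x σ h0 B (le_trans (pow_le_pow_of_two (by omega) ?_) hB)) ?_
  · rw [mul_add]; omega
  set σ1 : PState β := σ.withReg (fun j =>
    if hj : t ≤ j ∧ j < t + m ∧ j - t < m then h ⟨j - t, hj.2.2⟩ V else σ.reg j) with hσ1
  have e1 : (fun i : Fin m => σ1.reg (t + i)) = fun i => h i V := by
    funext i
    simp [hσ1, PState.withReg_reg]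
  have e2 := hc2 x σ1 (fun j hj => by
    simp only [hσ1, PState.withReg_reg]; rw [dif_neg (by omega)]; exact h0 j (by omega)) B (by
      simp only [show ∀ i : Fin m, σ1.reg (t + i) = h i V from fun i => congrFun e1 i]
      exact (hbd V).trans hB)
  rw [e1] at e2
  refine .seq e2 (.seq (hc3 x B _) ?_)
  have e3 := Exec.mv (x := x) (B := B) ((σ1.set (t + m + 1) (g fun i => h i V)).withReg fun j =>
    if t ≤ j ∧ j < t + m then 0 else (σ1.set (t + m + 1) (g fun i => h i V)).reg j)
    (a := t + m + 1) (b := t) (by omega)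
  have r1 : (if t ≤ t ∧ t < t + m then 0 else
      (σ1.set (t + m + 1) (g fun i => h i V)).reg t) = 0 := by
    split_ifs
    · rfl
    · rw [PState.set_reg, if_neg (by omega)]
      simp only [hσ1, PState.withReg_reg]; rw [dif_neg (by omega)]; exact h0 t le_rfl
  have r2 : (if t ≤ t + m + 1 ∧ t + m + 1 < t + m then 0 else
      (σ1.set (t + m + 1) (g fun i => h i V)).reg (t + m + 1)) = g fun i => h i V := by
    rw [if_neg (by omega), PState.set_reg, if_pos rfl]
  simp only [PState.withReg_reg, r1, r2, Nat.zero_add] at e3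
  convert e3 ((hg1 _).trans ((hbd V).trans hB)) using 1
  refine PState.ext (fun j => ?_) rfl rfl
  simp only [PState.set_reg, hσ1, PState.withReg_reg]
  by_cases h1 : j = t
  · simp [h1]
  · simp only [h1, if_false]
    by_cases h2 : j = t + m + 1
    · simp [h2, h0 (t + m + 1) (by omega)]
    · simp only [h2, if_false]
      by_cases h3 : t ≤ j ∧ j < t + m
      · rw [if_pos h3, h0 j h3.1]
      · rw [if_neg h3, dif_neg (by omega)]

theorem LF.comp1 {k : ℕ} {g : ℕ → ℕ} {f : (Fin k → ℕ) → ℕ}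
    (hg : LF fun v : Fin 1 → ℕ => g (v 0)) (hf : LF f) : LF (fun v => g (f v)) :=
  LF.comp (h := ![f]) hg (by simpa [Fin.forall_fin_succ] using hf)

theorem LF.comp2 {k : ℕ} {g : ℕ → ℕ → ℕ} {f1 f2 : (Fin k → ℕ) → ℕ}
    (hg : LF fun v : Fin 2 → ℕ => g (v 0) (v 1)) (h1 : LF f1) (h2 : LF f2) :
    LF (fun v => g (f1 v) (f2 v)) :=
  LF.comp (h := ![f1, f2]) hg (by simpa [Fin.forall_fin_succ] using ⟨h1, h2⟩)

theorem LF.comp3 {k : ℕ} {g : ℕ → ℕ → ℕ → ℕ} {f1 f2 f3 : (Fin k → ℕ) → ℕ}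
    (hg : LF fun v : Fin 3 → ℕ => g (v 0) (v 1) (v 2)) (h1 : LF f1) (h2 : LF f2) (h3 : LF f3) :
    LF (fun v => g (f1 v) (f2 v) (f3 v)) :=
  LF.comp (h := ![f1, f2, f3]) hg (by simpa [Fin.forall_fin_succ] using ⟨h1, h2, h3⟩)

/-- Functions do not depend on how many further variables there are. -/
theorem LF.lift {k : ℕ} {f : (Fin k → ℕ) → ℕ} (h : LF f) :
    LF (fun w : Fin (k + 1) → ℕ => f fun i => w i.succ) :=
  h.comp (h := fun i w => w i.succ) fun _ => .var _

/-- Closure under polynomially bounded primitive recursion. -/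
theorem LF.prec {k : ℕ} {b f : (Fin k → ℕ) → ℕ} {g : (Fin k → ℕ) → ℕ → ℕ → ℕ} (hb : LF b)
    (hf : LF f) (hg : LF fun w : Fin (k + 2) → ℕ => g (fun i => w i.succ.succ) (w 0) (w 1))
    (e : ℕ) (he : ∀ v, ∀ i ≤ b v,
      Nat.rec (motive := fun _ => ℕ) (f v) (g v) i ≤ (2 + ∑ i, v i) ^ e) :
    LF (fun v => Nat.rec (motive := fun _ => ℕ) (f v) (g v) (b v)) := by
  obtain ⟨db, hb1, hb2⟩ := hb
  obtain ⟨df, hf1, hf2⟩ := hf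
  obtain ⟨dg, hg1, hg2⟩ := hg
  -- With `S = 2 + ∑ i, v i` and `M = S ^ (1 + db + e)`, each of `S`, the index and the current
  -- value is at most `M`, and `3 * M ≤ M ^ 3`. This is the factor `3` in the exponent.
  set D := (3 * (1 + db + e)) * dg + df + db + e + 1 with hD
  have hbd : ∀ (v : Fin k → ℕ) (i a : ℕ), i ≤ (2 + ∑ i, v i) ^ db → a ≤ (2 + ∑ i, v i) ^ e →
      (2 + (i + (a + ∑ i, v i))) ^ dg ≤ (2 + ∑ i, v i) ^ D := by
    intro v i a hi ha
    set S := 2 + ∑ i, v i with hS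
    have hS2 : 2 ≤ S := by omega
    set M := S ^ (1 + db + e)
    have h1 : S ≤ M := by
      calc S = S ^ 1 := (pow_one _).symm
        _ ≤ _ := pow_le_pow_of_two hS2 (by omega)
    have h2 : S ^ db ≤ M := pow_le_pow_of_two hS2 (by omega)
    have h3 : S ^ e ≤ M := pow_le_pow_of_two hS2 (by omega)
    have h4 : 3 * M ≤ M ^ 3 := by
      have : 3 ≤ M ^ 2 := by nlinarith
      calc 3 * M ≤ M ^ 2 * M := Nat.mul_le_mul_right _ this
        _ = M ^ 3 := by ring
    calc (2 + (i + (a + ∑ i, v i))) ^ dg ≤ (M ^ 3) ^ dg := Nat.pow_le_pow_left (by omega) _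
      _ = S ^ ((3 * (1 + db + e)) * dg) := by
        rw [← pow_mul, ← pow_mul]; congr 1; ring
      _ ≤ S ^ D := pow_le_pow_of_two hS2 (by omega)
  refine ⟨D, fun v => (he v _ le_rfl).trans (pow_le_pow_of_two (by omega) (by omega)), ?_⟩
  intro α β as t ht
  obtain ⟨cb, hcb⟩ := hb2 α β as t ht
  obtain ⟨cf, hcf⟩ := hf2 α β as (t + 1) fun i => (ht i).trans (by omega)
  obtain ⟨cg, hcg⟩ := hg2 α β (Fin.cons (t + 2) (Fin.cons (t + 1) as)) (t + 3) (by
    intro i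
    refine Fin.cases ?_ (fun i => Fin.cases ?_ (fun i => ?_) i) i
    · simp
    · simp
    · simpa using (ht i).trans (by omega))
  -- Register `t` counts the remaining passes, `t + 1` holds the current value, `t + 2` the index,
  -- and `t + 3` receives the new value. At the end `t` is zero and takes the result.
  refine ⟨.seq cb (.seq cf (.seq (.loop t (.seq cg (.seq (.clear (t + 1))
    (.seq (.mv (t + 3) (t + 1)) (.inc (t + 2)))))) (.seq (.clear (t + 2)) (.mv (t + 1) t)))),
    fun x σ h0 B hB => ?_⟩
  set V : Fin k → ℕ := fun i => σ.reg (as i) with hV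
  have hS2 : 2 ≤ 2 + ∑ i, V i := by omega
  refine .seq (hcb x σ h0 B ((pow_le_pow_of_two hS2 (by omega)).trans hB)) ?_
  have ef := hcf x (σ.set t (b V)) (fun j hj => by
    rw [PState.set_reg, if_neg (by omega)]; exact h0 j (by omega)) B
  have er : ∀ i, (σ.set t (b V)).reg (as i) = V i := fun i => by
    rw [PState.set_reg, if_neg (ht i).ne]
  simp only [er] at ef
  refine .seq (ef ((pow_le_pow_of_two hS2 (by omega)).trans hB)) ?_
  set R : ℕ → ℕ := fun i => Nat.rec (motive := fun _ => ℕ) (f V) (g V) i with hR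
  let τ : ℕ → PState β := fun i => ((σ.set t (b V - i)).set (t + 1) (R i)).set (t + 2) i
  have hloop := Exec.loop_chain (x := x) (B := B) (r := t) (N := b V)
    (c := .seq cg (.seq (.clear (t + 1)) (.seq (.mv (t + 3) (t + 1)) (.inc (t + 2))))) τ
    (fun i _ => by simp [τ, PState.set_reg]) (fun i hi => by
      have hRi : R (i + 1) ≤ B :=
        (he V (i + 1) hi).trans ((pow_le_pow_of_two hS2 (by omega)).trans hB)
      have hbB : b V ≤ B := (hb1 V).trans ((pow_le_pow_of_two hS2 (by omega)).trans hB)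
      have e1 : ∀ j, ((τ i).set t (b V - i - 1)).reg j = if j = t then b V - i - 1 else
          if j = t + 2 then i else if j = t + 1 then R i else σ.reg j := fun j => by
        simp only [τ, PState.set_reg]
        split_ifs <;> rfl
      have e2 := hcg x ((τ i).set t (b V - i - 1)) (fun j hj => by
        rw [e1, if_neg (by omega), if_neg (by omega), if_neg (by omega)]
        exact h0 j (by omega)) B
      have e3 : ∀ i', ((τ i).set t (b V - i - 1)).reg (as i') = V i' := fun i' => by
        have := ht i'
        rw [e1, if_neg (by omega), if_neg (by omega), if_neg (by omega)]
      have e4 : ((τ i).set t (b V - i - 1)).reg (t + 1) = R i := by rw [e1]; simp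
      have e5 : ((τ i).set t (b V - i - 1)).reg (t + 2) = i := by rw [e1]; simp
      simp only [Fin.sum_univ_succ, Fin.cons_zero, Fin.cons_succ, e3, e4, e5, Fin.cons_one] at e2
      refine .seq (e2 ((hbd V i (R i) (hi.le.trans (hb1 V)) (he V i hi.le)).trans hB))
        (.seq (.clear _ _) ?_)
      have e6 : g V i (R i) = R (i + 1) := rfl
      rw [e6]
      set σ2 := (((τ i).set t (b V - i - 1)).set (t + 3) (R (i + 1))).set (t + 1) 0 with hσ2
      have e7 : ∀ j, σ2.reg j = if j = t + 1 then 0 else if j = t + 3 then R (i + 1) else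
          if j = t then b V - i - 1 else if j = t + 2 then i else σ.reg j := fun j => by
        rw [hσ2, PState.set_reg, PState.set_reg, e1]
        split_ifs <;> rfl
      have e8 := Exec.mv (x := x) (B := B) σ2 (a := t + 3) (b := t + 1) (by omega) (by
        rw [e7, e7]; simpa using hRi)
      refine .seq e8 ?_
      have e9 := Exec.inc (x := x) (B := B)
        ((σ2.set (t + 3) 0).set (t + 1) (σ2.reg (t + 1) + σ2.reg (t + 3))) (t + 2) (by
          simp only [PState.set_reg, e7]
          simp
          omega)
      convert e9 using 1
      refine PState.ext (fun j => ?_) rfl rfl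
      simp only [PState.set_reg, e7, τ]
      have h3 := h0 (t + 3) (by omega)
      rcases (by omega : j = t ∨ j = t + 1 ∨ j = t + 2 ∨ j = t + 3 ∨ (j ≠ t ∧ j ≠ t + 1 ∧
        j ≠ t + 2 ∧ j ≠ t + 3)) with rfl | rfl | rfl | rfl | ⟨h4, h5, h6, h7⟩
      · simp; omega
      · simp
      · simp
      · simp [h3]
      · simp [h4, h5, h6, h7])
  refine .seq (τ := τ (b V)) ?_ ?_
  · convert hloop using 1
    refine PState.ext (fun j => ?_) rfl rfl
    simp only [PState.set_reg, τ]
    have h2 := h0 (t + 2) (by omega)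
    rcases (by omega : j = t ∨ j = t + 1 ∨ j = t + 2 ∨ (j ≠ t ∧ j ≠ t + 1 ∧ j ≠ t + 2))
      with rfl | rfl | rfl | ⟨h4, h5, h6⟩
    · simp
    · simp [R, hV]
    · simp [h2]
    · simp [h4, h5, h6]
  · refine .seq (.clear _ _) ?_
    have hRb : R (b V) ≤ B :=
      (he V _ le_rfl).trans ((pow_le_pow_of_two hS2 (by omega)).trans hB)
    have e1 := Exec.mv (x := x) (B := B) ((τ (b V)).set (t + 2) 0) (a := t + 1) (b := t)
      (by omega) (by simpa [τ, PState.set_reg] using hRb)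
    convert e1 using 1
    refine PState.ext (fun j => ?_) rfl rfl
    simp only [PState.set_reg, τ]
    have h1 := h0 (t + 1) (by omega)
    have h2 := h0 (t + 2) (by omega)
    rcases (by omega : j = t ∨ j = t + 1 ∨ j = t + 2 ∨ (j ≠ t ∧ j ≠ t + 1 ∧ j ≠ t + 2))
      with rfl | rfl | rfl | ⟨h4, h5, h6⟩
    · simp [R]
    · simp [h1]
    · simp [h2]
    · simp [h4, h5, h6]


/-! ### Arithmetic -/

theorem LF.add {k : ℕ} {f g : (Fin k → ℕ) → ℕ} (hf : LF f) (hg : LF g) :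
    LF (fun v => f v + g v) := by
  refine LF.comp2 (g := fun a b => a + b) ?_ hf hg
  have h0 : ∀ (v : Fin 2 → ℕ) i, Nat.rec (motive := fun _ => ℕ) (v 0) (fun _ a => a + 1) i =
      v 0 + i := fun v i => by
    induction i with
    | zero => rfl
    | succ i ih => simp only [ih]; omega
  have := LF.prec (k := 2) (b := fun v => v 1) (f := fun v => v 0) (g := fun _ _ a => a + 1)
    (.var 1) (.var 0) (LF.var 1).succ 1 (fun v i hi => by
      rw [h0, Fin.sum_univ_two, pow_one]; omega)
  exact this.congr fun v => h0 v _

theorem LF.mul {k : ℕ} {f g : (Fin k → ℕ) → ℕ} (hf : LF f) (hg : LF g) :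
    LF (fun v => f v * g v) := by
  refine LF.comp2 (g := fun a b => a * b) ?_ hf hg
  have h0 : ∀ (v : Fin 2 → ℕ) i, Nat.rec (motive := fun _ => ℕ) 0 (fun _ a => a + v 0) i =
      v 0 * i := fun v i => by
    induction i with
    | zero => rfl
    | succ i ih => simp only [ih]; ring
  have := LF.prec (k := 2) (b := fun v => v 1) (f := fun v => 0) (g := fun v _ a => a + v 0)
    (.var 1) .zero (LF.add (.var 1) (.var 2)) 2 (fun v i hi => by
      rw [h0, Fin.sum_univ_two]; nlinarith)
  exact this.congr fun v => h0 v _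

theorem LF.pow_const {k : ℕ} {f : (Fin k → ℕ) → ℕ} (hf : LF f) (n : ℕ) :
    LF (fun v => f v ^ n) := by
  induction n with
  | zero => exact (LF.const 1).congr fun v => by simp
  | succ n ih => exact (ih.mul hf).congr fun v => by rw [pow_succ]

theorem LF.pred {k : ℕ} {f : (Fin k → ℕ) → ℕ} (hf : LF f) : LF (fun v => f v - 1) := by
  refine LF.comp1 (g := fun a => a - 1) ?_ hf
  have h0 : ∀ i, Nat.rec (motive := fun _ => ℕ) 0 (fun i _ => i) i = i - 1 := fun i => by
    cases i <;> rfl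
  have := LF.prec (k := 1) (b := fun v => v 0) (f := fun v => 0) (g := fun _ i _ => i)
    (.var 0) .zero (LF.var 0) 1 (fun v i hi => by
      rw [h0, Fin.sum_univ_one, pow_one]; omega)
  exact this.congr fun v => h0 _

theorem LF.sub {k : ℕ} {f g : (Fin k → ℕ) → ℕ} (hf : LF f) (hg : LF g) :
    LF (fun v => f v - g v) := by
  refine LF.comp2 (g := fun a b => a - b) ?_ hf hg
  have h0 : ∀ (v : Fin 2 → ℕ) i, Nat.rec (motive := fun _ => ℕ) (v 0) (fun _ a => a - 1) i =
      v 0 - i := fun v i => by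
    induction i with
    | zero => rfl
    | succ i ih => simp only [ih]; omega
  have := LF.prec (k := 2) (b := fun v => v 1) (f := fun v => v 0) (g := fun _ _ a => a - 1)
    (.var 1) (.var 0) (LF.var 1).pred 1 (fun v i hi => by
      rw [h0, Fin.sum_univ_two, pow_one]; omega)
  exact this.congr fun v => h0 v _

/-- Predicates whose characteristic function has polynomially bounded programs. -/
def LP {k : ℕ} (p : (Fin k → ℕ) → Prop) : Prop :=
  LF (open Classical in fun v => if p v then 1 else 0)

theorem LP.congr {k : ℕ} {p q : (Fin k → ℕ) → Prop} (h : LP p) (e : ∀ v, p v ↔ q v) : LP q := by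
  rwa [← funext fun v => propext (e v)]

theorem LF.ite {k : ℕ} {p : (Fin k → ℕ) → Prop} [∀ v, Decidable (p v)] {f g : (Fin k → ℕ) → ℕ}
    (hp : LP p) (hf : LF f) (hg : LF g) : LF (fun v => if p v then f v else g v) := by
  -- A case distinction is a recursion whose step ignores its arguments: it returns the initial
  -- value for length zero and the other value for every positive length.
  have h0 : ∀ a b i : ℕ, Nat.rec (motive := fun _ => ℕ) a (fun _ _ => b) i =
      if i = 0 then a else b := fun a b i => by cases i <;> rfl
  have h1 : LF fun v : Fin 3 → ℕ => if v 0 = 0 then v 1 else v 2 := by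
    have := LF.prec (k := 3) (b := fun v => v 0) (f := fun v => v 1) (g := fun v _ _ => v 2)
      (.var 0) (.var 1) (.var 4) 1 (fun v i hi => by
        rw [h0, Fin.sum_univ_three, pow_one]; split_ifs <;> omega)
    exact this.congr fun v => h0 _ _ _
  refine (LF.comp3 (g := fun a b c => if a = 0 then b else c) h1 hp hg hf).congr fun v => ?_
  by_cases h : p v <;> simp [h]

/-- With truncated subtraction, `1 - (1 - a)` is the sign of `a`. -/
theorem LP.ne_zero {k : ℕ} {f : (Fin k → ℕ) → ℕ} (hf : LF f) : LP (fun v => f v ≠ 0) := by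
  refine ((LF.const 1).sub ((LF.const 1).sub hf)).congr fun v => ?_
  split_ifs <;> omega

theorem LP.not {k : ℕ} {p : (Fin k → ℕ) → Prop} (hp : LP p) : LP (fun v => ¬ p v) := by
  refine ((LF.const 1).sub hp).congr fun v => ?_
  by_cases h : p v <;> simp [h]

theorem LP.and {k : ℕ} {p q : (Fin k → ℕ) → Prop} (hp : LP p) (hq : LP q) :
    LP (fun v => p v ∧ q v) := by
  refine (LF.mul hp hq).congr fun v => ?_
  by_cases h : p v <;> by_cases h' : q v <;> simp [h, h']

theorem LP.or {k : ℕ} {p q : (Fin k → ℕ) → Prop} (hp : LP p) (hq : LP q) :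
    LP (fun v => p v ∨ q v) :=
  (hp.not.and hq.not).not.congr fun v => by tauto

theorem LP.lt {k : ℕ} {f g : (Fin k → ℕ) → ℕ} (hf : LF f) (hg : LF g) :
    LP (fun v => f v < g v) :=
  (LP.ne_zero (hg.sub hf)).congr fun v => by omega

theorem LP.le {k : ℕ} {f g : (Fin k → ℕ) → ℕ} (hf : LF f) (hg : LF g) :
    LP (fun v => f v ≤ g v) :=
  (LP.lt hg hf).not.congr fun v => by omega

theorem LP.eq {k : ℕ} {f g : (Fin k → ℕ) → ℕ} (hf : LF f) (hg : LF g) :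
    LP (fun v => f v = g v) :=
  ((LP.le hf hg).and (LP.le hg hf)).congr fun v => by omega

theorem LP.lift {k : ℕ} {p : (Fin k → ℕ) → Prop} (h : LP p) :
    LP (fun w : Fin (k + 1) → ℕ => p fun i => w i.succ) :=
  LF.lift h

/-- The least number below a bound with a given property. -/
theorem LF.of_least {k : ℕ} {f b : (Fin k → ℕ) → ℕ} {p : ℕ → (Fin k → ℕ) → Prop}
    (hb : LF b) (hp : LP fun w : Fin (k + 1) → ℕ => p (w 0) fun i => w i.succ)
    (h1 : ∀ v, f v ≤ b v) (h2 : ∀ v, f v < b v → p (f v) v) (h3 : ∀ v, ∀ i < f v, ¬ p i v) :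
    LF f := by
  classical
  -- The search is a recursion that increments its value until the property holds and then keeps it;
  -- after `i` steps the value is `min i (f v)`.
  have h0 : ∀ v, ∀ i ≤ b v, Nat.rec (motive := fun _ => ℕ) 0
      (fun _ a => if p a v then a else a + 1) i = min i (f v) := fun v i hi => by
    induction i with
    | zero => simp
    | succ i ih =>
      simp only [ih (by omega)]
      rcases lt_or_ge i (f v) with h | h
      · rw [min_eq_left h.le, if_neg (h3 v i h)]; omega
      · rw [min_eq_right h, if_pos (h2 v (by omega))]; omega
  obtain ⟨d, hd⟩ := hb.poly
  have hp' : LP fun w : Fin (k + 2) → ℕ => p (w 1) fun i => w i.succ.succ :=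
    LF.lift (k := k + 1) hp
  have := LF.prec (b := b) (f := fun v => 0)
    (g := fun v _ a => if p a v then a else a + 1) hb .zero
    (LF.ite hp' (.var 1) (LF.var 1).succ) d (fun v i hi => by
      rw [h0 v i hi]; exact (min_le_left _ _).trans (hi.trans (hd v)))
  exact this.congr fun v => by rw [h0 v _ le_rfl, min_eq_right (h1 v)]

/-- Bounded quantification. -/
theorem LP.ex {k : ℕ} {b : (Fin k → ℕ) → ℕ} {p : ℕ → (Fin k → ℕ) → Prop}
    (hb : LF b) (hp : LP fun w : Fin (k + 1) → ℕ => p (w 0) fun i => w i.succ) :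
    LP fun v => ∃ i < b v, p i v := by
  classical
  have key : LF fun v => if h : ∃ i < b v, p i v then Nat.find h else b v := by
    refine LF.of_least hb hp (fun v => ?_) (fun v => ?_) (fun v i => ?_)
    · split_ifs with h
      · exact (Nat.find_spec h).1.le
      · exact le_rfl
    · split_ifs with h
      · exact fun _ => (Nat.find_spec h).2
      · exact fun h' => absurd h' (lt_irrefl _)
    · split_ifs with h
      · exact fun h' h2 => Nat.find_min h h' ⟨h'.trans (Nat.find_spec h).1, h2⟩
      · exact fun h' h2 => h ⟨i, h', h2⟩
  refine (LP.lt key hb).congr fun v => ?_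
  split_ifs with h
  · exact ⟨fun _ => h, fun _ => (Nat.find_spec h).1⟩
  · exact ⟨fun h' => absurd h' (lt_irrefl _), fun h' => absurd h' h⟩

theorem LF.div {k : ℕ} {f g : (Fin k → ℕ) → ℕ} (hf : LF f) (hg : LF g) :
    LF (fun v => f v / g v) := by
  refine LF.of_least (b := f) (p := fun i v => g v = 0 ∨ f v < (i + 1) * g v) hf
    ((LP.eq hg.lift (.const 0)).or (LP.lt hf.lift ((LF.var 0).succ.mul hg.lift)))
    (fun v => Nat.div_le_self _ _) (fun v _ => ?_) (fun v i hi => ?_)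
  · rcases Nat.eq_zero_or_pos (g v) with h | h
    · exact Or.inl h
    · exact Or.inr (by rw [mul_comm]; exact Nat.lt_mul_div_succ _ h)
  · rcases Nat.eq_zero_or_pos (g v) with h | h
    · rw [h] at hi; simp at hi
    · rintro (h' | h')
      · omega
      · have := (Nat.le_div_iff_mul_le h).1 (show i + 1 ≤ f v / g v from hi)
        omega

theorem LF.mod {k : ℕ} {f g : (Fin k → ℕ) → ℕ} (hf : LF f) (hg : LF g) :
    LF (fun v => f v % g v) :=
  (hf.sub (hg.mul (hf.div hg))).congr fun v => by
    have := Nat.div_add_mod (f v) (g v); omega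

theorem LF.sqrt {k : ℕ} {f : (Fin k → ℕ) → ℕ} (hf : LF f) : LF (fun v => Nat.sqrt (f v)) := by
  refine LF.of_least (b := f) (p := fun i v => f v < (i + 1) * (i + 1)) hf
    (LP.lt hf.lift ((LF.var 0).succ.mul (LF.var 0).succ))
    (fun v => Nat.sqrt_le_self _) (fun v _ => Nat.lt_succ_sqrt _) (fun v i hi h => ?_)
  have := Nat.le_sqrt.1 (show i + 1 ≤ Nat.sqrt (f v) from hi)
  omega

theorem LF.natPair {k : ℕ} {f g : (Fin k → ℕ) → ℕ} (hf : LF f) (hg : LF g) :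
    LF (fun v => Nat.pair (f v) (g v)) :=
  LF.ite (LP.lt hf hg) ((hg.mul hg).add hf) (((hf.mul hf).add hf).add hg)

theorem LF.unpair1 {k : ℕ} {f : (Fin k → ℕ) → ℕ} (hf : LF f) :
    LF (fun v => (Nat.unpair (f v)).1) := by
  have h1 := hf.sub (hf.sqrt.mul hf.sqrt)
  refine (LF.ite (LP.lt h1 hf.sqrt) h1 hf.sqrt).congr fun v => ?_
  unfold Nat.unpair
  dsimp only
  split_ifs <;> rfl

theorem LF.unpair2 {k : ℕ} {f : (Fin k → ℕ) → ℕ} (hf : LF f) :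
    LF (fun v => (Nat.unpair (f v)).2) := by
  have h1 := hf.sub (hf.sqrt.mul hf.sqrt)
  refine (LF.ite (LP.lt h1 hf.sqrt) hf.sqrt (h1.sub hf.sqrt)).congr fun v => ?_
  unfold Nat.unpair
  dsimp only
  split_ifs <;> rfl

/-- Powers `2 ^ i` are not polynomially bounded and hence not available. The quotients `n / 2 ^ i`
are, by repeated halving, and the logarithm is the least `i` for which `n / 2 ^ (i + 1)` vanishes.
-/
theorem LF.log {k : ℕ} {f : (Fin k → ℕ) → ℕ} (hf : LF f) : LF (fun v => Nat.log 2 (f v)) := by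
  refine LF.comp1 (g := fun n => Nat.log 2 n) ?_ hf
  have h0 : ∀ n i : ℕ, Nat.rec (motive := fun _ => ℕ) n (fun _ a => a / 2) i = n / 2 ^ i :=
    fun n i => by
      induction i with
      | zero => simp
      | succ i ih => simp only [ih]; rw [Nat.div_div_eq_div_mul, pow_succ]
  have h1 : LF fun v : Fin 2 → ℕ => v 1 / 2 ^ (v 0) := by
    have := LF.prec (k := 2) (b := fun v => v 0) (f := fun v => v 1) (g := fun v _ a => a / 2)
      (.var 0) (.var 1) ((LF.var 1).div (.const 2)) 1 (fun v i hi => by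
        rw [h0, Fin.sum_univ_two, pow_one]
        have := Nat.div_le_self (v 1) (2 ^ i)
        omega)
    exact this.congr fun v => h0 _ _
  refine LF.of_least (k := 1) (b := fun v => v 0) (p := fun i v => v 0 / 2 ^ (i + 1) = 0)
    (.var 0) (LP.eq (LF.comp2 (g := fun a b => b / 2 ^ a) h1 (LF.var 0).succ (.var 1))
      (.const 0)) (fun v => Nat.log_le_self _ _) (fun v _ => ?_) (fun v i hi h => ?_)
  · exact Nat.div_eq_of_lt (Nat.lt_pow_succ_log_self (by norm_num) _)
  · rw [Nat.div_eq_zero_iff] at h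
    rcases h with h | h
    · simp at h
    · rcases Nat.eq_zero_or_pos (v 0) with hv | hv
      · rw [hv] at hi; simp at hi
      · have := Nat.pow_le_of_le_log hv.ne' (show i + 1 ≤ Nat.log 2 (v 0) from hi)
        omega


/-! ### Output of long strings -/

/-- Append to the output. -/
def PState.addOut (σ : PState Bool) (l : List Bool) : PState Bool :=
  ⟨σ.reg, σ.pos, σ.out ++ l⟩

@[simp] theorem PState.addOut_reg (σ : PState Bool) (l : List Bool) :
    (σ.addOut l).reg = σ.reg := rfl

/-- String-valued functions with a program that writes the string, whose registers are
polynomially bounded. -/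
def LE {k : ℕ} (f : (Fin k → ℕ) → List Bool) : Prop :=
  ∃ d, ∀ (α : Type) (as : Fin k → ℕ) (t : ℕ), (∀ i, as i < t) → ∃ c : Cmd α Bool,
    ∀ (x : List α) (σ : PState Bool), (∀ j, t ≤ j → σ.reg j = 0) →
      ∀ B, (2 + ∑ i, σ.reg (as i)) ^ d ≤ B →
        Exec x B c σ (σ.addOut (f fun i => σ.reg (as i)))

theorem LE.congr {k : ℕ} {f g : (Fin k → ℕ) → List Bool} (h : LE f) (e : ∀ v, f v = g v) :
    LE g := by
  rwa [← funext e]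

theorem LE.nil {k : ℕ} : LE (fun _ : Fin k → ℕ => []) := by
  refine ⟨0, fun α as t _ => ⟨.skip, fun x σ _ B _ => ?_⟩⟩
  simpa [PState.addOut] using Exec.skip σ

theorem LE.bit {k : ℕ} (b : Bool) : LE (fun _ : Fin k → ℕ => [b]) :=
  ⟨0, fun _ _ _ _ => ⟨.emit b, fun _ σ _ _ _ => .emit σ b⟩⟩

theorem LE.append {k : ℕ} {f g : (Fin k → ℕ) → List Bool} (hf : LE f) (hg : LE g) :
    LE (fun v => f v ++ g v) := by
  obtain ⟨d1, h1⟩ := hf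
  obtain ⟨d2, h2⟩ := hg
  refine ⟨d1 + d2, fun α as t ht => ?_⟩
  obtain ⟨c1, hc1⟩ := h1 α as t ht
  obtain ⟨c2, hc2⟩ := h2 α as t ht
  refine ⟨.seq c1 c2, fun x σ h0 B hB => ?_⟩
  refine .seq (hc1 x σ h0 B ((pow_le_pow_of_two (by omega) (by omega)).trans hB)) ?_
  have := hc2 x (σ.addOut (f fun i => σ.reg (as i))) h0 B
    ((pow_le_pow_of_two (by omega) (by omega)).trans hB)
  simpa [PState.addOut, List.append_assoc] using this

theorem LE.cons {k : ℕ} (b : Bool) {f : (Fin k → ℕ) → List Bool} (hf : LE f) :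
    LE (fun v => b :: f v) :=
  (LE.bit b).append hf

/-- The characteristic function serves as a loop counter, so that the body runs once or not at all.
-/
theorem LE.cond {k : ℕ} {p : (Fin k → ℕ) → Prop} [∀ v, Decidable (p v)]
    {f : (Fin k → ℕ) → List Bool} (hp : LP p) (hf : LE f) :
    LE (fun v => if p v then f v else []) := by
  obtain ⟨d1, -, h1⟩ := hp
  obtain ⟨d2, h2⟩ := hf
  refine ⟨d1 + d2, fun α as t ht => ?_⟩
  obtain ⟨c1, hc1⟩ := h1 α Bool as t ht
  obtain ⟨c2, hc2⟩ := h2 α as t ht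
  refine ⟨.seq c1 (.loop t c2), fun x σ h0 B hB => ?_⟩
  refine .seq (hc1 x σ h0 B ((pow_le_pow_of_two (by omega) (by omega)).trans hB)) ?_
  have e : σ.set t 0 = σ := by
    rw [← h0 t le_rfl, PState.set_self]
  by_cases hv : p fun i => σ.reg (as i)
  · simp only [hv, if_true]
    refine .loop_succ (v := 0) (τ := σ.addOut (f fun i => σ.reg (as i)))
      (by simp [PState.set_reg]) ?_ (.loop_zero (h0 t le_rfl))
    rw [PState.set_set, e]
    exact hc2 x σ h0 B ((pow_le_pow_of_two (by omega) (by omega)).trans hB)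
  · simp only [hv, if_false, PState.addOut, List.append_nil, e]
    exact .loop_zero (h0 t le_rfl)

theorem LE.ite {k : ℕ} {p : (Fin k → ℕ) → Prop} [∀ v, Decidable (p v)]
    {f g : (Fin k → ℕ) → List Bool} (hp : LP p) (hf : LE f) (hg : LE g) :
    LE (fun v => if p v then f v else g v) :=
  ((LE.cond hp hf).append (LE.cond hp.not hg)).congr fun v => by
    by_cases h : p v <;> simp [h]

set_option maxHeartbeats 800000 in
theorem LE.flatMap {k : ℕ} {b : (Fin k → ℕ) → ℕ} {f : ℕ → (Fin k → ℕ) → List Bool} (hb : LF b)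
    (hf : LE fun w : Fin (k + 1) → ℕ => f (w 0) fun i => w i.succ) :
    LE (fun v => (List.range (b v)).flatMap fun i => f i v) := by
  obtain ⟨d1, hb1, h1⟩ := hb
  obtain ⟨d2, h2⟩ := hf
  -- The running index is at most the `d1`-th power of the base, so the arguments of the body sum up
  -- to at most the `(d1 + 1)`-th power.
  refine ⟨d1 + (d1 + 1) * d2, fun α as t ht => ?_⟩
  obtain ⟨c1, hc1⟩ := h1 α Bool as t ht
  obtain ⟨c2, hc2⟩ := h2 α (Fin.cons (t + 1) as) (t + 2) (by
    intro i
    refine Fin.cases ?_ (fun i => ?_) i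
    · simp
    · simpa using (ht i).trans (by omega))
  refine ⟨.seq c1 (.seq (.loop t (.seq c2 (.inc (t + 1)))) (.clear (t + 1))),
    fun x σ h0 B hB => ?_⟩
  set V : Fin k → ℕ := fun i => σ.reg (as i) with hV
  have hS2 : 2 ≤ 2 + ∑ i, V i := by omega
  have hbB : b V ≤ B := (hb1 V).trans ((pow_le_pow_of_two hS2 (by omega)).trans hB)
  refine .seq (hc1 x σ h0 B ((pow_le_pow_of_two hS2 (by omega)).trans hB)) ?_
  let τ : ℕ → PState Bool := fun i => { (σ.set t (b V - i)).set (t + 1) i with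
    out := σ.out ++ (List.range i).flatMap fun i => f i V }
  have hτ : ∀ i j, (τ i).reg j = if j = t + 1 then i else if j = t then b V - i else σ.reg j :=
    fun i j => by simp only [τ, PState.set_reg]
  have h3 : σ.set t (b V) = τ 0 := by
    refine PState.ext (fun j => ?_) rfl (by simp [τ])
    rw [hτ, PState.set_reg]
    have := h0 (t + 1) (by omega)
    split_ifs <;> simp_all
  have hloop := Exec.loop_chain (x := x) (B := B) (r := t) (N := b V)
    (c := .seq c2 (.inc (t + 1))) τ (fun i _ => by simp [hτ]) (fun i hi => by
      have e1 : ∀ j, ((τ i).set t (b V - i - 1)).reg j = if j = t then b V - i - 1 else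
          if j = t + 1 then i else σ.reg j := fun j => by
        rw [PState.set_reg, hτ]
        split_ifs <;> rfl
      have e2 := hc2 x ((τ i).set t (b V - i - 1)) (fun j hj => by
        rw [e1, if_neg (by omega), if_neg (by omega)]
        exact h0 j (by omega)) B
      have e3 : ∀ i', ((τ i).set t (b V - i - 1)).reg (as i') = V i' := fun i' => by
        have := ht i'
        rw [e1, if_neg (by omega), if_neg (by omega)]
      have e4 : ((τ i).set t (b V - i - 1)).reg (t + 1) = i := by rw [e1]; simp
      simp only [Fin.sum_univ_succ, Fin.cons_zero, Fin.cons_succ, e3, e4] at e2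
      refine .seq (e2 (le_trans ?_ hB)) ?_
      · have h4 : 2 + (i + ∑ i, V i) ≤ (2 + ∑ i, V i) ^ (d1 + 1) := by
          have h5 := hb1 V
          have h6 : (2 + ∑ i, V i) ^ d1 * 2 ≤ (2 + ∑ i, V i) ^ (d1 + 1) := by
            rw [pow_succ]; exact Nat.mul_le_mul_left _ hS2
          have h7 : 1 ≤ (2 + ∑ i, V i) ^ d1 := Nat.one_le_pow _ _ (by omega)
          have h8 : (2 + ∑ i, V i) ^ d1 + (1 + ∑ i, V i) ≤ (2 + ∑ i, V i) ^ (d1 + 1) := by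
            rw [pow_succ]; nlinarith
          omega
        refine (Nat.pow_le_pow_left h4 d2).trans ?_
        rw [← pow_mul]
        exact pow_le_pow_of_two hS2 (by omega)
      · refine (?_ : Exec x B (.inc (t + 1)) (((τ i).set t (b V - i - 1)).addOut (f i V)) (τ (i + 1)))
        have e5 := Exec.inc (x := x) (B := B) (((τ i).set t (b V - i - 1)).addOut (f i V)) (t + 1) (by
            change ((τ i).set t (b V - i - 1)).reg (t + 1) + 1 ≤ B
            rw [e4]; omega)
        convert e5 using 1
        refine PState.ext (fun j => ?_) rfl ?_
        · rw [hτ, PState.set_reg]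
          change _ = if j = t + 1 then ((τ i).set t (b V - i - 1)).reg (t + 1) + 1 else
            ((τ i).set t (b V - i - 1)).reg j
          rw [e4, e1]
          split_ifs <;> omega
        · simp [τ, List.range_succ, PState.addOut, PState.set])
  rw [h3]
  refine .seq hloop ?_
  convert Exec.clear (x := x) (B := B) (τ (b V)) (t + 1) using 1
  refine PState.ext (fun j => ?_) rfl rfl
  rw [PState.set_reg, hτ]
  rcases (by omega : j = t ∨ j = t + 1 ∨ (j ≠ t ∧ j ≠ t + 1)) with rfl | rfl | ⟨h3, h4⟩
  · simp [h0 j le_rfl]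
  · simp [h0 (t + 1) (by omega)]
  · simp [h3, h4]

theorem LE.replicate {k : ℕ} {b : (Fin k → ℕ) → ℕ} (hb : LF b) (y : Bool) :
    LE (fun v => List.replicate (b v) y) :=
  (LE.flatMap (f := fun _ _ => [y]) hb (LE.bit y)).congr fun v => by
    induction b v with
    | zero => rfl
    | succ n ih => rw [List.range_succ, List.flatMap_append, ih]; simp [List.replicate_succ']

theorem LE.encodeNat {k : ℕ} {b : (Fin k → ℕ) → ℕ} (hb : LF b) :
    LE (fun v => encodeNat (b v)) :=
  (LE.replicate hb true).append (LE.bit false)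

/-! ### Programs for functions of the input length -/

/-- The cell holds an input symbol. -/
def InCell.isSym {α : Type} : InCell α → Bool
  | .sym _ => true
  | _ => false

/-- The cell is the left end of the input. -/
def InCell.isLeft {α : Type} : InCell α → Bool
  | .leftEnd => true
  | _ => false

/-- The cell holds the input bit `true`. -/
def InCell.isTrue : InCell Bool → Bool
  | .sym b => b
  | _ => false

/-- Store the input length in register `0`. -/
def Cmd.inputLength {α β : Type} : Cmd α β :=
  .seq (.move .right) (.whileIn InCell.isSym (.seq (.move .right) (.inc 0)))

theorem inCell_of_lt {α : Type} (x : List α) {p : ℕ} (h : p < x.length) :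
    Machine.inCell x (p + 1) = .sym x[p] := by
  simp [Machine.inCell, h]

theorem inCell_length {α : Type} (x : List α) : Machine.inCell x (x.length + 1) = .rightEnd := by
  simp [Machine.inCell]

theorem Exec.inputLength {α β : Type} (x : List α) {B : ℕ} (hB : x.length ≤ B) :
    Exec x B (.inputLength : Cmd α β) ⟨fun _ => 0, 0, []⟩
      ⟨fun j => if j = 0 then x.length else 0, x.length + 1, []⟩ := by
  have key : ∀ i ≤ x.length, Exec (β := β) x B
      (.whileIn InCell.isSym (.seq (.move .right) (.inc 0)))
      ⟨fun j => if j = 0 then x.length - i else 0, x.length - i + 1, []⟩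
      ⟨fun j => if j = 0 then x.length else 0, x.length + 1, []⟩ := by
    intro i hi
    induction i with
    | zero =>
      refine .whileIn_false ?_
      change InCell.isSym (Machine.inCell x (x.length + 1)) = false
      rw [inCell_length]; rfl
    | succ i ih =>
      refine .whileIn_true ?_ (.seq (.move _ _) ?_) (ih (by omega))
      · rw [inCell_of_lt x (by omega)]; rfl
      · have := Exec.inc (x := x) (B := B) (⟨fun j => if j = 0 then x.length - (i + 1) else 0,
          x.length - i + 1, []⟩ : PState β) 0 (by simp; omega)
        convert this using 1
        · refine PState.ext (fun j => rfl) ?_ rfl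
          simp only [Machine.moveIn]; omega
        · refine PState.ext (fun j => ?_) rfl rfl
          simp only [PState.set_reg, if_true]
          split_ifs <;> omega
  refine .seq (.move _ _) ?_
  convert key x.length le_rfl using 1
  refine PState.ext (fun j => ?_) ?_ rfl
  · simp
  · simp [Machine.moveIn]

/-- Through this inequality, polynomial bounds on registers become linear bounds in `Nat.log 2 n` on
the number of their digits. -/
theorem two_add_le_two_pow (n : ℕ) : 2 + n ≤ 2 ^ (Nat.log 2 n + 2) := by
  have h1 := Nat.lt_pow_succ_log_self (b := 2) (by norm_num) n
  have h2 : 2 ^ (Nat.log 2 n + 2) = 2 ^ (Nat.log 2 n + 1) * 2 := pow_succ _ _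
  have h3 : 2 ^ (Nat.log 2 n + 1) = 2 ^ Nat.log 2 n * 2 := pow_succ _ _
  have h4 : 1 ≤ 2 ^ Nat.log 2 n := Nat.one_le_two_pow
  simp only [Nat.succ_eq_add_one] at h1
  omega

/-- The registers stay below a polynomial in `n`, so their binary forms have `O(log n)` digits. The
length of the written string does not count as space. -/
theorem logspaceUniform_of_LE {C : ℕ → Circuit}
    (h : LE fun v : Fin 1 → ℕ => (C (v 0)).encode) : LogspaceUniform C := by
  obtain ⟨d, hd⟩ := h
  obtain ⟨c, hc⟩ := hd Unit (fun _ => 0) 1 (fun _ => Nat.zero_lt_one)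
  refine computableInSpace_of_exec (.seq .inputLength c) (2 * (d + 1) + 1) fun x => ?_
  refine ⟨(2 + x.length) ^ (d + 1), ?_, ?_⟩
  · calc (2 + x.length) ^ (d + 1) ≤ (2 ^ (Nat.log 2 x.length + 2)) ^ (d + 1) :=
          Nat.pow_le_pow_left (two_add_le_two_pow _) _
      _ = 2 ^ ((Nat.log 2 x.length + 2) * (d + 1)) := by rw [pow_mul]
      _ < _ := Nat.pow_lt_pow_right (by norm_num) (by nlinarith)
  · have h1 := hc x ⟨fun j => if j = 0 then x.length else 0, x.length + 1, []⟩
      (fun j hj => if_neg (by omega)) ((2 + x.length) ^ (d + 1)) (by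
        simp only [if_true, Fin.sum_univ_one]
        exact pow_le_pow_of_two (by omega) (by omega))
    refine ⟨_, ?_, .seq (.inputLength x ?_) h1⟩
    · simp [PState.addOut]
    · calc x.length ≤ (2 + x.length) ^ 1 := by rw [pow_one]; omega
        _ ≤ _ := pow_le_pow_of_two (by omega) (by omega)

/-! ### Iterated functions with access to the input -/

/-- A bit of the input. -/
def bitAt (x : List Bool) (i : ℕ) : ℕ := (x.getD i false).toNat

/-- Move the input head to the left end. -/
def Cmd.rewind : Cmd Bool Bool := .whileIn (fun a => !a.isLeft) (.move .left)

theorem Exec.rewind (x : List Bool) (B : ℕ) (σ : PState Bool) :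
    Exec x B .rewind σ { σ with pos := 0 } := by
  obtain ⟨reg, pos, out⟩ := σ
  induction pos with
  | zero => exact .whileIn_false (by simp [Machine.inCell, InCell.isLeft])
  | succ p ih =>
    refine .whileIn_true ?_ (.move _ _) ih
    simp only [Machine.inCell]
    split <;> rfl

/-- Replace the number in register `2` by the input bit with this number. -/
def Cmd.inputBit : Cmd Bool Bool :=
  .seq .rewind (.seq (.move .right) (.seq (.loop 2 (.move .right))
    (.whileIn InCell.isTrue (.seq (.inc 2) .rewind))))

theorem Exec.inputBit (x : List Bool) {B : ℕ} (hB : 1 ≤ B) (σ : PState Bool) :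
    ∃ p, Exec x B .inputBit σ { σ.set 2 (bitAt x (σ.reg 2)) with pos := p } := by
  set q := σ.reg 2 with hq
  -- The minimum accounts for the head stopping at the right end marker. A query beyond the input
  -- therefore reads `false`, in agreement with `bitAt`.
  let τ : ℕ → PState Bool := fun i =>
    { σ.set 2 (q - i) with pos := min (1 + i) (x.length + 1) }
  have h1 : Exec x B (.loop 2 (.move .right)) (τ 0) (τ q) := by
    refine Exec.loop_chain τ (fun i _ => by simp [τ, PState.set_reg]) fun i hi => ?_
    convert Exec.move (x := x) (B := B) ((τ i).set 2 (q - i - 1)) .right using 1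
    refine PState.ext (fun j => ?_) ?_ rfl
    · simp only [τ, PState.set_reg]
      split_ifs <;> omega
    · simp only [τ, PState.set_pos, Machine.moveIn]; omega
  have h2 : Exec x B (.seq .rewind (.move .right)) σ (τ 0) := by
    refine .seq (.rewind _ _ _) ?_
    convert Exec.move (x := x) (B := B) { σ with pos := 0 } .right using 1
    refine PState.ext (fun j => ?_) ?_ rfl
    · simp only [τ, PState.set_reg]
      split_ifs with h
      · rw [h, hq, Nat.sub_zero]
      · rfl
    · simp [τ, Machine.moveIn]
  have h3 : (InCell.isTrue (Machine.inCell x (τ q).pos)).toNat = bitAt x q := by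
    simp only [τ, bitAt]
    rcases lt_or_ge q x.length with h | h
    · rw [show min (1 + q) (x.length + 1) = q + 1 by omega, inCell_of_lt x h]
      simp [InCell.isTrue, h]
    · rw [show min (1 + q) (x.length + 1) = x.length + 1 by omega, inCell_length]
      simp [InCell.isTrue, h]
  have h4 : ∃ p, Exec x B (.whileIn InCell.isTrue (.seq (.inc 2) .rewind)) (τ q)
      { σ.set 2 (bitAt x q) with pos := p } := by
    cases hb : InCell.isTrue (Machine.inCell x (τ q).pos) with
    | false =>
      refine ⟨(τ q).pos, ?_⟩
      convert Exec.whileIn_false hb using 1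
      refine PState.ext (fun j => ?_) rfl rfl
      rw [hb] at h3
      simp [τ, ← h3]
    | true =>
      -- The loop acts as a conditional: after the first pass the head is on the left end marker,
      -- where the test fails.
      refine ⟨0, .whileIn_true hb (.seq (.inc _ _ (by simp [τ, PState.set_reg, hB]))
        (.rewind _ _ _)) ?_⟩
      rw [hb] at h3
      convert Exec.whileIn_false (x := x) (B := B) (p := InCell.isTrue)
        (c := Cmd.seq (.inc 2) .rewind) (σ := { σ.set 2 (bitAt x q) with pos := 0 })
        (by simp [Machine.inCell, InCell.isTrue]) using 1
      refine PState.ext (fun j => ?_) rfl rfl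
      simp only [τ, PState.set_reg, ← h3]
      split_ifs <;> simp
  obtain ⟨p, h4⟩ := h4
  cases h2 with
  | seq h5 h6 => exact ⟨p, .seq h5 (.seq h6 (.seq h1 h4))⟩

/-- The computation of an iterated function with access to the input, from the state `S`;
the states are at most `M`. -/
inductive Iterates (x : List Bool) (M : ℕ) (query : ℕ → ℕ → ℕ) (cont : ℕ → ℕ → Prop)
    (step : ℕ → ℕ → ℕ → ℕ) (emit : ℕ → ℕ → ℕ → List Bool) : ℕ → List Bool → Prop
  | finish {S} : ¬ cont x.length S → Iterates x M query cont step emit S []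
  | go {S out} : cont x.length S →
      step x.length S (bitAt x (query x.length S)) ≤ M →
      Iterates x M query cont step emit (step x.length S (bitAt x (query x.length S))) out →
      Iterates x M query cont step emit S
        (emit x.length S (bitAt x (query x.length S)) ++ out)

/-- Only the length, the state and one input bit survive a step, so the space is the number of
digits of the largest state. Registers `0` and `1` hold the length and the state, `2` the query and
then its bit, `3` the new state and then the test for continuing. -/
theorem computableInSpace_of_iterates {s : ℕ → ℕ} {f : List Bool → List Bool}
    {init : ℕ → ℕ} {query : ℕ → ℕ → ℕ} {cont : ℕ → ℕ → Prop} {step : ℕ → ℕ → ℕ → ℕ}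
    {emit : ℕ → ℕ → ℕ → List Bool}
    (hinit : LF fun v : Fin 1 → ℕ => init (v 0))
    (hquery : LF fun v : Fin 2 → ℕ => query (v 0) (v 1))
    (hcont : LP fun v : Fin 2 → ℕ => cont (v 0) (v 1))
    (hstep : LF fun v : Fin 3 → ℕ => step (v 0) (v 1) (v 2))
    (hemit : LE fun v : Fin 3 → ℕ => emit (v 0) (v 1) (v 2)) (C : ℕ) (M : ℕ → ℕ)
    (hM : ∀ n, 2 + n + M n ≤ 2 ^ (C * s n + C)) (hM0 : ∀ n, init n ≤ M n)
    (h : ∀ x, Iterates x (M x.length) query cont step emit (init x.length) (f x)) :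
    ComputableInSpace s f := by
  classical
  obtain ⟨di, hi1, hi⟩ := hinit
  obtain ⟨dq, hq1, hq⟩ := hquery
  obtain ⟨dc, hc1, hc⟩ := hcont
  obtain ⟨ds, hs1, hs⟩ := hstep
  obtain ⟨de, he⟩ := hemit
  obtain ⟨ci, hci⟩ := hi Bool Bool ![0] 1 (by simp)
  obtain ⟨cq, hcq⟩ := hq Bool Bool ![0, 1] 2 (by simp [Fin.forall_fin_succ])
  obtain ⟨cc, hcc⟩ := hc Bool Bool ![0, 1] 3 (by simp [Fin.forall_fin_succ])
  obtain ⟨cs, hcs⟩ := hs Bool Bool ![0, 1, 2] 3 (by simp [Fin.forall_fin_succ])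
  obtain ⟨ce, hce⟩ := he Bool ![0, 1, 2] 3 (by simp [Fin.forall_fin_succ])
  set D := di + dq + dc + ds + de + 1 with hD
  refine computableInSpace_of_exec (.seq .inputLength (.seq ci (.seq cc (.loop 3
    (.seq cq (.seq .inputBit (.seq ce (.seq cs (.seq (.clear 1) (.seq (.mv 3 1)
      (.seq (.clear 2) cc)))))))))))
    (C * D + D + 1) fun x => ?_
  set n := x.length with hn
  set B := (3 + n + M n) ^ D with hBdef
  let st : ℕ → ℕ → ℕ → ℕ → List Bool → PState Bool := fun S b h p o =>
    ⟨fun j => if j = 0 then n else if j = 1 then S else if j = 2 then b else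
      if j = 3 then h else 0, p, o⟩
  have hpow : ∀ (a d : ℕ), a ≤ n + M n + 1 → d ≤ D → (2 + a) ^ d ≤ B := fun a d ha hd =>
    (Nat.pow_le_pow_left (show 2 + a ≤ 3 + n + M n by omega) d).trans
      (Nat.pow_le_pow_right (by omega) hd)
  have hB1 : 3 + n + M n ≤ B := by
    calc 3 + n + M n = (3 + n + M n) ^ 1 := (pow_one _).symm
      _ ≤ _ := Nat.pow_le_pow_right (by omega) (by omega)
  have hcont : ∀ S b p o, S ≤ M n → Exec x B cc (st S b 0 p o)
      (st S b (if cont n S then 1 else 0) p o) := fun S b p o hS => by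
    have := hcc x (st S b 0 p o) (fun j hj => by
      simp only [st]
      rw [if_neg (by omega), if_neg (by omega), if_neg (by omega)]; simp) B (by
        simp only [Fin.sum_univ_two]
        exact hpow _ _ (by simp [st]; omega) (by omega))
    convert this using 1
    refine PState.ext (fun j => ?_) rfl rfl
    simp only [PState.set_reg]
    by_cases h3 : j = 3
    · subst h3; simp [st]
    · simp [st, h3]
  have hloop : ∀ S o, Iterates x (M n) query cont step emit S o → S ≤ M n → ∀ p o',
      ∃ τ : PState Bool, τ.out = o' ++ o ∧ Exec x B (.loop 3
        (.seq cq (.seq .inputBit (.seq ce (.seq cs (.seq (.clear 1) (.seq (.mv 3 1)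
          (.seq (.clear 2) cc)))))))) (st S 0 (if cont n S then 1 else 0) p o') τ := by
    intro S o hS
    induction hS with
    | @finish S h1 =>
      intro _ p o'
      exact ⟨st S 0 0 p o', by simp [st], by rw [if_neg h1]; exact .loop_zero rfl⟩
    | @go S out h1 h2 h3 ih =>
      intro hSM p o'
      set q := query n S with hqd
      set b := bitAt x q with hb
      have hb1 : b ≤ 1 := by
        rw [hb, bitAt]; cases x.getD q false <;> simp
      have e1 : Exec x B cq (st S 0 0 p o') (st S q 0 p o') := by
        have := hcq x (st S 0 0 p o') (fun j hj => by
          simp only [st]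
          rw [if_neg (by omega), if_neg (by omega)]; simp) B (by
            simp only [Fin.sum_univ_two]
            exact hpow _ _ (by simp [st]; omega) (by omega))
        convert this using 1
        refine PState.ext (fun j => ?_) rfl rfl
        simp only [PState.set_reg]
        by_cases h3 : j = 2
        · subst h3; simp [st, hqd]
        · simp [st, h3]
      obtain ⟨p2, e2⟩ := Exec.inputBit x (B := B) (by omega) (st S q 0 p o')
      have e2' : Exec x B .inputBit (st S q 0 p o') (st S b 0 p2 o') := by
        convert e2 using 1
        refine PState.ext (fun j => ?_) rfl rfl
        simp only [PState.set_reg]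
        by_cases h3 : j = 2
        · subst h3; simp [st, hb]
        · simp [st, h3]
      have hz : ∀ o, ∀ j, 3 ≤ j → (st S b 0 p2 o).reg j = 0 := fun o j hj => by
        simp only [st]
        rw [if_neg (by omega), if_neg (by omega), if_neg (by omega)]; simp
      have hsum : ∀ o, ∑ i : Fin 3, (st S b 0 p2 o).reg (![0, 1, 2] i) ≤ n + M n + 1 := by
        intro o
        simp [Fin.sum_univ_three, st]; omega
      have e3 : Exec x B ce (st S b 0 p2 o') (st S b 0 p2 (o' ++ emit n S b)) := by
        have := hce x (st S b 0 p2 o') (hz _) B (hpow _ _ (hsum _) (by omega))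
        exact this
      have e4 := hcs x (st S b 0 p2 (o' ++ emit n S b)) (hz _) B (hpow _ _ (hsum _) (by omega))
      set S' := step n S b with hS'
      have e4' : Exec x B cs (st S b 0 p2 (o' ++ emit n S b))
          (st S b S' p2 (o' ++ emit n S b)) := by
        convert e4 using 1
        refine PState.ext (fun j => ?_) rfl rfl
        simp only [PState.set_reg]
        by_cases h3 : j = 3
        · subst h3; simp [st, hS']
        · simp [st, h3]
      have e5 : Exec x B (.clear 1) (st S b S' p2 (o' ++ emit n S b))
          (st 0 b S' p2 (o' ++ emit n S b)) := by
        convert Exec.clear (x := x) (B := B) (st S b S' p2 (o' ++ emit n S b)) 1 using 1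
        refine PState.ext (fun j => ?_) rfl rfl
        simp only [PState.set_reg]
        by_cases h3 : j = 1
        · subst h3; simp [st]
        · simp [st, h3]
      have e6 : Exec x B (.mv 3 1) (st 0 b S' p2 (o' ++ emit n S b))
          (st S' b 0 p2 (o' ++ emit n S b)) := by
        convert Exec.mv (x := x) (B := B) (st 0 b S' p2 (o' ++ emit n S b)) (a := 3) (b := 1)
          (by omega) (by simp [st]; omega) using 1
        refine PState.ext (fun j => ?_) rfl rfl
        simp only [PState.set_reg]
        by_cases h3 : j = 1
        · subst h3; simp [st]
        · by_cases h4 : j = 3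
          · subst h4; simp [st]
          · simp [st, h3, h4]
      have e7 : Exec x B (.clear 2) (st S' b 0 p2 (o' ++ emit n S b))
          (st S' 0 0 p2 (o' ++ emit n S b)) := by
        convert Exec.clear (x := x) (B := B) (st S' b 0 p2 (o' ++ emit n S b)) 2 using 1
        refine PState.ext (fun j => ?_) rfl rfl
        simp only [PState.set_reg]
        by_cases h3 : j = 2
        · subst h3; simp [st]
        · simp [st, h3]
      obtain ⟨τ, hτ1, hτ2⟩ := ih h2 p2 (o' ++ emit n S b)
      refine ⟨τ, by rw [hτ1, List.append_assoc], ?_⟩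
      rw [if_pos h1]
      refine .loop_succ (v := 0) (by simp [st]) ?_ hτ2
      refine .seq (τ := st S q 0 p o') ?_ (.seq e2' (.seq e3 (.seq e4' (.seq e5 (.seq e6
        (.seq e7 (hcont _ _ _ _ h2)))))))
      convert e1 using 1
      refine PState.ext (fun j => ?_) rfl rfl
      simp only [PState.set_reg]
      by_cases h3 : j = 3
      · subst h3; simp [st]
      · simp [st, h3]
  obtain ⟨τ, hτ1, hτ2⟩ := hloop _ _ (h x) (hM0 n) (n + 1) []
  refine ⟨B, ?_, τ, by simpa using hτ1, ?_⟩
  · calc B ≤ (2 ^ (C * s n + C + 1)) ^ D := Nat.pow_le_pow_left (by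
            have := hM n
            have h1 : 1 ≤ 2 ^ (C * s n + C) := Nat.one_le_two_pow
            rw [pow_succ]; omega) _
      _ = 2 ^ ((C * s n + C + 1) * D) := by rw [pow_mul]
      _ < _ := Nat.pow_lt_pow_right (by norm_num) ?_
    nlinarith [Nat.zero_le (D * s n), Nat.zero_le (s n)]
  · refine .seq (.inputLength x (by omega)) ?_
    have e1 := hci x (⟨fun j => if j = 0 then x.length else 0, x.length + 1, []⟩)
      (fun j hj => if_neg (by omega)) B (hpow _ _ (by simp; omega) (by omega))
    refine .seq (τ := st (init n) 0 0 (n + 1) []) ?_ (.seq (hcont _ _ _ _ (hM0 n)) hτ2)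
    convert e1 using 1
    refine PState.ext (fun j => ?_) rfl rfl
    simp only [PState.set_reg]
    by_cases h3 : j = 1
    · subst h3; simp [st, hn]
    · simp [st, h3, hn]


/-! ### Families of networks of NOR gates -/

/-- A uniform family of acyclic networks. The `n`-th network has the inputs `0, …, m n - 1`; the
other gates are NOR gates, whose arguments are given by `edge`. -/
structure Net (m : ℕ → ℕ) where
  size : ℕ → ℕ
  edge : ℕ → ℕ → ℕ → Prop
  dep : ℕ → ℕ → ℕ
  lf_size : LF fun v : Fin 1 → ℕ => size (v 0)
  lp_edge : LP fun v : Fin 3 → ℕ => edge (v 0) (v 1) (v 2)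
  le_size : ∀ n, m n ≤ size n
  dep_input : ∀ n, ∀ g < m n, dep n g = 0
  dep_lt : ∀ n g j, m n ≤ g → g < size n → j < g → edge n g j → dep n j < dep n g

namespace Net

variable {m : ℕ → ℕ}

/-- The value of a gate. -/
def val (N : Net m) (n : ℕ) (y : ℕ → Prop) (g : ℕ) : Prop :=
  (g < m n ∧ y g) ∨ (m n ≤ g ∧ ∀ j, ∀ _ : j < g, N.edge n g j → ¬ N.val n y j)
termination_by g

theorem val_input (N : Net m) {n : ℕ} (y : ℕ → Prop) {g : ℕ} (h : g < m n) :
    N.val n y g ↔ y g := by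
  rw [val]
  have : ¬ m n ≤ g := by omega
  simp [h, this]

theorem val_nor (N : Net m) {n : ℕ} (y : ℕ → Prop) {g : ℕ} (h : m n ≤ g) :
    N.val n y g ↔ ∀ j < g, N.edge n g j → ¬ N.val n y j := by
  rw [val]
  have : ¬ g < m n := by omega
  simp [h, this]

/-- The network without gates but the constant `true`. -/
def base (hm : LF fun v : Fin 1 → ℕ => m (v 0)) : Net m where
  size n := m n + 1
  edge _ _ _ := False
  dep n g := if g < m n then 0 else 1
  lf_size := hm.succ
  lp_edge := (LP.ne_zero .zero).congr fun v => by simp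
  le_size _ := Nat.le_succ _
  dep_input _ _ h := if_pos h
  dep_lt _ _ _ _ _ _ h := h.elim

theorem val_base (hm : LF fun v : Fin 1 → ℕ => m (v 0)) (n : ℕ) (y : ℕ → Prop) :
    (base hm).val n y (m n) := by
  rw [val_nor _ _ le_rfl]
  exact fun j _ h => h.elim

/-- Add a block of gates whose arguments are in the given network. -/
def extend (N : Net m) (D : ℕ) (hD : ∀ n g, N.dep n g ≤ D) (K : ℕ → ℕ)
    (hK : LF fun v : Fin 1 → ℕ => K (v 0)) (e : ℕ → ℕ → ℕ → Prop)
    (he : LP fun v : Fin 3 → ℕ => e (v 0) (v 1) (v 2)) : Net m where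
  size n := N.size n + K n
  edge n g j := (g < N.size n ∧ N.edge n g j) ∨
    (N.size n ≤ g ∧ j < N.size n ∧ e n (g - N.size n) j)
  dep n g := if g < N.size n then N.dep n g else D + 1
  lf_size := N.lf_size.add hK
  lp_edge := by
    have hs : LF fun v : Fin 3 → ℕ => N.size (v 0) :=
      LF.comp1 (g := N.size) N.lf_size (.var 0)
    refine ((LP.lt (.var 1) hs).and N.lp_edge).or ((LP.le hs (.var 1)).and
      ((LP.lt (.var 2) hs).and ?_))
    classical
    exact LF.comp3 (g := fun a b c => if e a b c then 1 else 0) he (.var 0)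
      ((LF.var 1).sub hs) (.var 2)
  le_size n := (N.le_size n).trans (Nat.le_add_right _ _)
  dep_input n g h := by
    rw [if_pos (h.trans_le (N.le_size n))]; exact N.dep_input n g h
  dep_lt n g j h1 h2 h3 h4 := by
    rcases h4 with ⟨h4, h5⟩ | ⟨h4, h5, h6⟩
    · rw [if_pos h4, if_pos (h3.trans h4)]
      exact N.dep_lt n g j h1 h4 h3 h5
    · rw [if_pos h5, if_neg (by omega)]
      exact Nat.lt_succ_of_le (hD n j)

section

variable {N : Net m} {D : ℕ} {hD : ∀ n g, N.dep n g ≤ D} {K : ℕ → ℕ}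
  {hK : LF fun v : Fin 1 → ℕ => K (v 0)} {e : ℕ → ℕ → ℕ → Prop}
  {he : LP fun v : Fin 3 → ℕ => e (v 0) (v 1) (v 2)}

theorem dep_extend (n g : ℕ) : (N.extend D hD K hK e he).dep n g ≤ D + 1 := by
  change (if g < N.size n then N.dep n g else D + 1) ≤ _
  split_ifs
  · exact (hD n g).trans (Nat.le_succ _)
  · exact le_rfl

/-- New gates are never arguments of old ones. -/
theorem val_extend_old {n : ℕ} (y : ℕ → Prop) {g : ℕ} (hg : g < N.size n) :
    (N.extend D hD K hK e he).val n y g ↔ N.val n y g := by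
  induction g using Nat.strong_induction_on with
  | _ g ih =>
    rcases lt_or_ge g (m n) with h | h
    · rw [val_input _ _ h, val_input _ _ h]
    · rw [val_nor _ _ h, val_nor _ _ h]
      refine forall₂_congr fun j hj => ?_
      rw [ih j hj (hj.trans hg)]
      have : (N.extend D hD K hK e he).edge n g j ↔ N.edge n g j := by
        change (_ ∨ _) ↔ _
        constructor
        · rintro (h | h)
          · exact h.2
          · omega
        · exact fun h => Or.inl ⟨hg, h⟩
      rw [this]

theorem val_extend_new {n : ℕ} (y : ℕ → Prop) (c : ℕ) :
    (N.extend D hD K hK e he).val n y (N.size n + c) ↔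
      ∀ j < N.size n, e n c j → ¬ N.val n y j := by
  rw [val_nor _ _ ((N.le_size n).trans (Nat.le_add_right _ _))]
  have : ∀ j, (N.extend D hD K hK e he).edge n (N.size n + c) j ↔
      j < N.size n ∧ e n c j := fun j => by
    change (_ ∨ _) ↔ _
    constructor
    · rintro (h | h)
      · omega
      · exact ⟨h.2.1, by simpa using h.2.2⟩
    · exact fun h => Or.inr ⟨Nat.le_add_right _ _, h.1, by simpa using h.2⟩
  simp only [this]
  constructor
  · intro h j hj hj' hv
    exact h j (by omega) ⟨hj, hj'⟩ ((val_extend_old y hj).2 hv)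
  · intro h j _ hj' hv
    exact h j hj'.1 hj'.2 ((val_extend_old y hj'.1).1 hv)

end

/-- Two networks with common inputs, side by side. -/
def merge (hm : LF fun v : Fin 1 → ℕ => m (v 0)) (N₁ N₂ : Net m) : Net m where
  size n := N₁.size n + N₂.size n
  edge n g j := (g < N₁.size n ∧ N₁.edge n g j) ∨
    (N₁.size n ≤ g ∧ m n ≤ g - N₁.size n ∧ ((j < m n ∧ N₂.edge n (g - N₁.size n) j) ∨
      (N₁.size n + m n ≤ j ∧ N₂.edge n (g - N₁.size n) (j - N₁.size n))))
  dep n g := if g < N₁.size n then N₁.dep n g else N₂.dep n (g - N₁.size n)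
  lf_size := N₁.lf_size.add N₂.lf_size
  lp_edge := by
    have hs : LF fun v : Fin 3 → ℕ => N₁.size (v 0) :=
      LF.comp1 (g := N₁.size) N₁.lf_size (.var 0)
    have hm' : LF fun v : Fin 3 → ℕ => m (v 0) := LF.comp1 (g := m) hm (.var 0)
    classical
    refine ((LP.lt (.var 1) hs).and N₁.lp_edge).or ((LP.le hs (.var 1)).and
      ((LP.le hm' ((LF.var 1).sub hs)).and (((LP.lt (.var 2) hm').and ?_).or
        ((LP.le (hs.add hm') (.var 2)).and ?_))))
    · exact LF.comp3 (g := fun a b c => if N₂.edge a b c then 1 else 0) N₂.lp_edge (.var 0)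
        ((LF.var 1).sub hs) (.var 2)
    · exact LF.comp3 (g := fun a b c => if N₂.edge a b c then 1 else 0) N₂.lp_edge (.var 0)
        ((LF.var 1).sub hs) ((LF.var 2).sub hs)
  le_size n := (N₁.le_size n).trans (Nat.le_add_right _ _)
  dep_input n g h := by
    rw [if_pos (h.trans_le (N₁.le_size n))]; exact N₁.dep_input n g h
  dep_lt n g j h1 h2 h3 h4 := by
    rcases h4 with ⟨h4, h5⟩ | ⟨h4, h5, ⟨h6, h7⟩ | ⟨h6, h7⟩⟩
    · rw [if_pos h4, if_pos (h3.trans h4)]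
      exact N₁.dep_lt n g j h1 h4 h3 h5
    · rw [if_pos (h6.trans_le (N₁.le_size n)), if_neg (by omega), N₁.dep_input n j h6,
        ← N₂.dep_input n j h6]
      exact N₂.dep_lt n _ j h5 (by omega) (by omega) h7
    · rw [if_neg (by omega), if_neg (by omega)]
      exact N₂.dep_lt n _ _ h5 (by omega) (by omega) h7

section

variable {hm : LF fun v : Fin 1 → ℕ => m (v 0)} {N₁ N₂ : Net m}

theorem dep_merge {D₁ D₂ : ℕ} (h₁ : ∀ n g, N₁.dep n g ≤ D₁) (h₂ : ∀ n g, N₂.dep n g ≤ D₂)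
    (n g : ℕ) : (merge hm N₁ N₂).dep n g ≤ D₁ + D₂ := by
  change (if g < N₁.size n then _ else _) ≤ _
  split_ifs
  · exact (h₁ n g).trans (Nat.le_add_right _ _)
  · exact (h₂ n _).trans (Nat.le_add_left _ _)

theorem val_merge_left {n : ℕ} (y : ℕ → Prop) {g : ℕ} (hg : g < N₁.size n) :
    (merge hm N₁ N₂).val n y g ↔ N₁.val n y g := by
  induction g using Nat.strong_induction_on with
  | _ g ih =>
    rcases lt_or_ge g (m n) with h | h
    · rw [val_input _ _ h, val_input _ _ h]
    · rw [val_nor _ _ h, val_nor _ _ h]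
      refine forall₂_congr fun j hj => ?_
      rw [ih j hj (hj.trans hg)]
      have : (merge hm N₁ N₂).edge n g j ↔ N₁.edge n g j := by
        change (_ ∨ _) ↔ _
        constructor
        · rintro (h | h)
          · exact h.2
          · omega
        · exact fun h => Or.inl ⟨hg, h⟩
      rw [this]

/-- The gates of the second network are shifted, but its inputs are the common ones at the
beginning. The shifted copies of the inputs are idle, whence the restriction to `m n ≤ g`. -/
theorem val_merge_right {n : ℕ} (y : ℕ → Prop) {g : ℕ} (hg : m n ≤ g) :
    (merge hm N₁ N₂).val n y (N₁.size n + g) ↔ N₂.val n y g := by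
  have hs := N₁.le_size n
  induction g using Nat.strong_induction_on with
  | _ g ih =>
    have hedge : ∀ j, (merge hm N₁ N₂).edge n (N₁.size n + g) j ↔ (j < m n ∧ N₂.edge n g j) ∨
        (N₁.size n + m n ≤ j ∧ N₂.edge n g (j - N₁.size n)) := fun j => by
      change (_ ∨ _) ↔ _
      rw [Nat.add_sub_cancel_left]
      constructor
      · rintro (h | h)
        · omega
        · exact h.2.2
      · exact fun h => Or.inr ⟨Nat.le_add_right _ _, hg, h⟩
    rw [val_nor _ _ (by omega), val_nor _ _ hg]
    simp only [hedge]
    constructor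
    · intro h j hj he hv
      rcases lt_or_ge j (m n) with hj' | hj'
      · exact h j (by omega) (Or.inl ⟨hj', he⟩) ((val_input _ _ hj').2 ((val_input _ _ hj').1 hv))
      · exact h (N₁.size n + j) (by omega) (Or.inr ⟨by omega, by simpa using he⟩)
          ((ih j hj hj').2 hv)
    · rintro h j hj (⟨h1, h2⟩ | ⟨h1, h2⟩) hv
      · exact h j (by omega) h2 ((val_input _ _ h1).2 ((val_input _ _ h1).1 hv))
      · obtain ⟨i, rfl⟩ := Nat.exists_eq_add_of_le (show N₁.size n ≤ j by omega)
        rw [Nat.add_sub_cancel_left] at h2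
        exact h i (by omega) h2 ((ih i (by omega) (by omega)).1 hv)

end

end Net

/-! ### Codes of tuples -/

theorem natPair_le_natPair {a b c d : ℕ} (h : a ≤ c) (h' : b ≤ d) :
    Nat.pair a b ≤ Nat.pair c d := by
  refine le_trans (b := Nat.pair c b) ?_ ?_
  · rcases h.eq_or_lt with rfl | h
    · exact le_rfl
    · exact (Nat.pair_lt_pair_left _ h).le
  · rcases h'.eq_or_lt with rfl | h
    · exact le_rfl
    · exact (Nat.pair_lt_pair_right _ h).le

/-- The code of a tuple. -/
def tupleCode : (k : ℕ) → (Fin k → ℕ) → ℕ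
  | 0, _ => 0
  | k + 1, v => Nat.pair (v 0) (tupleCode k fun i => v i.succ)

/-- The entries of a tuple with a given code. -/
def tupleDec : (k : ℕ) → ℕ → Fin k → ℕ
  | 0, _ => fun i => i.elim0
  | k + 1, c => Fin.cons c.unpair.1 (tupleDec k c.unpair.2)

theorem tupleDec_tupleCode (k : ℕ) (v : Fin k → ℕ) : tupleDec k (tupleCode k v) = v := by
  induction k with
  | zero => exact funext fun i => i.elim0
  | succ k ih =>
    funext i
    refine Fin.cases ?_ (fun i => ?_) i
    · simp [tupleCode, tupleDec]
    · simp [tupleCode, tupleDec, ih]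

/-- All tuples with entries up to `w` have codes up to that of the constant tuple `w`, which is
polynomial in `w`. This gives the size of a block of gates indexed by tuples. -/
theorem tupleCode_mono (k : ℕ) {v w : Fin k → ℕ} (h : ∀ i, v i ≤ w i) :
    tupleCode k v ≤ tupleCode k w := by
  induction k with
  | zero => exact le_rfl
  | succ k ih => exact natPair_le_natPair (h 0) (ih fun i => h i.succ)

theorem LF.tupleCode {l : ℕ} (k : ℕ) {f : Fin k → (Fin l → ℕ) → ℕ} (hf : ∀ i, LF (f i)) :
    LF fun v => tupleCode k fun i => f i v := by
  induction k with
  | zero => exact .zero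
  | succ k ih => exact (hf 0).natPair (ih fun i => hf i.succ)

theorem LF.tupleDec {l : ℕ} (k : ℕ) {f : (Fin l → ℕ) → ℕ} (hf : LF f) (i : Fin k) :
    LF fun v => tupleDec k (f v) i := by
  induction k generalizing f with
  | zero => exact i.elim0
  | succ k ih =>
    refine Fin.cases ?_ (fun i => ?_) i
    · exact hf.unpair1
    · exact ih hf.unpair2 i

/-! ### Definable predicates -/

/-- Predicates of an input `y`, of numbers `v 0, …, v (k - 1)`, and of `n = v k`, which are
computed by a uniform family of networks of constant depth, for all polynomially bounded
arguments. -/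
def Definable (m : ℕ → ℕ) {k : ℕ} (P : (ℕ → Prop) → (Fin (k + 1) → ℕ) → Prop) : Prop :=
  ∀ w : ℕ → ℕ, (LF fun v : Fin 1 → ℕ => w (v 0)) →
    ∃ (N : Net m) (D : ℕ) (g : (Fin (k + 1) → ℕ) → ℕ), LF g ∧ (∀ n i, N.dep n i ≤ D) ∧
      ∀ v, (∀ i, v i ≤ w (v (Fin.last k))) →
        m (v (Fin.last k)) ≤ g v ∧ g v < N.size (v (Fin.last k)) ∧
        ∀ y : ℕ → Prop, (∀ i, m (v (Fin.last k)) ≤ i → ¬ y i) →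
          (N.val (v (Fin.last k)) y (g v) ↔ P y v)

theorem Definable.congr {m : ℕ → ℕ} {k : ℕ} {P Q : (ℕ → Prop) → (Fin (k + 1) → ℕ) → Prop}
    (h : Definable m P) (e : ∀ y v, P y v ↔ Q y v) : Definable m Q := by
  rwa [← funext₂ fun y v => propext (e y v)]

/-- The common construction of all definable predicates: one more layer of NOR gates, with a gate
for each code of a bounded tuple. The relation `e` selects the arguments of the gate of `v`. -/
theorem definable_of_extend {m : ℕ → ℕ} {k : ℕ} {P : (ℕ → Prop) → (Fin (k + 1) → ℕ) → Prop}
    (h : ∀ w : ℕ → ℕ, (LF fun v : Fin 1 → ℕ => w (v 0)) →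
      ∃ (N : Net m) (D : ℕ) (e : (Fin (k + 2) → ℕ) → Prop), LP e ∧ (∀ n i, N.dep n i ≤ D) ∧
      ∀ v, (∀ i, v i ≤ w (v (Fin.last k))) →
        ∀ y : ℕ → Prop, (∀ i, m (v (Fin.last k)) ≤ i → ¬ y i) →
          ((∀ j < N.size (v (Fin.last k)), e (Fin.cons j v) → ¬ N.val (v (Fin.last k)) y j) ↔
            P y v)) : Definable m P := by
  intro w hw
  obtain ⟨N, D, e, he, hD, hN⟩ := h w hw
  have hK : LF fun v : Fin 1 → ℕ => tupleCode (k + 1) (fun _ => w (v 0)) + 1 :=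
    (LF.tupleCode (k + 1) fun _ => hw).succ
  have he' : LP fun v : Fin 3 → ℕ => e (Fin.cons (v 2) (tupleDec (k + 1) (v 1))) := by
    refine LF.comp (g := _) he
      (h := fun i v => (Fin.cons (v 2) (tupleDec (k + 1) (v 1)) : Fin (k + 2) → ℕ) i) fun i => ?_
    refine Fin.cases ?_ (fun i => ?_) i
    · exact .var 2
    · exact LF.tupleDec _ (.var 1) i
  refine ⟨N.extend D hD (fun n => tupleCode (k + 1) (fun _ => w n) + 1) hK
    (fun _ c j => e (Fin.cons j (tupleDec (k + 1) c))) he', D + 1,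
    fun v => N.size (v (Fin.last k)) + tupleCode (k + 1) v, ?_, Net.dep_extend, fun v hv => ?_⟩
  · exact (LF.comp1 (g := N.size) N.lf_size (.var _)).add (LF.tupleCode _ fun i => .var i)
  · refine ⟨(N.le_size _).trans (Nat.le_add_right _ _), ?_, fun y hy => ?_⟩
    · exact Nat.add_lt_add_left (Nat.lt_succ_of_le (tupleCode_mono _ hv)) _
    · rw [Net.val_extend_new, tupleDec_tupleCode]
      exact hN v hv y hy

section

variable {m : ℕ → ℕ} {k : ℕ}

/-- A NOR gate without arguments is true; with the constant `true` as its argument it is false. So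
the number-theoretic condition is decided when the circuit is built, not when it runs. -/
theorem Definable.atom (hm : LF fun v : Fin 1 → ℕ => m (v 0)) {p : (Fin (k + 1) → ℕ) → Prop}
    (hp : LP p) : Definable m (fun _ v => p v) := by
  refine definable_of_extend fun w _ => ⟨Net.base hm, 1,
    fun u => u 0 = m (u (Fin.last (k + 1))) ∧ ¬ p fun i => u i.succ, ?_, ?_, ?_⟩
  · exact (LP.eq (.var 0) (LF.comp1 (g := m) hm (.var _))).and hp.lift.not
  · intro n i
    change (if _ then _ else _) ≤ _
    split_ifs <;> omega
  · intro v _ y _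
    have hl : (Fin.cons (m (v (Fin.last k))) v : Fin (k + 2) → ℕ) (Fin.last (k + 1)) =
      v (Fin.last k) := rfl
    constructor
    · intro h
      by_contra hp'
      exact h (m (v (Fin.last k))) (Nat.lt_succ_self _) ⟨by simp [hl], by simpa using hp'⟩
        (Net.val_base hm _ y)
    · intro h j _ hj _
      exact hj.2 (by simpa using h)

/-- For an index beyond the inputs the gate has no arguments and is true. This is the right value
because `y` is assumed to vanish there. -/
theorem Definable.not_input (hm : LF fun v : Fin 1 → ℕ => m (v 0)) {f : (Fin (k + 1) → ℕ) → ℕ}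
    (hf : LF f) : Definable m (fun y v => ¬ y (f v)) := by
  refine definable_of_extend fun w _ => ⟨Net.base hm, 1,
    fun u => u 0 < m (u (Fin.last (k + 1))) ∧ u 0 = f fun i => u i.succ, ?_, ?_, ?_⟩
  · exact (LP.lt (.var 0) (LF.comp1 (g := m) hm (.var _))).and (LP.eq (.var 0) hf.lift)
  · intro n i
    change (if _ then _ else _) ≤ _
    split_ifs <;> omega
  · intro v _ y hy
    constructor
    · intro h hv
      have h1 : f v < m (v (Fin.last k)) := by
        by_contra h1
        exact hy _ (not_lt.1 h1) hv
      exact h (f v) (Nat.lt_succ_of_lt h1) ⟨h1, by simp⟩ ((Net.val_input _ _ h1).2 hv)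
    · intro h j _ hj hv
      have h1 : j < m (v (Fin.last k)) := hj.1
      have h2 : j = f v := by simpa using hj.2
      exact h (h2 ▸ (Net.val_input _ _ h1).1 hv)

/-- A bounded quantifier costs a single NOR gate of unbounded fan-in. Together with `Definable.nor`
it yields all bounded first-order formulas. -/
theorem Definable.all_not {P : (ℕ → Prop) → ℕ → (Fin (k + 1) → ℕ) → Prop}
    {b : (Fin (k + 1) → ℕ) → ℕ} (hb : LF b)
    (hP : Definable m (k := k + 1) fun y v => P y (v 0) fun i => v i.succ) :
    Definable m (fun y v => ∀ i < b v, ¬ P y i v) := by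
  refine definable_of_extend fun w hw => ?_
  obtain ⟨d, hd⟩ := hb.poly
  -- The quantified number may exceed `w`, so the network for the body is taken for a larger bound
  -- that also covers the values of `b`.
  obtain ⟨N, D, g, hg, hD, hN⟩ := hP (fun n => w n + (2 + (k + 1) * w n) ^ d)
    (hw.add (((LF.const 2).add ((LF.const (k + 1)).mul hw)).pow_const d))
  refine ⟨N, D, fun u => ∃ i < b (fun i => u i.succ), u 0 = g (Fin.cons i fun i => u i.succ),
    ?_, hD, fun v hv y hy => ?_⟩
  · refine LP.ex hb.lift (LP.eq (.var 1) ?_)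
    refine LF.comp hg (h := fun i (u : Fin (k + 3) → ℕ) =>
      (Fin.cons (u 0) (fun i => u i.succ.succ) : Fin (k + 2) → ℕ) i) fun i => ?_
    refine Fin.cases ?_ (fun i => ?_) i
    · exact .var 0
    · exact .var _
  · have key : ∀ i < b v, ∀ i', (Fin.cons i v : Fin (k + 2) → ℕ) i' ≤
        w (v (Fin.last k)) + (2 + (k + 1) * w (v (Fin.last k))) ^ d := by
      intro i hi i'
      refine Fin.cases ?_ (fun i' => ?_) i'
      · have h1 : ∑ i, v i ≤ (k + 1) * w (v (Fin.last k)) :=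
          (Finset.sum_le_card_nsmul _ _ _ fun i _ => hv i).trans (by simp)
        have h2 := hd v
        have h3 : (2 + ∑ i, v i) ^ d ≤ (2 + (k + 1) * w (v (Fin.last k))) ^ d :=
          Nat.pow_le_pow_left (by omega) d
        simp only [Fin.cons_zero]
        omega
      · have := hv i'
        simp only [Fin.cons_succ]
        omega
    have hl : ∀ i, (Fin.cons i v : Fin (k + 2) → ℕ) (Fin.last (k + 1)) = v (Fin.last k) :=
      fun _ => rfl
    constructor
    · intro h i hi hPi
      obtain ⟨-, h2, h3⟩ := hN (Fin.cons i v) (by rw [hl]; exact key i hi)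
      rw [hl] at h2 h3
      exact h _ h2 ⟨i, by simpa using hi, by simp⟩ ((h3 y hy).2 (by simpa using hPi))
    · rintro h j _ ⟨i, hi, hj⟩ hv'
      have hi' : i < b v := by simpa using hi
      obtain ⟨-, h2, h3⟩ := hN (Fin.cons i v) (by rw [hl]; exact key i hi')
      rw [hl] at h3
      have hj' : j = g (Fin.cons i v) := by simpa using hj
      rw [hj'] at hv'
      exact h i hi' (by simpa using (h3 y hy).1 hv')

theorem Definable.nor (hm : LF fun v : Fin 1 → ℕ => m (v 0))
    {P Q : (ℕ → Prop) → (Fin (k + 1) → ℕ) → Prop} (hP : Definable m P) (hQ : Definable m Q) :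
    Definable m (fun y v => ¬ P y v ∧ ¬ Q y v) := by
  refine definable_of_extend fun w hw => ?_
  obtain ⟨N₁, D₁, g₁, hg₁, hD₁, hN₁⟩ := hP w hw
  obtain ⟨N₂, D₂, g₂, hg₂, hD₂, hN₂⟩ := hQ w hw
  refine ⟨Net.merge hm N₁ N₂, D₁ + D₂, fun u => u 0 = g₁ (fun i => u i.succ) ∨
    u 0 = N₁.size (u (Fin.last (k + 1))) + g₂ fun i => u i.succ, ?_, Net.dep_merge hD₁ hD₂,
    fun v hv y hy => ?_⟩
  · exact (LP.eq (.var 0) hg₁.lift).or (LP.eq (.var 0)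
      ((LF.comp1 (g := N₁.size) N₁.lf_size (.var _)).add hg₂.lift))
  · obtain ⟨-, h2, h3⟩ := hN₁ v hv
    obtain ⟨h4, h5, h6⟩ := hN₂ v hv
    rw [← h3 y hy, ← h6 y hy]
    have hl : ∀ j, (Fin.cons j v : Fin (k + 2) → ℕ) (Fin.last (k + 1)) = v (Fin.last k) :=
      fun _ => rfl
    simp only [Fin.cons_zero, Fin.cons_succ, hl]
    constructor
    · intro h
      constructor
      · intro h'
        exact h _ (Nat.lt_add_right _ h2) (Or.inl rfl) ((Net.val_merge_left y h2).2 h')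
      · intro h'
        exact h _ (Nat.add_lt_add_left h5 _) (Or.inr rfl) ((Net.val_merge_right y h4).2 h')
    · rintro ⟨h, h'⟩ j _ (rfl | rfl) hv'
      · exact h ((Net.val_merge_left y h2).1 hv')
      · exact h' ((Net.val_merge_right y h4).1 hv')

variable {P Q : (ℕ → Prop) → (Fin (k + 1) → ℕ) → Prop}

theorem Definable.not (hm : LF fun v : Fin 1 → ℕ => m (v 0)) (hP : Definable m P) :
    Definable m (fun y v => ¬ P y v) :=
  (hP.nor hm hP).congr fun _ _ => and_self_iff

theorem Definable.input (hm : LF fun v : Fin 1 → ℕ => m (v 0)) {f : (Fin (k + 1) → ℕ) → ℕ}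
    (hf : LF f) : Definable m (fun y v => y (f v)) :=
  ((Definable.not_input hm hf).not hm).congr fun _ _ => not_not

theorem Definable.and (hm : LF fun v : Fin 1 → ℕ => m (v 0)) (hP : Definable m P)
    (hQ : Definable m Q) : Definable m (fun y v => P y v ∧ Q y v) :=
  ((hP.not hm).nor hm (hQ.not hm)).congr fun _ _ => by rw [not_not, not_not]

theorem Definable.or (hm : LF fun v : Fin 1 → ℕ => m (v 0)) (hP : Definable m P)
    (hQ : Definable m Q) : Definable m (fun y v => P y v ∨ Q y v) :=
  ((hP.nor hm hQ).not hm).congr fun _ _ => by tauto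

theorem Definable.imp (hm : LF fun v : Fin 1 → ℕ => m (v 0)) (hP : Definable m P)
    (hQ : Definable m Q) : Definable m (fun y v => P y v → Q y v) :=
  ((hP.not hm).or hm hQ).congr fun _ _ => by tauto

theorem Definable.ex (hm : LF fun v : Fin 1 → ℕ => m (v 0))
    {P : (ℕ → Prop) → ℕ → (Fin (k + 1) → ℕ) → Prop} {b : (Fin (k + 1) → ℕ) → ℕ} (hb : LF b)
    (hP : Definable m (k := k + 1) fun y v => P y (v 0) fun i => v i.succ) :
    Definable m (fun y v => ∃ i < b v, P y i v) :=
  ((Definable.all_not hb hP).not hm).congr fun _ _ => by push Not; rfl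

theorem Definable.all (hm : LF fun v : Fin 1 → ℕ => m (v 0))
    {P : (ℕ → Prop) → ℕ → (Fin (k + 1) → ℕ) → Prop} {b : (Fin (k + 1) → ℕ) → ℕ} (hb : LF b)
    (hP : Definable m (k := k + 1) fun y v => P y (v 0) fun i => v i.succ) :
    Definable m (fun y v => ∀ i < b v, P y i v) :=
  (Definable.all_not (P := fun y i v => ¬ P y i v) hb (hP.not hm)).congr fun _ _ => by
    simp only [not_not]

end


/-! ### Circuits from networks -/

namespace Net

variable (N : Net id)

open Classical in
/-- The two gates that compute the gate `g` of a network; the second one holds its value. -/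
noncomputable def gatePair (n g : ℕ) : List Gate :=
  if g < n then [.input g, .or [2 * g]]
  else [.or (((List.range g).filter fun j => N.edge n g j).map fun j => 2 * j + 1), .not (2 * g)]

/-- The gates that compute the first `G` gates of a network. -/
noncomputable def gates (n G : ℕ) : List Gate := (List.range G).flatMap (N.gatePair n)

/-- A circuit for a network, with chosen outputs. -/
noncomputable def circuit (o : ℕ → ℕ) (idx : ℕ → ℕ → ℕ) (n : ℕ) : Circuit where
  gates := N.gates n (N.size n)
  outputs := (List.range (o n)).map fun j => 2 * idx n j + 1

variable {N}

theorem gates_succ (n G : ℕ) : N.gates n (G + 1) = N.gates n G ++ N.gatePair n G := by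
  simp [gates, List.range_succ]

theorem gatePair_eq (n g : ℕ) : ∃ a b, N.gatePair n g = [a, b] := by
  unfold gatePair
  split_ifs <;> exact ⟨_, _, rfl⟩

theorem length_gates (n G : ℕ) : (N.gates n G).length = 2 * G := by
  induction G with
  | zero => rfl
  | succ G ih =>
    obtain ⟨a, b, h⟩ := N.gatePair_eq n G
    rw [gates_succ, List.length_append, ih, h]
    rfl

theorem wellFormed_gates (n G k : ℕ) (g : Gate) (h : (N.gates n G)[k]? = some g) :
    g.WellFormed n k := by
  induction G with
  | zero => simp [gates] at h
  | succ G ih =>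
    rw [gates_succ] at h
    rcases lt_or_ge k (N.gates n G).length with hk | hk
    · rw [List.getElem?_append_left hk] at h
      exact ih h
    · rw [List.getElem?_append_right hk, length_gates] at h
      rw [length_gates] at hk
      obtain ⟨i, rfl⟩ := Nat.exists_eq_add_of_le hk
      rw [Nat.add_sub_cancel_left] at h
      unfold gatePair at h
      split_ifs at h with hG
      · rcases i with _ | _ | i
        · obtain rfl : Gate.input G = g := by simpa using h
          exact hG
        · obtain rfl : Gate.or [2 * G] = g := by simpa using h
          simp [Gate.WellFormed]
        · simp at h
      · rcases i with _ | _ | i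
        · simp only [List.getElem?_cons_zero, Option.some.injEq] at h
          subst h
          intro j hj
          simp only [List.mem_map, List.mem_filter, List.mem_range] at hj
          omega
        · obtain rfl : Gate.not (2 * G) = g := by simpa using h
          simp [Gate.WellFormed]
        · simp at h

open Classical in
theorem sum_fanIn_gates (n G : ℕ) : ((N.gates n G).map Gate.fanIn).sum ≤ G * (G + 1) := by
  induction G with
  | zero => simp [gates]
  | succ G ih =>
    rw [gates_succ, List.map_append, List.sum_append]
    have : ((N.gatePair n G).map Gate.fanIn).sum ≤ G + 1 := by
      unfold gatePair
      split_ifs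
      · simp [Gate.fanIn]
      · simp only [List.map_cons, List.map_nil, Gate.fanIn, List.length_map, List.sum_cons,
          List.sum_nil]
        have := List.length_filter_le (fun j => decide (N.edge n G j)) (List.range G)
        rw [List.length_range] at this
        omega
    nlinarith

theorem foldl_two {α β : Type} (f : List β → α → β) (l : List β) (a b : α) :
    [a, b].foldl (fun l g => l ++ [f l g]) l = l ++ [f l a, f (l ++ [f l a]) b] := by
  simp

/-- Inputs are followed by an idle disjunction so that every gate of the network takes up two
places; gate `g` can then be found at `2 * g + 1` without counting. -/
theorem values_gates (n : ℕ) (x : List Bool) (G : ℕ) :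
    ((N.gates n G).foldl (fun vals g => vals ++ [g.value x vals]) []).length = 2 * G ∧
    ∀ g < G, (((N.gates n G).foldl (fun vals g => vals ++ [g.value x vals]) []).getD
      (2 * g + 1) false = true ↔ N.val n (fun i => x.getD i false = true) g) := by
  induction G with
  | zero => simp [gates]
  | succ G ih =>
    rw [gates_succ, List.foldl_append]
    set l := (N.gates n G).foldl (fun vals g => vals ++ [g.value x vals]) [] with hl
    obtain ⟨ih1, ih2⟩ := ih
    obtain ⟨a, b, hab⟩ := N.gatePair_eq n G
    rw [hab, foldl_two (fun l g => Gate.value x l g)]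
    refine ⟨by simp [ih1]; omega, fun g hg => ?_⟩
    rcases (Nat.lt_succ_iff_lt_or_eq.1 hg) with hg | rfl
    · rw [List.getD_append _ _ _ _ (by omega)]
      exact ih2 g hg
    · rw [List.getD_append_right _ _ _ _ (by omega), ih1, Nat.add_sub_cancel_left,
        List.getD_cons_succ, List.getD_cons_zero]
      unfold gatePair at hab
      split_ifs at hab with hG
      · simp only [List.cons.injEq, and_true] at hab
        obtain ⟨rfl, rfl⟩ := hab
        rw [val_input _ _ (by exact hG)]
        simp only [Gate.value, List.any_cons, List.any_nil, Bool.or_false]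
        rw [List.getD_append_right _ _ _ _ (by omega), ih1]
        simp
      · simp only [List.cons.injEq, and_true] at hab
        obtain ⟨rfl, rfl⟩ := hab
        rw [val_nor _ _ (by exact not_lt.1 hG)]
        simp only [Gate.value]
        rw [List.getD_append_right _ _ _ _ (by omega), ih1, Nat.sub_self, List.getD_cons_zero]
        simp only [Bool.not_eq_true', List.any_eq_false, List.mem_map, List.mem_filter,
          List.mem_range, decide_eq_true_eq]
        constructor
        · intro h j hj he hv
          exact h _ ⟨j, ⟨hj, he⟩, rfl⟩ ((ih2 j hj).2 hv)
        · rintro h _ ⟨j, ⟨hj, he⟩, rfl⟩ hv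
          exact h j hj he ((ih2 j hj).1 hv)

theorem foldr_max_le {l : List ℕ} {b : ℕ} (h : ∀ a ∈ l, a ≤ b) : l.foldr max 0 ≤ b := by
  induction l with
  | nil => exact Nat.zero_le _
  | cons a l ih =>
    exact max_le (h a (by simp)) (ih fun c hc => h c (by simp [hc]))

open Classical in
-- A NOR gate costs two levels, a disjunction and a negation; an input, of depth `0`, gets its
-- second gate on level one.
theorem depths_gates (n : ℕ) (G : ℕ) (hGs : G ≤ N.size n) :
    ((N.gates n G).foldl (fun ds g => ds ++ [g.depth ds]) []).length = 2 * G ∧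
    ∀ g < G, ((N.gates n G).foldl (fun ds g => ds ++ [g.depth ds]) []).getD
      (2 * g) 0 ≤ 2 * N.dep n g + 1 ∧
      ((N.gates n G).foldl (fun ds g => ds ++ [g.depth ds]) []).getD
      (2 * g + 1) 0 ≤ 2 * N.dep n g + 2 := by
  induction G with
  | zero => simp [gates]
  | succ G ih =>
    rw [gates_succ, List.foldl_append]
    set l := (N.gates n G).foldl (fun ds g => ds ++ [g.depth ds]) [] with hl
    obtain ⟨ih1, ih2⟩ := ih (by omega)
    obtain ⟨a, b, hab⟩ := N.gatePair_eq n G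
    rw [hab, foldl_two (fun l g => Gate.depth l g)]
    refine ⟨by simp [ih1]; omega, fun g hg => ?_⟩
    rcases (Nat.lt_succ_iff_lt_or_eq.1 hg) with hg | rfl
    · rw [List.getD_append _ _ _ _ (by omega), List.getD_append _ _ _ _ (by omega)]
      exact ih2 g hg
    · rw [List.getD_append_right _ _ _ _ (by omega), List.getD_append_right _ _ _ _ (by omega),
        ih1, Nat.add_sub_cancel_left, Nat.sub_self, List.getD_cons_succ, List.getD_cons_zero,
        List.getD_cons_zero]
      unfold gatePair at hab
      split_ifs at hab with hG
      · simp only [List.cons.injEq, and_true] at hab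
        obtain ⟨rfl, rfl⟩ := hab
        simp only [Gate.depth, List.map_cons, List.map_nil, List.foldr_cons, List.foldr_nil]
        rw [List.getD_append_right _ _ _ _ (by omega), ih1]
        simp
      · simp only [List.cons.injEq, and_true] at hab
        obtain ⟨rfl, rfl⟩ := hab
        have : Gate.depth l (.or (((List.range g).filter fun j => decide (N.edge n g j)).map
            fun j => 2 * j + 1)) ≤ 2 * N.dep n g + 1 := by
          simp only [Gate.depth, List.map_map]
          refine Nat.succ_le_succ (foldr_max_le fun a ha => ?_)
          simp only [List.mem_map, List.mem_filter, List.mem_range, decide_eq_true_eq,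
            Function.comp] at ha
          obtain ⟨j, ⟨hj, he⟩, rfl⟩ := ha
          have h1 := (ih2 j hj).2
          have h2 := N.dep_lt n g j (not_lt.1 hG) (Nat.lt_of_succ_le hGs) hj he
          omega
        refine ⟨this, ?_⟩
        simp only [Gate.depth]
        rw [List.getD_append_right _ _ _ _ (by omega), ih1, Nat.sub_self, List.getD_cons_zero]
        exact Nat.succ_le_succ this

theorem encode_gates (n G : ℕ) : encodeList Gate.encode (N.gates n G) =
    ((List.range G).flatMap fun g => (N.gatePair n g).flatMap fun a => true :: a.encode) ++
      [false] := by
  rw [encodeList, gates, List.flatMap_assoc]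

theorem flatMap_filter_map {α β γ : Type} (p : α → Bool) (f : α → β) (h : β → List γ)
    (l : List α) : ((l.filter p).map f).flatMap h = l.flatMap fun a => if p a then h (f a) else [] := by
  induction l with
  | nil => rfl
  | cons a l ih => by_cases hp : p a <;> simp [hp, ih]

/-- Argument lists are written by a loop over all earlier gates with output conditional on the edge
relation, so no list is ever stored. -/
theorem encode_circuit {o : ℕ → ℕ} {idx : ℕ → ℕ → ℕ} (ho : LF fun v : Fin 1 → ℕ => o (v 0))
    (hidx : LF fun v : Fin 2 → ℕ => idx (v 0) (v 1)) :
    LE fun v : Fin 1 → ℕ => (N.circuit o idx (v 0)).encode := by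
  classical
  have h1 : LE fun w : Fin 2 → ℕ => (N.gatePair (w 1) (w 0)).flatMap fun a => true :: a.encode := by
    have h0 : LE fun w : Fin 2 → ℕ => (List.range (w 0)).flatMap fun j =>
        if N.edge (w 1) (w 0) j then true :: encodeNat (2 * j + 1) else [] := by
      refine LE.flatMap (f := fun j (w : Fin 2 → ℕ) =>
        if N.edge (w 1) (w 0) j then true :: encodeNat (2 * j + 1) else []) (.var 0) ?_
      refine LE.cond (p := fun w : Fin 3 → ℕ => N.edge (w 2) (w 1) (w 0))
        (LF.comp3 (g := fun a b c => if N.edge a b c then 1 else 0) N.lp_edge (.var 2) (.var 1)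
          (.var 0)) (LE.cons true (LE.encodeNat (((LF.const 2).mul (.var 0)).succ)))
    -- In the literals below the first bit announces an item of the list of gates and the next two
    -- give the kind of the gate; the fourth bit in the first alternative announces the single
    -- argument of the disjunction.
    refine (LE.ite (p := fun w : Fin 2 → ℕ => w 0 < w 1) (LP.lt (.var 0) (.var 1))
      (f := fun w => [true, false, false] ++ encodeNat (w 0) ++ ([true, true, true, true] ++
        encodeNat (2 * w 0) ++ [false]))
      (g := fun w => [true, true, true] ++ ((List.range (w 0)).flatMap fun j =>
        if N.edge (w 1) (w 0) j then true :: encodeNat (2 * j + 1) else []) ++ [false] ++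
        ([true, false, true] ++ encodeNat (2 * w 0))) ?_ ?_).congr fun w => ?_
    · exact (((LE.nil.cons _).cons _).cons _ |>.append (.encodeNat (.var 0))).append
        ((((((LE.nil.cons _).cons _).cons _).cons _).append
          (.encodeNat ((LF.const 2).mul (.var 0)))).append (.bit _))
    · exact (((((LE.nil.cons _).cons _).cons _).append h0).append (.bit _)).append
        ((((LE.nil.cons _).cons _).cons _).append (.encodeNat ((LF.const 2).mul (.var 0))))
    · unfold gatePair
      split_ifs
      · simp [Gate.encode, encodeList]
      · simp [Gate.encode, encodeList, flatMap_filter_map]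
  refine ((LE.flatMap (f := fun g (v : Fin 1 → ℕ) => (N.gatePair (v 0) g).flatMap fun a =>
    true :: a.encode) N.lf_size h1).append (.bit false)).append
    ((LE.flatMap (f := fun j (v : Fin 1 → ℕ) => true :: encodeNat (2 * idx (v 0) j + 1)) ho
      (LE.cons true (LE.encodeNat ((LF.const 2).mul
        (LF.comp2 (g := idx) hidx (.var 1) (.var 0))).succ))).append (.bit false))
    |>.congr fun v => ?_
  rw [Circuit.encode]
  change _ = encodeList Gate.encode (N.gates (v 0) (N.size (v 0))) ++ _
  rw [encode_gates]
  simp [circuit, encodeList, List.flatMap_map]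

/-- The size bound has to be of the form `n ^ c + c`. The additive term takes care of `n ≤ 1`, and
otherwise `2 + n ≤ n ^ 2`. -/
theorem two_add_pow_le (d n : ℕ) : (2 + n) ^ d ≤ n ^ (2 * d + 3 ^ d) + (2 * d + 3 ^ d) := by
  have h3 : 1 ≤ 3 ^ d := Nat.one_le_pow _ _ (by omega)
  rcases le_or_gt n 1 with h | h
  · have : (2 + n) ^ d ≤ 3 ^ d := Nat.pow_le_pow_left (by omega) d
    omega
  · have h1 : 2 + n ≤ n ^ 2 := by nlinarith
    calc (2 + n) ^ d ≤ (n ^ 2) ^ d := Nat.pow_le_pow_left h1 d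
      _ = n ^ (2 * d) := (pow_mul _ _ _).symm
      _ ≤ n ^ (2 * d + 3 ^ d) := Nat.pow_le_pow_right (by omega) (by omega)
      _ ≤ _ := Nat.le_add_right _ _

end Net

/-- Problems that are solved by networks of depth `O((log n) ^ k)` are in `AC^k`. -/
theorem inAC_of_net (N : Net id) {o : ℕ → ℕ} {idx : ℕ → ℕ → ℕ}
    (ho : LF fun v : Fin 1 → ℕ => o (v 0)) (hidx : LF fun v : Fin 2 → ℕ => idx (v 0) (v 1))
    (hlt : ∀ n, ∀ j < o n, idx n j < N.size n) {k c : ℕ}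
    (hdep : ∀ n, ∀ g < N.size n, N.dep n g ≤ c * Nat.log 2 n ^ k + c)
    {R : List Bool → List Bool → Prop} {f : List Bool → List Bool} (hR : ∀ x, R x (f x))
    (hlen : ∀ x, (f x).length = o x.length)
    (hf : ∀ x, ∀ j (hj : j < (f x).length),
      ((f x)[j] = true ↔ N.val x.length (fun i => x.getD i false = true) (idx x.length j))) :
    InAC k R := by
  refine ⟨N.circuit o idx, logspaceUniform_of_LE (Net.encode_circuit ho hidx), ?_, fun x => ?_⟩
  · obtain ⟨d, hd⟩ := LF.poly ((((LF.const 2).mul N.lf_size).add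
      (N.lf_size.mul N.lf_size.succ)).add ho)
    -- One constant serves three purposes: `2 * d + 3 ^ d` is needed for the size, `2 * c + 2` for
    -- the depth, which doubles when NOR gates are split.
    refine ⟨2 * d + 3 ^ d + (2 * c + 2), fun n => ⟨⟨fun i g h => Net.wellFormed_gates n _ _ _ h, ?_⟩,
      ?_, ?_⟩⟩
    · intro j hj
      simp only [Net.circuit, List.mem_map, List.mem_range] at hj
      obtain ⟨i, hi, rfl⟩ := hj
      change _ < (N.gates n (N.size n)).length
      rw [Net.length_gates]
      have := hlt n i hi
      omega
    · have h1 := hd fun _ => n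
      have h2 := Net.sum_fanIn_gates (N := N) n (N.size n)
      have h3 := Net.length_gates (N := N) n (N.size n)
      have h4 := Net.two_add_pow_le d n
      have h0 : 1 ≤ 3 ^ d := Nat.one_le_pow _ _ (by omega)
      have h5 : n ^ (2 * d + 3 ^ d) ≤ n ^ (2 * d + 3 ^ d + (2 * c + 2)) := by
        rcases Nat.eq_zero_or_pos n with rfl | hn
        · rw [zero_pow (by omega)]
          exact Nat.zero_le _
        · exact Nat.pow_le_pow_right hn (by omega)
      simp only [Finset.univ_unique, Finset.sum_const, Finset.card_singleton, one_smul] at h1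
      have h6 : (N.circuit o idx n).size = (N.gates n (N.size n)).length +
        ((N.gates n (N.size n)).map Gate.fanIn).sum + o n := by
        simp [Circuit.size, Net.circuit]
      omega
    · have h0 : 1 ≤ 3 ^ d := Nat.one_le_pow _ _ (by omega)
      refine Net.foldr_max_le fun a ha => ?_
      obtain ⟨h1, h2⟩ := Net.depths_gates (N := N) n (N.size n) le_rfl
      obtain ⟨i, hi, rfl⟩ := List.getElem_of_mem ha
      have h3 : (N.circuit o idx n).depths[i] = (N.circuit o idx n).depths.getD i 0 := by
        simp [hi]
      have hi' : i < 2 * N.size n := by rw [← h1]; exact hi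
      have h4 := h2 (i / 2) (by omega)
      have h5 := hdep n (i / 2) (by omega)
      have h6 : (N.circuit o idx n).depths.getD i 0 ≤ 2 * N.dep n (i / 2) + 2 := by
        rcases Nat.even_or_odd' i with ⟨j, rfl | rfl⟩
        · rw [show 2 * j / 2 = j by omega] at h4 ⊢
          exact h4.1.trans (by omega)
        · rw [show (2 * j + 1) / 2 = j by omega] at h4 ⊢
          exact h4.2
      rw [h3]
      refine h6.trans ?_
      have : (2 * c) * Nat.log 2 n ^ k ≤ (2 * d + 3 ^ d + (2 * c + 2)) * Nat.log 2 n ^ k :=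
        Nat.mul_le_mul_right _ (by omega)
      nlinarith
  · convert hR x
    refine List.ext_getElem ?_ fun j h1 h2 => ?_
    · simp [Circuit.eval, Net.circuit, hlen]
    · rw [Bool.eq_iff_iff, hf x j h2]
      have h3 := (Net.values_gates (N := N) x.length x (N.size x.length)).2 _
        (hlt x.length j (by rw [← hlen]; exact h2))
      rw [← h3]
      simp only [Circuit.eval, Net.circuit, List.getElem_map, List.getElem_range]
      rfl


/-! ### Evaluation of networks in small space -/

/-- The code of a stack of gates, to the base `B`. -/
def stackCode (B : ℕ) : List ℕ → ℕ
  | [] => 0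
  | g :: l => stackCode B l * B + (g + 1)

/-- Digits are `g + 1`, never zero, so a zero rest means that the stack has been emptied. -/
theorem stackCode_lt {B : ℕ} {l : List ℕ} (h : ∀ g ∈ l, g + 1 < B) :
    stackCode B l < B ^ l.length := by
  induction l with
  | nil => simp [stackCode]
  | cons g l ih =>
    have h1 := ih fun g hg => h g (by simp [hg])
    have h2 := h g (by simp)
    have h3 : (stackCode B l + 1) * B ≤ B ^ l.length * B := Nat.mul_le_mul_right _ h1
    rw [stackCode, List.length_cons, pow_succ]
    nlinarith

theorem Iterates.silent {x : List Bool} {M : ℕ} {query : ℕ → ℕ → ℕ} {cont : ℕ → ℕ → Prop}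
    {step : ℕ → ℕ → ℕ → ℕ} {emit : ℕ → ℕ → ℕ → List Bool} {S S' : ℕ} {out : List Bool}
    (hc : cont x.length S) (hs : step x.length S (bitAt x (query x.length S)) = S') (hM : S' ≤ M)
    (he : emit x.length S (bitAt x (query x.length S)) = [])
    (h : Iterates x M query cont step emit S' out) :
    Iterates x M query cont step emit S out := by
  subst hs
  simpa [he] using Iterates.go hc hM h

namespace Net

variable (N : Net id)

open Classical in
/-- One step of the depth-first evaluation of a network. -/
noncomputable def evalStep (n S b : ℕ) : ℕ :=
  -- `S / 4` codes the stack, and `S % 4` is the mode: `1` starts the evaluation of the top gate,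
  -- `0` tries the top as an argument of the gate below it, and `2` and `3` report that the top gate
  -- is false or true. A true argument makes the gate below it false; a false one leads to the next
  -- candidate; when the candidate reaches the gate itself, the gate is true.
  if S % 4 = 1 then
    if S / 4 % (N.size n + 2) - 1 < n then 4 * (S / 4) + (2 + b)
    else 4 * (S / 4 * (N.size n + 2) + 1)
  else if S % 4 = 0 then
    if S / 4 / (N.size n + 2) % (N.size n + 2) - 1 ≤ S / 4 % (N.size n + 2) - 1 then
      4 * (S / 4 / (N.size n + 2)) + 3
    else if N.edge n (S / 4 / (N.size n + 2) % (N.size n + 2) - 1)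
        (S / 4 % (N.size n + 2) - 1) then 4 * (S / 4) + 1
    else 4 * (S / 4 + 1)
  else if S / 4 / (N.size n + 2) = 0 then 0
  else if S % 4 = 2 then 4 * (S / 4 + 1)
  else 4 * (S / 4 / (N.size n + 2)) + 2

/-- The output of one step of the depth-first evaluation of a network. -/
def evalEmit (n S : ℕ) : List Bool :=
  if 2 ≤ S % 4 ∧ S / 4 / (N.size n + 2) = 0 then (if S % 4 = 2 then [false] else [true]) else []

theorem lf_evalStep : LF fun v : Fin 3 → ℕ => N.evalStep (v 0) (v 1) (v 2) := by
  classical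
  have hB : LF fun v : Fin 3 → ℕ => N.size (v 0) + 2 :=
    (LF.comp1 (g := N.size) N.lf_size (.var 0)).add (.const 2)
  have hmode : LF fun v : Fin 3 → ℕ => v 1 % 4 := (LF.var 1).mod (.const 4)
  have hstk : LF fun v : Fin 3 → ℕ => v 1 / 4 := (LF.var 1).div (.const 4)
  have hrest := hstk.div hB
  have htop := (hstk.mod hB).sub (.const 1)
  have hpar := (hrest.mod hB).sub (.const 1)
  refine LF.ite (LP.eq hmode (.const 1)) (LF.ite (LP.lt htop (.var 0))
    (((LF.const 4).mul hstk).add ((LF.const 2).add (.var 2)))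
    ((LF.const 4).mul ((hstk.mul hB).add (.const 1)))) (LF.ite (LP.eq hmode (.const 0))
    (LF.ite (LP.le hpar htop) (((LF.const 4).mul hrest).add (.const 3)) (LF.ite ?_
      (((LF.const 4).mul hstk).add (.const 1)) ((LF.const 4).mul (hstk.add (.const 1)))))
    (LF.ite (LP.eq hrest (.const 0)) (.const 0) (LF.ite (LP.eq hmode (.const 2))
      ((LF.const 4).mul (hstk.add (.const 1))) (((LF.const 4).mul hrest).add (.const 2)))))
  exact LF.comp3 (g := fun a b c => if N.edge a b c then 1 else 0) N.lp_edge (.var 0) hpar htop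

theorem le_evalEmit : LE fun v : Fin 3 → ℕ => N.evalEmit (v 0) (v 1) := by
  have hB : LF fun v : Fin 3 → ℕ => N.size (v 0) + 2 :=
    (LF.comp1 (g := N.size) N.lf_size (.var 0)).add (.const 2)
  have hmode : LF fun v : Fin 3 → ℕ => v 1 % 4 := (LF.var 1).mod (.const 4)
  have hstk : LF fun v : Fin 3 → ℕ => v 1 / 4 := (LF.var 1).div (.const 4)
  exact LE.cond ((LP.le (.const 2) hmode).and (LP.eq (hstk.div hB) (.const 0)))
    (LE.ite (LP.eq hmode (.const 2)) (.bit _) (.bit _))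

/-- The runs of the depth-first evaluation. -/
abbrev Run (x : List Bool) (M : ℕ) : ℕ → List Bool → Prop :=
  Iterates x M (fun n S => S / 4 % (N.size n + 2) - 1) (fun _ S => S ≠ 0) N.evalStep
    (fun n S _ => N.evalEmit n S)

variable {N} {x : List Bool} {M H : ℕ} {out : List Bool}

open Classical in
-- Along edges the depth decreases, so the stack never holds more than `dep g + 2` items above
-- `rest`, the last one being a candidate argument that need not be joined by an edge. The induction
-- on the gate contains one on the number of candidates left.
theorem run_eval (hM : 4 * (N.size x.length + 2) ^ H ≤ M) (g : ℕ) (rest : List ℕ)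
    (hg : g < N.size x.length)
    (hrest : ∀ a ∈ rest, a < N.size x.length)
    (hH : rest.length + N.dep x.length g + 2 ≤ H)
    (h : N.Run x M (4 * stackCode (N.size x.length + 2) (g :: rest) +
      if N.val x.length (fun i => x.getD i false = true) g then 3 else 2) out) :
    N.Run x M (4 * stackCode (N.size x.length + 2) (g :: rest) + 1) out := by
  induction g using Nat.strong_induction_on generalizing rest out with
  | _ g ih =>
  set n := x.length with hn
  set B := N.size n + 2 with hB
  set y : ℕ → Prop := fun i => x.getD i false = true with hy
  have hcode : ∀ (l : List ℕ) (r : ℕ), l.length ≤ H → (∀ a ∈ l, a < N.size n) → r < 4 →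
      4 * stackCode B l + r ≤ M := fun l r hl hl' hr => by
    have h1 := stackCode_lt (B := B) (l := l) fun g hg => by
      have := hl' g hg; omega
    have h2 : B ^ l.length ≤ B ^ H := Nat.pow_le_pow_right (by omega) hl
    omega
  have hdiv : ∀ (a : ℕ) (l : List ℕ) (r : ℕ), r < 4 → (4 * stackCode B (a :: l) + r) / 4 =
      stackCode B l * B + (a + 1) := fun a l r hr => by
    rw [stackCode]; omega
  have hmod : ∀ (l : List ℕ) (r : ℕ), r < 4 → (4 * stackCode B l + r) % 4 = r := by
    intro l r hr; omega
  have htop : ∀ (a : ℕ) (l : List ℕ), a + 1 < B → (stackCode B l * B + (a + 1)) % B = a + 1 :=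
    fun a l ha => by rw [Nat.mul_add_mod_self_right, Nat.mod_eq_of_lt ha]
  have hrst : ∀ (a : ℕ) (l : List ℕ), a + 1 < B → (stackCode B l * B + (a + 1)) / B =
      stackCode B l := fun a l ha => by
    rw [Nat.add_comm, Nat.add_mul_div_right _ _ (by omega), Nat.div_eq_of_lt ha, Nat.zero_add]
  have hgr : ∀ a ∈ g :: rest, a < N.size n := by
    intro a ha
    rcases List.mem_cons.1 ha with rfl | ha
    · exact hg
    · exact hrest a ha
  rcases lt_or_ge g n with hgn | hgn
  · refine Iterates.silent (S' := 4 * stackCode B (g :: rest) + if N.val n y g then 3 else 2)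
      (by omega) ?_ (hcode _ _ (by simp only [List.length_cons]; omega) hgr (by split_ifs <;> omega))
      ?_ h
    · rw [evalStep, hmod _ _ (by omega), if_pos rfl, hdiv _ _ _ (by omega), ← hB, htop _ _ (by omega),
        Nat.add_sub_cancel, if_pos hgn, stackCode, N.val_input y (by exact hgn)]
      simp only [hy, bitAt]
      cases x.getD g false <;> simp
    · simp only [evalEmit, hmod _ 1 (by omega)]
      simp
  -- Here `j` is the current candidate and `k` the number of candidates that remain; all earlier
  -- arguments are known to be false.
  · have htry : ∀ k j, k + j = g → (∀ i < j, N.edge n g i → ¬ N.val n y i) →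
        N.Run x M (4 * stackCode B (j :: g :: rest)) out := by
      have hemit : ∀ l r, r < 2 → N.evalEmit n (4 * stackCode B l + r) = [] := fun l r hr => by
        rw [evalEmit, hmod _ _ (by omega), if_neg (by omega)]
      have hne : ∀ a l r, 4 * stackCode B (a :: l) + r ≠ 0 := fun a l r => by
        rw [stackCode]; omega
      intro k
      induction k with
      | zero =>
        intro j hj hjv
        obtain rfl : j = g := by omega
        have hv : N.val n y j := (N.val_nor y (by exact hgn)).2 hjv
        rw [if_pos hv] at h
        refine Iterates.silent (S' := 4 * stackCode B (j :: rest) + 3) (hne j (j :: rest) 0) ?_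
          (hcode _ _ (by simp only [List.length_cons]; omega) hgr (by omega))
          (hemit (j :: j :: rest) 0 (by omega)) h
        have h1 := hmod (j :: j :: rest) 0 (by omega)
        have h2 := hdiv j (j :: rest) 0 (by omega)
        simp only [Nat.add_zero] at h1 h2
        rw [evalStep, h1, if_neg (by omega), if_pos rfl, h2, ← hB, hrst _ _ (by omega),
          htop _ _ (by omega), stackCode, htop _ _ (by omega), if_pos le_rfl]
      | succ k ihk =>
        intro j hj hjv
        have h1 := hmod (j :: g :: rest) 0 (by omega)
        have h2 := hdiv j (g :: rest) 0 (by omega)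
        simp only [Nat.add_zero] at h1 h2
        have hnext : (N.edge n g j → ¬ N.val n y j) →
            N.Run x M (4 * (stackCode B (j :: g :: rest) + 1)) out := fun h0 => by
          refine ihk (j + 1) (by omega) fun i hi => ?_
          rcases Nat.lt_succ_iff_lt_or_eq.1 hi with hi | rfl
          · exact hjv i hi
          · exact h0
        have hjgr : ∀ a ∈ j :: g :: rest, a < N.size n := by
          intro a ha
          rcases List.mem_cons.1 ha with rfl | ha
          · omega
          · exact hgr a ha
        have hjgr' : ∀ a ∈ (j + 1) :: g :: rest, a < N.size n := by
          intro a ha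
          rcases List.mem_cons.1 ha with rfl | ha
          · omega
          · exact hgr a ha
        have hl : (j :: g :: rest).length ≤ H := by simp only [List.length_cons]; omega
        have hM' : 4 * (stackCode B (j :: g :: rest) + 1) ≤ M := by
          have := hcode ((j + 1) :: g :: rest) 0 hl hjgr' (by omega)
          simp only [stackCode] at this ⊢
          omega
        by_cases he : N.edge n g j
        · refine Iterates.silent (S' := 4 * stackCode B (j :: g :: rest) + 1)
            (hne j (g :: rest) 0) ?_ (hcode _ _ hl hjgr (by omega))
            (hemit (j :: g :: rest) 0 (by omega)) ?_
          · rw [evalStep, h1, if_neg (by omega), if_pos rfl, h2, ← hB, hrst _ _ (by omega),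
              htop _ _ (by omega), stackCode, htop _ _ (by omega), Nat.add_sub_cancel,
              Nat.add_sub_cancel, if_neg (by omega), if_pos he, stackCode, stackCode]
          · have hdep := N.dep_lt n g j (by exact hgn) hg (by omega) he
            refine ih j (by omega) (g :: rest) (by omega) hgr
              (by simp only [List.length_cons]; omega) ?_
            have hne' : stackCode B (g :: rest) ≠ 0 := by rw [stackCode]; omega
            by_cases hv : N.val n y j
            · rw [if_pos hv]
              have hv' : ¬ N.val n y g := fun hv' =>
                (N.val_nor y (by exact hgn)).1 hv' j (by omega) he hv
              rw [if_neg hv'] at h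
              refine Iterates.silent (S' := 4 * stackCode B (g :: rest) + 2)
                (hne _ _ _) ?_ (hcode _ _ (by simp only [List.length_cons]; omega) hgr (by omega))
                ?_ h
              · rw [evalStep, hmod _ _ (by omega), if_neg (by omega), if_neg (by omega),
                  hdiv _ _ _ (by omega), ← hB, hrst _ _ (by omega), if_neg hne', if_neg (by omega)]
              · rw [evalEmit, hdiv _ _ _ (by omega), ← hB, hrst _ _ (by omega),
                  if_neg (fun h => hne' h.2)]
            · rw [if_neg hv]
              refine Iterates.silent (S' := 4 * (stackCode B (j :: g :: rest) + 1))
                (hne _ _ _) ?_ hM' ?_ (hnext fun _ => hv)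
              · rw [evalStep, hmod _ _ (by omega), if_neg (by omega), if_neg (by omega),
                  hdiv _ _ _ (by omega), ← hB, hrst _ _ (by omega), if_neg hne', if_pos rfl]
                simp only [stackCode]
              · rw [evalEmit, hdiv _ _ _ (by omega), ← hB, hrst _ _ (by omega),
                  if_neg (fun h => hne' h.2)]
        · refine Iterates.silent (S' := 4 * (stackCode B (j :: g :: rest) + 1))
            (hne j (g :: rest) 0) ?_ hM' (hemit (j :: g :: rest) 0 (by omega))
            (hnext fun h => absurd h he)
          rw [evalStep, h1, if_neg (by omega), if_pos rfl, h2, ← hB, hrst _ _ (by omega),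
            htop _ _ (by omega), stackCode, htop _ _ (by omega), Nat.add_sub_cancel,
            Nat.add_sub_cancel, if_neg (by omega), if_neg he, stackCode, stackCode]
    refine Iterates.silent (S' := 4 * stackCode B (0 :: g :: rest)) (by rw [stackCode]; omega) ?_
      (hcode (0 :: g :: rest) 0 (by simp only [List.length_cons]; omega) ?_ (by omega)) ?_
      (htry g 0 rfl fun i hi => absurd hi (Nat.not_lt_zero _))
    · rw [evalStep, hmod _ _ (by omega), if_pos rfl, hdiv _ _ _ (by omega), ← hB,
        htop _ _ (by omega), Nat.add_sub_cancel, if_neg (by omega), stackCode, stackCode]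
    · intro a ha
      rcases List.mem_cons.1 ha with rfl | ha
      · omega
      · exact hgr a ha
    · simp only [evalEmit, hmod _ 1 (by omega)]
      simp

end Net

/-- Languages that are decided by networks of logarithmic depth are in `DSpace((log n)^2)`. -/
theorem mem_dspace_of_net (N : Net id) {root : ℕ → ℕ} (hroot : LF fun v : Fin 1 → ℕ => root (v 0))
    (hlt : ∀ n, root n < N.size n) {c : ℕ}
    (hdep : ∀ n, ∀ g < N.size n, N.dep n g ≤ c * Nat.log 2 n + c) {L : Set (List Bool)}
    (hL : ∀ x, x ∈ L ↔ N.val x.length (fun i => x.getD i false = true) (root x.length)) :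
    L ∈ DSpace fun n => Nat.log 2 n ^ 2 := by
  classical
  obtain ⟨d, hd⟩ := LF.poly (N.lf_size.add (.const 2))
  have hB : LF fun v : Fin 2 → ℕ => N.size (v 0) + 2 :=
    (LF.comp1 (g := N.size) N.lf_size (.var 0)).add (.const 2)
  change ComputableInSpace (fun n => Nat.log 2 n ^ 2) (answer L)
  refine computableInSpace_of_iterates (init := fun n => 4 * (root n + 1) + 1)
    (query := fun n S => S / 4 % (N.size n + 2) - 1) (cont := fun _ S => S ≠ 0)
    (step := N.evalStep) (emit := fun n S _ => N.evalEmit n S)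
    (((LF.const 4).mul hroot.succ).succ) ((((LF.var 1).div (.const 4)).mod hB).sub (.const 1))
    (LP.ne_zero (.var 1)) N.lf_evalStep N.le_evalEmit (d * (6 * c + 9) + 6)
    (fun n => 4 * (N.size n + 2) ^ (c * Nat.log 2 n + c + 3)) (fun n => ?_) (fun n => ?_)
    (fun x => ?_)
  -- The stack has up to `c * l + c + 3` digits to a base below `2 ^ ((l + 2) * d)`. The rest is the
  -- expansion of the product of these two exponents, with `l ≤ l ^ 2`.
  · set l := Nat.log 2 n
    have h1 : N.size n + 2 ≤ 2 ^ ((l + 2) * d) := by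
      have := hd fun _ => n
      simp only [Finset.univ_unique, Finset.sum_const, Finset.card_singleton, one_smul] at this
      rw [pow_mul]
      exact this.trans (Nat.pow_le_pow_left (two_add_le_two_pow n) d)
    have h2 : (N.size n + 2) ^ (c * l + c + 3) ≤ 2 ^ ((l + 2) * d * (c * l + c + 3)) := by
      rw [pow_mul 2 ((l + 2) * d)]; exact Nat.pow_le_pow_left h1 _
    have h3 : 2 + n ≤ 2 ^ (l + 2) := two_add_le_two_pow n
    set E := (l + 2) * d * (c * l + c + 3) with hE
    have h4 : 2 ^ (l + 2) * 1 ≤ 2 ^ (l + 2) * 2 ^ E := Nat.mul_le_mul_left _ (Nat.one_le_two_pow)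
    have h5 : 4 * 2 ^ E ≤ 2 ^ (l + 2) * 2 ^ E := Nat.mul_le_mul_right _ (by
      rw [pow_add]; have := Nat.one_le_two_pow (n := l); omega)
    have h6 : 2 ^ (l + 2 + E + 1) ≤ 2 ^ ((d * (6 * c + 9) + 6) * l ^ 2 + (d * (6 * c + 9) + 6)) := by
      refine Nat.pow_le_pow_right (by omega) ?_
      have hl : l ≤ l ^ 2 := Nat.le_self_pow (by omega) l
      have e1 : E = d * (c * l ^ 2 + (3 * c + 3) * l + (2 * c + 6)) := by rw [hE]; ring
      have e2 : E ≤ d * (c * l ^ 2 + (3 * c + 3) * l ^ 2 + (2 * c + 6)) := by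
        rw [e1]; gcongr
      have e3 : d * (c * l ^ 2 + (3 * c + 3) * l ^ 2 + (2 * c + 6)) ≤
          d * ((6 * c + 9) * l ^ 2 + (6 * c + 9)) := Nat.mul_le_mul_left _ (by nlinarith)
      nlinarith
    rw [pow_succ, pow_add] at h6
    change 2 + n + 4 * _ ≤ _
    omega
  · have h1 := hlt n
    have h2 : N.size n + 2 ≤ (N.size n + 2) ^ (c * Nat.log 2 n + c + 3) :=
      Nat.le_self_pow (by omega) _
    change 4 * (root n + 1) + 1 ≤ 4 * _
    omega
  · have h0 : stackCode (N.size x.length + 2) [root x.length] = root x.length + 1 := by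
      simp [stackCode]
    have h1 := hlt x.length
    have h2 := hdep x.length _ h1
    have := Net.run_eval (N := N) (x := x) (out := answer L x) le_rfl (root x.length) [] h1
      (by simp) (H := c * Nat.log 2 x.length + c + 3) (by simp; omega) ?_
    · rwa [h0] at this
    · rw [h0]
      have h3 : answer L x = [decide (N.val x.length (fun i => x.getD i false = true)
          (root x.length))] := by
        rw [answer, List.cons.injEq]
        exact ⟨by rw [Bool.eq_iff_iff]; simpa using hL x, rfl⟩
      rw [h3]
      set v := N.val x.length (fun i => x.getD i false = true) (root x.length)
      set S := 4 * (root x.length + 1) + if v then 3 else 2 with hS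
      obtain ⟨r, hr, hr'⟩ : ∃ r, (r = 2 ∨ r = 3) ∧ r = if v then 3 else 2 :=
        ⟨_, by split_ifs <;> simp, rfl⟩
      rw [← hr'] at hS
      have h4 : S / 4 = root x.length + 1 := by omega
      have h5 : S % 4 = r := by omega
      have h6 : (root x.length + 1) / (N.size x.length + 2) = 0 := Nat.div_eq_of_lt (by omega)
      have h7 : ∀ b, N.evalStep x.length S b = 0 := fun b => by
        rw [Net.evalStep, h4, h6, if_neg (by omega),
          if_neg (by omega), if_pos rfl]
      have h8 : N.evalEmit x.length S = [decide v] := by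
        rw [Net.evalEmit, h4, h6, h5, hr']
        by_cases hv : v <;> simp [hv]
      have := Iterates.go (x := x) (M := 4 * (N.size x.length + 2) ^ (c * Nat.log 2 x.length + c + 3))
        (query := fun n S => S / 4 % (N.size n + 2) - 1) (cont := fun _ S => S ≠ 0)
        (step := N.evalStep) (emit := fun n S _ => N.evalEmit n S) (S := S) (out := [])
        (by omega) (by rw [h7]; exact Nat.zero_le _) (by rw [h7]; exact .finish (by simp))
      simpa only [h8, List.append_nil] using this


/-! ### Iterated definable relations -/

/-- The input of one round of an iteration: the `n` input bits, followed by the current relation. -/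
def joinInput (n : ℕ) (x R : ℕ → Prop) (j : ℕ) : Prop := (j < n ∧ x j) ∨ (n ≤ j ∧ R (j - n))

/-- The relation on numbers less than `r n` which is obtained from the empty relation in `t`
rounds. -/
def iterRel (Φ : (ℕ → Prop) → (Fin 2 → ℕ) → Prop) (r : ℕ → ℕ) (n : ℕ) (x : ℕ → Prop) :
    ℕ → ℕ → Prop
  | 0, _ => False
  | t + 1, i => i < r n ∧ Φ (joinInput n x (iterRel Φ r n x t)) ![i, n]

section

variable {r : ℕ → ℕ}

theorem div_of_layer {S t g : ℕ} (h : g < S) : (t * S + g) / S = t := by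
  rw [Nat.add_comm, Nat.add_mul_div_right _ _ (by omega), Nat.div_eq_of_lt h, Nat.zero_add]

theorem mod_of_layer {S t g : ℕ} (h : g < S) : (t * S + g) % S = g := by
  rw [Nat.mul_add_mod_self_right, Nat.mod_eq_of_lt h]

/-- Arguments of the gates of an iterated network. -/
def iterEdge (r : ℕ → ℕ) (N : Net fun n => n + r n) (a : ℕ → ℕ → ℕ) (n G J : ℕ) : Prop :=
  n ≤ G ∧ n + r n ≤ (G - n) % N.size n ∧
    ((J < n ∧ N.edge n ((G - n) % N.size n) J) ∨
    (n ≤ J ∧ (J - n) / N.size n = (G - n) / N.size n ∧ n + r n ≤ (J - n) % N.size n ∧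
      N.edge n ((G - n) % N.size n) ((J - n) % N.size n)) ∨
    (n ≤ J ∧ (J - n) / N.size n + 1 = (G - n) / N.size n ∧
      ∃ i < r n, (J - n) % N.size n = a i n ∧ N.edge n ((G - n) % N.size n) (n + i)))

theorem LP.iterEdge {N : Net fun n => n + r n} (hr : LF fun v : Fin 1 → ℕ => r (v 0))
    {a : ℕ → ℕ → ℕ} (ha : LF fun v : Fin 2 → ℕ => a (v 0) (v 1)) :
    LP fun v : Fin 3 → ℕ => iterEdge r N a (v 0) (v 1) (v 2) := by
  classical
  have hS : ∀ {k : ℕ} (i : Fin k), LF fun v : Fin k → ℕ => N.size (v i) := fun i =>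
    LF.comp1 (g := N.size) N.lf_size (.var i)
  have hr' : ∀ {k : ℕ} (i : Fin k), LF fun v : Fin k → ℕ => r (v i) := fun i =>
    LF.comp1 (g := r) hr (.var i)
  have he : ∀ {k : ℕ} {f1 f2 f3 : (Fin k → ℕ) → ℕ}, LF f1 → LF f2 → LF f3 →
      LP fun v => N.edge (f1 v) (f2 v) (f3 v) := fun h1 h2 h3 =>
    LF.comp3 (g := fun a b c => if N.edge a b c then 1 else 0) N.lp_edge h1 h2 h3
  have hg := ((LF.var (k := 3) 1).sub (.var 0)).mod (hS 0)
  have hj := ((LF.var (k := 3) 2).sub (.var 0)).mod (hS 0)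
  have ht := ((LF.var (k := 3) 1).sub (.var 0)).div (hS 0)
  have hu := ((LF.var (k := 3) 2).sub (.var 0)).div (hS 0)
  refine (LP.le (.var 0) (.var 1)).and ((LP.le ((LF.var 0).add (hr' 0)) hg).and
    (((LP.lt (.var 2) (.var 0)).and (he (.var 0) hg (.var 2))).or
    (((LP.le (.var 0) (.var 2)).and ((LP.eq hu ht).and ((LP.le ((LF.var 0).add (hr' 0)) hj).and
      (he (.var 0) hg hj)))).or
    ((LP.le (.var 0) (.var 2)).and ((LP.eq hu.succ ht).and (LP.ex (hr' 0) ?_))))))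
  exact (LP.eq hj.lift (LF.comp2 (g := a) ha (.var 0) (.var 1))).and
    (he (.var 1) hg.lift ((LF.var 1).add (.var 0)))

/-- The network which iterates a network. -/
def Net.iter (N : Net fun n => n + r n) (hr : LF fun v : Fin 1 → ℕ => r (v 0)) (D : ℕ)
    (hD : ∀ n g, N.dep n g ≤ D) (a : ℕ → ℕ → ℕ) (ha : LF fun v : Fin 2 → ℕ => a (v 0) (v 1))
    (T : ℕ → ℕ) (hT : LF fun v : Fin 1 → ℕ => T (v 0)) : Net id where
  size n := n + T n * N.size n
  edge := iterEdge r N a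
  dep n G := if G < n then 0 else (G - n) / N.size n * (D + 1) + N.dep n ((G - n) % N.size n)
  lf_size := (LF.var 0).add (hT.mul N.lf_size)
  lp_edge := LP.iterEdge hr ha
  le_size n := Nat.le_add_right _ _
  dep_input n g h := if_pos h
  dep_lt n G J h1 h2 h3 h4 := by
    obtain ⟨h5, h6, h7⟩ := h4
    have h8 : (G - n) % N.size n < N.size n := by
      refine Nat.mod_lt _ (Nat.pos_of_ne_zero fun h0 => ?_)
      rw [h0] at h2
      simp only [id] at h1
      omega
    rw [if_neg (show ¬ G < n by omega)]
    rcases h7 with ⟨h7, h9⟩ | ⟨h7, h9, h10, h11⟩ | ⟨h7, h9, i, -, -, -⟩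
    · rw [if_pos h7]
      have := N.dep_lt n _ J h6 h8 (by omega) h9
      omega
    · rw [if_neg (by omega), h9]
      have h12 : (J - n) % N.size n < (G - n) % N.size n := by
        have e1 := Nat.div_add_mod (J - n) (N.size n)
        have e2 := Nat.div_add_mod (G - n) (N.size n)
        rw [h9] at e1
        omega
      have := N.dep_lt n _ _ h6 h8 h12 h11
      omega
    · rw [if_neg (by omega), ← h9]
      have := hD n ((J - n) % N.size n)
      rw [Nat.add_mul]
      omega

/-- The gates of a definable predicate are only guaranteed to be correct for inputs that vanish
beyond the `n + r n` places; this provides that hypothesis in each round. -/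
theorem joinInput_vanish {Φ : (ℕ → Prop) → (Fin 2 → ℕ) → Prop} (n : ℕ) (x : ℕ → Prop) (t : ℕ) :
    ∀ i, n + r n ≤ i → ¬ joinInput n x (iterRel Φ r n x t) i := by
  rintro i hi (h | h)
  · omega
  · cases t with
    | zero => exact h.2
    | succ t => have := h.2.1; omega

/-- Place `n + (t * N.size n + g)` is gate `g` in copy `t`. All copies share the `n` input bits. The
relation input `n + i` of a copy is replaced by the gate `a i n` of the preceding copy, and it is
simply omitted in copy `0`, where the relation is empty. -/
theorem Net.val_iter {N : Net fun n => n + r n} {hr : LF fun v : Fin 1 → ℕ => r (v 0)} {D : ℕ}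
    {hD : ∀ n g, N.dep n g ≤ D} {a : ℕ → ℕ → ℕ} {ha : LF fun v : Fin 2 → ℕ => a (v 0) (v 1)}
    {T : ℕ → ℕ} {hT : LF fun v : Fin 1 → ℕ => T (v 0)}
    {Φ : (ℕ → Prop) → (Fin 2 → ℕ) → Prop} {n : ℕ}
    (hΦ : ∀ i < r n, n + r n ≤ a i n ∧ a i n < N.size n ∧
      ∀ y : ℕ → Prop, (∀ i, n + r n ≤ i → ¬ y i) → (N.val n y (a i n) ↔ Φ y ![i, n]))
    (x : ℕ → Prop) (t : ℕ) {g : ℕ} (hg : n + r n ≤ g) (hgS : g < N.size n) :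
    (N.iter hr D hD a ha T hT).val n x (n + (t * N.size n + g)) ↔
      N.val n (joinInput n x (iterRel Φ r n x t)) g := by
  set S := N.size n with hS
  induction t generalizing g with
  | zero =>
    induction g using Nat.strong_induction_on with
    | _ g ih =>
      rw [val_nor (m := id) _ _ (show id n ≤ n + _ from Nat.le_add_right n _), val_nor _ _ (by exact hg)]
      constructor
      · intro h j hj he hv
        rcases lt_or_ge j n with hjn | hjn
        · rw [val_input _ _ (by omega)] at hv
          refine h j (by omega) ⟨Nat.le_add_right _ _, ?_⟩ ((val_input _ _ (by exact hjn)).2 ?_)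
          · rw [Nat.add_sub_cancel_left, mod_of_layer hgS]
            exact ⟨hg, Or.inl ⟨hjn, he⟩⟩
          · rcases hv with hv | hv
            · exact hv.2
            · omega
        · rcases lt_or_ge j (n + r n) with hjr | hjr
          · rw [val_input _ _ (by omega)] at hv
            rcases hv with hv | hv
            · omega
            · exact hv.2
          · refine h (n + (0 * S + j)) (by omega) ⟨Nat.le_add_right _ _, ?_⟩
              ((ih j hj hjr (by omega)).2 hv)
            rw [Nat.add_sub_cancel_left, Nat.add_sub_cancel_left, mod_of_layer hgS,
              mod_of_layer (by omega), div_of_layer hgS, div_of_layer (by omega)]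
            exact ⟨hg, Or.inr (Or.inl ⟨Nat.le_add_right _ _, rfl, hjr, he⟩)⟩
      · rintro h J hJ ⟨-, h1⟩ hv
        rw [Nat.add_sub_cancel_left, mod_of_layer hgS, div_of_layer hgS] at h1
        rcases h1 with ⟨-, ⟨h1, h2⟩ | ⟨h1, h2, h3, h4⟩ | ⟨h1, h2, h3⟩⟩
        · rw [val_input _ _ (by exact h1)] at hv
          exact h J (by omega) h2 ((val_input _ _ (by omega)).2 (Or.inl ⟨h1, hv⟩))
        · have e := Nat.div_add_mod (J - n) S
          rw [h2] at e
          have e' : (J - n) % S = J - n := by omega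
          rw [e'] at h3 h4
          refine h (J - n) (by omega) h4 ((ih (J - n) (by omega) h3 (by omega)).1 ?_)
          rwa [show n + (0 * S + (J - n)) = J by omega]
        · exact absurd h2 (Nat.succ_ne_zero _)
  | succ t iht =>
    -- The induction hypothesis for the preceding copy: its gates `a i n` hold the relation that the
    -- present copy receives.
    have hR : ∀ i < r n, (iterRel Φ r n x (t + 1) i ↔
        (N.iter hr D hD a ha T hT).val n x (n + (t * S + a i n))) := fun i hi => by
      obtain ⟨h1, h2, h3⟩ := hΦ i hi
      refine Iff.trans ?_ (iht h1 h2).symm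
      rw [h3 _ (joinInput_vanish n x t), iterRel]
      exact and_iff_right hi
    have hts : (t + 1) * S = t * S + S := by ring
    induction g using Nat.strong_induction_on with
    | _ g ih =>
      rw [val_nor (m := id) _ _ (show id n ≤ n + _ from Nat.le_add_right n _), val_nor _ _ (by exact hg)]
      constructor
      · intro h j hj he hv
        rcases lt_or_ge j n with hjn | hjn
        · rw [val_input _ _ (by omega)] at hv
          refine h j (by omega) ⟨Nat.le_add_right _ _, ?_⟩ ((val_input _ _ (by exact hjn)).2 ?_)
          · rw [Nat.add_sub_cancel_left, mod_of_layer hgS]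
            exact ⟨hg, Or.inl ⟨hjn, he⟩⟩
          · rcases hv with hv | hv
            · exact hv.2
            · omega
        · rcases lt_or_ge j (n + r n) with hjr | hjr
          · rw [val_input _ _ (by omega)] at hv
            rcases hv with hv | hv
            · omega
            · have hi : j - n < r n := by omega
              obtain ⟨h1, h2, -⟩ := hΦ _ hi
              refine h (n + (t * S + a (j - n) n)) (by omega) ⟨Nat.le_add_right _ _, ?_⟩
                ((hR _ hi).1 hv.2)
              rw [Nat.add_sub_cancel_left, Nat.add_sub_cancel_left, mod_of_layer hgS,
                mod_of_layer h2, div_of_layer hgS, div_of_layer h2]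
              exact ⟨hg, Or.inr (Or.inr ⟨Nat.le_add_right _ _, rfl, j - n, hi, rfl,
                by rwa [Nat.add_sub_cancel' hjn]⟩)⟩
          · refine h (n + ((t + 1) * S + j)) (by omega) ⟨Nat.le_add_right _ _, ?_⟩
              ((ih j hj hjr (by omega)).2 hv)
            rw [Nat.add_sub_cancel_left, Nat.add_sub_cancel_left, mod_of_layer hgS,
              mod_of_layer (by omega), div_of_layer hgS, div_of_layer (by omega)]
            exact ⟨hg, Or.inr (Or.inl ⟨Nat.le_add_right _ _, rfl, hjr, he⟩)⟩
      · rintro h J hJ ⟨-, h1⟩ hv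
        rw [Nat.add_sub_cancel_left, mod_of_layer hgS, div_of_layer hgS, ← hS] at h1
        rcases h1 with ⟨-, ⟨h1, h2⟩ | ⟨h1, h2, h3, h4⟩ | ⟨h1, h2, i, hi, h3, h4⟩⟩
        · rw [val_input _ _ (by exact h1)] at hv
          exact h J (by omega) h2 ((val_input _ _ (by omega)).2 (Or.inl ⟨h1, hv⟩))
        · have e := Nat.div_add_mod (J - n) S
          rw [h2, Nat.mul_comm] at e
          refine h ((J - n) % S) (by omega) h4 ((ih _ (by omega) h3
            (Nat.mod_lt _ (by omega))).1 ?_)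
          rwa [e, Nat.add_sub_cancel' h1]
        · have e := Nat.div_add_mod (J - n) S
          rw [Nat.succ_inj.1 h2, Nat.mul_comm, h3] at e
          refine h (n + i) (by omega) h4 ((val_input _ _ (by exact Nat.add_lt_add_left hi n)).2
            (Or.inr ⟨Nat.le_add_right _ _, ?_⟩))
          rw [Nat.add_sub_cancel_left, hR i hi, e, Nat.add_sub_cancel' h1]
          exact hv

end

/-- Each round costs `D + 1` levels. The last copy has number `T n`; it applies the formula to the
relation after `T n` rounds, and so it holds the relation after `T n + 1` rounds. -/
theorem exists_net_iter {r : ℕ → ℕ} (hr : LF fun v : Fin 1 → ℕ => r (v 0))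
    {Φ : (ℕ → Prop) → (Fin 2 → ℕ) → Prop} (hΦ : Definable (fun n => n + r n) Φ)
    {T : ℕ → ℕ} (hT : LF fun v : Fin 1 → ℕ => T (v 0)) {c k : ℕ}
    (hTle : ∀ n, T n ≤ c * Nat.log 2 n ^ k + c) :
    ∃ (N : Net id) (c' : ℕ) (a : ℕ → ℕ → ℕ), (LF fun v : Fin 2 → ℕ => a (v 0) (v 1)) ∧
      (∀ n, ∀ g < N.size n, N.dep n g ≤ c' * Nat.log 2 n ^ k + c') ∧
      ∀ n, ∀ i < r n, a n i < N.size n ∧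
        ∀ x, N.val n x (a n i) ↔ iterRel Φ r n x (T n + 1) i := by
  obtain ⟨N, D, g, hg, hD, hN⟩ := hΦ (fun n => n + r n) ((LF.var 0).add hr)
  have ha : LF fun v : Fin 2 → ℕ => g ![v 0, v 1] := hg.congr fun v => by
    congr 1
    funext i
    fin_cases i <;> rfl
  have hN' : ∀ n, ∀ i < r n, n + r n ≤ g ![i, n] ∧ g ![i, n] < N.size n ∧
      ∀ y : ℕ → Prop, (∀ i, n + r n ≤ i → ¬ y i) → (N.val n y (g ![i, n]) ↔ Φ y ![i, n]) := by
    intro n i hi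
    have := hN ![i, n] (by
      intro j
      fin_cases j
      · change i ≤ n + r n
        omega
      · exact Nat.le_add_right _ _)
    exact this
  refine ⟨N.iter hr D hD (fun i n => g ![i, n]) ha (fun n => T n + 1) hT.succ,
    c * (D + 1) + D, fun n i => n + (T n * N.size n + g ![i, n]), ?_, fun n G hG => ?_,
    fun n i hi => ?_⟩
  · exact (LF.var 0).add (((LF.comp1 (g := T) hT (.var 0)).mul
      (LF.comp1 (g := N.size) N.lf_size (.var 0))).add
      (LF.comp2 (g := fun i n => g ![i, n]) ha (.var 1) (.var 0)))
  · change (if G < n then 0 else (G - n) / N.size n * (D + 1) + N.dep n ((G - n) % N.size n)) ≤ _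
    change G < n + (T n + 1) * N.size n at hG
    split_ifs with h
    · exact Nat.zero_le _
    · have h1 : (G - n) / N.size n < T n + 1 := Nat.div_lt_of_lt_mul (by
        rw [Nat.mul_comm]; omega)
      have h2 := hD n ((G - n) % N.size n)
      have h3 : (G - n) / N.size n * (D + 1) ≤ (c * Nat.log 2 n ^ k + c) * (D + 1) :=
        Nat.mul_le_mul_right _ ((Nat.lt_succ_iff.1 h1).trans (hTle n))
      have h4 : 0 ≤ D * Nat.log 2 n ^ k := Nat.zero_le _
      nlinarith
  · obtain ⟨h1, h2, h3⟩ := hN' n i hi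
    refine ⟨?_, fun x => ?_⟩
    · change n + (T n * N.size n + g ![i, n]) < n + (T n + 1) * N.size n
      rw [Nat.add_mul]
      omega
    · rw [Net.val_iter (Φ := Φ) (hN' n) x (T n) h1 h2, h3 _ (joinInput_vanish n x _), iterRel]
      exact (and_iff_right hi).symm

/-- Problems that are solved by `O((log n) ^ k)` rounds of an iteration are in `AC^k`. -/
theorem inAC_of_iter {r : ℕ → ℕ} (hr : LF fun v : Fin 1 → ℕ => r (v 0))
    {Φ : (ℕ → Prop) → (Fin 2 → ℕ) → Prop} (hΦ : Definable (fun n => n + r n) Φ)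
    {T : ℕ → ℕ} (hT : LF fun v : Fin 1 → ℕ => T (v 0)) {c k : ℕ}
    (hTle : ∀ n, T n ≤ c * Nat.log 2 n ^ k + c) {o : ℕ → ℕ} {idx : ℕ → ℕ → ℕ}
    (ho : LF fun v : Fin 1 → ℕ => o (v 0)) (hidx : LF fun v : Fin 2 → ℕ => idx (v 0) (v 1))
    (hlt : ∀ n, ∀ j < o n, idx n j < r n)
    {R : List Bool → List Bool → Prop} {f : List Bool → List Bool} (hR : ∀ x, R x (f x))
    (hlen : ∀ x, (f x).length = o x.length)
    (hf : ∀ x, ∀ j (hj : j < (f x).length), ((f x)[j] = true ↔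
      iterRel Φ r x.length (fun i => x.getD i false = true) (T x.length + 1) (idx x.length j))) :
    InAC k R := by
  obtain ⟨N, c', a, ha, hdep, hN⟩ := exists_net_iter hr hΦ hT hTle
  refine inAC_of_net N ho (idx := fun n j => a n (idx n j))
    (LF.comp2 (g := a) ha (.var 0) hidx) (fun n j hj => (hN n _ (hlt n j hj)).1) hdep hR hlen
    fun x j hj => ?_
  rw [hf x j hj, (hN _ _ (hlt _ j (by rwa [← hlen]))).2]

/-- Languages that are decided by `O(log n)` rounds of an iteration are in `DSpace((log n)^2)`. -/
theorem mem_dspace_of_iter {r : ℕ → ℕ} (hr : LF fun v : Fin 1 → ℕ => r (v 0))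
    {Φ : (ℕ → Prop) → (Fin 2 → ℕ) → Prop} (hΦ : Definable (fun n => n + r n) Φ)
    {T : ℕ → ℕ} (hT : LF fun v : Fin 1 → ℕ => T (v 0)) {c : ℕ}
    (hTle : ∀ n, T n ≤ c * Nat.log 2 n + c) {idx : ℕ → ℕ}
    (hidx : LF fun v : Fin 1 → ℕ => idx (v 0)) (hlt : ∀ n, idx n < r n) {L : Set (List Bool)}
    (hL : ∀ x, x ∈ L ↔
      iterRel Φ r x.length (fun i => x.getD i false = true) (T x.length + 1) (idx x.length)) :
    L ∈ DSpace fun n => Nat.log 2 n ^ 2 := by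
  obtain ⟨N, c', a, ha, hdep, hN⟩ := exists_net_iter (k := 1) hr hΦ hT
    (fun n => by rw [pow_one]; exact hTle n)
  refine mem_dspace_of_net N (root := fun n => a n (idx n)) (c := c')
    (LF.comp2 (g := a) ha (.var 0) hidx) (fun n => (hN n _ (hlt n)).1)
    (fun n g hg => by simpa using hdep n g hg) fun x => ?_
  rw [hL, (hN _ _ (hlt _)).2]

/-- Languages that are decided by `O((log n) ^ k)` rounds of an iteration are in `AC^k`. -/
theorem mem_AC_of_iter {r : ℕ → ℕ} (hr : LF fun v : Fin 1 → ℕ => r (v 0))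
    {Φ : (ℕ → Prop) → (Fin 2 → ℕ) → Prop} (hΦ : Definable (fun n => n + r n) Φ)
    {T : ℕ → ℕ} (hT : LF fun v : Fin 1 → ℕ => T (v 0)) {c k : ℕ}
    (hTle : ∀ n, T n ≤ c * Nat.log 2 n ^ k + c) {idx : ℕ → ℕ}
    (hidx : LF fun v : Fin 1 → ℕ => idx (v 0)) (hlt : ∀ n, idx n < r n) {L : Set (List Bool)}
    (hL : ∀ x, x ∈ L ↔
      iterRel Φ r x.length (fun i => x.getD i false = true) (T x.length + 1) (idx x.length)) :
    L ∈ AC k := by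
  classical
  change InAC k fun x y => y = answer L x
  refine inAC_of_iter hr hΦ hT hTle (R := fun x y => y = answer L x) (o := fun _ => 1) (idx := fun n _ => idx n) (.const 1)
    (LF.comp1 (g := idx) hidx (.var 0)) (fun n _ _ => hlt n) (f := answer L) (fun _ => rfl)
    (fun _ => rfl) fun x j hj => ?_
  obtain rfl : j = 0 := by simpa [answer] using hj
  rw [← hL]
  simp [answer]

end Complexity

/-! ### Tables of right-ideal isomorphisms, their strings, and the two problems -/

namespace Thompson

open Complexity

/-! ### First-order description of strings and of the composition of tables -/

section Formulas

variable (q : ℕ)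

/-- A bound for all numbers that occur in the computation on inputs of length `n`. -/
def bound (n : ℕ) : ℕ := 8 * (n + 2) ^ 2 + q + 4

/-- `S i c` says that the symbol number `i` of a string has the code `c`. The symbol number `i` is
a letter. -/
def IsLetterAt (S : ℕ → ℕ → Prop) (i : ℕ) : Prop := ∃ c < q, S i c

/-- A slot, or the bar of a table, starts at `a`. -/
def SlotStart (S : ℕ → ℕ → Prop) (a : ℕ) : Prop := a = 0 ∨ S (a - 1) (q + 2) ∨ S (a - 1) (q + 3)

/-- A table starts at `p`. -/
def TableStart (S : ℕ → ℕ → Prop) (p : ℕ) : Prop := p = 0 ∨ S (p - 1) (q + 3)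

/-- The word written at `p` has the letter `k` at `t`, or it has length `t` and `k = q`. -/
def WordAt (S : ℕ → ℕ → Prop) (p t k : ℕ) : Prop :=
  (∀ i < t, IsLetterAt q S (p + i)) ∧ ((k < q ∧ S (p + t) k) ∨ (k = q ∧ ¬ IsLetterAt q S (p + t)))

/-- The table that starts at `p` has an entry in the slot `a`, the component `d` of which has the
letter `k` at `t`, or it has length `t` and `k = q`. -/
def Leaf (M : ℕ) (S : ℕ → ℕ → Prop) (p a d t k : ℕ) : Prop :=
  TableStart q S p ∧ p ≤ a ∧ (∀ i < a, p ≤ i → ¬ S i (q + 3)) ∧ SlotStart q S a ∧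
    ∃ c < M, a ≤ c ∧ S c (q + 1) ∧ (∀ i < c, a ≤ i → IsLetterAt q S i ∨ S i q) ∧
      ((d = 0 ∧ WordAt q S a t k) ∨ (d = 1 ∧ WordAt q S (c + 1) t k))

/-- The block `b` of the relation `R` has an entry. -/
def HasEntry (M : ℕ) (R : ℕ → ℕ → ℕ → ℕ → ℕ → Prop) (b : ℕ) : Prop :=
  ∃ a < M, ∃ t < M, R b a 0 t q

/-- One half of the entries of a composite: a component of an entry of `by'` is a prefix of
a component of the entry `a` of `bx`. -/
def HalfStep (M : ℕ) (R : ℕ → ℕ → ℕ → ℕ → ℕ → Prop) (bx by' dx e a d t k : ℕ) : Prop :=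
  ∃ a' < M, ∃ m < M, ∃ m' < M, ∃ l < M, R by' a' (1 - dx) m q ∧ R bx a dx m' q ∧
    R by' a' dx l q ∧ (e = 1 → m ≠ m') ∧
    (∀ i < m, ∀ c < q, R by' a' (1 - dx) i c → R bx a dx i c) ∧
    ((d = 1 - dx ∧ R bx a d t k) ∨
      (d = dx ∧ ((t < l ∧ R by' a' dx t k) ∨ (l ≤ t ∧ R bx a dx (m + (t - l)) k))))

/-- The composites of neighbouring blocks. -/
def ComposeStep (M : ℕ) (R : ℕ → ℕ → ℕ → ℕ → ℕ → Prop) (b a d t k : ℕ) : Prop :=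
  (HasEntry q M R (2 * b) ∧ HasEntry q M R (2 * b + 1) ∧
    (HalfStep q M R (2 * b + 1) (2 * b) 1 0 a d t k ∨
      HalfStep q M R (2 * b) (2 * b + 1) 0 1 a d t k)) ∨
  (¬ (HasEntry q M R (2 * b) ∧ HasEntry q M R (2 * b + 1)) ∧
    (R (2 * b) a d t k ∨ R (2 * b + 1) a d t k))

/-- One round: read the tables if there is nothing yet, otherwise compose them in pairs. The table
that starts at `p` is put into a block `b` with `B p b`. -/
def Round (M : ℕ) (B : ℕ → ℕ → Prop) (R : ℕ → ℕ → ℕ → ℕ → ℕ → Prop) (S : ℕ → ℕ → Prop)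
    (b a d t k : ℕ) : Prop :=
  ((∃ b' < M, HasEntry q M R b') ∧ ComposeStep q M R b a d t k) ∨
    (¬ (∃ b' < M, HasEntry q M R b') ∧ ∃ p < M, B p b ∧ Leaf q M S p a d t k)

/-- The number of symbols in a bit string of length `n`. -/
def numSymb (n : ℕ) : ℕ := n / (q + 4)

/-- The symbols of a bit string. -/
def symbAt (y : ℕ → Prop) (n i c : ℕ) : Prop :=
  (i < numSymb q n ∧ c < q + 4) ∧ y (i * (q + 4) + c)

/-- The current relation, in the input of a round. -/
def relAt (y : ℕ → Prop) (n b a d t k : ℕ) : Prop := y (n + tupleCode 5 ![b, a, d, t, k])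

/-- The map that is iterated. -/
def roundMap (B : ℕ → ℕ → Prop) (Out : (ℕ → Prop) → ℕ → ℕ → ℕ → Prop) (y : ℕ → Prop)
    (v : Fin 2 → ℕ) : Prop :=
  (∀ j, tupleDec 5 (v 0) j ≤ bound q (v 1)) ∧
    ((tupleDec 5 (v 0) 4 < q + 1 ∧ Round q (bound q (v 1) + 1) B (relAt y (v 1)) (symbAt q y (v 1))
        (tupleDec 5 (v 0) 0) (tupleDec 5 (v 0) 1) (tupleDec 5 (v 0) 2) (tupleDec 5 (v 0) 3)
        (tupleDec 5 (v 0) 4)) ∨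
      (tupleDec 5 (v 0) 4 = q + 1 ∧ Out y (v 1) (tupleDec 5 (v 0) 0) (tupleDec 5 (v 0) 1)))

/-- The number of codes of relevant tuples. -/
def relSize (n : ℕ) : ℕ := tupleCode 5 (fun _ => bound q n) + 1

end Formulas

/-! ### Definability of the formulas for reading and composing tables -/

section Definability

variable {q k : ℕ} {m : ℕ → ℕ}

theorem LF.bound {f : (Fin k → ℕ) → ℕ} (hf : LF f) : LF fun v => bound q (f v) :=
  (((LF.const 8).mul ((hf.add (.const 2)).pow_const 2)).add (.const q)).add (.const 4)

theorem LF.relSize : LF fun v : Fin 1 → ℕ => relSize q (v 0) :=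
  (LF.tupleCode 5 fun _ => LF.bound (.var 0)).succ

variable {fn f1 f2 f3 f4 f5 f6 f7 f8 fM : (Fin (k + 1) → ℕ) → ℕ}

theorem definable_relAt (hm : LF fun v : Fin 1 → ℕ => m (v 0)) (hn : LF fn) (h1 : LF f1)
    (h2 : LF f2) (h3 : LF f3) (h4 : LF f4) (h5 : LF f5) :
    Definable m fun y v => relAt y (fn v) (f1 v) (f2 v) (f3 v) (f4 v) (f5 v) :=
  Definable.input hm (hn.add ((LF.tupleCode 5 (f := ![f1, f2, f3, f4, f5]) (by
    intro i; fin_cases i <;> assumption)).congr fun v => by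
      congr 1; funext i; fin_cases i <;> rfl))

theorem definable_symbAt (hm : LF fun v : Fin 1 → ℕ => m (v 0)) (hn : LF fn) (h1 : LF f1)
    (h2 : LF f2) : Definable m fun y v => symbAt q y (fn v) (f1 v) (f2 v) :=
  (Definable.atom hm ((LP.lt h1 (hn.div (.const (q + 4)))).and (LP.lt h2 (.const (q + 4))))).and hm
    (Definable.input hm ((h1.mul (.const (q + 4))).add h2))

theorem definable_isLetterAt (hm : LF fun v : Fin 1 → ℕ => m (v 0)) (hn : LF fn) (h1 : LF f1) :
    Definable m fun y v => IsLetterAt q (symbAt q y (fn v)) (f1 v) :=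
  Definable.ex hm (.const q) (definable_symbAt hm hn.lift h1.lift (.var 0))

theorem definable_slotStart (hm : LF fun v : Fin 1 → ℕ => m (v 0)) (hn : LF fn) (h1 : LF f1) :
    Definable m fun y v => SlotStart q (symbAt q y (fn v)) (f1 v) :=
  (Definable.atom hm (LP.eq h1 .zero)).or hm
    ((definable_symbAt hm hn h1.pred (.const _)).or hm (definable_symbAt hm hn h1.pred (.const _)))

theorem definable_tableStart (hm : LF fun v : Fin 1 → ℕ => m (v 0)) (hn : LF fn) (h1 : LF f1) :
    Definable m fun y v => TableStart q (symbAt q y (fn v)) (f1 v) :=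
  (Definable.atom hm (LP.eq h1 .zero)).or hm (definable_symbAt hm hn h1.pred (.const _))

theorem definable_wordAt (hm : LF fun v : Fin 1 → ℕ => m (v 0)) (hn : LF fn) (h1 : LF f1)
    (h2 : LF f2) (h3 : LF f3) :
    Definable m fun y v => WordAt q (symbAt q y (fn v)) (f1 v) (f2 v) (f3 v) :=
  (Definable.all hm h2 (definable_isLetterAt hm hn.lift (h1.lift.add (.var 0)))).and hm
    (((Definable.atom hm (LP.lt h3 (.const q))).and hm (definable_symbAt hm hn (h1.add h2) h3)).or hm
      ((Definable.atom hm (LP.eq h3 (.const q))).and hm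
        ((definable_isLetterAt hm hn (h1.add h2)).not hm)))

/-- The term follows the formula connective by connective. Variables are numbered from the innermost
quantifier: each quantifier introduces variable `0`, and `lift` shifts the others. -/
theorem definable_leaf (hm : LF fun v : Fin 1 → ℕ => m (v 0)) (hM : LF fM) (hn : LF fn)
    (h1 : LF f1) (h2 : LF f2) (h3 : LF f3) (h4 : LF f4) (h5 : LF f5) :
    Definable m fun y v => Leaf q (fM v) (symbAt q y (fn v)) (f1 v) (f2 v) (f3 v) (f4 v) (f5 v) := by
  refine (definable_tableStart hm hn h1).and hm ((Definable.atom hm (LP.le h1 h2)).and hm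
    ((Definable.all hm h2 ((Definable.atom hm (LP.le h1.lift (.var 0))).imp hm
      ((definable_symbAt hm hn.lift (.var 0) (.const _)).not hm))).and hm
    ((definable_slotStart hm hn h2).and hm (Definable.ex hm hM
      ((Definable.atom hm (LP.le h2.lift (.var 0))).and hm
      ((definable_symbAt hm hn.lift (.var 0) (.const _)).and hm
      ((Definable.all hm (.var 0) ((Definable.atom hm (LP.le h2.lift.lift (.var 0))).imp hm
        ((definable_isLetterAt hm hn.lift.lift (.var 0)).or hm
          (definable_symbAt hm hn.lift.lift (.var 0) (.const _))))).and hm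
      (((Definable.atom hm (LP.eq h3.lift .zero)).and hm
        (definable_wordAt hm hn.lift h2.lift h4.lift h5.lift)).or hm
      ((Definable.atom hm (LP.eq h3.lift (.const 1))).and hm
        (definable_wordAt hm hn.lift (LF.var 0).succ h4.lift h5.lift))))))))))

theorem definable_hasEntry (hm : LF fun v : Fin 1 → ℕ => m (v 0)) (hM : LF fM) (hn : LF fn)
    (h1 : LF f1) : Definable m fun y v => HasEntry q (fM v) (relAt y (fn v)) (f1 v) :=
  Definable.ex hm hM (Definable.ex hm hM.lift
    (definable_relAt hm hn.lift.lift h1.lift.lift (.var 1) .zero (.var 0) (.const q)))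

theorem definable_halfStep (hm : LF fun v : Fin 1 → ℕ => m (v 0)) (hM : LF fM) (hn : LF fn)
    (h1 : LF f1) (h2 : LF f2) (h3 : LF f3) (h4 : LF f4) (h5 : LF f5) (h6 : LF f6) (h7 : LF f7)
    (h8 : LF f8) :
    Definable m fun y v => HalfStep q (fM v) (relAt y (fn v)) (f1 v) (f2 v) (f3 v) (f4 v) (f5 v)
      (f6 v) (f7 v) (f8 v) := by
  -- Under the four quantifiers over `a'`, `m`, `m'`, `l`, these become the variables `3`, `2`, `1`,
  -- `0`.
  have n4 := hn.lift.lift.lift.lift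
  have bx := h1.lift.lift.lift.lift
  have by' := h2.lift.lift.lift.lift
  have dx := h3.lift.lift.lift.lift
  have a := h5.lift.lift.lift.lift
  have d := h6.lift.lift.lift.lift
  have t := h7.lift.lift.lift.lift
  have k4 := h8.lift.lift.lift.lift
  have d1 := (LF.const 1).sub dx
  refine Definable.ex hm hM (Definable.ex hm hM.lift (Definable.ex hm hM.lift.lift
    (Definable.ex hm hM.lift.lift.lift ?_)))
  refine (definable_relAt hm n4 by' (.var 3) d1 (.var 2) (.const q)).and hm
    ((definable_relAt hm n4 bx a dx (.var 1) (.const q)).and hm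
    ((definable_relAt hm n4 by' (.var 3) dx (.var 0) (.const q)).and hm
    (((Definable.atom hm (LP.eq h4.lift.lift.lift.lift (.const 1))).imp hm
      (Definable.atom hm (LP.eq (.var 2) (.var 1)).not)).and hm
    ((Definable.all hm (.var 2) (Definable.all hm (.const q) ?_)).and hm
    (((Definable.atom hm (LP.eq d d1)).and hm (definable_relAt hm n4 bx a d t k4)).or hm
    ((Definable.atom hm (LP.eq d dx)).and hm
      (((Definable.atom hm (LP.lt t (.var 0))).and hm
        (definable_relAt hm n4 by' (.var 3) dx t k4)).or hm
      ((Definable.atom hm (LP.le (.var 0) t)).and hm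
        (definable_relAt hm n4 bx a dx ((LF.var 2).add (t.sub (.var 0))) k4)))))))))
  exact (definable_relAt hm n4.lift.lift by'.lift.lift (.var 5) d1.lift.lift (.var 1) (.var 0)).imp hm
    (definable_relAt hm n4.lift.lift bx.lift.lift a.lift.lift dx.lift.lift (.var 1) (.var 0))

theorem definable_composeStep (hm : LF fun v : Fin 1 → ℕ => m (v 0)) (hM : LF fM) (hn : LF fn)
    (h1 : LF f1) (h2 : LF f2) (h3 : LF f3) (h4 : LF f4) (h5 : LF f5) :
    Definable m fun y v => ComposeStep q (fM v) (relAt y (fn v)) (f1 v) (f2 v) (f3 v) (f4 v)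
      (f5 v) := by
  have e := (LF.const 2).mul h1
  have o := ((LF.const 2).mul h1).succ
  exact ((definable_hasEntry hm hM hn e).and hm ((definable_hasEntry hm hM hn o).and hm
    ((definable_halfStep hm hM hn o e (.const 1) .zero h2 h3 h4 h5).or hm
      (definable_halfStep hm hM hn e o .zero (.const 1) h2 h3 h4 h5)))).or hm
    ((((definable_hasEntry hm hM hn e).and hm (definable_hasEntry hm hM hn o)).not hm).and hm
      ((definable_relAt hm hn e h2 h3 h4 h5).or hm (definable_relAt hm hn o h2 h3 h4 h5)))

theorem definable_round (hm : LF fun v : Fin 1 → ℕ => m (v 0)) {B : ℕ → ℕ → Prop}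
    (hB : LP fun v : Fin 2 → ℕ => B (v 0) (v 1)) (hM : LF fM) (hn : LF fn)
    (h1 : LF f1) (h2 : LF f2) (h3 : LF f3) (h4 : LF f4) (h5 : LF f5) :
    Definable m fun y v => Round q (fM v) B (relAt y (fn v)) (symbAt q y (fn v)) (f1 v) (f2 v)
      (f3 v) (f4 v) (f5 v) := by
  classical
  have h : Definable m fun y v => ∃ b' < fM v, HasEntry q (fM v) (relAt y (fn v)) b' :=
    Definable.ex hm hM (definable_hasEntry hm hM.lift hn.lift (.var 0))
  refine (h.and hm (definable_composeStep hm hM hn h1 h2 h3 h4 h5)).or hm ((h.not hm).and hm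
    (Definable.ex hm hM ((Definable.atom hm ?_).and hm
      (definable_leaf hm hM.lift hn.lift (.var 0) h2.lift h3.lift h4.lift h5.lift))))
  exact LF.comp2 (g := fun a b => if B a b then 1 else 0) hB (.var 0) h1.lift

theorem definable_roundMap (hm : LF fun v : Fin 1 → ℕ => m (v 0)) {B : ℕ → ℕ → Prop}
    (hB : LP fun v : Fin 2 → ℕ => B (v 0) (v 1)) {Out : (ℕ → Prop) → ℕ → ℕ → ℕ → Prop}
    (hOut : ∀ {f1 f2 f3 : (Fin 2 → ℕ) → ℕ}, LF f1 → LF f2 → LF f3 →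
      Definable m fun y v => Out y (f1 v) (f2 v) (f3 v)) :
    Definable m (roundMap q B Out) := by
  have hd : ∀ j, LF fun v : Fin 2 → ℕ => tupleDec 5 (v 0) j := fun j => LF.tupleDec 5 (.var 0) j
  have hW : LF fun v : Fin 2 → ℕ => bound q (v 1) := LF.bound (.var 1)
  refine Definable.and hm ?_ (((Definable.atom hm (LP.lt (hd 4) (.const _))).and hm
    (definable_round hm hB hW.succ (.var 1) (hd 0) (hd 1) (hd 2) (hd 3) (hd 4))).or hm
    ((Definable.atom hm (LP.eq (hd 4) (.const _))).and hm (hOut (.var 1) (hd 0) (hd 1))))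
  refine ((Definable.atom hm (LP.le (hd 0) hW)).and hm ((Definable.atom hm (LP.le (hd 1) hW)).and hm
    ((Definable.atom hm (LP.le (hd 2) hW)).and hm ((Definable.atom hm (LP.le (hd 3) hW)).and hm
      (Definable.atom hm (LP.le (hd 4) hW)))))).congr fun y v => ?_
  simp [Fin.forall_fin_succ]

end Definability


/-! ### Tables of isomorphisms between essential right ideals -/

namespace EssIso

variable {A : Type}

/-- `u` is a minimal element of the domain, for the prefix order. -/
def IsMin (f : EssIso A) (u : List A) : Prop :=
  u ∈ dom f.map ∧ ∀ u', u' <+: u → u' ∈ dom f.map → u' = u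

/-- `(u, v)` is an entry of the table. -/
def Entry (f : EssIso A) (u v : List A) : Prop := v ∈ f.map u ∧ f.IsMin u

theorem exists_isMin {f : EssIso A} {u : List A} (h : u ∈ dom f.map) :
    ∃ p x, f.IsMin p ∧ u = p ++ x := by
  induction hl : u.length using Nat.strong_induction_on generalizing u with
  | _ l ih =>
    by_cases hm : f.IsMin u
    · exact ⟨u, [], hm, by simp⟩
    · have : ∃ u', u' <+: u ∧ u' ∈ dom f.map ∧ u' ≠ u := by
        by_contra hc
        push Not at hc
        exact hm ⟨h, hc⟩
      obtain ⟨u', ⟨x, rfl⟩, h1, h2⟩ := this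
      have hx : x ≠ [] := by rintro rfl; simp at h2
      have hx' := List.length_pos_iff.2 hx
      obtain ⟨p, y, hp, rfl⟩ := ih u'.length (by rw [← hl, List.length_append]; omega) h1 rfl
      exact ⟨p, y ++ x, hp, by simp⟩

theorem exists_entry {f : EssIso A} {u v : List A} (h : v ∈ f.map u) :
    ∃ p r x, f.Entry p r ∧ u = p ++ x ∧ v = r ++ x := by
  obtain ⟨p, x, hp, rfl⟩ := exists_isMin ⟨v, h⟩
  obtain ⟨r, hr⟩ := hp.1
  exact ⟨p, r, x, ⟨hr, hp⟩, rfl, Option.mem_unique h (f.iso _ _ x hr)⟩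

theorem IsMin.unique {f : EssIso A} {p p' u : List A} (h : f.IsMin p) (h' : f.IsMin p')
    (hu : p <+: u) (hu' : p' <+: u) : p = p' := by
  rcases List.prefix_or_prefix_of_prefix hu hu' with hp | hp
  · exact h'.2 _ hp h.1
  · exact (h.2 _ hp h'.1).symm

/-- Minimality passes to the image: a proper prefix of `v` in the range would have a preimage that
is a proper prefix of `u` in the domain. -/
theorem Entry.inv {f : EssIso A} {u v : List A} (h : f.Entry u v) : f.inv.Entry v u := by
  have h0 : u ∈ f.inv.map v := (f.map.mem_iff_mem).2 h.1
  refine ⟨h0, ⟨u, h0⟩, ?_⟩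
  rintro v' ⟨x, rfl⟩ ⟨u', hu'⟩
  have hu'' : v' ∈ f.map u' := (f.map.mem_iff_mem).1 hu'
  have e := f.map.inj h.1 (f.iso _ _ x hu'')
  subst e
  have := h.2.2 u' ⟨x, rfl⟩ ⟨v', hu''⟩
  rw [List.self_eq_append_right] at this
  subst this
  simp

theorem inv_inv (f : EssIso A) : f.inv.inv = f := ext (PEquiv.symm_symm _)

theorem entry_inv_iff {f : EssIso A} {u v : List A} : f.inv.Entry v u ↔ f.Entry u v :=
  ⟨fun h => by simpa [inv_inv] using h.inv, Entry.inv⟩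

theorem Entry.unique {f : EssIso A} {p p' r r' u : List A} (h : f.Entry p r) (h' : f.Entry p' r')
    (hu : p <+: u) (hu' : p' <+: u) : p = p' ∧ r = r' := by
  obtain rfl := h.2.unique h'.2 hu hu'
  exact ⟨rfl, Option.mem_unique h.1 h'.1⟩

theorem Entry.unique_right {f : EssIso A} {p p' r r' v : List A} (h : f.Entry p r)
    (h' : f.Entry p' r') (hv : r <+: v) (hv' : r' <+: v) : p = p' ∧ r = r' :=
  (h.inv.unique h'.inv hv hv').symm

theorem exists_entry_of_dom (f : EssIso A) (u : List A) :
    ∃ p r x, f.Entry p r ∧ p <+: u ++ x := by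
  obtain ⟨x, v, hv⟩ := ((isEssential_iff _).1 f.ess_dom).2 u
  obtain ⟨p, r, y, h, h1, -⟩ := exists_entry hv
  exact ⟨p, r, x, h, y, h1.symm⟩

/-- Essentiality in local form: every way to branch off from a domain word leads to another entry. A
shorter entry on that branch would be a proper prefix of `u`. -/
theorem Entry.complete {f : EssIso A} {u v : List A} (h : f.Entry u v) {t : ℕ} (ht : t < u.length)
    (c : A) : ∃ u' v', f.Entry u' v' ∧ u.take t ++ [c] <+: u' := by
  obtain ⟨p, r, x, hp, hpx⟩ := exists_entry_of_dom f (u.take t ++ [c])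
  refine ⟨p, r, hp, ?_⟩
  rcases List.prefix_or_prefix_of_prefix hpx (List.prefix_append _ x) with h1 | h1
  · rcases List.prefix_concat_iff.1 h1 with h2 | h2
    · rw [h2]
    · have h3 := (hp.unique h (h2.trans (List.take_prefix t u)) (List.prefix_refl u)).1
      have := h2.length_le
      rw [h3, List.length_take] at this
      omega
  · exact h1

/-- The composite is defined where the middle words `q₁` and `p₂` have a common extension, that is,
where they are comparable, and the minimal such place is given by the longer one. The condition `z ≠
[]` assigns the case of equality to the first alternative only. -/
theorem entry_comp_iff {f g : EssIso A} {u w : List A} : (g.comp f).Entry u w ↔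
    ∃ p₁ q₁ p₂ q₂ z, f.Entry p₁ q₁ ∧ g.Entry p₂ q₂ ∧ ((q₁ = p₂ ++ z ∧ u = p₁ ∧ w = q₂ ++ z) ∨
      (z ≠ [] ∧ p₂ = q₁ ++ z ∧ u = p₁ ++ z ∧ w = q₂)) := by
  have hc : ∀ u w, w ∈ (g.comp f).map u ↔ ∃ v, v ∈ f.map u ∧ w ∈ g.map v := fun u w =>
    PEquiv.mem_trans _ _ _ _
  constructor
  · rintro ⟨h, hm⟩
    obtain ⟨v, hv, hw⟩ := (hc u w).1 h
    obtain ⟨p₁, q₁, x, hp, rfl, rfl⟩ := exists_entry hv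
    obtain ⟨p₂, q₂, y, hq, e, rfl⟩ := exists_entry hw
    refine ⟨p₁, q₁, p₂, q₂, ?_⟩
    rcases List.append_eq_append_iff.1 e with ⟨z, h1, h2⟩ | ⟨z, h1, h2⟩
    -- A common tail `y` could be dropped on both sides, against the minimality of `u`.
    · have h3 := hm.2 (p₁ ++ z) ⟨y, by simp [h2]⟩ ⟨q₂, (hc _ _).2 ⟨p₂, by
        rw [h1]; exact f.iso _ _ z hp.1, hq.1⟩⟩
      rw [h2] at h3 ⊢
      obtain rfl : y = [] := by simpa using h3
      refine ⟨z, hp, hq, ?_⟩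
      by_cases hz : z = []
      · subst hz; left; simpa using h1.symm
      · right; exact ⟨hz, h1, by simp, by simp⟩
    · have h3 := hm.2 p₁ ⟨x, rfl⟩ ⟨q₂ ++ z, (hc _ _).2 ⟨q₁, hp.1, by
        rw [h1]; exact g.iso _ _ z hq.1⟩⟩
      obtain rfl : x = [] := by simpa using h3
      exact ⟨z, hp, hq, Or.inl ⟨h1, by simp, by simp [h2]⟩⟩
  · rintro ⟨p₁, q₁, p₂, q₂, z, hp, hq, ⟨rfl, rfl, rfl⟩ | ⟨hz, rfl, rfl, rfl⟩⟩
    · have h : q₂ ++ z ∈ (g.comp f).map u := (hc _ _).2 ⟨_, hp.1, g.iso _ _ z hq.1⟩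
      refine ⟨h, ⟨_, h⟩, fun u' hu' ⟨w', hw'⟩ => ?_⟩
      obtain ⟨v', hv', -⟩ := (hc _ _).1 hw'
      exact hp.2.2 u' hu' ⟨v', hv'⟩
    · have h : w ∈ (g.comp f).map (p₁ ++ z) := (hc _ _).2 ⟨_, f.iso _ _ z hp.1, hq.1⟩
      refine ⟨h, ⟨_, h⟩, fun u' hu' ⟨w', hw'⟩ => ?_⟩
      obtain ⟨v', hv', hw''⟩ := (hc _ _).1 hw'
      obtain ⟨p', q', x, hp', rfl, rfl⟩ := exists_entry hv'
      obtain ⟨rfl, rfl⟩ := hp.unique hp' (List.prefix_append p₁ z)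
        ((List.prefix_append p' x).trans hu')
      rw [List.prefix_append_right_inj] at hu'
      have := hq.2.2 (q₁ ++ x) ((List.prefix_append_right_inj _).2 hu') ⟨w', hw''⟩
      rw [List.append_cancel_left this]

theorem eq_id_iff {f : EssIso A} :
    (∀ u v, v ∈ f.map u → u = v) ↔ ∀ u v, f.Entry u v → u = v := by
  constructor
  · exact fun h u v hv => h u v hv.1
  · intro h u v hv
    obtain ⟨p, r, x, hp, rfl, rfl⟩ := exists_entry hv
    rw [h p r hp]

theorem toMaxIso_comp [Finite A] (f g : EssIso A) :
    (f.comp g).toMaxIso = f.toMaxIso * g.toMaxIso :=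
  Subtype.ext (max_eq_of_le (comp_mono f.le_max g.le_max))

/-- The identity is maximal and is the maximum extension of each of its restrictions. So triviality
in the group can be tested on a table of any representative, without extending it. -/
theorem toMaxIso_eq_one_iff [Finite A] {f : EssIso A} :
    f.toMaxIso = 1 ↔ ∀ u v, f.Entry u v → u = v := by
  rw [← eq_id_iff]
  constructor
  · intro h u v hv
    have h1 : f.max = EssIso.id A := congrArg Subtype.val h
    have h2 : v ∈ f.max.map u := PEquiv.le_def.1 f.le_max _ _ hv
    rw [h1] at h2
    have h3 : v ∈ (PEquiv.refl (List A)) u := h2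
    simpa using h3
  · intro h
    refine Subtype.ext ?_
    change f.max = EssIso.id A
    rw [← (isMaximal_id (A := A)).max_eq]
    refine max_eq_of_le (PEquiv.le_def.2 fun u v hv => ?_)
    rw [h u v hv]
    rfl

end EssIso

variable {A : Type}

/-- The prefix code `P` in a table has no freedom: it consists of the minimal words of the domain,
and it is maximal because the domain is essential. From here on tables are handled through their
entries alone. -/
theorem isTable_iff {l : List (List A × List A)} {f : EssIso A} :
    IsTable l f ↔ l.Nodup ∧ ∀ u v, (u, v) ∈ l ↔ f.Entry u v := by
  refine and_congr_right fun _ => ⟨?_, fun h => ?_⟩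
  · rintro ⟨P, ⟨hP, -⟩, hd, h⟩ u v
    rw [h, and_comm]
    refine and_congr_right fun hv => ⟨fun hu => ⟨⟨v, hv⟩, fun u' hu' h' => ?_⟩, fun hu => ?_⟩
    · rw [hd] at h'
      obtain ⟨p, hp, x, rfl⟩ := h'
      have := hP p hp u hu ((List.prefix_append p x).trans hu')
      subst this
      exact hu'.eq_of_length (le_antisymm hu'.length_le (by simp))
    · have hu1 := hu.1
      rw [hd] at hu1
      obtain ⟨p, hp, x, rfl⟩ := hu1
      have h1 : p ∈ dom f.map := by rw [hd]; exact ⟨p, hp, [], by simp⟩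
      rwa [← hu.2 p (List.prefix_append p x) h1]
  · refine ⟨{u | f.IsMin u}, ⟨?_, ?_⟩, ?_, fun u v => by rw [h]; exact and_comm⟩
    · exact fun u hu v hv huv => hv.2 u huv hu.1
    · intro Q hQ hPQ
      refine Set.Subset.antisymm (fun w hw => ?_) hPQ
      obtain ⟨p, r, x, hp, hpx⟩ := EssIso.exists_entry_of_dom f w
      have : p = w := by
        rcases List.prefix_or_prefix_of_prefix hpx (List.prefix_append w x) with h1 | h1
        · exact hQ _ (hPQ hp.2) _ hw h1
        · exact (hQ _ hw _ (hPQ hp.2) h1).symm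
      exact this ▸ hp.2
    · ext u
      constructor
      · intro hu
        obtain ⟨p, x, hp, rfl⟩ := EssIso.exists_isMin hu
        exact ⟨p, hp, x, rfl⟩
      · rintro ⟨p, hp, x, rfl⟩
        exact f.iso.dom _ hp.1 x

/-- A set of words is a non-empty complete prefix code, in the form of a first-order condition. -/
theorem exists_prefix_of_complete {P : Set (List A)} (hne : P.Nonempty)
    (hP : ∀ u ∈ P, ∀ t < u.length, ∀ c, ∃ u' ∈ P, u.take t ++ [c] <+: u') (w : List A) :
    ∃ x, w ++ x ∈ ideal P := by
  suffices h : (∃ p ∈ P, p <+: w) ∨ ∃ p ∈ P, w <+: p by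
    rcases h with ⟨p, hp, x, rfl⟩ | ⟨p, hp, x, rfl⟩
    · exact ⟨[], p, hp, x, by simp⟩
    · exact ⟨x, w ++ x, hp, [], by simp⟩
  induction w using List.reverseRecOn with
  | nil =>
    obtain ⟨p, hp⟩ := hne
    exact Or.inr ⟨p, hp, List.nil_prefix⟩
  | append_singleton w c ih =>
    rcases ih with ⟨p, hp, h⟩ | ⟨p, hp, x, rfl⟩
    · exact Or.inl ⟨p, hp, h.trans (List.prefix_append _ _)⟩
    · rcases x with _ | ⟨a, x⟩
      · exact Or.inl ⟨w ++ [], hp, by simp⟩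
      · obtain ⟨p', hp', h⟩ := hP _ hp w.length (by simp) c
        rw [List.take_left] at h
        exact Or.inr ⟨p', hp', h⟩

/-- The two components of the pairs in `T` run through complete prefix codes. -/
structure IsTableSet (T : Set (List A × List A)) : Prop where
  finite : T.Finite
  nonempty : T.Nonempty
  left : ∀ e ∈ T, ∀ e' ∈ T, e.1 <+: e'.1 → e = e'
  right : ∀ e ∈ T, ∀ e' ∈ T, e.2 <+: e'.2 → e = e'
  complete_left : ∀ e ∈ T, ∀ t < e.1.length, ∀ c, ∃ e' ∈ T, e.1.take t ++ [c] <+: e'.1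
  complete_right : ∀ e ∈ T, ∀ t < e.2.length, ∀ c, ∃ e' ∈ T, e.2.take t ++ [c] <+: e'.2

namespace IsTableSet

variable {T : Set (List A × List A)}

theorem unique_left (hT : IsTableSet T) {e e' : List A × List A} {x y : List A} (h : e ∈ T) (h' : e' ∈ T)
    (hx : e.1 ++ x = e'.1 ++ y) : e = e' ∧ x = y := by
  have h1 : e.1 <+: e'.1 ++ y := ⟨x, hx⟩
  obtain rfl : e = e' := by
    rcases List.prefix_or_prefix_of_prefix h1 (List.prefix_append _ _) with h2 | h2
    · exact hT.left _ h _ h' h2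
    · exact (hT.left _ h' _ h h2).symm
  exact ⟨rfl, List.append_cancel_left hx⟩

theorem unique_right (hT : IsTableSet T) {e e' : List A × List A} {x y : List A} (h : e ∈ T) (h' : e' ∈ T)
    (hx : e.2 ++ x = e'.2 ++ y) : e = e' ∧ x = y := by
  have h1 : e.2 <+: e'.2 ++ y := ⟨x, hx⟩
  obtain rfl : e = e' := by
    rcases List.prefix_or_prefix_of_prefix h1 (List.prefix_append _ _) with h2 | h2
    · exact hT.right _ h _ h' h2
    · exact (hT.right _ h' _ h h2).symm
  exact ⟨rfl, List.append_cancel_left hx⟩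

open Classical in
/-- The partial injection given by a table. -/
noncomputable def map (hT : IsTableSet T) : List A ≃. List A where
  toFun u := if h : ∃ v, ∃ e ∈ T, ∃ x, u = e.1 ++ x ∧ v = e.2 ++ x then some h.choose else none
  invFun v := if h : ∃ u, ∃ e ∈ T, ∃ x, u = e.1 ++ x ∧ v = e.2 ++ x then some h.choose else none
  inv u v := by
    constructor
    · intro h
      split_ifs at h with h1
      obtain ⟨e, he, x, hu, hv⟩ := h1.choose_spec
      rw [Option.some.inj h] at hu
      have h2 : ∃ w, ∃ e ∈ T, ∃ x, u = e.1 ++ x ∧ w = e.2 ++ x := ⟨v, e, he, x, hu, hv⟩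
      obtain ⟨e', he', y, hu', hv'⟩ := h2.choose_spec
      obtain ⟨rfl, rfl⟩ := hT.unique_left he he' (hu.symm.trans hu')
      rw [dif_pos h2, hv']
      exact congrArg some hv.symm
    · intro h
      split_ifs at h with h1
      obtain ⟨e, he, x, hu, hv⟩ := h1.choose_spec
      rw [Option.some.inj h] at hv
      have h2 : ∃ w, ∃ e ∈ T, ∃ x, w = e.1 ++ x ∧ v = e.2 ++ x := ⟨u, e, he, x, hu, hv⟩
      obtain ⟨e', he', y, hu', hv'⟩ := h2.choose_spec
      obtain ⟨rfl, rfl⟩ := hT.unique_right he he' (hv.symm.trans hv')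
      rw [dif_pos h2, hu']
      exact congrArg some hu.symm

theorem mem_map (hT : IsTableSet T) {u v : List A} :
    v ∈ hT.map u ↔ ∃ e ∈ T, ∃ x, u = e.1 ++ x ∧ v = e.2 ++ x := by
  classical
  change (if h : ∃ v, ∃ e ∈ T, ∃ x, u = e.1 ++ x ∧ v = e.2 ++ x then some h.choose else none) =
    some v ↔ _
  constructor
  · intro h
    split_ifs at h with h1
    rw [← Option.some.inj h]
    exact h1.choose_spec
  · rintro ⟨e, he, x, hu, hv⟩
    have h2 : ∃ w, ∃ e ∈ T, ∃ x, u = e.1 ++ x ∧ w = e.2 ++ x := ⟨v, e, he, x, hu, hv⟩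
    obtain ⟨e', he', y, hu', hv'⟩ := h2.choose_spec
    obtain ⟨rfl, rfl⟩ := hT.unique_left he he' (hu.symm.trans hu')
    rw [dif_pos h2, hv', hv]

theorem dom_map (hT : IsTableSet T) : dom hT.map = ideal (Prod.fst '' T) := by
  ext u
  constructor
  · rintro ⟨v, hv⟩
    obtain ⟨e, he, x, hu, -⟩ := hT.mem_map.1 hv
    exact ⟨e.1, ⟨e, he, rfl⟩, x, hu⟩
  · rintro ⟨_, ⟨e, he, rfl⟩, x, hu⟩
    exact ⟨e.2 ++ x, hT.mem_map.2 ⟨e, he, x, hu, rfl⟩⟩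

theorem ran_map (hT : IsTableSet T) : ran hT.map = ideal (Prod.snd '' T) := by
  ext v
  constructor
  · rintro ⟨u, hv⟩
    obtain ⟨e, he, x, -, hv⟩ := hT.mem_map.1 hv
    exact ⟨e.2, ⟨e, he, rfl⟩, x, hv⟩
  · rintro ⟨_, ⟨e, he, rfl⟩, x, hu⟩
    exact ⟨e.1 ++ x, hT.mem_map.2 ⟨e, he, x, rfl, hu⟩⟩

/-- The isomorphism given by a table. -/
noncomputable def toEssIso (hT : IsTableSet T) : EssIso A where
  map := hT.map
  iso u v x h := by
    obtain ⟨e, he, y, rfl, rfl⟩ := hT.mem_map.1 h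
    exact hT.mem_map.2 ⟨e, he, y ++ x, by simp, by simp⟩
  ess_dom := by
    rw [dom_map]
    refine (isEssential_iff _).2 ⟨isRightIdeal_ideal _, exists_prefix_of_complete
      (hT.nonempty.image _) ?_⟩
    rintro _ ⟨e, he, rfl⟩ t ht c
    obtain ⟨e', he', h⟩ := hT.complete_left e he t ht c
    exact ⟨_, ⟨e', he', rfl⟩, h⟩
  ess_ran := by
    rw [ran_map]
    refine (isEssential_iff _).2 ⟨isRightIdeal_ideal _, exists_prefix_of_complete
      (hT.nonempty.image _) ?_⟩
    rintro _ ⟨e, he, rfl⟩ t ht c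
    obtain ⟨e', he', h⟩ := hT.complete_right e he t ht c
    exact ⟨_, ⟨e', he', rfl⟩, h⟩
  fg_dom := ⟨_, hT.finite.image _, hT.dom_map⟩
  fg_ran := ⟨_, hT.finite.image _, hT.ran_map⟩

/-- The prefix condition on first components makes all of them minimal in the domain, so the given
table is recovered. -/
theorem entry_toEssIso (hT : IsTableSet T) {u v : List A} : hT.toEssIso.Entry u v ↔ (u, v) ∈ T := by
  have hm : ∀ u v, v ∈ hT.toEssIso.map u ↔ ∃ e ∈ T, ∃ x, u = e.1 ++ x ∧ v = e.2 ++ x :=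
    fun u v => hT.mem_map
  constructor
  · rintro ⟨h, hmin⟩
    obtain ⟨e, he, x, rfl, rfl⟩ := (hm _ _).1 h
    have := hmin.2 e.1 (List.prefix_append _ _) ⟨e.2, (hm _ _).2 ⟨e, he, [], by simp, by simp⟩⟩
    obtain rfl : x = [] := by simpa using this
    simpa using he
  · intro h
    have h1 : v ∈ hT.toEssIso.map u := (hm _ _).2 ⟨_, h, [], by simp, by simp⟩
    refine ⟨h1, ⟨v, h1⟩, ?_⟩
    rintro u' ⟨y, hy⟩ ⟨v', hv'⟩
    obtain ⟨e, he, x, rfl, rfl⟩ := (hm _ _).1 hv'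
    have := hT.left e he _ h ⟨x ++ y, by simpa using hy⟩
    subst this
    simp at hy ⊢
    exact hy.1

end IsTableSet

/-- This is the converse of `IsTableSet.toEssIso`: the conditions that are checked by formulas are
necessary as well. -/
theorem EssIso.isTableSet {f : EssIso A} {T : Set (List A × List A)} (hf : T.Finite)
    (h : ∀ u v, (u, v) ∈ T ↔ f.Entry u v) : IsTableSet T where
  finite := hf
  nonempty := by
    obtain ⟨p, r, -, hp, -⟩ := exists_entry_of_dom f []
    exact ⟨(p, r), (h _ _).2 hp⟩
  left e he e' he' hp := by
    have := ((h _ _).1 he).unique ((h _ _).1 he') hp (List.prefix_refl _)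
    exact Prod.ext this.1 this.2
  right e he e' he' hp := by
    have := ((h _ _).1 he).unique_right ((h _ _).1 he') hp (List.prefix_refl _)
    exact Prod.ext this.1 this.2
  complete_left e he t ht c := by
    obtain ⟨u', v', h1, h2⟩ := ((h _ _).1 he).complete ht c
    exact ⟨(u', v'), (h _ _).2 h1, h2⟩
  complete_right e he t ht c := by
    obtain ⟨v', u', h1, h2⟩ := ((h _ _).1 he).inv.complete ht c
    exact ⟨(u', v'), (h _ _).2 (entry_inv_iff.1 h1), h2⟩


/-! ### Tables with numbered entries -/

section Lists

variable {A : Type}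

/-- `E a u v` says that the entry number `a` of a table of `f` is `(u, v)`. -/
structure Lists (E : ℕ → List A → List A → Prop) (f : EssIso A) : Prop where
  functional : ∀ a u v u' v', E a u v → E a u' v' → u = u' ∧ v = v'
  inj : ∀ a a' u v, E a u v → E a' u v → a = a'
  entry : ∀ u v, (∃ a, E a u v) ↔ f.Entry u v

/-- The numbered entries of the composite of two tables, the first one of which is applied
first. -/
def CompEntry (E₁ E₂ : ℕ → List A → List A → Prop) (a : ℕ) (u w : List A) : Prop :=
  (∃ a' p₁ q₁ p₂ q₂ z, E₁ a p₁ q₁ ∧ E₂ a' p₂ q₂ ∧ q₁ = p₂ ++ z ∧ u = p₁ ∧ w = q₂ ++ z) ∨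
    ∃ a' p₂ q₂ p₁ q₁ z, E₂ a p₂ q₂ ∧ E₁ a' p₁ q₁ ∧ p₂ = q₁ ++ z ∧ z ≠ [] ∧ u = p₁ ++ z ∧ w = q₂

/-- An entry of the composite takes the number of the entry with the longer middle word, which
determines the other one by the prefix property. The hypothesis `hd` keeps numbers inherited from
the two tables apart. -/
theorem Lists.comp {E₁ E₂ : ℕ → List A → List A → Prop} {f g : EssIso A} (hf : Lists E₁ f)
    (hg : Lists E₂ g) (hd : ∀ a u v u' v', E₁ a u v → ¬ E₂ a u' v') :
    Lists (CompEntry E₁ E₂) (g.comp f) where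
  functional := by
    rintro a u w u' w' (⟨b, p₁, q₁, p₂, q₂, z, h1, h2, rfl, rfl, rfl⟩ |
        ⟨b, p₂, q₂, p₁, q₁, z, h1, h2, rfl, hz, rfl, rfl⟩)
      (⟨b', p₁', q₁', p₂', q₂', z', h1', h2', rfl, rfl, rfl⟩ |
        ⟨b', p₂', q₂', p₁', q₁', z', h1', h2', rfl, hz', rfl, rfl⟩)
    · obtain ⟨e1, e2⟩ := hf.functional _ _ _ _ _ h1 h1'
      obtain ⟨rfl, rfl⟩ := ((hg.entry _ _).1 ⟨_, h2⟩).unique ((hg.entry _ _).1 ⟨_, h2'⟩)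
        (List.prefix_append _ z) ⟨z', e2.symm⟩
      rw [List.append_cancel_left e2]
      exact ⟨e1, rfl⟩
    · exact (hd _ _ _ _ _ h1 h1').elim
    · exact (hd _ _ _ _ _ h1' h1).elim
    · obtain ⟨e1, e2⟩ := hg.functional _ _ _ _ _ h1 h1'
      obtain ⟨rfl, rfl⟩ := ((hf.entry _ _).1 ⟨_, h2⟩).unique_right ((hf.entry _ _).1 ⟨_, h2'⟩)
        (List.prefix_append _ z) ⟨z', e1.symm⟩
      rw [List.append_cancel_left e1]
      exact ⟨rfl, e2⟩
  inj := by
    rintro a a' u w (⟨b, p₁, q₁, p₂, q₂, z, h1, h2, rfl, rfl, rfl⟩ |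
        ⟨b, p₂, q₂, p₁, q₁, z, h1, h2, rfl, hz, rfl, rfl⟩)
      (⟨b', p₁', q₁', p₂', q₂', z', h1', h2', rfl, rfl, e⟩ |
        ⟨b', p₂', q₂', p₁', q₁', z', h1', h2', rfl, hz', e, e'⟩)
    · obtain ⟨-, e1⟩ := ((hf.entry _ _).1 ⟨_, h1⟩).unique ((hf.entry _ _).1 ⟨_, h1'⟩)
        (List.prefix_refl _) (List.prefix_refl _)
      rw [← e1] at h1'
      exact hf.inj _ _ _ _ h1 h1'
    -- In the mixed cases both first components of the first table are prefixes of one word, hence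
    -- equal, and then the tail of the second alternative is empty.
    · obtain ⟨e1, rfl⟩ := ((hf.entry _ _).1 ⟨_, h1⟩).unique ((hf.entry _ _).1 ⟨_, h2'⟩)
        (List.prefix_refl _) ⟨z', e.symm⟩
      rw [e1] at e
      exact (hz' (by simpa using e)).elim
    · obtain ⟨e1, -⟩ := ((hf.entry _ _).1 ⟨_, h2⟩).unique ((hf.entry _ _).1 ⟨_, h1'⟩)
        (List.prefix_append _ z) (List.prefix_refl _)
      exact (hz (by simpa using e1)).elim
    · subst e'
      obtain ⟨e1, -⟩ := ((hg.entry _ _).1 ⟨_, h1⟩).unique_right ((hg.entry _ _).1 ⟨_, h1'⟩)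
        (List.prefix_refl _) (List.prefix_refl _)
      rw [← e1] at h1'
      exact hg.inj _ _ _ _ h1 h1'
  entry u w := by
    rw [EssIso.entry_comp_iff]
    constructor
    · rintro ⟨a, ⟨b, p₁, q₁, p₂, q₂, z, h1, h2, h3, h4, h5⟩ |
        ⟨b, p₂, q₂, p₁, q₁, z, h1, h2, h3, h4, h5, h6⟩⟩
      · exact ⟨p₁, q₁, p₂, q₂, z, (hf.entry _ _).1 ⟨_, h1⟩, (hg.entry _ _).1 ⟨_, h2⟩,
          Or.inl ⟨h3, h4, h5⟩⟩
      · exact ⟨p₁, q₁, p₂, q₂, z, (hf.entry _ _).1 ⟨_, h2⟩, (hg.entry _ _).1 ⟨_, h1⟩,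
          Or.inr ⟨h4, h3, h5, h6⟩⟩
    · rintro ⟨p₁, q₁, p₂, q₂, z, h1, h2, h⟩
      obtain ⟨a, h1⟩ := (hf.entry _ _).2 h1
      obtain ⟨a', h2⟩ := (hg.entry _ _).2 h2
      rcases h with ⟨h3, h4, h5⟩ | ⟨h4, h3, h5, h6⟩
      · exact ⟨a, Or.inl ⟨a', p₁, q₁, p₂, q₂, z, h1, h2, h3, h4, h5⟩⟩
      · exact ⟨a', Or.inr ⟨a, p₂, q₂, p₁, q₁, z, h2, h1, h3, h4, h5, h6⟩⟩

/-- The composite of two isomorphisms, each of which may be absent. -/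
def ocomp : Option (EssIso A) → Option (EssIso A) → Option (EssIso A)
  | some f, some g => some (f.comp g)
  | some f, none => some f
  | none, o => o

end Lists

/-! ### Words as relations on numbers -/

section Spell

variable {q : ℕ}

/-- The codes of the letters of a word, followed by an end marker. -/
def spell (w : List (Fin q)) : List ℕ := w.map Fin.val ++ [q]

theorem spell_getElem?_of_lt {w : List (Fin q)} {t : ℕ} (h : t < w.length) :
    (spell w)[t]? = some (w[t] : ℕ) := by
  rw [spell, List.getElem?_append_left (by simpa using h)]
  simp [h]

theorem spell_length {w : List (Fin q)} : (spell w)[w.length]? = some q := by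
  rw [spell, List.getElem?_append_right (by simp)]
  simp

theorem le_of_spell {w : List (Fin q)} {t k : ℕ} (h : (spell w)[t]? = some k) : t ≤ w.length := by
  obtain ⟨h, -⟩ := List.getElem?_eq_some_iff.1 h
  simpa [spell, Nat.lt_succ_iff] using h

/-- The end marker makes the length of a word accessible to formulas that only see the letters. -/
theorem spell_eq_q {w : List (Fin q)} {t : ℕ} : (spell w)[t]? = some q ↔ t = w.length := by
  constructor
  · intro h
    rcases (le_of_spell h).lt_or_eq with h1 | h1
    · rw [spell_getElem?_of_lt h1, Option.some.injEq] at h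
      have := w[t].2
      omega
    · exact h1
  · rintro rfl; exact spell_length

theorem lt_of_spell {w : List (Fin q)} {t k : ℕ} (h : (spell w)[t]? = some k) (hk : k < q) :
    t < w.length := by
  rcases (le_of_spell h).lt_or_eq with h1 | rfl
  · exact h1
  · rw [spell_length, Option.some.injEq] at h
    omega

theorem spell_le {w : List (Fin q)} {t k : ℕ} (h : (spell w)[t]? = some k) : k ≤ q := by
  rcases (le_of_spell h).lt_or_eq with h1 | rfl
  · rw [spell_getElem?_of_lt h1, Option.some.injEq] at h
    have := w[t].2
    omega
  · rw [spell_length, Option.some.injEq] at h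
    omega

theorem spell_append_left {u z : List (Fin q)} {t : ℕ} (h : t < u.length) :
    (spell (u ++ z))[t]? = (spell u)[t]? := by
  rw [spell_getElem?_of_lt h, spell_getElem?_of_lt (by simp; omega), List.getElem_append_left h]

theorem spell_append_right {u z : List (Fin q)} {t : ℕ} (h : u.length ≤ t) :
    (spell (u ++ z))[t]? = (spell z)[t - u.length]? := by
  rw [spell, List.map_append, List.append_assoc, List.getElem?_append_right (by simpa using h)]
  simp [spell]

theorem spell_inj {u v : List (Fin q)} (h : ∀ t k : ℕ, (spell u)[t]? = some k ↔
    (spell v)[t]? = some k) : u = v := by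
  have hl : u.length = v.length := spell_eq_q.1 ((h _ _).1 spell_length)
  refine List.ext_getElem hl fun t h1 h2 => ?_
  have := (h t u[t]).1 (spell_getElem?_of_lt h1)
  rw [spell_getElem?_of_lt h2, Option.some.injEq] at this
  exact Fin.ext this.symm

/-- The prefix order becomes a bounded universal statement on letters. An end marker of `v` inside
`u` is excluded because it is not a letter. -/
theorem prefix_iff_spell {u v : List (Fin q)} : u <+: v ↔
    ∀ i < u.length, ∀ c < q, (spell u)[i]? = some c → (spell v)[i]? = some c := by
  constructor
  · rintro ⟨z, rfl⟩ i hi c - h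
    rwa [spell_append_left hi]
  · intro h
    rw [List.prefix_iff_getElem?]
    intro i hi
    have := h i hi u[i] u[i].2 (spell_getElem?_of_lt hi)
    have hi' := lt_of_spell this u[i].2
    rw [spell_getElem?_of_lt hi', Option.some.injEq] at this
    rw [List.getElem?_eq_getElem hi']
    exact congrArg some (Fin.ext this)

/-- A component of a pair. -/
def side {A : Type} : ℕ → List A → List A → List A
  | 0, u, _ => u
  | _ + 1, _, v => v

end Spell

/-! ### The meaning of the relations in the iteration -/

section Level

variable {q : ℕ}

/-- The relation `R` describes the isomorphisms `F b`, by tables with numbered entries `E b`. -/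
structure Level (N len : ℕ) (R : ℕ → ℕ → ℕ → ℕ → ℕ → Prop) (F : ℕ → Option (EssIso (Fin q)))
    (E : ℕ → ℕ → List (Fin q) → List (Fin q) → Prop) : Prop where
  reads : ∀ b a d t k, k ≤ q →
    (R b a d t k ↔ ∃ u v, E b a u v ∧ d < 2 ∧ (spell (side d u v))[t]? = some k)
  bounds : ∀ b a u v, E b a u v → b < N ∧ a < N ∧ u.length ≤ len ∧ v.length ≤ len
  disjoint : ∀ b b' a u v u' v', E b a u v → E b' a u' v' → b = b'
  lists : ∀ b f, F b = some f → Lists (E b) f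
  none : ∀ b, F b = none → ∀ a u v, ¬ E b a u v

variable {N len W : ℕ} {R : ℕ → ℕ → ℕ → ℕ → ℕ → Prop} {F : ℕ → Option (EssIso (Fin q))}
  {E : ℕ → ℕ → List (Fin q) → List (Fin q) → Prop}

namespace Level

theorem functional (h : Level N len R F E) {b a : ℕ} {u v u' v' : List (Fin q)} (h1 : E b a u v)
    (h2 : E b a u' v') : u = u' ∧ v = v' := by
  cases hF : F b with
  | none => exact (h.none b hF _ _ _ h1).elim
  | some f => exact (h.lists b f hF).functional _ _ _ _ _ h1 h2

theorem reads_entry (h : Level N len R F E) {b a d t k : ℕ} {u v : List (Fin q)} (h1 : E b a u v)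
    (hd : d < 2) (hk : k ≤ q) : R b a d t k ↔ (spell (side d u v))[t]? = some k := by
  rw [h.reads _ _ _ _ _ hk]
  constructor
  · rintro ⟨u', v', h2, -, h3⟩
    obtain ⟨rfl, rfl⟩ := h.functional h1 h2
    exact h3
  · exact fun h2 => ⟨u, v, h1, hd, h2⟩

theorem side_length_le (h : Level N len R F E) {b a : ℕ} {u v : List (Fin q)} (h1 : E b a u v)
    (d : ℕ) : (side d u v).length ≤ len := by
  obtain ⟨-, -, h2, h3⟩ := h.bounds _ _ _ _ h1
  cases d
  · exact h2
  · exact h3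

/-- An essential ideal is not empty, so a block with an isomorphism always has at least one entry.
-/
theorem hasEntry_iff (h : Level N len R F E) (hN : N ≤ W) (hlen : len ≤ W) (b : ℕ) :
    HasEntry q (W + 1) R b ↔ ∃ f, F b = some f := by
  constructor
  · rintro ⟨a, -, t, -, h1⟩
    obtain ⟨u, v, h2, -⟩ := (h.reads _ _ _ _ _ le_rfl).1 h1
    cases hF : F b with
    | none => exact (h.none b hF _ _ _ h2).elim
    | some f => exact ⟨f, rfl⟩
  · rintro ⟨f, hf⟩
    obtain ⟨p, r, -, hp, -⟩ := EssIso.exists_entry_of_dom f []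
    obtain ⟨a, ha⟩ := ((h.lists b f hf).entry p r).2 hp
    obtain ⟨-, h1, h2, -⟩ := h.bounds _ _ _ _ ha
    exact ⟨a, by omega, p.length, by omega, (h.reads_entry ha (by omega) le_rfl).2 spell_length⟩

/-- The numbers `m`, `m'`, `l` in the formula are lengths, found by the end marker. For `e = 1` the
comparison of `m` and `m'` says that the prefix is strict, so a tie is used by one of the two halves
only. -/
theorem halfStep_iff (h : Level N len R F E) (hN : N ≤ W) (hlen : len ≤ W) {bx b' dx e a d t k : ℕ}
    (hdx : dx < 2) (hk : k ≤ q) : HalfStep q (W + 1) R bx b' dx e a d t k ↔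
      ∃ a' u v u' v' z, E bx a u v ∧ E b' a' u' v' ∧ side dx u v = side (1 - dx) u' v' ++ z ∧
        (e = 1 → z ≠ []) ∧ ((d = 1 - dx ∧ (spell (side d u v))[t]? = some k) ∨
          (d = dx ∧ (spell (side dx u' v' ++ z))[t]? = some k)) := by
  have hdx' : 1 - dx < 2 := by omega
  constructor
  · rintro ⟨a', -, m, -, m', -, l, -, h1, h2, h3, h4, h5, h6⟩
    obtain ⟨u', v', hE', -, -⟩ := (h.reads _ _ _ _ _ le_rfl).1 h1
    obtain ⟨u, v, hE, -, -⟩ := (h.reads _ _ _ _ _ le_rfl).1 h2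
    have r1 := fun t k (hk : k ≤ q) => h.reads_entry (d := 1 - dx) (t := t) hE' hdx' hk
    have r2 := fun t k (hk : k ≤ q) => h.reads_entry (d := dx) (t := t) hE hdx hk
    have r3 := fun t k (hk : k ≤ q) => h.reads_entry (d := dx) (t := t) hE' hdx hk
    rw [r1 _ _ le_rfl, spell_eq_q] at h1
    rw [r2 _ _ le_rfl, spell_eq_q] at h2
    rw [r3 _ _ le_rfl, spell_eq_q] at h3
    obtain ⟨z, hz⟩ : side (1 - dx) u' v' <+: side dx u v := prefix_iff_spell.2 fun i hi c hc hs =>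
      (r2 _ _ hc.le).1 (h5 i (by omega) c hc ((r1 _ _ hc.le).2 hs))
    refine ⟨a', u, v, u', v', z, hE, hE', hz.symm, fun he hz' => ?_, ?_⟩
    · subst hz'
      rw [List.append_nil] at hz
      exact h4 he (by rw [h1, h2, hz])
    · rcases h6 with ⟨h6, h7⟩ | ⟨h6, ⟨h7, h8⟩ | ⟨h7, h8⟩⟩
      · subst h6
        exact Or.inl ⟨rfl, (h.reads_entry hE hdx' hk).1 h7⟩
      · refine Or.inr ⟨h6, ?_⟩
        rw [spell_append_left (by omega)]
        exact (r3 _ _ hk).1 h8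
      · refine Or.inr ⟨h6, ?_⟩
        have h9 := (r2 _ _ hk).1 h8
        rw [← hz, spell_append_right (by omega), h1, Nat.add_sub_cancel_left] at h9
        rwa [spell_append_right (by omega), ← h3]
  · rintro ⟨a', u, v, u', v', z, hE, hE', hz, he, h6⟩
    have r1 := fun t k (hk : k ≤ q) => h.reads_entry (d := 1 - dx) (t := t) hE' hdx' hk
    have r2 := fun t k (hk : k ≤ q) => h.reads_entry (d := dx) (t := t) hE hdx hk
    have r3 := fun t k (hk : k ≤ q) => h.reads_entry (d := dx) (t := t) hE' hdx hk
    have l1 := h.side_length_le hE' (1 - dx)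
    have l2 := h.side_length_le hE dx
    have l3 := h.side_length_le hE' dx
    have ha' := (h.bounds _ _ _ _ hE').2.1
    refine ⟨a', by omega, (side (1 - dx) u' v').length, by omega, (side dx u v).length, by omega,
      (side dx u' v').length, by omega, (r1 _ _ le_rfl).2 spell_length, (r2 _ _ le_rfl).2 spell_length,
      (r3 _ _ le_rfl).2 spell_length, fun h1 h2 => ?_, fun i hi c hc hs => ?_, ?_⟩
    · rw [hz, List.length_append] at h2
      exact he h1 (List.length_eq_zero_iff.1 (by omega))
    · rw [r1 _ _ hc.le] at hs
      rw [r2 _ _ hc.le, hz, spell_append_left hi, hs]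
    · rcases h6 with ⟨h6, h7⟩ | ⟨h6, h7⟩
      · subst h6
        exact Or.inl ⟨rfl, (h.reads_entry hE hdx' hk).2 h7⟩
      · refine Or.inr ⟨h6, ?_⟩
        rcases lt_or_ge t (side dx u' v').length with h8 | h8
        · rw [spell_append_left h8] at h7
          exact Or.inl ⟨h8, (r3 _ _ hk).2 h7⟩
        · rw [spell_append_right h8] at h7
          refine Or.inr ⟨h8, (r2 _ _ hk).2 ?_⟩
          rw [hz, spell_append_right (Nat.le_add_right _ _), Nat.add_sub_cancel_left, h7]

/-- The numbered entries after one more round. -/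
def next (F : ℕ → Option (EssIso (Fin q))) (E : ℕ → ℕ → List (Fin q) → List (Fin q) → Prop)
    (b a : ℕ) (u v : List (Fin q)) : Prop :=
  CompEntry (E (2 * b + 1)) (E (2 * b)) a u v ∨
    ((F (2 * b) = .none ∨ F (2 * b + 1) = .none) ∧ (E (2 * b) a u v ∨ E (2 * b + 1) a u v))

/-- Block `2 * b + 1` is applied first, as products are written from left to right. Its second
components and the first components of block `2 * b` are the middle words, and the two halves
correspond to the alternatives of `CompEntry`. -/
theorem composeStep_iff (h : Level N len R F E) (hN : N ≤ W) (hlen : len ≤ W) {b a d t k : ℕ}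
    (hk : k ≤ q) : ComposeStep q (W + 1) R b a d t k ↔
      ∃ u v, next F E b a u v ∧ d < 2 ∧ (spell (side d u v))[t]? = some k := by
  have hex : ∀ {b a u v}, E b a u v → ∃ f, F b = some f := fun {b a u v} hE => by
    cases hF : F b with
    | none => exact (h.none b hF _ _ _ hE).elim
    | some f => exact ⟨f, rfl⟩
  unfold ComposeStep
  rw [h.hasEntry_iff hN hlen, h.hasEntry_iff hN hlen, h.halfStep_iff hN hlen (by omega) hk,
    h.halfStep_iff hN hlen (by omega) hk, h.reads _ _ _ _ _ hk, h.reads _ _ _ _ _ hk]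
  constructor
  · rintro (⟨-, -, ⟨a', u, v, u', v', z, hE, hE', hz, -, h6⟩ |
      ⟨a', u, v, u', v', z, hE, hE', hz, he, h6⟩⟩ | ⟨h1, h2⟩)
    · refine ⟨u, v' ++ z, Or.inl (Or.inl ⟨a', u, v, u', v', z, hE, hE', hz, rfl, rfl⟩), ?_⟩
      rcases h6 with ⟨rfl, h6⟩ | ⟨rfl, h6⟩ <;> exact ⟨by omega, h6⟩
    · refine ⟨u' ++ z, v, Or.inl (Or.inr ⟨a', u, v, u', v', z, hE, hE', hz, he rfl, rfl, rfl⟩), ?_⟩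
      rcases h6 with ⟨rfl, h6⟩ | ⟨rfl, h6⟩ <;> exact ⟨by omega, h6⟩
    · have h3 : F (2 * b) = .none ∨ F (2 * b + 1) = .none := by
        by_contra hc
        push Not at hc
        exact h1 ⟨Option.ne_none_iff_exists'.1 hc.1, Option.ne_none_iff_exists'.1 hc.2⟩
      rcases h2 with ⟨u, v, hE, h2⟩ | ⟨u, v, hE, h2⟩
      · exact ⟨u, v, Or.inr ⟨h3, Or.inl hE⟩, h2⟩
      · exact ⟨u, v, Or.inr ⟨h3, Or.inr hE⟩, h2⟩
  · have hd2 : ∀ d < 2, d = 0 ∨ d = 1 := fun d hd => by omega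
    rintro ⟨u, v, (⟨a', p₁, q₁, p₂, q₂, z, h1, h2, h3, rfl, rfl⟩ |
      ⟨a', p₂, q₂, p₁, q₁, z, h1, h2, h3, h4, rfl, rfl⟩) | ⟨h1, h2⟩, hd, hs⟩
    · refine Or.inl ⟨hex h2, hex h1, Or.inl ⟨a', u, q₁, p₂, q₂, z, h1, h2, h3, by simp, ?_⟩⟩
      rcases hd2 d hd with rfl | rfl
      · exact Or.inl ⟨rfl, hs⟩
      · exact Or.inr ⟨rfl, hs⟩
    · refine Or.inl ⟨hex h1, hex h2, Or.inr ⟨a', p₂, v, p₁, q₁, z, h1, h2, h3, fun _ => h4, ?_⟩⟩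
      rcases hd2 d hd with rfl | rfl
      · exact Or.inr ⟨rfl, hs⟩
      · exact Or.inl ⟨rfl, hs⟩
    · refine Or.inr ⟨?_, ?_⟩
      · rintro ⟨⟨f, hf⟩, ⟨g, hg⟩⟩
        simp [hf, hg] at h1
      · rcases h2 with h2 | h2
        · exact Or.inl ⟨u, v, h2, hd, hs⟩
        · exact Or.inr ⟨u, v, h2, hd, hs⟩

/-- The tail `z` is part of a middle word, so a new word is no longer than two old ones together.
Entry numbers are inherited, and block `b'` goes to block `b' / 2`; hence a number still belongs to
one block only. -/
theorem step (h : Level N len R F E) (hN : N ≤ W) (hlen : 2 * len ≤ W) (hW : 1 ≤ W)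
    {R' : ℕ → ℕ → ℕ → ℕ → ℕ → Prop}
    (hR' : ∀ b a d t k, k ≤ q → (R' b a d t k ↔
      (b ≤ W ∧ a ≤ W ∧ d ≤ W ∧ t ≤ W) ∧ ComposeStep q (W + 1) R b a d t k)) :
    Level N (2 * len) R' (fun b => ocomp (F (2 * b)) (F (2 * b + 1))) (next F E) := by
  have hb : ∀ b a u v, next F E b a u v →
      b < N ∧ a < N ∧ u.length ≤ 2 * len ∧ v.length ≤ 2 * len := by
    rintro b a u v ((⟨a', p₁, q₁, p₂, q₂, z, h1, h2, h3, rfl, rfl⟩ |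
      ⟨a', p₂, q₂, p₁, q₁, z, h1, h2, h3, h4, rfl, rfl⟩) | ⟨-, h1 | h1⟩)
    · have e1 := h.bounds _ _ _ _ h1
      have e2 := h.bounds _ _ _ _ h2
      have e3 := congrArg List.length h3
      rw [List.length_append] at e3 ⊢
      omega
    · have e1 := h.bounds _ _ _ _ h1
      have e2 := h.bounds _ _ _ _ h2
      have e3 := congrArg List.length h3
      rw [List.length_append] at e3 ⊢
      omega
    · have e1 := h.bounds _ _ _ _ h1
      omega
    · have e1 := h.bounds _ _ _ _ h1
      omega
  have hin : ∀ b a u v, next F E b a u v → ∃ b' u' v', E b' a u' v' ∧ b = b' / 2 := by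
    rintro b a u v ((⟨a', p₁, q₁, p₂, q₂, z, h1, h2, h3, rfl, rfl⟩ |
      ⟨a', p₂, q₂, p₁, q₁, z, h1, h2, h3, h4, rfl, rfl⟩) | ⟨-, h1 | h1⟩)
    · exact ⟨_, _, _, h1, by omega⟩
    · exact ⟨_, _, _, h1, by omega⟩
    · exact ⟨_, _, _, h1, by omega⟩
    · exact ⟨_, _, _, h1, by omega⟩
  refine ⟨fun b a d t k hk => ?_, hb, ?_, fun b f hf => ?_, fun b hf a u v hE => ?_⟩
  · rw [hR' _ _ _ _ _ hk, h.composeStep_iff hN (by omega) hk]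
    constructor
    · exact fun h => h.2
    · rintro ⟨u, v, h1, h2, h3⟩
      refine ⟨?_, u, v, h1, h2, h3⟩
      obtain ⟨e1, e2, e3, e4⟩ := hb _ _ _ _ h1
      have e5 := le_of_spell h3
      have e6 : (side d u v).length ≤ 2 * len := by
        cases d
        · exact e3
        · exact e4
      omega
  · intro b b' a u v u' v' h1 h2
    obtain ⟨c, _, _, h3, rfl⟩ := hin _ _ _ _ h1
    obtain ⟨c', _, _, h4, rfl⟩ := hin _ _ _ _ h2
    rw [h.disjoint _ _ _ _ _ _ _ h3 h4]
  · have key : ∀ {c g}, F c = some g → (∀ a u v, next F E b a u v ↔ E c a u v) →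
        Lists (next F E b) g := fun hc he => by
      have : next F E b = E _ := funext fun a => funext fun u => funext fun v => propext (he a u v)
      rw [this]
      exact h.lists _ _ hc
    cases h1 : F (2 * b) with
    | none =>
      cases h2 : F (2 * b + 1) with
      | none => simp [h1, h2, ocomp] at hf
      | some g =>
        simp only [h1, h2, ocomp, Option.some.injEq] at hf
        subst hf
        refine key h2 fun a u v => ⟨?_, fun hE => Or.inr ⟨Or.inl h1, Or.inr hE⟩⟩
        rintro ((⟨a', p₁, q₁, p₂, q₂, z, e1, e2, -⟩ | ⟨a', p₂, q₂, p₁, q₁, z, e2, -⟩) | ⟨-, e2 | hE⟩)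
        · exact (h.none _ h1 _ _ _ e2).elim
        · exact (h.none _ h1 _ _ _ e2).elim
        · exact (h.none _ h1 _ _ _ e2).elim
        · exact hE
    | some f' =>
      cases h2 : F (2 * b + 1) with
      | none =>
        simp only [h1, h2, ocomp, Option.some.injEq] at hf
        subst hf
        refine key h1 fun a u v => ⟨?_, fun hE => Or.inr ⟨Or.inr h2, Or.inl hE⟩⟩
        rintro ((⟨a', p₁, q₁, p₂, q₂, z, e2, -⟩ | ⟨a', p₂, q₂, p₁, q₁, z, -, e2, -⟩) | ⟨-, hE | e2⟩)
        · exact (h.none _ h2 _ _ _ e2).elim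
        · exact (h.none _ h2 _ _ _ e2).elim
        · exact hE
        · exact (h.none _ h2 _ _ _ e2).elim
      | some g =>
        simp only [h1, h2, ocomp, Option.some.injEq] at hf
        subst hf
        have : next F E b = CompEntry (E (2 * b + 1)) (E (2 * b)) := by
          funext a u v
          simp [next, h1, h2]
        rw [this]
        refine (h.lists _ _ h2).comp (h.lists _ _ h1) fun a u v u' v' e1 e2 => ?_
        have := h.disjoint _ _ _ _ _ _ _ e1 e2
        omega
  · have h12 : F (2 * b) = .none ∧ F (2 * b + 1) = .none := by
      cases h1 : F (2 * b) <;> cases h2 : F (2 * b + 1) <;> simp [h1, h2, ocomp] at hf ⊢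
    obtain ⟨h1, h2⟩ := h12
    rcases hE with (⟨a', p₁, q₁, p₂, q₂, z, e1, -⟩ | ⟨a', p₂, q₂, p₁, q₁, z, e1, -⟩) | ⟨-, e1 | e1⟩
    · exact h.none _ h2 _ _ _ e1
    · exact h.none _ h1 _ _ _ e1
    · exact h.none _ h1 _ _ _ e1
    · exact h.none _ h2 _ _ _ e1

end Level

end Level


/-! ### Strings of symbols -/

section Strings

variable {q : ℕ}

/-- The symbol number `i` of `s` has the code `c`. -/
def strSymb (s : List (Symb q)) (i c : ℕ) : Prop := ∃ σ, s[i]? = some σ ∧ σ.code = c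

theorem Symb.code_lt (σ : Symb q) : σ.code < q + 4 := by
  cases σ with
  | letter i => have := i.2; simp only [Symb.code]; omega
  | blank => simp only [Symb.code]; omega
  | comma => simp only [Symb.code]; omega
  | semi => simp only [Symb.code]; omega
  | bar => simp only [Symb.code]; omega

theorem Symb.code_injective : Function.Injective (Symb.code (q := q)) := by
  intro σ τ h
  cases σ with
  | letter i =>
    have := i.2
    cases τ <;> simp only [Symb.code] at h <;> first | (rw [Fin.ext h]) | omega
  | blank => cases τ <;> simp only [Symb.code] at h <;> first | rfl | omega
  | comma => cases τ <;> simp only [Symb.code] at h <;> first | rfl | omega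
  | semi => cases τ <;> simp only [Symb.code] at h <;> first | rfl | omega
  | bar => cases τ <;> simp only [Symb.code] at h <;> first | rfl | omega

theorem strSymb_code {s : List (Symb q)} {i : ℕ} (σ : Symb q) :
    strSymb s i σ.code ↔ s[i]? = some σ :=
  ⟨fun ⟨_, h1, h2⟩ => Symb.code_injective h2 ▸ h1, fun h => ⟨σ, h, rfl⟩⟩

theorem strSymb_blank {s : List (Symb q)} {i : ℕ} : strSymb s i q ↔ s[i]? = some .blank :=
  strSymb_code .blank

theorem strSymb_comma {s : List (Symb q)} {i : ℕ} : strSymb s i (q + 1) ↔ s[i]? = some .comma :=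
  strSymb_code .comma

theorem strSymb_semi {s : List (Symb q)} {i : ℕ} : strSymb s i (q + 2) ↔ s[i]? = some .semi :=
  strSymb_code .semi

theorem strSymb_bar {s : List (Symb q)} {i : ℕ} : strSymb s i (q + 3) ↔ s[i]? = some .bar :=
  strSymb_code .bar

theorem strSymb_letter {s : List (Symb q)} {i c : ℕ} (h : c < q) :
    strSymb s i c ↔ s[i]? = some (.letter ⟨c, h⟩) :=
  strSymb_code (.letter ⟨c, h⟩)

theorem isLetterAt_strSymb {s : List (Symb q)} {i : ℕ} :
    IsLetterAt q (strSymb s) i ↔ ∃ l, s[i]? = some (.letter l) := by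
  constructor
  · rintro ⟨c, hc, h⟩
    exact ⟨_, (strSymb_letter hc).1 h⟩
  · rintro ⟨l, h⟩
    exact ⟨l, l.2, (strSymb_letter l.2).2 h⟩

theorem length_toBits (s : List (Symb q)) : (toBits s).length = s.length * (q + 4) := by
  induction s with
  | nil => simp [toBits]
  | cons σ s ih =>
    rw [toBits, List.flatMap_cons, List.length_append, ← toBits, ih]
    simp [Symb.bits]
    ring

theorem numSymb_toBits (s : List (Symb q)) : numSymb q (toBits s).length = s.length := by
  rw [numSymb, length_toBits, Nat.mul_div_cancel _ (by omega)]

/-- With one-hot blocks, a single input bit answers the question whether a given symbol has a given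
code. -/
theorem getElem?_toBits (s : List (Symb q)) (i : ℕ) {c : ℕ} (hc : c < q + 4) :
    (toBits s)[i * (q + 4) + c]? = (s[i]?).map fun σ => decide (c = σ.code) := by
  induction s generalizing i with
  | nil => simp [toBits]
  | cons σ s ih =>
    have hl : (Symb.bits σ).length = q + 4 := by simp [Symb.bits]
    rw [toBits, List.flatMap_cons]
    cases i with
    | zero =>
      rw [List.getElem?_append_left (by omega)]
      simp [Symb.bits, hc]
    | succ i =>
      have h1 : (i + 1) * (q + 4) = i * (q + 4) + (q + 4) := by ring
      rw [List.getElem?_append_right (by omega), List.getElem?_cons_succ, ← ih i, hl, ← toBits]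
      congr 1
      omega

theorem symbAt_toBits (s : List (Symb q)) {y : ℕ → Prop}
    (hy : ∀ i < (toBits s).length, (y i ↔ (toBits s).getD i false = true)) :
    symbAt q y (toBits s).length = strSymb s := by
  funext i c
  rw [symbAt, numSymb_toBits, eq_iff_iff]
  constructor
  · rintro ⟨⟨hi, hc⟩, h⟩
    rw [hy _ (by rw [length_toBits]; nlinarith), List.getD_eq_getElem?_getD, getElem?_toBits s i hc,
      List.getElem?_eq_getElem hi] at h
    exact ⟨_, List.getElem?_eq_getElem hi, by simp at h; exact h.symm⟩
  · rintro ⟨σ, h, rfl⟩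
    obtain ⟨hi, -⟩ := List.getElem?_eq_some_iff.1 h
    have hc := σ.code_lt
    refine ⟨⟨hi, hc⟩, ?_⟩
    rw [hy _ (by rw [length_toBits]; nlinarith), List.getD_eq_getElem?_getD, getElem?_toBits s i hc, h]
    simp

end Strings

/-! ### Reading tables from strings -/

section Parse

variable {q : ℕ}

/-- A slot: a string and its content. -/
abbrev Slot (q : ℕ) : Type := List (Symb q) × Option (List (Fin q) × List (Fin q))

/-- The string of a table. -/
def tableStr (t : List (Slot q)) : List (Symb q) := t.flatMap Prod.fst ++ [.bar]

/-- The strings of the slots are correct. -/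
def SlotsOK (t : List (Slot q)) : Prop := ∀ x ∈ t, WritesSlot x.1 x.2

theorem writesTable_iff {s : List (Symb q)} {f : EssIso (Fin q)} : WritesTable s f ↔
    ∃ t : List (Slot q), (SlotsOK t ∧ IsTable (t.map Prod.snd).reduceOption f) ∧ s = tableStr t := by
  constructor
  · rintro ⟨slots, strs, h, h2, rfl⟩
    obtain ⟨hl, h3⟩ := List.forall₂_iff_zip.1 h2
    refine ⟨strs.zip slots, ⟨fun x hx => h3 hx, ?_⟩, ?_⟩
    · rwa [List.map_snd_zip hl.ge]
    · rw [tableStr, List.flatMap_def, List.map_fst_zip hl.le]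
  · rintro ⟨t, ⟨h1, h2⟩, rfl⟩
    refine ⟨t.map Prod.snd, t.map Prod.fst, h2, ?_, by rw [tableStr, List.flatMap_def]⟩
    rw [List.forall₂_map_left_iff, List.forall₂_map_right_iff, List.forall₂_same]
    exact h1

theorem forall₂_exists_iff {α β γ : Type} {P : γ → β → Prop} {F : γ → α} {l : List α} {l' : List β} :
    List.Forall₂ (fun a b => ∃ c, P c b ∧ a = F c) l l' ↔
      ∃ m, List.Forall₂ P m l' ∧ l = m.map F := by
  constructor
  · intro h
    induction h with
    | nil => exact ⟨[], .nil, rfl⟩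
    | cons h _ ih =>
      obtain ⟨c, hc, rfl⟩ := h
      obtain ⟨m, hm, rfl⟩ := ih
      exact ⟨c :: m, .cons hc hm, rfl⟩
  · rintro ⟨m, hm, rfl⟩
    rw [List.forall₂_map_left_iff]
    exact hm.imp fun c b h => ⟨c, h, rfl⟩

theorem describes_iff {x : List Bool} {fs : List (EssIso (Fin q))} : Describes x fs ↔
    ∃ T : List (List (Slot q)),
      List.Forall₂ (fun t f => SlotsOK t ∧ IsTable (t.map Prod.snd).reduceOption f) T fs ∧
        x = toBits (T.flatMap tableStr) := by
  have : (WritesTable : List (Symb q) → EssIso (Fin q) → Prop) = fun s f => ∃ t : List (Slot q),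
      (SlotsOK t ∧ IsTable (t.map Prod.snd).reduceOption f) ∧ s = tableStr t :=
    funext₂ fun s f => propext writesTable_iff
  rw [Describes, this]
  simp only [forall₂_exists_iff]
  constructor
  · rintro ⟨_, ⟨T, hT, rfl⟩, rfl⟩
    exact ⟨T, hT, by rw [List.flatMap_def]⟩
  · rintro ⟨T, hT, rfl⟩
    exact ⟨_, ⟨T, hT, rfl⟩, by rw [List.flatMap_def]⟩

/-- The slot `x` of a table is at position `a`, when the table starts at `o`. -/
def SlotAt : ℕ → List (Slot q) → ℕ → Slot q → Prop
  | _, [], _, _ => False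
  | o, y :: t, a, x => (a = o ∧ x = y) ∨ SlotAt (o + y.1.length) t a x

/-- The slot `x` of the table that starts at `p` is at position `a`, when the sequence of tables
starts at `o`. -/
def TableSlotAt : ℕ → List (List (Slot q)) → ℕ → ℕ → Slot q → Prop
  | _, [], _, _, _ => False
  | o, t :: T, p, a, x => (p = o ∧ SlotAt o t a x) ∨ TableSlotAt (o + (tableStr t).length) T p a x

/-- Semicolons occur only at the ends of slots, and bars in no slot, so positions of slots and
tables can be recognised from the preceding symbol. -/
theorem WritesSlot.last {s : List (Symb q)} {e : Option (List (Fin q) × List (Fin q))}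
    (h : WritesSlot s e) : ∃ s', s = s' ++ [.semi] ∧ ∀ σ ∈ s', σ ≠ .semi ∧ σ ≠ .bar := by
  have hw : ∀ {s : List (Symb q)} {w : List (Fin q)}, WritesWord s w →
      ∀ σ ∈ s, σ ≠ .semi ∧ σ ≠ .bar := by
    rintro s w ⟨k, rfl⟩ σ hσ
    rcases List.mem_append.1 hσ with hσ | hσ
    · obtain ⟨i, -, rfl⟩ := List.mem_map.1 hσ
      simp
    · rw [List.eq_of_mem_replicate hσ]
      simp
  rcases e with _ | ⟨u, v⟩
  · obtain ⟨k, rfl⟩ := h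
    refine ⟨_, rfl, fun σ hσ => ?_⟩
    rw [List.eq_of_mem_replicate hσ]
    simp
  · obtain ⟨s₁, s₂, h1, h2, rfl⟩ := h
    refine ⟨_, rfl, fun σ hσ => ?_⟩
    simp only [List.mem_append, List.mem_singleton] at hσ
    rcases hσ with (hσ | rfl) | hσ
    · exact hw h1 σ hσ
    · simp
    · exact hw h2 σ hσ

theorem SlotsOK.ne_bar {t : List (Slot q)} (h : SlotsOK t) : ∀ σ ∈ t.flatMap Prod.fst, σ ≠ .bar := by
  intro σ hσ
  obtain ⟨x, hx, hσ⟩ := List.mem_flatMap.1 hσ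
  obtain ⟨s', h1, h2⟩ := (h x hx).last
  rw [h1] at hσ
  rcases List.mem_append.1 hσ with hσ | hσ
  · exact (h2 σ hσ).2
  · rw [List.mem_singleton.1 hσ]
    simp

theorem SlotAt.split {o a : ℕ} {t : List (Slot q)} {x : Slot q} (h : SlotAt o t a x)
    (ht : SlotsOK t) : x ∈ t ∧ ∃ l r, t.flatMap Prod.fst = l ++ x.1 ++ r ∧ a = o + l.length ∧
      (l = [] ∨ l.getLast? = some .semi) := by
  induction t generalizing o with
  | nil => exact h.elim
  | cons y t ih =>
    rcases h with ⟨rfl, rfl⟩ | h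
    · exact ⟨by simp, [], t.flatMap Prod.fst, by simp, by simp, Or.inl rfl⟩
    · obtain ⟨h1, l, r, h2, rfl, h3⟩ := ih h fun x hx => ht x (by simp [hx])
      refine ⟨by simp [h1], y.1 ++ l, r, by simp [h2], by simp; ring, Or.inr ?_⟩
      obtain ⟨s', h4, -⟩ := (ht y (by simp)).last
      rcases h3 with rfl | h3
      · simp [h4]
      · simp [List.getLast?_append, h3]

theorem TableSlotAt.split {o p a : ℕ} {T : List (List (Slot q))} {x : Slot q}
    (h : TableSlotAt o T p a x) (hT : ∀ t ∈ T, SlotsOK t) : WritesSlot x.1 x.2 ∧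
      ∃ l l' r, T.flatMap tableStr = l ++ l' ++ x.1 ++ r ∧
      p = o + l.length ∧ a = p + l'.length ∧ (l = [] ∨ l.getLast? = some .bar) ∧
      (l' = [] ∨ l'.getLast? = some .semi) ∧ ∀ σ ∈ l', σ ≠ .bar := by
  induction T generalizing o with
  | nil => exact h.elim
  | cons t T ih =>
    have ht := hT t (by simp)
    rcases h with ⟨rfl, h⟩ | h
    · obtain ⟨h1, l, r, h2, rfl, h3⟩ := h.split ht
      refine ⟨ht _ h1, [], l, r ++ [.bar] ++ T.flatMap tableStr, by simp [tableStr, h2], by simp,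
        by simp, Or.inl rfl, h3, fun σ hσ => ht.ne_bar σ (by simp [h2, hσ])⟩
    · obtain ⟨h1, l, l', r, h2, rfl, h3, h4, h5⟩ := ih h fun t ht => hT t (by simp [ht])
      refine ⟨h1, tableStr t ++ l, l', r, by simp [h2], by simp; ring, h3, Or.inr ?_, h5⟩
      rcases h4 with rfl | h4
      · simp [tableStr]
      · simp [List.getLast?_append, h4]

/-- A position after a semicolon cannot be in the interior of a slot. The string `pre` keeps
absolute positions during the induction. -/
theorem exists_slotAt {pre post : List (Symb q)} {t : List (Slot q)} (ht : SlotsOK t) {a : ℕ}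
    (ha : pre.length ≤ a) (ha' : a < pre.length + (t.flatMap Prod.fst).length)
    (h : a = pre.length ∨ (pre ++ t.flatMap Prod.fst ++ post)[a - 1]? = some .semi) :
    ∃ x, SlotAt pre.length t a x := by
  induction t generalizing pre with
  | nil => simp at ha'; omega
  | cons y t ih =>
    obtain ⟨s', h1, h2⟩ := (ht y (by simp)).last
    rcases lt_or_ge a (pre.length + y.1.length) with h3 | h3
    · rcases ha.eq_or_lt with rfl | h4
      · exact ⟨y, Or.inl ⟨rfl, rfl⟩⟩
      · exfalso
        rcases h with h | h
        · omega
        · have hy : y.1.length = s'.length + 1 := by rw [h1]; simp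
          rw [List.flatMap_cons, h1, List.append_assoc, List.append_assoc, List.append_assoc,
            List.getElem?_append_right (by omega), List.getElem?_append_left (by omega)] at h
          exact (h2 _ (List.mem_of_getElem? h)).1 rfl
    · obtain ⟨x, hx⟩ := ih (pre := pre ++ y.1) (fun x hx => ht x (by simp [hx]))
        (by simpa using h3) (by simp at ha' ⊢; omega) (by
          rcases h with h | h
          · left
            have := List.length_append (as := pre) (bs := y.1)
            omega
          · right; simpa using h)
      refine ⟨x, Or.inr ?_⟩
      rwa [List.length_append] at hx

/-- Without a bar between `p` and `a` both positions belong to one table. The position of the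
closing bar also follows a semicolon or the start of its table, and so it remains as an alternative.
-/
theorem exists_tableSlotAt {pre : List (Symb q)} {T : List (List (Slot q))}
    (hT : ∀ t ∈ T, SlotsOK t) {p a : ℕ} (hp : pre.length ≤ p)
    (h1 : p = pre.length ∨ (pre ++ T.flatMap tableStr)[p - 1]? = some .bar) (hpa : p ≤ a)
    (h2 : ∀ i < a, p ≤ i → (pre ++ T.flatMap tableStr)[i]? ≠ some .bar)
    (h3 : a = p ∨ (pre ++ T.flatMap tableStr)[a - 1]? = some .semi)
    (ha : a < pre.length + (T.flatMap tableStr).length) :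
    (pre ++ T.flatMap tableStr)[a]? = some .bar ∨ ∃ x, TableSlotAt pre.length T p a x := by
  induction T generalizing pre with
  | nil => simp at ha; omega
  | cons t T ih =>
    have ht := hT t (by simp)
    have hl : (tableStr t).length = (t.flatMap Prod.fst).length + 1 := by simp [tableStr]
    rcases lt_or_ge p (pre.length + (tableStr t).length) with h4 | h4
    · have hs : pre ++ (t :: T).flatMap tableStr =
          pre ++ t.flatMap Prod.fst ++ (.bar :: T.flatMap tableStr) := by simp [tableStr]
      rw [hs] at h1 h2 h3 ⊢
      have hp' : p = pre.length := by
        rcases h1 with h1 | h1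
        · exact h1
        · by_contra hne
          rw [List.getElem?_append_left (by simp only [List.length_append]; omega),
            List.getElem?_append_right (by omega)] at h1
          exact ht.ne_bar _ (List.mem_of_getElem? h1) rfl
      subst hp'
      have hbar : (pre ++ t.flatMap Prod.fst ++ (.bar :: T.flatMap tableStr))[
          pre.length + (t.flatMap Prod.fst).length]? = some .bar := by
        rw [List.getElem?_append_right (by simp)]
        simp
      rcases lt_trichotomy a (pre.length + (t.flatMap Prod.fst).length) with h5 | rfl | h5
      · obtain ⟨x, hx⟩ := exists_slotAt ht hpa h5 h3
        exact Or.inr ⟨x, Or.inl ⟨rfl, hx⟩⟩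
      · exact Or.inl hbar
      · exact (h2 _ h5 (by omega) hbar).elim
    · have hs : pre ++ (t :: T).flatMap tableStr = (pre ++ tableStr t) ++ T.flatMap tableStr := by
        simp
      rw [hs] at h1 h2 h3 ⊢
      have hl' := List.length_append (as := pre) (bs := tableStr t)
      rcases ih (pre := pre ++ tableStr t) (fun t ht => hT t (by simp [ht])) (by omega)
        (h1.imp (fun h => by omega) id) h2 h3 (by simp at ha ⊢; omega) with h | ⟨x, hx⟩
      · exact Or.inl h
      · refine Or.inr ⟨x, Or.inr ?_⟩
        rwa [hl'] at hx

end Parse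


/-! ### Contents of slots and positions of tables in a string -/

section Leaf

variable {q : ℕ}

theorem getElem?_of_drop {s C r : List (Symb q)} {a : ℕ} (h : s.drop a = C ++ r) (i : ℕ) :
    s[a + i]? = (C ++ r)[i]? := by
  rw [← h, List.getElem?_drop]

/-- The word is a maximal run of letters; the hypothesis `hr` says that the run ends with it. -/
theorem wordAt_iff {s r : List (Symb q)} {p : ℕ} {w : List (Fin q)}
    (h : s.drop p = w.map .letter ++ r) (hr : ∀ l, r[0]? ≠ some (.letter l)) {t k : ℕ} :
    WordAt q (strSymb s) p t k ↔ (spell w)[t]? = some k := by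
  have hlt : ∀ i (hi : i < w.length), s[p + i]? = some (.letter w[i]) := fun i hi => by
    rw [getElem?_of_drop h, List.getElem?_append_left (by simpa using hi)]
    simp [hi]
  have hend : ¬ IsLetterAt q (strSymb s) (p + w.length) := by
    rw [isLetterAt_strSymb, getElem?_of_drop h, List.getElem?_append_right (by simp)]
    rintro ⟨l, hl⟩
    exact hr l (by simpa using hl)
  have hall : ∀ t ≤ w.length, ∀ i < t, IsLetterAt q (strSymb s) (p + i) := fun t ht i hi =>
    isLetterAt_strSymb.2 ⟨_, hlt i (by omega)⟩
  constructor
  · rintro ⟨h1, h2⟩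
    have ht : t ≤ w.length := by
      by_contra hc
      exact hend (h1 _ (by omega))
    rcases h2 with ⟨hk, h2⟩ | ⟨rfl, h2⟩
    · rcases ht.lt_or_eq with ht | rfl
      · rw [strSymb_letter hk, hlt t ht] at h2
        rw [spell_getElem?_of_lt ht]
        simp only [Option.some.injEq, Symb.letter.injEq] at h2 ⊢
        rw [h2]
      · exact (hend ⟨k, hk, h2⟩).elim
    · rw [spell_eq_q]
      by_contra hc
      exact h2 (isLetterAt_strSymb.2 ⟨_, hlt t (by omega)⟩)
  · intro h1
    have ht := le_of_spell h1
    refine ⟨hall t ht, ?_⟩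
    rcases ht.lt_or_eq with ht | rfl
    · rw [spell_getElem?_of_lt ht, Option.some.injEq] at h1
      subst h1
      exact Or.inl ⟨w[t].2, (strSymb_letter w[t].2).2 (hlt t ht)⟩
    · rw [spell_length, Option.some.injEq] at h1
      exact Or.inr ⟨h1.symm, hend⟩

/-- Only letters and blanks may precede the comma of an entry, so the sole candidate is the first
other symbol. If that is a semicolon or a bar, there is no entry here. -/
theorem comma_iff {s C r : List (Symb q)} {a : ℕ} {σ : Symb q} (h : s.drop a = C ++ σ :: r)
    (hC : ∀ τ ∈ C, (∃ l, τ = .letter l) ∨ τ = .blank)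
    (hσ : σ = .comma ∨ σ = .semi ∨ σ = .bar) (c : ℕ) :
    (a ≤ c ∧ strSymb s c (q + 1) ∧ ∀ i < c, a ≤ i → IsLetterAt q (strSymb s) i ∨ strSymb s i q) ↔
      c = a + C.length ∧ σ = .comma := by
  have hlt : ∀ i (hi : i < C.length), s[a + i]? = some C[i] := fun i hi => by
    rw [getElem?_of_drop h, List.getElem?_append_left hi, List.getElem?_eq_getElem hi]
  have hend : s[a + C.length]? = some σ := by
    rw [getElem?_of_drop h, List.getElem?_append_right le_rfl]
    simp
  constructor
  · rintro ⟨h1, h2, h3⟩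
    obtain ⟨i, rfl⟩ := Nat.exists_eq_add_of_le h1
    rw [strSymb_comma] at h2
    rcases lt_trichotomy i C.length with hi | rfl | hi
    · rw [hlt i hi, Option.some.injEq] at h2
      rcases hC _ (List.getElem_mem hi) with ⟨l, h4⟩ | h4 <;> rw [h4] at h2 <;> simp at h2
    · rw [hend, Option.some.injEq] at h2
      exact ⟨rfl, h2⟩
    · have h4 := h3 (a + C.length) (by omega) (by omega)
      rw [isLetterAt_strSymb, strSymb_blank, hend] at h4
      rcases hσ with rfl | rfl | rfl <;> simp at h4
  · rintro ⟨rfl, rfl⟩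
    refine ⟨by omega, strSymb_comma.2 hend, fun i hi hai => ?_⟩
    obtain ⟨i, rfl⟩ := Nat.exists_eq_add_of_le hai
    have hi' : i < C.length := by omega
    rw [isLetterAt_strSymb, strSymb_blank, hlt i hi']
    rcases hC _ (List.getElem_mem hi') with ⟨l, h4⟩ | h4
    · exact Or.inl ⟨l, by rw [h4]⟩
    · exact Or.inr (by rw [h4])

theorem mem_word {w : List (Fin q)} {k : ℕ} {τ : Symb q}
    (h : τ ∈ w.map .letter ++ List.replicate k .blank) : (∃ l, τ = .letter l) ∨ τ = .blank := by
  rcases List.mem_append.1 h with h | h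
  · obtain ⟨l, -, rfl⟩ := List.mem_map.1 h
    exact Or.inl ⟨l, rfl⟩
  · exact Or.inr (List.eq_of_mem_replicate h)

/-- The content of a slot. -/
theorem content_iff {s x r : List (Symb q)} {a : ℕ} {e : Option (List (Fin q) × List (Fin q))}
    (h : s.drop a = x ++ r) (hx : WritesSlot x e) {M : ℕ} (hM : s.length ≤ M) {d t k : ℕ} :
    (∃ c < M, a ≤ c ∧ strSymb s c (q + 1) ∧
      (∀ i < c, a ≤ i → IsLetterAt q (strSymb s) i ∨ strSymb s i q) ∧
      ((d = 0 ∧ WordAt q (strSymb s) a t k) ∨ (d = 1 ∧ WordAt q (strSymb s) (c + 1) t k))) ↔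
    ∃ u v, e = some (u, v) ∧ d < 2 ∧ (spell (side d u v))[t]? = some k := by
  rcases e with _ | ⟨u, v⟩
  · obtain ⟨n, rfl⟩ := hx
    rw [List.append_assoc] at h
    constructor
    · rintro ⟨c, -, h1, h2, h3, -⟩
      have := ((comma_iff h (fun τ hτ => Or.inr (List.eq_of_mem_replicate hτ))
        (Or.inr (Or.inl rfl)) c).1 ⟨h1, h2, h3⟩).2
      simp at this
    · rintro ⟨u, v, h1, -⟩
      simp at h1
  · obtain ⟨s₁, s₂, ⟨k₁, rfl⟩, ⟨k₂, rfl⟩, rfl⟩ := hx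
    have h' : s.drop a = (u.map .letter ++ List.replicate k₁ .blank) ++ .comma ::
        (v.map .letter ++ (List.replicate k₂ .blank ++ .semi :: r)) := by rw [h]; simp
    -- The comma is at `c₀`, after the first word and its blanks; the second word starts at `c₀ +
    -- 1`.
    have hc := comma_iff h' (fun τ hτ => mem_word hτ) (Or.inl rfl)
    set c₀ := a + (u.map Symb.letter ++ List.replicate k₁ (Symb.blank (q := q))).length with hc₀
    have hu : s.drop a = u.map .letter ++ (List.replicate k₁ .blank ++ .comma ::
        (v.map .letter ++ (List.replicate k₂ .blank ++ .semi :: r))) := by rw [h']; simp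
    have hv : s.drop (c₀ + 1) = v.map .letter ++ (List.replicate k₂ .blank ++ .semi :: r) := by
      rw [hc₀, Nat.add_assoc, ← List.drop_drop, h', ← List.drop_drop, List.drop_left]
      simp
    have wu := wordAt_iff (t := t) (k := k) hu (by rcases k₁ with _ | k₁ <;> simp [List.replicate_succ])
    have wv := wordAt_iff (t := t) (k := k) hv (by rcases k₂ with _ | k₂ <;> simp [List.replicate_succ])
    constructor
    · rintro ⟨c, -, h1, h2, h3, h4⟩
      obtain ⟨rfl, -⟩ := (hc c).1 ⟨h1, h2, h3⟩
      rcases h4 with ⟨rfl, h4⟩ | ⟨rfl, h4⟩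
      · exact ⟨u, v, rfl, by omega, wu.1 h4⟩
      · exact ⟨u, v, rfl, by omega, wv.1 h4⟩
    · rintro ⟨u', v', he, hd, h4⟩
      obtain ⟨rfl, rfl⟩ : u = u' ∧ v = v' := by simpa using he
      obtain ⟨h1, h2, h3⟩ := (hc c₀).2 ⟨rfl, rfl⟩
      refine ⟨c₀, ?_, h1, h2, h3, ?_⟩
      · obtain ⟨σ, h5, -⟩ := h2
        exact (List.getElem?_eq_some_iff.1 h5).1.trans_le hM
      · obtain rfl | rfl : d = 0 ∨ d = 1 := by omega
        · exact Or.inl ⟨rfl, wu.2 h4⟩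
        · exact Or.inr ⟨rfl, wv.2 h4⟩

theorem getElem?_pred_of_getLast? {l r : List (Symb q)} {σ : Symb q} (h : l.getLast? = some σ) :
    l.length ≠ 0 ∧ (l ++ r)[l.length - 1]? = some σ := by
  have hl : l.length ≠ 0 := by
    intro h0
    rw [List.length_eq_zero_iff.1 h0] at h
    simp at h
  exact ⟨hl, by rw [List.getElem?_append_left (by omega), ← List.getLast?_eq_getElem?, h]⟩

theorem leaf_iff {T : List (List (Slot q))} (hT : ∀ t ∈ T, SlotsOK t) {M : ℕ}
    (hM : (T.flatMap tableStr).length ≤ M) {p a d t k : ℕ} :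
    Leaf q M (strSymb (T.flatMap tableStr)) p a d t k ↔
      ∃ x u v, TableSlotAt 0 T p a (x, some (u, v)) ∧ d < 2 ∧
        (spell (side d u v))[t]? = some k := by
  set s := T.flatMap tableStr with hs
  constructor
  · rintro ⟨h1, h2, h3, h4, h5⟩
    have ha : a < s.length := by
      obtain ⟨c, -, hc, ⟨σ, hσ, -⟩, -⟩ := h5
      exact hc.trans_lt (List.getElem?_eq_some_iff.1 hσ).1
    have h3' : ∀ i < a, p ≤ i → s[i]? ≠ some .bar := fun i hi hpi h => h3 i hi hpi (strSymb_bar.2 h)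
    have key := exists_tableSlotAt (pre := []) hT (Nat.zero_le p)
      (h1.imp id strSymb_bar.1) h2 h3' (by
        rw [List.nil_append, ← hs]
        rcases h4 with h4 | h4 | h4
        · exact Or.inl (by omega)
        · exact Or.inr (strSymb_semi.1 h4)
        · rw [strSymb_bar] at h4
          by_contra hc
          push Not at hc
          exact h3' (a - 1) (by omega) (by omega) h4) (by rwa [List.length_nil, Nat.zero_add])
    rw [List.nil_append, ← hs] at key
    rcases key with hb | ⟨⟨x, e⟩, hx⟩
    -- The position of the bar passes as the start of a slot, but no comma can be reached from it.
    · obtain ⟨c, -, h6, h7, h8, -⟩ := h5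
      have hd : s.drop a = [] ++ .bar :: s.drop (a + 1) := by
        rw [List.drop_eq_getElem_cons ha, List.nil_append]
        rw [List.getElem?_eq_getElem ha, Option.some.injEq] at hb
        rw [hb]
      have := ((comma_iff hd (by simp) (Or.inr (Or.inr rfl)) c).1 ⟨h6, h7, h8⟩).2
      simp at this
    · obtain ⟨hw, l, l', r, h6, h7, h8, -⟩ := hx.split hT
      have hd : s.drop a = x ++ r := by
        rw [hs, h6, h8, h7, List.append_assoc (l ++ l'), List.length_nil, Nat.zero_add, ← List.length_append,
          List.drop_left]
      obtain ⟨u, v, rfl, h9⟩ := (content_iff hd hw hM).1 h5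
      exact ⟨x, u, v, hx, h9⟩
  · rintro ⟨x, u, v, hx, h9⟩
    obtain ⟨hw, l, l', r, h6, h7, h8, h10, h11, h12⟩ := hx.split hT
    rw [← hs] at h6
    have hd : s.drop a = x ++ r := by
      rw [h6, h8, h7, List.append_assoc (l ++ l'), Nat.zero_add, ← List.length_append,
        List.drop_left]
    rw [Nat.zero_add] at h7
    have hbar : l = [] ∨ s[p - 1]? = some .bar := h10.imp id fun h => by
      have := (getElem?_pred_of_getLast? (r := l' ++ x ++ r) h).2
      rw [h6, h7]
      simpa using this
    refine ⟨?_, by omega, fun i hi hpi hb => ?_, ?_, (content_iff hd hw hM).2 ⟨u, v, rfl, h9⟩⟩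
    · rcases hbar with rfl | hbar
      · exact Or.inl h7
      · exact Or.inr (strSymb_bar.2 hbar)
    · rw [strSymb_bar, h6, List.append_assoc, List.append_assoc, List.getElem?_append_right (by omega),
        List.getElem?_append_left (by omega)] at hb
      exact h12 _ (List.mem_of_getElem? hb) rfl
    · rcases h11 with rfl | h11
      · rcases hbar with rfl | hbar
        · exact Or.inl (by simp at h7 h8; omega)
        · exact Or.inr (Or.inr (strSymb_bar.2 (by simpa [h8] using hbar)))
      · obtain ⟨h13, h14⟩ := getElem?_pred_of_getLast? (r := x ++ r) h11
        refine Or.inr (Or.inl (strSymb_semi.2 ?_))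
        rw [h6, h8, h7, List.append_assoc, List.append_assoc, List.getElem?_append_right (by omega),
          ← h14]
        congr 1
        omega

/-! ### Positions of the tables -/

theorem SlotAt.bounds {o a : ℕ} {t : List (Slot q)} {x : Slot q} (h : SlotAt o t a x)
    (ht : SlotsOK t) : o ≤ a ∧ a < o + (t.flatMap Prod.fst).length := by
  obtain ⟨h1, l, r, h2, rfl, -⟩ := h.split ht
  obtain ⟨s', h3, -⟩ := (ht _ h1).last
  rw [h2, h3]
  simp only [List.length_append, List.length_singleton]
  omega

theorem SlotAt.unique {o a : ℕ} {t : List (Slot q)} {x y : Slot q} (h : SlotAt o t a x)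
    (h' : SlotAt o t a y) (ht : SlotsOK t) : x = y := by
  induction t generalizing o with
  | nil => exact h.elim
  | cons z t ih =>
    have ht' : SlotsOK t := fun x hx => ht x (by simp [hx])
    have hz : z.1.length ≠ 0 := by
      obtain ⟨s', h3, -⟩ := (ht z (by simp)).last
      rw [h3]; simp
    rcases h with ⟨rfl, rfl⟩ | h <;> rcases h' with ⟨h1, rfl⟩ | h'
    · rfl
    · have := (h'.bounds ht').1; omega
    · have := (h.bounds ht').1; omega
    · exact ih h h' ht'

theorem exists_slotAt_iff {o : ℕ} {t : List (Slot q)} {u v : List (Fin q)} :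
    (∃ a x, SlotAt o t a (x, some (u, v))) ↔ (u, v) ∈ (t.map Prod.snd).reduceOption := by
  rw [List.reduceOption_mem_iff]
  induction t generalizing o with
  | nil => simp [SlotAt]
  | cons y t ih =>
    simp only [SlotAt, List.map_cons, List.mem_cons]
    rw [← ih (o := o + y.1.length)]
    constructor
    · rintro ⟨a, x, ⟨rfl, rfl⟩ | h⟩
      · exact Or.inl rfl
      · exact Or.inr ⟨a, x, h⟩
    · rintro (h | ⟨a, x, h⟩)
      · exact ⟨o, y.1, Or.inl ⟨rfl, by rw [h]⟩⟩
      · exact ⟨a, x, Or.inr h⟩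

/-- As the listed entries are distinct, one entry cannot occur in two slots. -/
theorem SlotAt.inj {o a a' : ℕ} {t : List (Slot q)} {u v : List (Fin q)} {x x' : List (Symb q)}
    (h : SlotAt o t a (x, some (u, v))) (h' : SlotAt o t a' (x', some (u, v)))
    (ht : (t.map Prod.snd).reduceOption.Nodup) : a = a' := by
  induction t generalizing o with
  | nil => exact h.elim
  | cons y t ih =>
    have hmem : ∀ {a x}, SlotAt (o + y.1.length) t a (x, some (u, v)) → y.2 ≠ some (u, v) := by
      rintro a x h1 h2
      rw [List.map_cons, h2, List.reduceOption_cons_of_some, List.nodup_cons] at ht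
      exact ht.1 (exists_slotAt_iff.1 ⟨a, x, h1⟩)
    have ht' : (t.map Prod.snd).reduceOption.Nodup := by
      rcases hy : y.2 with _ | e
      · rwa [List.map_cons, hy, List.reduceOption_cons_of_none] at ht
      · rw [List.map_cons, hy, List.reduceOption_cons_of_some, List.nodup_cons] at ht
        exact ht.2
    rcases h with ⟨rfl, rfl⟩ | h <;> rcases h' with ⟨rfl, h1⟩ | h'
    · rfl
    · exact (hmem h' rfl).elim
    · exact (hmem h (by rw [← h1])).elim
    · exact ih h h' ht'

/-- The table `t` starts at `p`, when the sequence of tables starts at `o`. -/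
def TableAt : ℕ → List (List (Slot q)) → ℕ → List (Slot q) → Prop
  | _, [], _, _ => False
  | o, t' :: T, p, t => (p = o ∧ t = t') ∨ TableAt (o + (tableStr t').length) T p t

theorem tableSlotAt_iff {o : ℕ} {T : List (List (Slot q))} {p a : ℕ} {x : Slot q} :
    TableSlotAt o T p a x ↔ ∃ t, TableAt o T p t ∧ SlotAt p t a x := by
  induction T generalizing o with
  | nil => simp [TableSlotAt, TableAt]
  | cons t T ih =>
    simp only [TableSlotAt, TableAt, ih]
    constructor
    · rintro (⟨rfl, h⟩ | ⟨t', h1, h2⟩)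
      · exact ⟨t, Or.inl ⟨rfl, rfl⟩, h⟩
      · exact ⟨t', Or.inr h1, h2⟩
    · rintro ⟨t', ⟨rfl, rfl⟩ | h1, h2⟩
      · exact Or.inl ⟨rfl, h2⟩
      · exact Or.inr ⟨t', h1, h2⟩

theorem TableAt.mem {o : ℕ} {T : List (List (Slot q))} {p : ℕ} {t : List (Slot q)}
    (h : TableAt o T p t) : t ∈ T := by
  induction T generalizing o with
  | nil => exact h.elim
  | cons t' T ih =>
    rcases h with ⟨rfl, rfl⟩ | h
    · simp
    · simp [ih h]

theorem TableAt.bounds {o : ℕ} {T : List (List (Slot q))} {p : ℕ} {t : List (Slot q)}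
    (h : TableAt o T p t) : o ≤ p ∧ p + (tableStr t).length ≤ o + (T.flatMap tableStr).length := by
  induction T generalizing o with
  | nil => exact h.elim
  | cons t' T ih =>
    rw [List.flatMap_cons, List.length_append]
    rcases h with ⟨rfl, rfl⟩ | h
    · omega
    · have := ih h
      omega

/-- Tables are consecutive and non-empty strings, so those that overlap coincide. -/
theorem TableAt.disjoint {o : ℕ} {T : List (List (Slot q))} {p p' : ℕ} {t t' : List (Slot q)}
    (h : TableAt o T p t) (h' : TableAt o T p' t') (hp : p' < p + (tableStr t).length)
    (hp' : p < p' + (tableStr t').length) : p = p' ∧ t = t' := by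
  induction T generalizing o with
  | nil => exact h.elim
  | cons t'' T ih =>
    rcases h with ⟨rfl, rfl⟩ | h <;> rcases h' with ⟨rfl, rfl⟩ | h'
    · exact ⟨rfl, rfl⟩
    · have := h'.bounds.1; omega
    · have := h.bounds.1; omega
    · exact ih h h'

end Leaf


open Complexity

/-! ### The relation obtained by reading the tables -/

section Leaves

variable {q : ℕ}

/-- The isomorphism of the table that starts at `p`, when the sequence of tables starts at `o`. -/
def isoAt : ℕ → List (List (Slot q)) → List (EssIso (Fin q)) → ℕ → Option (EssIso (Fin q))
  | o, t :: T, f :: fs, p => if p = o then some f else isoAt (o + (tableStr t).length) T fs p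
  | _, _, _, _ => none

theorem exists_tableAt_of_isoAt {P : List (Slot q) → EssIso (Fin q) → Prop}
    {T : List (List (Slot q))} {fs : List (EssIso (Fin q))} (h : List.Forall₂ P T fs) {o p : ℕ}
    {f : EssIso (Fin q)} (hf : isoAt o T fs p = some f) : ∃ t, TableAt o T p t ∧ P t f := by
  induction h generalizing o with
  | nil => simp [isoAt] at hf
  | @cons t g T fs h1 h2 ih =>
    rw [isoAt] at hf
    split_ifs at hf with hp
    · rw [Option.some.injEq] at hf
      subst hf
      exact ⟨t, Or.inl ⟨hp, rfl⟩, h1⟩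
    · obtain ⟨t', h3, h4⟩ := ih hf
      exact ⟨t', Or.inr h3, h4⟩

theorem isoAt_ne_none {P : List (Slot q) → EssIso (Fin q) → Prop}
    {T : List (List (Slot q))} {fs : List (EssIso (Fin q))} (h : List.Forall₂ P T fs) {o p : ℕ}
    {t : List (Slot q)} (ht : TableAt o T p t) : isoAt o T fs p ≠ none := by
  induction h generalizing o with
  | nil => exact ht.elim
  | @cons t' g T fs h1 h2 ih =>
    rw [isoAt]
    split_ifs with hp
    · simp
    · rcases ht with ⟨h3, -⟩ | h3
      · exact (hp h3).elim
      · exact ih h3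

/-- The tables of a description. -/
abbrev IsDescription (T : List (List (Slot q))) (fs : List (EssIso (Fin q))) : Prop :=
  List.Forall₂ (fun t f => SlotsOK t ∧ IsTable (t.map Prod.snd).reduceOption f) T fs

theorem IsDescription.slotsOK {T : List (List (Slot q))} {fs : List (EssIso (Fin q))}
    (h : IsDescription T fs) : ∀ t ∈ T, SlotsOK t := by
  induction h with
  | nil => simp
  | cons h1 _ ih =>
    intro t ht
    rcases List.mem_cons.1 ht with rfl | ht
    · exact h1.1
    · exact ih t ht

/-- The numbered entries of the tables in a description. -/
def LeafEntry (B : ℕ → ℕ → Prop) (T : List (List (Slot q))) (b a : ℕ) (u v : List (Fin q)) : Prop :=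
  ∃ p, B p b ∧ ∃ x, TableSlotAt 0 T p a (x, some (u, v))

theorem lists_tableSlotAt {T : List (List (Slot q))} {fs : List (EssIso (Fin q))}
    (h : IsDescription T fs) {p : ℕ} {f : EssIso (Fin q)} (hf : isoAt 0 T fs p = some f) :
    Lists (fun a u v => ∃ x, TableSlotAt 0 T p a (x, some (u, v))) f := by
  obtain ⟨t, ht, hok, htab⟩ := exists_tableAt_of_isoAt h hf
  rw [isTable_iff] at htab
  have hE : ∀ a y, TableSlotAt 0 T p a y ↔ SlotAt p t a y := fun a y => by
    rw [tableSlotAt_iff]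
    constructor
    · rintro ⟨t', h1, h2⟩
      have hl : ∀ t : List (Slot q), p < p + (tableStr t).length := fun t => by simp [tableStr]
      rwa [(ht.disjoint h1 (hl _) (hl _)).2]
    · exact fun h => ⟨t, ht, h⟩
  simp only [hE]
  refine ⟨?_, ?_, fun u v => ?_⟩
  · rintro a u v u' v' ⟨x, h1⟩ ⟨x', h2⟩
    have := congrArg Prod.snd (h1.unique h2 hok)
    simpa using this
  · rintro a a' u v ⟨x, h1⟩ ⟨x', h2⟩
    exact h1.inj h2 htab.1
  · rw [exists_slotAt_iff, htab.2]

theorem WritesSlot.length_le {s : List (Symb q)} {u v : List (Fin q)}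
    (h : WritesSlot s (some (u, v))) : u.length + v.length + 2 ≤ s.length := by
  obtain ⟨s₁, s₂, ⟨k₁, rfl⟩, ⟨k₂, rfl⟩, rfl⟩ := h
  simp
  omega

/-- An entry is numbered by the position of its slot in the whole string. Tables occupy disjoint
segments, so entries of different blocks have different numbers. The conditions on `B` say that each
block receives at most one table and each table at most one block. -/
theorem level_zero {T : List (List (Slot q))} {fs : List (EssIso (Fin q))}
    (h : IsDescription T fs) {N W : ℕ} (hN : N = (T.flatMap tableStr).length) (hNW : N ≤ W)
    (hW : 1 ≤ W) {B : ℕ → ℕ → Prop} {F : ℕ → Option (EssIso (Fin q))}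
    (hF : ∀ b f, F b = some f → ∃ p, B p b ∧ isoAt 0 T fs p = some f ∧
      ∀ p', B p' b → isoAt 0 T fs p' ≠ none → p' = p)
    (hF' : ∀ b, F b = none → ∀ p, B p b → isoAt 0 T fs p = none)
    (hB : ∀ p b b', B p b → B p b' → b = b')
    (hBN : ∀ p b, B p b → isoAt 0 T fs p ≠ none → b < N)
    {R : ℕ → ℕ → ℕ → ℕ → ℕ → Prop}
    (hR : ∀ b a d t k, k ≤ q → (R b a d t k ↔ (b ≤ W ∧ a ≤ W ∧ d ≤ W ∧ t ≤ W) ∧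
      ∃ p < W + 1, B p b ∧ Leaf q (W + 1) (strSymb (T.flatMap tableStr)) p a d t k)) :
    Level N N R F (LeafEntry B T) := by
  have hbd : ∀ b a u v, LeafEntry B T b a u v →
      b < N ∧ a < N ∧ u.length ≤ N ∧ v.length ≤ N ∧ ∃ p < W + 1, B p b ∧
        ∃ x, TableSlotAt 0 T p a (x, some (u, v)) := by
    rintro b a u v ⟨p, hp, x, hx⟩
    obtain ⟨t, ht, -⟩ := tableSlotAt_iff.1 hx
    have h1 := hBN p b hp (isoAt_ne_none h ht)
    obtain ⟨hw, l, l', r, h2, h3, h4, -⟩ := hx.split h.slotsOK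
    have h5 : u.length + v.length + 2 ≤ x.length := hw.length_le
    have h6 := congrArg List.length h2
    simp only [List.length_append] at h6
    exact ⟨h1, by omega, by omega, by omega, p, by omega, hp, x, hx⟩
  refine ⟨fun b a d t k hk => ?_, fun b a u v hE => ?_, ?_, fun b f hf => ?_,
    fun b hb a u v hE => ?_⟩
  · rw [hR _ _ _ _ _ hk]
    constructor
    · rintro ⟨-, p, -, hp, hl⟩
      obtain ⟨x, u, v, h1, h2⟩ := (leaf_iff h.slotsOK (by omega)).1 hl
      exact ⟨u, v, ⟨p, hp, x, h1⟩, h2⟩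
    · rintro ⟨u, v, h1, h2⟩
      obtain ⟨e1, e2, e3, e4, p, e5, hp, x, hx⟩ := hbd _ _ _ _ h1
      have e6 := le_of_spell h2.2
      have e7 : (side d u v).length ≤ N := by
        cases d
        · exact e3
        · exact e4
      exact ⟨by omega, p, e5, hp, (leaf_iff h.slotsOK (by omega)).2 ⟨x, u, v, hx, h2⟩⟩
  · obtain ⟨h1, h2, h3, h4, -⟩ := hbd _ _ _ _ hE
    exact ⟨h1, h2, h3, h4⟩
  · rintro b b' a u v u' v' ⟨p, hp, x, hx⟩ ⟨p', hp', x', hx'⟩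
    obtain ⟨t, ht, h1⟩ := tableSlotAt_iff.1 hx
    obtain ⟨t', ht', h2⟩ := tableSlotAt_iff.1 hx'
    have e1 := h1.bounds (h.slotsOK t ht.mem)
    have e2 := h2.bounds (h.slotsOK t' ht'.mem)
    have hl : ∀ t : List (Slot q), (tableStr t).length = (t.flatMap Prod.fst).length + 1 :=
      fun t => by simp [tableStr]
    obtain ⟨rfl, -⟩ := ht.disjoint ht' (by rw [hl]; omega) (by rw [hl]; omega)
    exact hB _ _ _ hp hp'
  · obtain ⟨p, hp, hf', hu⟩ := hF b f hf
    have : LeafEntry B T b = fun a u v => ∃ x, TableSlotAt 0 T p a (x, some (u, v)) := by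
      funext a u v
      rw [eq_iff_iff]
      constructor
      · rintro ⟨p', hp', x, hx⟩
        obtain ⟨t, ht, -⟩ := tableSlotAt_iff.1 hx
        obtain rfl := hu p' hp' (isoAt_ne_none h ht)
        exact ⟨x, hx⟩
      · rintro ⟨x, hx⟩
        exact ⟨p, hp, x, hx⟩
    rw [this]
    exact lists_tableSlotAt h hf'
  · obtain ⟨p, hp, x, hx⟩ := hE
    obtain ⟨t, ht, -⟩ := tableSlotAt_iff.1 hx
    exact isoAt_ne_none h ht (hF' b hb p hp)

/-- The isomorphisms described by the relation after some rounds. -/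
def levelIso (F : ℕ → Option (EssIso (Fin q))) : ℕ → ℕ → Option (EssIso (Fin q))
  | 0, b => F b
  | l + 1, b => ocomp (levelIso F l (2 * b)) (levelIso F l (2 * b + 1))

theorem ocomp_eq_none {f g : Option (EssIso (Fin q))} : ocomp f g = none ↔ f = none ∧ g = none := by
  cases f <;> cases g <;> simp [ocomp]

/-- Composition never makes a block disappear, so absence everywhere can be traced back to the
beginning. -/
theorem levelIso_none {F : ℕ → Option (EssIso (Fin q))} {l : ℕ} (h : ∀ b, levelIso F l b = none)
    (b : ℕ) : F b = none := by
  induction l generalizing b with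
  | zero => exact h b
  | succ l ih =>
    refine ih (fun b => ?_) b
    have := ocomp_eq_none.1 (h (b / 2))
    rcases Nat.even_or_odd' b with ⟨c, rfl | rfl⟩
    · rw [show 2 * c / 2 = c by omega] at this
      exact this.1
    · rw [show (2 * c + 1) / 2 = c by omega] at this
      exact this.2

end Leaves

/-! ### The relation after several rounds -/

section Rounds

variable {q : ℕ} {B : ℕ → ℕ → Prop} {Out : (ℕ → Prop) → ℕ → ℕ → ℕ → Prop} {n : ℕ} {x : ℕ → Prop}

/-- The relation after `t` rounds. -/
def relAfter (q : ℕ) (B : ℕ → ℕ → Prop) (Out : (ℕ → Prop) → ℕ → ℕ → ℕ → Prop) (n : ℕ)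
    (x : ℕ → Prop) (t b a d i k : ℕ) : Prop :=
  iterRel (roundMap q B Out) (relSize q) n x t (tupleCode 5 ![b, a, d, i, k])

theorem relAt_joinInput {R : ℕ → Prop} {b a d i k : ℕ} :
    relAt (joinInput n x R) n b a d i k ↔ R (tupleCode 5 ![b, a, d, i, k]) := by
  simp [relAt, joinInput]

theorem symbAt_joinInput {R : ℕ → Prop} : symbAt q (joinInput n x R) n = symbAt q x n := by
  funext i c
  rw [symbAt, symbAt, eq_iff_iff]
  refine and_congr_right fun ⟨hi, hc⟩ => ?_
  have h1 : i * (q + 4) + c < n := by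
    have h2 : (i + 1) * (q + 4) ≤ n := (Nat.mul_le_mul_right _ hi).trans (Nat.div_mul_le_self _ _)
    rw [Nat.add_mul] at h2
    omega
  simp [joinInput, h1]

theorem tupleCode_lt {b a d i k : ℕ} (h : ∀ j : Fin 5, ![b, a, d, i, k] j ≤ bound q n) :
    tupleCode 5 ![b, a, d, i, k] < relSize q n := Nat.lt_succ_of_le (tupleCode_mono 5 h)

theorem relAfter_succ (t b a d i k : ℕ) (hk : k ≤ q) :
    relAfter q B Out n x (t + 1) b a d i k ↔
      (b ≤ bound q n ∧ a ≤ bound q n ∧ d ≤ bound q n ∧ i ≤ bound q n) ∧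
      Round q (bound q n + 1) B (relAfter q B Out n x t) (symbAt q x n) b a d i k := by
  have hkW : k ≤ bound q n := by rw [bound]; omega
  have hrel : relAt (joinInput n x (iterRel (roundMap q B Out) (relSize q) n x t)) n =
      relAfter q B Out n x t := by
    funext b a d i k
    exact propext relAt_joinInput
  rw [relAfter, iterRel, roundMap]
  simp only [Matrix.cons_val_zero, Matrix.cons_val_one, tupleDec_tupleCode, symbAt_joinInput, hrel]
  constructor
  · rintro ⟨-, h1, ⟨-, h2⟩ | ⟨h2, -⟩⟩
    · exact ⟨⟨h1 0, h1 1, h1 2, h1 3⟩, h2⟩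
    · have : k = q + 1 := h2
      omega
  · rintro ⟨⟨h1, h2, h3, h4⟩, h5⟩
    have h6 : ∀ j : Fin 5, ![b, a, d, i, k] j ≤ bound q n := by
      intro j
      fin_cases j <;> assumption
    exact ⟨tupleCode_lt h6, h6, Or.inl ⟨Nat.lt_succ_of_le hk, h5⟩⟩

/-- The code `q + 1` is neither that of a letter nor the end marker `q`, so tuples with it are free
to carry the answer. The answer is computed from the relation of the preceding round. -/
theorem relAfter_out (t b a : ℕ) (hb : b ≤ bound q n) (ha : a ≤ bound q n) :
    relAfter q B Out n x (t + 1) b a 0 0 (q + 1) ↔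
      Out (joinInput n x (iterRel (roundMap q B Out) (relSize q) n x t)) n b a := by
  have h6 : ∀ j : Fin 5, ![b, a, 0, 0, q + 1] j ≤ bound q n := by
    intro j
    fin_cases j <;> first | assumption | exact Nat.zero_le _ | (simp [bound]; omega)
  rw [relAfter, iterRel, roundMap]
  simp only [Matrix.cons_val_zero, Matrix.cons_val_one, tupleDec_tupleCode]
  constructor
  · rintro ⟨-, h1, ⟨h2, -⟩ | ⟨-, h2⟩⟩
    · exact absurd h2 (lt_irrefl (q + 1))
    · exact h2
  · intro h
    exact ⟨tupleCode_lt h6, h6, Or.inr ⟨rfl, h⟩⟩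

theorem round_zero {t b a d i k : ℕ} (h : ∀ b a d i, ¬ relAfter q B Out n x t b a d i q) :
    Round q (bound q n + 1) B (relAfter q B Out n x t) (symbAt q x n) b a d i k ↔
      ∃ p < bound q n + 1, B p b ∧ Leaf q (bound q n + 1) (symbAt q x n) p a d i k := by
  have : ¬ ∃ b' < bound q n + 1, HasEntry q (bound q n + 1) (relAfter q B Out n x t) b' := by
    rintro ⟨b', -, a, -, t, -, h'⟩
    exact h _ _ _ _ h'
  rw [Round, and_iff_right this, or_iff_right fun h => this h.1]

/-- The relation after `l + 1` rounds describes the composites of blocks of `2 ^ l` isomorphisms. -/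
theorem exists_level {T : List (List (Slot q))} {fs : List (EssIso (Fin q))}
    (h : IsDescription T fs) (hn : n = (toBits (T.flatMap tableStr)).length)
    (hx : ∀ i < n, (x i ↔ (toBits (T.flatMap tableStr)).getD i false = true))
    {F : ℕ → Option (EssIso (Fin q))}
    (hF : ∀ b f, F b = some f → ∃ p, B p b ∧ isoAt 0 T fs p = some f ∧
      ∀ p', B p' b → isoAt 0 T fs p' ≠ none → p' = p)
    (hF' : ∀ b, F b = none → ∀ p, B p b → isoAt 0 T fs p = none)
    (hB : ∀ p b b', B p b → B p b' → b = b')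
    (hBN : ∀ p b, B p b → isoAt 0 T fs p ≠ none → b < (T.flatMap tableStr).length)
    (l : ℕ) (hl : 2 ^ l * (T.flatMap tableStr).length ≤ bound q n) :
    ∃ E, Level (T.flatMap tableStr).length (2 ^ l * (T.flatMap tableStr).length)
      (relAfter q B Out n x (l + 1)) (levelIso F l) E := by
  set N := (T.flatMap tableStr).length with hN
  have hW : 1 ≤ bound q n := by rw [bound]; omega
  have hS : symbAt q x n = strSymb (T.flatMap tableStr) := by
    subst hn
    exact symbAt_toBits _ hx
  have hNW : N ≤ bound q n := by
    have := Nat.one_le_two_pow (n := l)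
    nlinarith
  -- There is no counter of rounds: tables are read whenever the relation has no entries, in
  -- particular in the first round.
  have hfirst : ∀ t, (∀ b a d i, ¬ relAfter q B Out n x t b a d i q) → Level N N
      (relAfter q B Out n x (t + 1)) F (LeafEntry B T) := fun t ht =>
    level_zero h hN hNW hW hF hF' hB hBN fun b a d i k hk => by
      rw [relAfter_succ _ _ _ _ _ _ hk, round_zero ht, hS]
  induction l with
  | zero =>
    rw [pow_zero, one_mul]
    exact ⟨_, hfirst 0 fun b a d i h => h⟩
  | succ l ih =>
    have hl' : 2 ^ (l + 1) * N = 2 * (2 ^ l * N) := by ring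
    rw [hl'] at hl ⊢
    obtain ⟨E, hE⟩ := ih (by omega)
    refine ⟨_, hE.step hNW hl hW fun b a d i k hk => ?_⟩
    rw [relAfter_succ _ _ _ _ _ _ hk]
    refine and_congr_right fun _ => ?_
    by_cases hex : ∃ b f, levelIso F l b = some f
    · obtain ⟨b', f, hb'⟩ := hex
      have h1 : ∃ b' < bound q n + 1, HasEntry q (bound q n + 1)
          (relAfter q B Out n x (l + 1)) b' := by
        have h2 := (hE.hasEntry_iff hNW (by omega) b').2 ⟨f, hb'⟩
        obtain ⟨p, r, -, hp, -⟩ := EssIso.exists_entry_of_dom f []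
        obtain ⟨a, ha⟩ := ((hE.lists b' f hb').entry p r).2 hp
        have := (hE.bounds _ _ _ _ ha).1
        exact ⟨b', by omega, h2⟩
      rw [Round, and_iff_right h1, or_iff_left fun h => h.1 h1]
    -- No table at all: each later round tries to read again, finds nothing, and leaves the relation
    -- empty.
    · have h0 : ∀ b, levelIso F l b = none := fun b => by
        by_contra hc
        exact hex ⟨b, Option.ne_none_iff_exists'.1 hc⟩
      have h1 : ∀ b a d i k, k ≤ q → ¬ relAfter q B Out n x (l + 1) b a d i k :=
        fun b a d i k hk h2 => by
          obtain ⟨u, v, h3, -⟩ := (hE.reads _ _ _ _ _ hk).1 h2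
          exact hE.none _ (h0 b) _ _ _ h3
      rw [round_zero fun b a d i => h1 b a d i q le_rfl, hE.composeStep_iff hNW (by omega) hk]
      constructor
      · rintro ⟨p, -, hp, hleaf⟩
        rw [hS] at hleaf
        obtain ⟨y, u, v, h2, -⟩ := (leaf_iff h.slotsOK (by omega)).1 hleaf
        obtain ⟨t, ht, -⟩ := tableSlotAt_iff.1 h2
        exact (isoAt_ne_none h ht (hF' b (levelIso_none h0 b) p hp)).elim
      · rintro ⟨u, v, h2, -⟩
        rcases h2 with (⟨a', p₁, q₁, p₂, q₂, z, e1, -⟩ | ⟨a', p₂, q₂, p₁, q₁, z, e1, -⟩) |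
          ⟨-, e1 | e1⟩ <;> exact (hE.none _ (h0 _) _ _ _ e1).elim

end Rounds


/-! ### Recognition of strings of tables -/

section Recognition

variable {q : ℕ}

/-- A word followed by blanks is written on the positions from `p` to `e - 1`. -/
def WordBlock (q : ℕ) (S : ℕ → ℕ → Prop) (p e : ℕ) : Prop :=
  ∃ m < e + 1, p ≤ m ∧ (∀ i < m, p ≤ i → IsLetterAt q S i) ∧ ∀ i < e, m ≤ i → S i q

/-- A slot is written at `p`, in a string of length `N`. -/
def SlotBlock (q : ℕ) (S : ℕ → ℕ → Prop) (N p : ℕ) : Prop :=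
  ∃ e < N, p ≤ e ∧ S e (q + 2) ∧ ((∀ i < e, p ≤ i → S i q) ∨
    ∃ c < e, p ≤ c ∧ S c (q + 1) ∧ WordBlock q S p c ∧ WordBlock q S (c + 1) e)

/-- The string `S` of length `N` is a sequence of tables, apart from the content of the tables. -/
def TablesForm (q : ℕ) (S : ℕ → ℕ → Prop) (N : ℕ) : Prop :=
  (N = 0 ∨ S (N - 1) (q + 3)) ∧ ∀ p < N, SlotStart q S p → S p (q + 3) ∨ SlotBlock q S N p

theorem exists_cut {s : List (Symb q)} {p e : ℕ} {σ : Symb q} (hp : p ≤ e) (h : s[e]? = some σ) :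
    ∃ x, s.drop p = x ++ σ :: s.drop (e + 1) ∧ e = p + x.length := by
  obtain ⟨he, h'⟩ := List.getElem?_eq_some_iff.1 h
  refine ⟨(s.drop p).take (e - p), ?_, by simp; omega⟩
  rw [← h', ← List.drop_eq_getElem_cons he]
  conv_lhs => rw [← List.take_append_drop (e - p) (s.drop p)]
  rw [List.drop_drop]
  congr 2
  omega

/-- Conditions on the positions of a window become conditions on the members of a substring. -/
theorem forall_drop_iff {s x r : List (Symb q)} {p : ℕ} (h : s.drop p = x ++ r)
    (P : Option (Symb q) → Prop) :
    (∀ i < p + x.length, p ≤ i → P s[i]?) ↔ ∀ σ ∈ x, P (some σ) := by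
  constructor
  · intro h1 σ hσ
    obtain ⟨i, hi, rfl⟩ := List.mem_iff_getElem.1 hσ
    have := h1 (p + i) (by omega) (by omega)
    rwa [getElem?_of_drop h, List.getElem?_append_left hi, List.getElem?_eq_getElem hi] at this
  · intro h1 i hi hpi
    obtain ⟨i, rfl⟩ := Nat.exists_eq_add_of_le hpi
    have hi' : i < x.length := by omega
    rw [getElem?_of_drop h, List.getElem?_append_left hi', List.getElem?_eq_getElem hi']
    exact h1 _ (List.getElem_mem _)

theorem blanks_iff {s x r : List (Symb q)} {p : ℕ} (h : s.drop p = x ++ r) :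
    (∀ i < p + x.length, p ≤ i → strSymb s i q) ↔ x = List.replicate x.length .blank := by
  simp only [strSymb_blank]
  rw [forall_drop_iff h fun o => o = some .blank, List.eq_replicate_iff]
  simp

theorem letters_iff {s x r : List (Symb q)} {p : ℕ} (h : s.drop p = x ++ r) :
    (∀ i < p + x.length, p ≤ i → IsLetterAt q (strSymb s) i) ↔ ∃ w : List (Fin q), x = w.map .letter := by
  simp only [isLetterAt_strSymb]
  rw [forall_drop_iff h fun o => ∃ l, o = some (.letter l)]
  have := Set.ext_iff.1 (Set.range_list_map (Symb.letter (q := q))) x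
  simp only [Set.mem_range, Set.mem_ofPred_eq] at this
  simp only [Option.some.injEq, eq_comm (a := x), this]
  simp only [eq_comm]

theorem wordBlock_iff {s x r : List (Symb q)} {p e : ℕ} (h : s.drop p = x ++ r)
    (he : e = p + x.length) : WordBlock q (strSymb s) p e ↔ ∃ w, WritesWord x w := by
  subst he
  constructor
  · rintro ⟨m, hm, hpm, h1, h2⟩
    obtain ⟨m, rfl⟩ := Nat.exists_eq_add_of_le hpm
    have e1 : s.drop p = x.take m ++ (x.drop m ++ r) := by
      rw [← List.append_assoc, List.take_append_drop, h]
    have e2 : s.drop (p + m) = x.drop m ++ r := by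
      rw [← List.drop_drop, h, List.drop_append_of_le_length (by omega)]
    have l1 : (x.take m).length = m := by simp; omega
    have l2 : p + m + (x.drop m).length = p + x.length := by simp; omega
    obtain ⟨w, hw⟩ := (letters_iff e1).1 (by rwa [l1])
    have hb := (blanks_iff e2).1 (by rwa [l2])
    exact ⟨w, _, by rw [← hw, ← hb, List.take_append_drop]⟩
  · rintro ⟨w, k, rfl⟩
    rw [List.append_assoc] at h
    have e2 : s.drop (p + w.length) = List.replicate k .blank ++ r := by
      rw [← List.drop_drop, h, List.drop_left' (by simp)]
    refine ⟨p + w.length, by simp, by omega, ?_, ?_⟩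
    · simpa using (letters_iff h).2 ⟨w, rfl⟩
    · have := (blanks_iff e2).2 (by rw [List.length_replicate])
      simpa [Nat.add_assoc] using this

theorem slotBlock_iff {s : List (Symb q)} {p : ℕ} : SlotBlock q (strSymb s) s.length p ↔
    ∃ x r e, s.drop p = x ++ r ∧ WritesSlot x e := by
  constructor
  · rintro ⟨e, -, hpe, he, h1 | ⟨c, hce, hpc, hc, h1, h2⟩⟩
    · obtain ⟨x, hx, rfl⟩ := exists_cut hpe (strSymb_semi.1 he)
      rw [blanks_iff hx] at h1
      exact ⟨x ++ [.semi], _, none, by rw [hx, List.append_assoc]; rfl, x.length, by rw [← h1]⟩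
    · obtain ⟨x, hx, hxc⟩ := exists_cut hpc (strSymb_comma.1 hc)
      obtain ⟨y, hy, hye⟩ := exists_cut (p := c + 1) hce (strSymb_semi.1 he)
      obtain ⟨u, hu⟩ := (wordBlock_iff hx hxc).1 h1
      obtain ⟨v, hv⟩ := (wordBlock_iff hy hye).1 h2
      exact ⟨x ++ [.comma] ++ y ++ [.semi], s.drop (e + 1), some (u, v), by rw [hx, hy]; simp,
        x, y, hu, hv, rfl⟩
  · rintro ⟨x, r, e, h, hx⟩
    have hlen := congrArg List.length h
    rw [List.length_drop, List.length_append] at hlen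
    rcases e with _ | ⟨u, v⟩
    · obtain ⟨k, rfl⟩ := hx
      rw [List.append_assoc] at h
      have := (blanks_iff h).2 (by simp)
      simp only [List.length_append, List.length_replicate, List.length_singleton] at hlen this
      refine ⟨p + k, by omega, by omega, ?_, Or.inl this⟩
      rw [strSymb_semi, getElem?_of_drop h, List.getElem?_append_right (by simp)]
      simp
    · obtain ⟨s₁, s₂, h1, h2, rfl⟩ := hx
      simp only [List.length_append, List.length_singleton] at hlen
      have e1 : s.drop p = s₁ ++ (.comma :: (s₂ ++ .semi :: r)) := by rw [h]; simp
      have e2 : s.drop (p + s₁.length + 1) = s₂ ++ .semi :: r := by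
        rw [Nat.add_assoc, ← List.drop_drop, e1, ← List.drop_drop, List.drop_left]
        simp
      refine ⟨p + s₁.length + 1 + s₂.length, by omega, by omega, ?_, Or.inr
        ⟨p + s₁.length, by omega, by omega, ?_, (wordBlock_iff e1 rfl).2 ⟨u, h1⟩,
          (wordBlock_iff e2 rfl).2 ⟨v, h2⟩⟩⟩
      · rw [strSymb_semi, getElem?_of_drop e2, List.getElem?_append_right le_rfl]
        simp
      · rw [strSymb_comma, getElem?_of_drop e1, List.getElem?_append_right le_rfl]
        simp

/-- A slot or a bar. -/
def IsItem (x : List (Symb q)) : Prop := x = [.bar] ∨ ∃ e, WritesSlot x e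

theorem IsItem.last {x : List (Symb q)} (h : IsItem x) : ∃ x' σ, x = x' ++ [σ] ∧
    (σ = .semi ∨ σ = .bar) ∧ ∀ τ ∈ x', τ ≠ .semi ∧ τ ≠ .bar := by
  rcases h with rfl | ⟨e, h⟩
  · exact ⟨[], .bar, rfl, Or.inr rfl, by simp⟩
  · obtain ⟨s', h1, h2⟩ := h.last
    exact ⟨s', .semi, h1, Or.inl rfl, h2⟩

/-- Slots and bars are treated alike here: both end with a symbol that occurs nowhere else in them,
so any position after such a symbol begins the next item. -/
theorem exists_item {pre : List (Symb q)} {l : List (List (Symb q))} (hl : ∀ x ∈ l, IsItem x)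
    {a : ℕ} (ha : pre.length ≤ a) (ha' : a < (pre ++ l.flatten).length) (h : a = pre.length ∨
      ∃ σ, (pre ++ l.flatten)[a - 1]? = some σ ∧ (σ = .semi ∨ σ = .bar)) :
    ∃ x r, IsItem x ∧ (pre ++ l.flatten).drop a = x ++ r := by
  induction l generalizing pre with
  | nil => simp at ha'; omega
  | cons y l ih =>
    obtain ⟨y', σ, hy, -, hy'⟩ := (hl y (by simp)).last
    rcases lt_or_ge a (pre.length + y.length) with h3 | h3
    · rcases ha.eq_or_lt with rfl | h4
      · exact ⟨y, l.flatten, hl y (by simp), by simp⟩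
      · obtain ⟨τ, h, h'⟩ := h.resolve_left (by omega)
        have hl : y.length = y'.length + 1 := by rw [hy]; simp
        rw [List.flatten_cons, hy, List.append_assoc, List.getElem?_append_right (by omega),
          List.getElem?_append_left (by omega)] at h
        have := hy' _ (List.mem_of_getElem? h)
        exact (h'.elim this.1 this.2).elim
    · have hs : pre ++ (y :: l).flatten = (pre ++ y) ++ l.flatten := by simp
      have hl' := List.length_append (as := pre) (bs := y)
      rw [hs] at ha' h ⊢
      exact ih (fun x hx => hl x (by simp [hx])) (by omega) ha' (h.imp (fun h => by omega) id)

/-- The global structure follows from a local condition: whatever starts at a slot position ends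
just before another such position. The condition on the last symbol excludes an unfinished table. -/
theorem tablesForm_iff {s : List (Symb q)} : TablesForm q (strSymb s) s.length ↔
    ∃ T : List (List (Slot q)), (∀ t ∈ T, SlotsOK t) ∧ s = T.flatMap tableStr := by
  constructor
  · rintro ⟨h1, h2⟩
    -- Induction on the length `d` that remains after `p`; the first table is separated because a
    -- slot has to be put in front of it.
    have key : ∀ d p, p + d = s.length → SlotStart q (strSymb s) p → s.drop p = [] ∨
        ∃ (t : List (Slot q)) (T : List (List (Slot q))), (SlotsOK t ∧ ∀ t ∈ T, SlotsOK t) ∧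
          s.drop p = tableStr t ++ T.flatMap tableStr := by
      intro d
      induction d using Nat.strong_induction_on with
      | _ d ih =>
        intro p hp hst
        rcases Nat.eq_zero_or_pos d with rfl | hd
        · exact Or.inl (List.drop_eq_nil_of_le (by omega))
        have hpl : p < s.length := by omega
        right
        rcases h2 p hpl hst with hb | hb
        · have e1 : s.drop p = .bar :: s.drop (p + 1) := by
            obtain ⟨x, hx, hx'⟩ := exists_cut le_rfl (strSymb_bar.1 hb)
            obtain rfl : x = [] := List.length_eq_zero_iff.1 (by omega)
            exact hx
          rcases ih (d - 1) (by omega) (p + 1) (by omega) (Or.inr (Or.inr hb)) with h3 | ⟨t, T, h3, h4⟩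
          · exact ⟨[], [], by simp [SlotsOK], by rw [e1, h3]; rfl⟩
          · refine ⟨[], t :: T, ⟨by simp [SlotsOK], ?_⟩, by rw [e1, h4]; rfl⟩
            rintro t' ht'
            rcases List.mem_cons.1 ht' with rfl | ht'
            · exact h3.1
            · exact h3.2 t' ht'
        · obtain ⟨x, r, e, e1, hx⟩ := slotBlock_iff.1 hb
          obtain ⟨x', hx', -⟩ := hx.last
          have hxl : x.length = x'.length + 1 := by rw [hx']; simp
          have hlen := congrArg List.length e1
          rw [List.length_drop, List.length_append] at hlen
          have e2 : s.drop (p + x.length) = r := by rw [← List.drop_drop, e1, List.drop_left]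
          have hsemi : s[p + x.length - 1]? = some .semi := by
            rw [hxl, ← Nat.add_assoc, Nat.add_sub_cancel, getElem?_of_drop e1, hx', List.append_assoc,
              List.getElem?_append_right le_rfl]
            simp
          rcases ih (d - x.length) (by omega) (p + x.length) (by omega)
            (Or.inr (Or.inl (strSymb_semi.2 hsemi))) with h3 | ⟨t, T, h3, h4⟩
          -- The string would end with a semicolon instead of a bar.
          · exfalso
            rw [List.drop_eq_nil_iff] at h3
            rcases h1 with h1 | h1
            · omega
            · rw [strSymb_bar, show s.length - 1 = p + x.length - 1 by omega, hsemi] at h1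
              simp at h1
          · refine ⟨(x, e) :: t, T, ⟨?_, h3.2⟩, ?_⟩
            · intro y hy
              rcases List.mem_cons.1 hy with rfl | hy
              · exact hx
              · exact h3.1 y hy
            · rw [e1, ← e2, h4]
              simp [tableStr]
    rcases key s.length 0 (by omega) (Or.inl rfl) with h | ⟨t, T, h3, h4⟩
    · exact ⟨[], by simp, by simpa using h⟩
    · refine ⟨t :: T, fun t' ht' => ?_, by simpa using h4⟩
      rcases List.mem_cons.1 ht' with rfl | ht'
      · exact h3.1
      · exact h3.2 t' ht'
  · rintro ⟨T, hT, rfl⟩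
    constructor
    · rcases List.eq_nil_or_concat T with rfl | ⟨T, t, rfl⟩
      · simp
      · right
        rw [strSymb_bar, ← List.getLast?_eq_getElem?]
        simp [tableStr]
    · intro p hp hst
      have hfl : T.flatMap tableStr =
          (T.flatMap fun t => t.map Prod.fst ++ [[.bar]]).flatten := by
        clear hT hp hst
        induction T with
        | nil => rfl
        | cons t T ih =>
          rw [List.flatMap_cons, List.flatMap_cons, List.flatten_append, ← ih]
          simp [tableStr, List.flatMap_def]
      have hit : ∀ x ∈ T.flatMap fun t => t.map Prod.fst ++ [[.bar]], IsItem x := by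
        intro x hx
        obtain ⟨t, ht, hx⟩ := List.mem_flatMap.1 hx
        rcases List.mem_append.1 hx with hx | hx
        · obtain ⟨y, hy, rfl⟩ := List.mem_map.1 hx
          exact Or.inr ⟨y.2, hT t ht y hy⟩
        · exact Or.inl (List.mem_singleton.1 hx)
      have := exists_item (pre := []) hit (a := p) (by simp) (by rwa [List.nil_append, ← hfl]) (by
        rw [List.nil_append, ← hfl]
        rcases hst with h | h | h
        · exact Or.inl h
        · exact Or.inr ⟨_, strSymb_semi.1 h, Or.inl rfl⟩
        · exact Or.inr ⟨_, strSymb_bar.1 h, Or.inr rfl⟩)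
      rw [List.nil_append, ← hfl] at this
      obtain ⟨x, r, hx | ⟨e, hx⟩, h⟩ := this
      · left
        subst hx
        rw [strSymb_bar]
        have := getElem?_of_drop h 0
        simpa using this
      · exact Or.inr (slotBlock_iff.2 ⟨x, r, e, h, hx⟩)

/-- The bit string `y` of length `n` consists of codes of symbols. -/
def BlockForm (q : ℕ) (y : ℕ → Prop) (n : ℕ) : Prop :=
  n % (q + 4) = 0 ∧ ∀ i < numSymb q n, ∃ c < q + 4, symbAt q y n i c ∧
    ∀ c' < q + 4, symbAt q y n i c' → c' = c

theorem exists_symb {c : ℕ} (hc : c < q + 4) : ∃ σ : Symb q, σ.code = c := by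
  by_cases h : c < q
  · exact ⟨.letter ⟨c, h⟩, rfl⟩
  · obtain rfl | rfl | rfl | rfl : c = q ∨ c = q + 1 ∨ c = q + 2 ∨ c = q + 3 := by omega
    · exact ⟨.blank, rfl⟩
    · exact ⟨.comma, rfl⟩
    · exact ⟨.semi, rfl⟩
    · exact ⟨.bar, rfl⟩

/-- A bit string is a code exactly if its length is a multiple of `q + 4` and every block has
exactly one bit set. -/
theorem blockForm_iff {x : List Bool} {y : ℕ → Prop}
    (hy : ∀ i < x.length, (y i ↔ x.getD i false = true)) :
    BlockForm q y x.length ↔ ∃ s : List (Symb q), x = toBits s := by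
  constructor
  · rintro ⟨h1, h2⟩
    choose c hc h3 h4 using h2
    choose σ hσ using fun i : Fin (numSymb q x.length) => exists_symb (hc i i.2)
    have hl : numSymb q x.length * (q + 4) = x.length := Nat.div_mul_cancel (Nat.dvd_of_mod_eq_zero h1)
    refine ⟨List.ofFn σ, List.ext_getElem (by rw [length_toBits, List.length_ofFn, hl]) fun j hj hj' => ?_⟩
    have hi : j / (q + 4) < numSymb q x.length := Nat.div_lt_of_lt_mul (by rw [Nat.mul_comm, hl]; exact hj)
    have hm : j % (q + 4) < q + 4 := Nat.mod_lt _ (by omega)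
    have hj2 : j / (q + 4) * (q + 4) + j % (q + 4) = j := Nat.div_add_mod' _ _
    have h5 := getElem?_toBits (List.ofFn σ) (j / (q + 4)) hm
    rw [hj2, List.getElem?_eq_getElem hj', List.getElem?_eq_getElem (by rwa [List.length_ofFn]),
      List.getElem_ofFn, Option.map_some, Option.some.injEq, hσ ⟨_, hi⟩] at h5
    have h6 : symbAt q y x.length (j / (q + 4)) (j % (q + 4)) ↔ x[j] = true := by
      rw [symbAt, and_iff_right ⟨hi, hm⟩, hj2, hy j hj, List.getD_eq_getElem _ _ hj]
    rw [h5, Bool.eq_iff_iff, ← h6, decide_eq_true_iff]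
    constructor
    · exact h4 _ hi _ hm
    · intro h
      rw [h]
      exact h3 _ hi
  · rintro ⟨s, rfl⟩
    rw [BlockForm, symbAt_toBits s hy, numSymb_toBits]
    refine ⟨by rw [length_toBits]; exact Nat.mul_mod_left _ _, fun i hi => ⟨s[i].code, s[i].code_lt,
      ⟨_, List.getElem?_eq_getElem hi, rfl⟩, ?_⟩⟩
    rintro c' - ⟨σ, h, rfl⟩
    rw [List.getElem?_eq_getElem hi, Option.some.injEq] at h
    rw [h]

end Recognition


open Complexity

/-! ### Recognition of tables -/

section Tables

variable {q : ℕ}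

theorem take_append_prefix_iff {w w' : List (Fin q)} {t : ℕ} (ht : t ≤ w.length) {c : Fin q} :
    w.take t ++ [c] <+: w' ↔ (spell w')[t]? = some (c : ℕ) ∧
      ∀ i < t, ∀ k < q, (spell w)[i]? = some k → (spell w')[i]? = some k := by
  have hl : (w.take t).length = t := by simp [ht]
  have h1 : ∀ i < t, (spell (w.take t ++ [c]))[i]? = (spell w)[i]? := fun i hi => by
    rw [spell_append_left (by omega), ← spell_append_left (z := w.drop t) (by omega),
      List.take_append_drop]
  have h2 : (spell (w.take t ++ [c]))[t]? = some (c : ℕ) := by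
    rw [spell_append_right (by omega), hl, Nat.sub_self]
    rfl
  rw [prefix_iff_spell, List.length_append, hl, List.length_singleton]
  constructor
  · intro h
    exact ⟨h t (by omega) c c.2 h2, fun i hi k hk h3 => h i (by omega) k hk (by rwa [h1 i hi])⟩
  · rintro ⟨h3, h4⟩ i hi k hk h5
    rcases Nat.lt_succ_iff_lt_or_eq.1 hi with hi | rfl
    · exact h4 i hi k hk (by rwa [h1 i hi] at h5)
    · rw [h2, Option.some.injEq] at h5
      rwa [← h5]

/-- The relation `L` describes a table with numbered entries. -/
def TableForm (q M : ℕ) (L : ℕ → ℕ → ℕ → ℕ → Prop) : Prop :=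
  (∃ a < M, ∃ t < M, L a 0 t q) ∧ ∀ d < 2,
    (∀ a < M, ∀ a' < M, (∃ t < M, L a 0 t q) → (∃ t < M, L a' 0 t q) → ¬ a = a' →
      ∃ t < M, ∃ c < q, L a d t c ∧ ¬ L a' d t c) ∧
    ∀ a < M, ∀ t < M, (∃ c < q, L a d t c) → ∀ c < q, ∃ a' < M, L a' d t c ∧
      ∀ i < t, ∀ k < q, L a d i k → L a' d i k

/-- `TableForm` expresses by bounded quantifiers that both components have the prefix property and
branch completely. Distinct numbers with the same entry are excluded by the prefix property too, as
every word is a prefix of itself. -/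
theorem tableForm_iff {M : ℕ} {L : ℕ → ℕ → ℕ → ℕ → Prop}
    {E : ℕ → List (Fin q) → List (Fin q) → Prop}
    (hL : ∀ a d t k, L a d t k ↔ ∃ u v, E a u v ∧ d < 2 ∧ (spell (side d u v))[t]? = some k)
    (hE : ∀ a u v u' v', E a u v → E a u' v' → u = u' ∧ v = v')
    (hM : ∀ a u v, E a u v → a < M ∧ u.length < M ∧ v.length < M) :
    TableForm q M L ↔ (∀ a a' u v, E a u v → E a' u v → a = a') ∧
      IsTableSet {e : List (Fin q) × List (Fin q) | ∃ a, E a e.1 e.2} := by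
  have hLE : ∀ {a d t k u v}, E a u v → d < 2 → (L a d t k ↔ (spell (side d u v))[t]? = some k) := by
    intro a d t k u v h hd
    rw [hL]
    constructor
    · rintro ⟨u', v', h1, -, h2⟩
      obtain ⟨rfl, rfl⟩ := hE _ _ _ _ _ h h1
      exact h2
    · exact fun h2 => ⟨u, v, h, hd, h2⟩
  have hside : ∀ {a u v}, E a u v → ∀ d, (side d u v).length < M := fun h d => by
    cases d
    · exact (hM _ _ _ h).2.1
    · exact (hM _ _ _ h).2.2
  have hact : ∀ a, (∃ t < M, L a 0 t q) ↔ ∃ u v, E a u v := fun a => by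
    constructor
    · rintro ⟨t, -, h⟩
      obtain ⟨u, v, h, -⟩ := (hL _ _ _ _).1 h
      exact ⟨u, v, h⟩
    · rintro ⟨u, v, h⟩
      exact ⟨u.length, (hM _ _ _ h).2.1, (hLE h (by omega)).2 spell_length⟩
  have hne : (∃ a < M, ∃ t < M, L a 0 t q) ↔ ∃ a u v, E a u v := by
    simp only [hact]
    constructor
    · rintro ⟨a, -, h⟩
      exact ⟨a, h⟩
    · rintro ⟨a, u, v, h⟩
      exact ⟨a, (hM _ _ _ h).1, u, v, h⟩
  -- The formula is the contrapositive of the prefix property: of two different entries, each has a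
  -- letter that the other one does not have at that place.
  have hpre : ∀ d < 2, (∀ a < M, ∀ a' < M, (∃ t < M, L a 0 t q) → (∃ t < M, L a' 0 t q) →
      ¬ a = a' → ∃ t < M, ∃ c < q, L a d t c ∧ ¬ L a' d t c) ↔
      ∀ a u v a' u' v', E a u v → E a' u' v' → side d u v <+: side d u' v' → a = a' := by
    intro d hd
    simp only [hact]
    constructor
    · intro h a u v a' u' v' h1 h2 h3
      by_contra hc
      obtain ⟨t, -, c, hc, h4, h5⟩ := h a (hM _ _ _ h1).1 a' (hM _ _ _ h2).1 ⟨u, v, h1⟩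
        ⟨u', v', h2⟩ hc
      rw [hLE h1 hd] at h4
      rw [hLE h2 hd] at h5
      exact h5 (prefix_iff_spell.1 h3 t (lt_of_spell h4 hc) c hc h4)
    · rintro h a - a' - ⟨u, v, h1⟩ ⟨u', v', h2⟩ hne
      have h3 := mt (h a u v a' u' v' h1 h2) hne
      rw [prefix_iff_spell] at h3
      push Not at h3
      obtain ⟨t, ht, c, hc, h4, h5⟩ := h3
      exact ⟨t, ht.trans (hside h1 d), c, hc, (hLE h1 hd).2 h4, mt (hLE h2 hd).1 h5⟩
  have hcom : ∀ d < 2, (∀ a < M, ∀ t < M, (∃ c < q, L a d t c) → ∀ c < q, ∃ a' < M, L a' d t c ∧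
      ∀ i < t, ∀ k < q, L a d i k → L a' d i k) ↔
      ∀ a u v, E a u v → ∀ t < (side d u v).length, ∀ c, ∃ a' u' v', E a' u' v' ∧
        (side d u v).take t ++ [c] <+: side d u' v' := by
    intro d hd
    constructor
    · intro h a u v h1 t ht c
      obtain ⟨a', -, h2, h3⟩ := h a (hM _ _ _ h1).1 t (ht.trans (hside h1 d))
        ⟨_, ((side d u v)[t]).2, (hLE h1 hd).2 (spell_getElem?_of_lt ht)⟩ c c.2
      obtain ⟨u', v', h4, -, h5⟩ := (hL _ _ _ _).1 h2
      refine ⟨a', u', v', h4, (take_append_prefix_iff ht.le).2 ⟨h5, fun i hi k hk h6 => ?_⟩⟩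
      exact (hLE h4 hd).1 (h3 i hi k hk ((hLE h1 hd).2 h6))
    · rintro h a - t - ⟨c₀, hc₀, h1⟩ c hc
      obtain ⟨u, v, h1, -, h2⟩ := (hL _ _ _ _).1 h1
      have ht := lt_of_spell h2 hc₀
      obtain ⟨a', u', v', h3, h4⟩ := h a u v h1 t ht ⟨c, hc⟩
      obtain ⟨h5, h6⟩ := (take_append_prefix_iff ht.le).1 h4
      exact ⟨a', (hM _ _ _ h3).1, (hLE h3 hd).2 h5, fun i hi k hk h7 =>
        (hLE h3 hd).2 (h6 i hi k hk ((hLE h1 hd).1 h7))⟩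
  have hfin : {e : List (Fin q) × List (Fin q) | ∃ a, E a e.1 e.2}.Finite := by
    refine Set.Finite.subset ((List.finite_length_le (Fin q) M).prod
      (List.finite_length_le (Fin q) M)) ?_
    rintro ⟨u, v⟩ ⟨a, h⟩
    exact ⟨(hM _ _ _ h).2.1.le, (hM _ _ _ h).2.2.le⟩
  rw [TableForm, hne]
  constructor
  · rintro ⟨⟨a, u, v, h⟩, h'⟩
    have p0 := (hpre 0 (by omega)).1 (h' 0 (by omega)).1
    have p1 := (hpre 1 (by omega)).1 (h' 1 (by omega)).1
    have c0 := (hcom 0 (by omega)).1 (h' 0 (by omega)).2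
    have c1 := (hcom 1 (by omega)).1 (h' 1 (by omega)).2
    refine ⟨fun a a' u v h1 h2 => p0 _ _ _ _ _ _ h1 h2 (List.prefix_refl _), hfin, ⟨(u, v), a, h⟩,
      ?_, ?_, ?_, ?_⟩
    · rintro ⟨u, v⟩ ⟨a, h1⟩ ⟨u', v'⟩ ⟨a', h2⟩ hp
      obtain rfl := p0 _ _ _ _ _ _ h1 h2 hp
      obtain ⟨rfl, rfl⟩ := hE _ _ _ _ _ h1 h2
      rfl
    · rintro ⟨u, v⟩ ⟨a, h1⟩ ⟨u', v'⟩ ⟨a', h2⟩ hp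
      obtain rfl := p1 _ _ _ _ _ _ h1 h2 hp
      obtain ⟨rfl, rfl⟩ := hE _ _ _ _ _ h1 h2
      rfl
    · rintro ⟨u, v⟩ ⟨a, h1⟩ t ht c
      obtain ⟨a', u', v', h2, h3⟩ := c0 _ _ _ h1 t ht c
      exact ⟨(u', v'), ⟨a', h2⟩, h3⟩
    · rintro ⟨u, v⟩ ⟨a, h1⟩ t ht c
      obtain ⟨a', u', v', h2, h3⟩ := c1 _ _ _ h1 t ht c
      exact ⟨(u', v'), ⟨a', h2⟩, h3⟩
  · rintro ⟨hinj, hT⟩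
    refine ⟨?_, fun d hd => ?_⟩
    · obtain ⟨⟨u, v⟩, a, h⟩ := hT.nonempty
      exact ⟨a, u, v, h⟩
    rw [hpre d hd, hcom d hd]
    obtain rfl | rfl : d = 0 ∨ d = 1 := by omega
    · refine ⟨fun a u v a' u' v' h1 h2 hp => ?_, fun a u v h1 t ht c => ?_⟩
      · have := hT.left (u, v) ⟨a, h1⟩ (u', v') ⟨a', h2⟩ hp
        rw [Prod.mk.injEq] at this
        obtain ⟨rfl, rfl⟩ := this
        exact hinj _ _ _ _ h1 h2
      · obtain ⟨⟨u', v'⟩, ⟨a', h2⟩, h3⟩ := hT.complete_left (u, v) ⟨a, h1⟩ t ht c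
        exact ⟨a', u', v', h2, h3⟩
    · refine ⟨fun a u v a' u' v' h1 h2 hp => ?_, fun a u v h1 t ht c => ?_⟩
      · have := hT.right (u, v) ⟨a, h1⟩ (u', v') ⟨a', h2⟩ hp
        rw [Prod.mk.injEq] at this
        obtain ⟨rfl, rfl⟩ := this
        exact hinj _ _ _ _ h1 h2
      · obtain ⟨⟨u', v'⟩, ⟨a', h2⟩, h3⟩ := hT.complete_right (u, v) ⟨a, h1⟩ t ht c
        exact ⟨a', u', v', h2, h3⟩

/-- The bit string `y` of length `n` describes a sequence of isomorphisms. -/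
def Valid (q : ℕ) (y : ℕ → Prop) (n : ℕ) : Prop :=
  (BlockForm q y n ∧ TablesForm q (symbAt q y n) (numSymb q n)) ∧
    ∀ p < numSymb q n, TableStart q (symbAt q y n) p →
      TableForm q (numSymb q n) (Leaf q (numSymb q n) (symbAt q y n) p)

/-- A repeated entry would stand in two slots, which have different positions since slots are
non-empty strings. -/
theorem nodup_of_slotAt_inj {o : ℕ} {t : List (Slot q)} (ht : SlotsOK t)
    (h : ∀ a a' u v, (∃ x, SlotAt o t a (x, some (u, v))) → (∃ x, SlotAt o t a' (x, some (u, v))) →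
      a = a') : (t.map Prod.snd).reduceOption.Nodup := by
  induction t generalizing o with
  | nil => simp
  | cons y t ih =>
    have ht' : SlotsOK t := fun x hx => ht x (by simp [hx])
    have ih' := ih (o := o + y.1.length) ht' fun a a' u v ⟨x, h1⟩ ⟨x', h2⟩ =>
      h a a' u v ⟨x, Or.inr h1⟩ ⟨x', Or.inr h2⟩
    rcases y with ⟨s, _ | ⟨u, v⟩⟩
    · exact ih'
    · rw [List.map_cons, List.reduceOption_cons_of_some, List.nodup_cons]
      refine ⟨fun hmem => ?_, ih'⟩
      obtain ⟨a, x, hx⟩ := (exists_slotAt_iff (o := o + s.length)).2 hmem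
      have h1 := h o a u v ⟨s, Or.inl ⟨rfl, rfl⟩⟩ ⟨x, Or.inr hx⟩
      obtain ⟨s', h2, -⟩ := (ht (s, some (u, v)) (by simp)).last
      have h3 : s.length = s'.length + 1 := by
        have := congrArg List.length h2
        simpa using this
      have := (hx.bounds ht').1
      omega

theorem isTable_of_isTableSet {o : ℕ} {t : List (Slot q)} (ht : SlotsOK t) :
    ((∀ a a' u v, (∃ x, SlotAt o t a (x, some (u, v))) → (∃ x, SlotAt o t a' (x, some (u, v))) →
      a = a') ∧ IsTableSet {e : List (Fin q) × List (Fin q) |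
        ∃ a, ∃ x, SlotAt o t a (x, some (e.1, e.2))}) ↔
      ∃ f, IsTable (t.map Prod.snd).reduceOption f := by
  constructor
  · rintro ⟨h1, h2⟩
    refine ⟨h2.toEssIso, isTable_iff.2 ⟨nodup_of_slotAt_inj ht h1, fun u v => ?_⟩⟩
    rw [h2.entry_toEssIso, ← exists_slotAt_iff (o := o)]
    rfl
  · rintro ⟨f, hf⟩
    rw [isTable_iff] at hf
    have h1 : ∀ u v, (u, v) ∈ {e : List (Fin q) × List (Fin q) |
        ∃ a, ∃ x, SlotAt o t a (x, some (e.1, e.2))} ↔ f.Entry u v := fun u v => by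
      rw [← hf.2, ← exists_slotAt_iff (o := o)]
      rfl
    refine ⟨fun a a' u v ⟨x, h2⟩ ⟨x', h3⟩ => h2.inj h3 hf.1, EssIso.isTableSet ?_ h1⟩
    refine ((t.map Prod.snd).reduceOption.finite_toSet).subset ?_
    rintro ⟨u, v⟩ h
    exact exists_slotAt_iff.1 h

/-- The only bar of a table is its last symbol. -/
theorem tableStart_iff {T : List (List (Slot q))} (hT : ∀ t ∈ T, SlotsOK t) {p : ℕ}
    (hp : p < (T.flatMap tableStr).length) :
    TableStart q (strSymb (T.flatMap tableStr)) p ↔ ∃ t, TableAt 0 T p t := by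
  suffices h : ∀ pre : List (Symb q), pre.length ≤ p → p < (pre ++ T.flatMap tableStr).length →
      ((p = pre.length ∨ (pre ++ T.flatMap tableStr)[p - 1]? = some .bar) ↔
        ∃ t, TableAt pre.length T p t) by
    have := h [] (Nat.zero_le _) hp
    rwa [List.nil_append, List.length_nil, ← strSymb_bar] at this
  clear hp
  induction T with
  | nil =>
    intro pre h1 h2
    simp at h2
    omega
  | cons t T ih =>
    intro pre h1 h2
    have ht := hT t (by simp)
    have hs : pre ++ (t :: T).flatMap tableStr = (pre ++ tableStr t) ++ T.flatMap tableStr := by simp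
    have hl := List.length_append (as := pre) (bs := tableStr t)
    have htl : (tableStr t).length = (t.flatMap Prod.fst).length + 1 := by simp [tableStr]
    rw [hs] at h2 ⊢
    rcases lt_or_ge p (pre.length + (tableStr t).length) with h3 | h3
    · constructor
      · intro h
        obtain rfl : p = pre.length := by
          by_contra hne
          have h := h.resolve_left hne
          rw [List.getElem?_append_left (by omega), List.getElem?_append_right (by omega), tableStr,
            List.getElem?_append_left (by omega)] at h
          exact ht.ne_bar _ (List.mem_of_getElem? h) rfl
        exact ⟨t, Or.inl ⟨rfl, rfl⟩⟩
      · rintro ⟨t', ⟨h, -⟩ | h⟩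
        · exact Or.inl h
        · have := h.bounds.1
          omega
    · have key := ih (fun t ht => hT t (by simp [ht])) (pre ++ tableStr t) (by omega) h2
      rw [hl] at key
      have hbar : (pre ++ tableStr t ++ T.flatMap tableStr)[pre.length + (tableStr t).length - 1]? =
          some .bar := by
        rw [List.getElem?_append_left (by omega), List.getElem?_append_right (by omega), tableStr,
          List.getElem?_append_right (by simp)]
        simp
      have h4 : (p = pre.length ∨ (pre ++ tableStr t ++ T.flatMap tableStr)[p - 1]? = some .bar) ↔
          (p = pre.length + (tableStr t).length ∨
            (pre ++ tableStr t ++ T.flatMap tableStr)[p - 1]? = some .bar) := by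
        constructor
        · exact fun h => Or.inr (h.resolve_left (by omega))
        · rintro (h | h)
          · right; rw [h]; exact hbar
          · exact Or.inr h
      rw [h4, key]
      refine exists_congr fun t' => ?_
      rw [TableAt, or_iff_right]
      rintro ⟨rfl, -⟩
      omega

/-- The string is first cut into tables, and then each table is tested alone. A table has an
isomorphism exactly if it passes the test, so the isomorphisms can be chosen one by one. -/
theorem valid_iff {x : List Bool} {y : ℕ → Prop}
    (hy : ∀ i < x.length, (y i ↔ x.getD i false = true)) :
    Valid q y x.length ↔ ∃ fs : List (EssIso (Fin q)), Describes x fs := by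
  have key : ∀ T : List (List (Slot q)), (∀ t ∈ T, SlotsOK t) → x = toBits (T.flatMap tableStr) →
      ((∀ p < numSymb q x.length, TableStart q (symbAt q y x.length) p →
        TableForm q (numSymb q x.length) (Leaf q (numSymb q x.length) (symbAt q y x.length) p)) ↔
      ∀ t ∈ T, ∃ f, IsTable (t.map Prod.snd).reduceOption f) := by
    rintro T hT rfl
    rw [symbAt_toBits _ hy, numSymb_toBits]
    have h1 : ∀ p t, TableAt 0 T p t →
        (TableForm q (T.flatMap tableStr).length (Leaf q (T.flatMap tableStr).length
          (strSymb (T.flatMap tableStr)) p) ↔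
        ∃ f, IsTable (t.map Prod.snd).reduceOption f) := by
      intro p t hpt
      have ht := hT t hpt.mem
      have hTt : ∀ a z, TableSlotAt 0 T p a z ↔ SlotAt p t a z := fun a z => by
        rw [tableSlotAt_iff]
        constructor
        · rintro ⟨t', h1, h2⟩
          have hl : ∀ t : List (Slot q), p < p + (tableStr t).length := fun t => by simp [tableStr]
          rwa [(hpt.disjoint h1 (hl _) (hl _)).2]
        · exact fun h => ⟨t, hpt, h⟩
      rw [← isTable_of_isTableSet (o := p) ht, tableForm_iff fun a d t' k => ?_]
      · rintro a u v u' v' ⟨z, h2⟩ ⟨z', h3⟩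
        have := congrArg Prod.snd (h2.unique h3 ht)
        simpa using this
      · rintro a u v ⟨z, h2⟩
        obtain ⟨hw, l, l', r, h3, h4, h5, -⟩ := ((hTt _ _).2 h2).split hT
        have h6 := congrArg List.length h3
        have h7 : u.length + v.length + 2 ≤ z.length := hw.length_le
        simp only [List.length_append] at h6
        omega
      · rw [leaf_iff hT le_rfl]
        simp only [hTt]
        constructor
        · rintro ⟨z, u, v, h2, h3⟩
          exact ⟨u, v, ⟨z, h2⟩, h3⟩
        · rintro ⟨u, v, ⟨z, h2⟩, h3⟩
          exact ⟨z, u, v, h2, h3⟩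
    constructor
    · intro h t ht
      obtain ⟨p, hp⟩ : ∃ p, TableAt 0 T p t := by
        clear hy h h1 hT
        generalize 0 = o
        induction T generalizing o with
        | nil => simp at ht
        | cons t' T ih =>
          rcases List.mem_cons.1 ht with rfl | ht
          · exact ⟨o, Or.inl ⟨rfl, rfl⟩⟩
          · obtain ⟨p, hp⟩ := ih ht (o + (tableStr t').length)
            exact ⟨p, Or.inr hp⟩
      have hb := hp.bounds.2
      have hl : (tableStr t).length ≠ 0 := by simp [tableStr]
      have hpl : p < (T.flatMap tableStr).length := by omega
      exact (h1 p t hp).1 (h p hpl ((tableStart_iff hT hpl).2 ⟨t, hp⟩))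
    · intro h p hp hst
      obtain ⟨t, ht⟩ := (tableStart_iff hT hp).1 hst
      exact (h1 p t ht).2 (h t ht.mem)
  constructor
  · rintro ⟨⟨h1, h2⟩, h3⟩
    obtain ⟨s, rfl⟩ := (blockForm_iff hy).1 h1
    rw [symbAt_toBits s hy, numSymb_toBits, tablesForm_iff] at h2
    obtain ⟨T, hT, rfl⟩ := h2
    choose f hf using (key T hT rfl).1 h3
    refine ⟨T.attach.map fun t : {t // t ∈ T} => f t.1 t.2, describes_iff.2 ⟨T, ?_, rfl⟩⟩
    rw [List.forall₂_map_right_iff]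
    have : List.Forall₂ (fun (t : List (Slot q)) (t' : {t // t ∈ T}) => t = t') T T.attach := by
      have h := List.forall₂_map_left_iff (R := fun (t : List (Slot q)) (t' : {t // t ∈ T}) => t = t')
        (f := Subtype.val) (l := T.attach) (u := T.attach)
      rw [List.attach_map_subtype_val] at h
      exact h.2 (List.forall₂_same.2 fun _ _ => rfl)
    refine this.imp ?_
    rintro t t' rfl
    exact ⟨hT t' t'.2, hf t' t'.2⟩
  · rintro ⟨fs, h⟩
    obtain ⟨T, hT, rfl⟩ := describes_iff.1 h
    have hok := IsDescription.slotsOK hT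
    refine ⟨⟨(blockForm_iff hy).2 ⟨_, rfl⟩, ?_⟩, (key T hok rfl).2 ?_⟩
    · rw [symbAt_toBits _ hy, numSymb_toBits, tablesForm_iff]
      exact ⟨T, hok, rfl⟩
    · clear h hok key hy
      induction hT with
      | nil => simp
      | cons h1 _ ih =>
        intro t ht
        rcases List.mem_cons.1 ht with rfl | ht
        · exact ⟨_, h1.2⟩
        · exact ih t ht

end Tables

/-! ### Definability of the recognition of descriptions -/

section Definability

variable {q k : ℕ} {m : ℕ → ℕ} {fn f1 f2 : (Fin (k + 1) → ℕ) → ℕ}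

theorem LF.numSymb (hn : LF fn) : LF fun v => numSymb q (fn v) := hn.div (.const (q + 4))

theorem definable_wordBlock (hm : LF fun v : Fin 1 → ℕ => m (v 0)) (hn : LF fn) (h1 : LF f1)
    (h2 : LF f2) : Definable m fun y v => WordBlock q (symbAt q y (fn v)) (f1 v) (f2 v) :=
  Definable.ex hm h2.succ ((Definable.atom hm (LP.le h1.lift (.var 0))).and hm
    ((Definable.all hm (.var 0) ((Definable.atom hm (LP.le h1.lift.lift (.var 0))).imp hm
      (definable_isLetterAt hm hn.lift.lift (.var 0)))).and hm
    (Definable.all hm h2.lift ((Definable.atom hm (LP.le (.var 1) (.var 0))).imp hm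
      (definable_symbAt hm hn.lift.lift (.var 0) (.const q))))))

theorem definable_slotBlock (hm : LF fun v : Fin 1 → ℕ => m (v 0)) (hn : LF fn) (h1 : LF f1)
    (h2 : LF f2) : Definable m fun y v => SlotBlock q (symbAt q y (fn v)) (f1 v) (f2 v) :=
  Definable.ex hm h1 ((Definable.atom hm (LP.le h2.lift (.var 0))).and hm
    ((definable_symbAt hm hn.lift (.var 0) (.const (q + 2))).and hm
    ((Definable.all hm (.var 0) ((Definable.atom hm (LP.le h2.lift.lift (.var 0))).imp hm
      (definable_symbAt hm hn.lift.lift (.var 0) (.const q)))).or hm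
    (Definable.ex hm (.var 0) ((Definable.atom hm (LP.le h2.lift.lift (.var 0))).and hm
      ((definable_symbAt hm hn.lift.lift (.var 0) (.const (q + 1))).and hm
      ((definable_wordBlock hm hn.lift.lift h2.lift.lift (.var 0)).and hm
        (definable_wordBlock hm hn.lift.lift (LF.var 0).succ (.var 1)))))))))

theorem definable_tablesForm (hm : LF fun v : Fin 1 → ℕ => m (v 0)) (hn : LF fn) (h1 : LF f1) :
    Definable m fun y v => TablesForm q (symbAt q y (fn v)) (f1 v) :=
  ((Definable.atom hm (LP.eq h1 .zero)).or hm (definable_symbAt hm hn h1.pred (.const (q + 3)))).and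
    hm (Definable.all hm h1 ((definable_slotStart hm hn.lift (.var 0)).imp hm
      ((definable_symbAt hm hn.lift (.var 0) (.const (q + 3))).or hm
        (definable_slotBlock hm hn.lift h1.lift (.var 0)))))

theorem definable_blockForm (hm : LF fun v : Fin 1 → ℕ => m (v 0)) (hn : LF fn) :
    Definable m fun y v => BlockForm q y (fn v) :=
  (Definable.atom hm (LP.eq (hn.mod (.const (q + 4))) .zero)).and hm
    (Definable.all hm (LF.numSymb hn) (Definable.ex hm (.const (q + 4))
      ((definable_symbAt hm hn.lift.lift (.var 1) (.var 0)).and hm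
      (Definable.all hm (.const (q + 4)) ((definable_symbAt hm hn.lift.lift.lift (.var 2)
        (.var 0)).imp hm (Definable.atom hm (LP.eq (.var 0) (.var 1))))))))

/-- The relation `L` has parameters and occurs under different numbers of quantifiers. The
hypothesis `hL` therefore allows any context, in which `e` locates the parameters. -/
theorem definable_tableForm (hm : LF fun v : Fin 1 → ℕ => m (v 0))
    {L : (ℕ → Prop) → (Fin (k + 1) → ℕ) → ℕ → ℕ → ℕ → ℕ → Prop} (h1 : LF f1)
    (hL : ∀ {l : ℕ} {e : (Fin (l + 1) → ℕ) → Fin (k + 1) → ℕ} {g1 g2 g3 g4 : (Fin (l + 1) → ℕ) → ℕ},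
      (∀ i, LF fun v => e v i) → LF g1 → LF g2 → LF g3 → LF g4 →
        Definable m fun y v => L y (e v) (g1 v) (g2 v) (g3 v) (g4 v)) :
    Definable m fun y v => TableForm q (f1 v) (L y v) := by
  have act : ∀ {l : ℕ} {e : (Fin (l + 1) → ℕ) → Fin (k + 1) → ℕ} {g : (Fin (l + 1) → ℕ) → ℕ},
      (∀ i, LF fun v => e v i) → LF g → Definable m fun y v => ∃ t < f1 (e v), L y (e v) (g v) 0 t q :=
    fun {l e g} he hg => Definable.ex hm (LF.comp h1 he) (hL (fun i => (he i).lift) hg.lift .zero (.var 0) (.const q))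
  have e0 : ∀ i, LF fun v : Fin (k + 1) → ℕ => v i := fun i => .var i
  have e1 := fun i => (e0 i).lift
  have e2 := fun i => (e1 i).lift
  have e3 := fun i => (e2 i).lift
  have e4 := fun i => (e3 i).lift
  have e5 := fun i => (e4 i).lift
  have e6 := fun i => (e5 i).lift
  have e7 := fun i => (e6 i).lift
  refine (Definable.ex hm h1 (act e1 (.var 0))).and hm (Definable.all hm (.const 2)
    ((Definable.all hm h1.lift (Definable.all hm h1.lift.lift ((act e3 (.var 1)).imp hm
      ((act e3 (.var 0)).imp hm ((Definable.atom hm (LP.eq (.var 1) (.var 0)).not).imp hm ?_))))).and hm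
    (Definable.all hm h1.lift (Definable.all hm h1.lift.lift (Definable.imp hm ?_
      (Definable.all hm (.const q) (Definable.ex hm h1.lift.lift.lift.lift (Definable.and hm ?_
        (Definable.all hm (.var 2) (Definable.all hm (.const q) (Definable.imp hm ?_ ?_)))))))))))
  · exact Definable.ex hm h1.lift.lift.lift (Definable.ex hm (.const q)
      ((hL e5 (.var 3) (.var 4) (.var 1) (.var 0)).and hm
        ((hL e5 (.var 2) (.var 4) (.var 1) (.var 0)).not hm)))
  · exact Definable.ex hm (.const q) (hL e4 (.var 2) (.var 3) (.var 1) (.var 0))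
  · exact hL e5 (.var 0) (.var 4) (.var 2) (.var 1)
  · exact hL e7 (.var 5) (.var 6) (.var 1) (.var 0)
  · exact hL e7 (.var 2) (.var 6) (.var 1) (.var 0)

theorem definable_valid (hm : LF fun v : Fin 1 → ℕ => m (v 0)) (hn : LF fn) :
    Definable m fun y v => Valid q y (fn v) := by
  refine ((definable_blockForm hm hn).and hm (definable_tablesForm hm hn (LF.numSymb hn))).and hm
    (Definable.all hm (LF.numSymb hn) ((definable_tableStart hm hn.lift (.var 0)).imp hm
      (definable_tableForm hm (LF.numSymb hn.lift)
        (L := fun y v => Leaf q (numSymb q (fn fun i => v i.succ)) (symbAt q y (fn fun i => v i.succ)) (v 0)) ?_)))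
  intro l e g1 g2 g3 g4 he h1 h2 h3 h4
  have h0 : LF fun v => fn fun i => e v i.succ := LF.comp hn fun i => he i.succ
  exact definable_leaf hm (LF.numSymb h0) h0 (he 0) h1 h2 h3 h4

end Definability


open Complexity

/-! ### The word problem -/

section Product

variable {q : ℕ}

/-- The element of the group that is represented by an isomorphism, which may be absent. -/
noncomputable def optMaxIso (f : Option (EssIso (Fin q))) : MaxIso (Fin q) := f.elim 1 EssIso.toMaxIso

theorem optMaxIso_ocomp (f g : Option (EssIso (Fin q))) :
    optMaxIso (ocomp f g) = optMaxIso f * optMaxIso g := by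
  rcases f with _ | f
  · exact (one_mul _).symm
  · rcases g with _ | g
    · exact (mul_one _).symm
    · exact f.toMaxIso_comp g

/-- The tree keeps the order of the factors: block `b` of level `l` covers the blocks from `b * 2 ^
l` on, and the left half stands on the left of the product. -/
theorem optMaxIso_levelIso (F : ℕ → Option (EssIso (Fin q))) (l b : ℕ) :
    optMaxIso (levelIso F l b) =
      ((List.range' (b * 2 ^ l) (2 ^ l)).map fun i => optMaxIso (F i)).prod := by
  induction l generalizing b with
  | zero => simp [levelIso]
  | succ l ih =>
    have h : List.range' (b * 2 ^ (l + 1)) (2 ^ (l + 1)) =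
        List.range' (2 * b * 2 ^ l) (2 ^ l) ++ List.range' ((2 * b + 1) * 2 ^ l) (2 ^ l) := by
      rw [show (2 * b + 1) * 2 ^ l = 2 * b * 2 ^ l + 2 ^ l by ring, List.range'_append_1]
      congr 1 <;> ring
    rw [levelIso, optMaxIso_ocomp, ih, ih, h, List.map_append, List.prod_append]

theorem isoAt_eq_none {o : ℕ} {T : List (List (Slot q))} {fs : List (EssIso (Fin q))} {p : ℕ}
    (h : p < o) : isoAt o T fs p = none := by
  induction T generalizing o fs with
  | nil => rfl
  | cons t T ih =>
    rcases fs with _ | ⟨f, fs⟩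
    · rfl
    · rw [isoAt, if_neg (by omega), ih (by omega)]

/-- Blocks are numbered by positions in the string, and most of them are absent. They count as `1`,
so neither the gaps nor an excess of `m` matters. -/
theorem prod_isoAt {P : List (Slot q) → EssIso (Fin q) → Prop} {T : List (List (Slot q))}
    {fs : List (EssIso (Fin q))} (h : List.Forall₂ P T fs) (o m : ℕ)
    (hm : (T.flatMap tableStr).length ≤ m) :
    ((List.range' o m).map fun i => optMaxIso (isoAt o T fs i)).prod =
      (fs.map EssIso.toMaxIso).prod := by
  induction h generalizing o m with
  | nil =>
    refine List.prod_eq_one fun x hx => ?_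
    obtain ⟨i, -, rfl⟩ := List.mem_map.1 hx
    rfl
  | @cons t f T fs h1 h2 ih =>
    have hl : (tableStr t).length = (t.flatMap Prod.fst).length + 1 := by simp [tableStr]
    rw [List.flatMap_cons, List.length_append] at hm
    have hr : List.range' o m = o :: List.range' (o + 1) ((tableStr t).length - 1) ++
        List.range' (o + (tableStr t).length) (m - (tableStr t).length) := by
      rw [← List.range'_succ, Nat.sub_add_cancel (by omega), List.range'_append_1]
      congr 1
      omega
    rw [hr, List.map_append, List.prod_append, List.map_cons, List.prod_cons,
      List.prod_eq_one (l := List.map _ (List.range' (o + 1) _)), List.map_cons, List.prod_cons,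
      ← ih (o + (tableStr t).length) (m - (tableStr t).length) (by omega), mul_one]
    · congr 2
      · simp [isoAt, optMaxIso]
      · refine List.map_congr_left fun i hi => ?_
        have := List.mem_range'_1.1 hi
        rw [isoAt, if_neg (by omega)]
    · intro x hx
      obtain ⟨i, hi, rfl⟩ := List.mem_map.1 hx
      have := List.mem_range'_1.1 hi
      rw [isoAt, if_neg (by omega), isoAt_eq_none (by omega)]
      rfl

end Product

/-! ### The iteration that decides the word problem -/

section WordProblem

/-- The answer of the last round: the input describes a sequence of isomorphisms, and the table
that has been computed is a table of a restriction of the identity. -/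
def IsTrivial (q : ℕ) (y : ℕ → Prop) (n _b _a : ℕ) : Prop :=
  Valid q y n ∧ ∀ a < bound q n + 1, ∀ t < bound q n + 1, ∀ k < q + 1,
    (relAt y n 0 a 0 t k → relAt y n 0 a 1 t k) ∧ (relAt y n 0 a 1 t k → relAt y n 0 a 0 t k)

theorem definable_isTrivial {q k : ℕ} {m : ℕ → ℕ} (hm : LF fun v : Fin 1 → ℕ => m (v 0))
    {f1 f2 f3 : (Fin (k + 1) → ℕ) → ℕ} (h1 : LF f1) :
    Definable m fun y v => IsTrivial q y (f1 v) (f2 v) (f3 v) := by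
  have hr : ∀ d d', Definable m (k := k + 3) fun y v =>
      relAt y (f1 fun i => v i.succ.succ.succ) 0 (v 2) d (v 1) (v 0) →
        relAt y (f1 fun i => v i.succ.succ.succ) 0 (v 2) d' (v 1) (v 0) := fun d d' =>
    (definable_relAt hm h1.lift.lift.lift .zero (.var 2) (.const d) (.var 1) (.var 0)).imp hm
      (definable_relAt hm h1.lift.lift.lift .zero (.var 2) (.const d') (.var 1) (.var 0))
  exact (definable_valid hm h1).and hm (Definable.all hm (LF.bound h1).succ (Definable.all hm
    (LF.bound h1).succ.lift (Definable.all hm (.const (q + 1)) ((hr 0 1).and hm (hr 1 0)))))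

/-- After `Nat.log 2 n + 1` doublings the words still have length at most `2 * n * n`. This is one
reason for the quadratic `bound`. -/
theorem two_pow_mul_le_bound (q : ℕ) {n N : ℕ} (h : N ≤ n) :
    2 ^ (Nat.log 2 n + 1) * N ≤ bound q n := by
  have h1 : 2 ^ (Nat.log 2 n + 1) * N ≤ 2 * n * n := by
    rcases Nat.eq_zero_or_pos n with rfl | hn
    · simp [Nat.le_zero.1 h]
    · rw [pow_succ]
      have := Nat.pow_log_le_self 2 hn.ne'
      exact Nat.mul_le_mul (by omega) h
  rw [bound]
  nlinarith

/-- As `2 ^ (Nat.log 2 n + 1)` exceeds `n`, block `0` contains all factors after `Nat.log 2 n + 1`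
levels; one round more is spent on reading. The entries are then compared letter by letter, end
marker included. -/
theorem isTrivial_iff {q : ℕ} {x : List Bool} {fs : List (EssIso (Fin q))} (h : Describes x fs) :
    (∀ a < bound q x.length + 1, ∀ t < bound q x.length + 1, ∀ k < q + 1,
      (relAfter q (fun p b => p = b) (IsTrivial q) x.length (fun i => x.getD i false = true)
        (Nat.log 2 x.length + 2) 0 a 0 t k ↔
      relAfter q (fun p b => p = b) (IsTrivial q) x.length (fun i => x.getD i false = true)
        (Nat.log 2 x.length + 2) 0 a 1 t k)) ↔ (fs.map EssIso.toMaxIso).prod = 1 := by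
  obtain ⟨T, hT, rfl⟩ := describes_iff.1 h
  set s := T.flatMap tableStr with hs
  set n := (toBits s).length with hn
  have hNn : s.length ≤ n := by
    rw [hn, length_toBits]
    exact Nat.le_mul_of_pos_right _ (by omega)
  have hl := two_pow_mul_le_bound q hNn
  -- A table goes to the block whose number is its starting position; this avoids counting the
  -- tables.
  obtain ⟨E, hE⟩ := exists_level (B := fun p b => p = b) (Out := IsTrivial q) (F := isoAt 0 T fs)
    (x := fun i => (toBits s).getD i false = true) hT hn (fun _ _ => Iff.rfl)
    (fun b f hf => ⟨b, rfl, hf, fun p' hp' _ => hp'⟩) (fun b hb p hp => hp ▸ hb)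
    (fun p b b' h h' => h.symm.trans h') (fun p b hpb hp => by
      obtain ⟨f, hf⟩ := Option.ne_none_iff_exists'.1 hp
      obtain ⟨t, ht, -⟩ := exists_tableAt_of_isoAt hT hf
      have := ht.bounds.2
      have hl : (tableStr t).length ≠ 0 := by simp [tableStr]
      omega) (Nat.log 2 n + 1) hl
  rw [← hs] at hE
  have hprod : optMaxIso (levelIso (isoAt 0 T fs) (Nat.log 2 n + 1) 0) =
      (fs.map EssIso.toMaxIso).prod := by
    rw [optMaxIso_levelIso, Nat.zero_mul, prod_isoAt hT]
    exact hNn.trans (Nat.lt_pow_succ_log_self (by omega) n).le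
  rw [← hprod]
  have hNW : s.length ≤ bound q n := by
    have := Nat.one_le_two_pow (n := Nat.log 2 n + 1)
    nlinarith
  have h1 : optMaxIso (levelIso (isoAt 0 T fs) (Nat.log 2 n + 1) 0) = 1 ↔
      ∀ a u v, E 0 a u v → u = v := by
    cases hf : levelIso (isoAt 0 T fs) (Nat.log 2 n + 1) 0 with
    | none => exact ⟨fun _ a u v h => (hE.none 0 hf a u v h).elim, fun _ => rfl⟩
    | some f =>
      rw [optMaxIso, Option.elim_some, EssIso.toMaxIso_eq_one_iff]
      constructor
      · exact fun h a u v h' => h u v (((hE.lists 0 f hf).entry u v).1 ⟨a, h'⟩)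
      · intro h u v h'
        obtain ⟨a, ha⟩ := ((hE.lists 0 f hf).entry u v).2 h'
        exact h a u v ha
  rw [h1]
  constructor
  · intro h2 a u v h3
    obtain ⟨-, h4, -⟩ := hE.bounds _ _ _ _ h3
    have h5 := hE.side_length_le h3 0
    have h6 := hE.side_length_le h3 1
    refine spell_inj fun t k => ?_
    have h7 : ∀ {w : List (Fin q)}, w.length ≤ 2 ^ (Nat.log 2 n + 1) * s.length →
        (spell w)[t]? = some k → t ≤ bound q n ∧ k ≤ q := fun hw h =>
      ⟨(le_of_spell h).trans (hw.trans hl), spell_le h⟩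
    have h8 := fun (h : t ≤ bound q n ∧ k ≤ q) => h2 a (by omega) t (by omega) k (by omega)
    have r : ∀ d, d < 2 → k ≤ q → _ := fun d hd hk => hE.reads_entry (t := t) h3 hd hk
    constructor
    · intro h
      have h9 := h7 h5 h
      exact (r 1 (by omega) h9.2).1 ((h8 h9).1 ((r 0 (by omega) h9.2).2 h))
    · intro h
      have h9 := h7 h6 h
      exact (r 0 (by omega) h9.2).1 ((h8 h9).2 ((r 1 (by omega) h9.2).2 h))
  · intro h2 a ha t ht k hk
    rw [hE.reads _ _ _ _ _ (by omega), hE.reads _ _ _ _ _ (by omega)]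
    refine exists_congr fun u => exists_congr fun v => and_congr_right fun h3 => ?_
    obtain rfl := h2 _ _ _ h3
    simp [side]

/-- The final `+ 1` is the round in which the answer is formed from the finished table. -/
theorem mem_wordProblem_iff (x : List Bool) : x ∈ wordProblem ↔
    iterRel (roundMap 2 (fun p b => p = b) (IsTrivial 2)) (relSize 2) x.length
      (fun i => x.getD i false = true) (Nat.log 2 x.length + 2 + 1)
      (tupleCode 5 ![0, 0, 0, 0, 2 + 1]) := by
  have hout := relAfter_out (q := 2) (B := fun p b => p = b) (Out := IsTrivial 2) (n := x.length)
    (x := fun i => x.getD i false = true) (Nat.log 2 x.length + 2) 0 0 (Nat.zero_le _)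
    (Nat.zero_le _)
  rw [relAfter] at hout
  rw [hout, IsTrivial, valid_iff fun i hi => by simp [joinInput, hi]]
  simp only [relAt_joinInput, ← iff_def]
  constructor
  · rintro ⟨fs, h, hp⟩
    exact ⟨⟨fs, h⟩, (isTrivial_iff h).2 hp⟩
  · rintro ⟨⟨fs, h⟩, h'⟩
    exact ⟨fs, h, (isTrivial_iff h).1 h'⟩

theorem definable_wordProblem :
    Definable (fun n => n + relSize 2 n) (roundMap 2 (fun p b => p = b) (IsTrivial 2)) := by
  have hm : LF fun v : Fin 1 → ℕ => v 0 + relSize 2 (v 0) := (LF.var 0).add LF.relSize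
  exact definable_roundMap (m := fun n => n + relSize 2 n) hm (LP.eq (.var 0) (.var 1))
    fun h1 _ _ => definable_isTrivial (m := fun n => n + relSize 2 n) hm h1

theorem tupleCode_answer_lt (n : ℕ) : tupleCode 5 ![0, 0, 0, 0, 2 + 1] < relSize 2 n :=
  tupleCode_lt fun j => by fin_cases j <;> first | exact Nat.zero_le _ | simp [bound]

theorem wordProblem_mem_AC : wordProblem ∈ AC 1 :=
  mem_AC_of_iter (T := fun n => Nat.log 2 n + 2) (c := 2) LF.relSize definable_wordProblem
    (((LF.var 0).log).add (.const 2)) (fun n => by rw [pow_one]; omega) (LF.const _)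
    tupleCode_answer_lt mem_wordProblem_iff

theorem wordProblem_mem_dspace : wordProblem ∈ DSpace fun n => Nat.log 2 n ^ 2 :=
  mem_dspace_of_iter (T := fun n => Nat.log 2 n + 2) (c := 2) LF.relSize definable_wordProblem
    (((LF.var 0).log).add (.const 2)) (fun n => by omega) (LF.const _)
    tupleCode_answer_lt mem_wordProblem_iff

end WordProblem


open Complexity

/-! ### The composition problem -/

section Output

variable {q : ℕ}

/-- The word `w`, followed by blanks up to the length `K`. -/
def pad (K : ℕ) (w : List (Fin q)) : List (Symb q) :=
  w.map .letter ++ List.replicate (K - w.length) .blank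

theorem length_pad {K : ℕ} {w : List (Fin q)} (h : w.length ≤ K) : (pad K w).length = K := by
  simp [pad, h]

theorem strSymb_append {l r : List (Symb q)} {i c : ℕ} : strSymb (l ++ r) i c ↔
    (i < l.length ∧ strSymb l i c) ∨ (l.length ≤ i ∧ strSymb r (i - l.length) c) := by
  rcases lt_or_ge i l.length with h | h
  · rw [and_iff_right h, or_iff_left fun h' => absurd h'.1 (by omega), strSymb, strSymb,
      List.getElem?_append_left h]
  · rw [and_iff_right h, or_iff_right fun h' => absurd h'.1 (by omega), strSymb, strSymb,
      List.getElem?_append_right h]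

theorem strSymb_singleton {σ : Symb q} {i c : ℕ} : strSymb [σ] i c ↔ i = 0 ∧ c = σ.code := by
  rcases i with _ | i
  · simp [strSymb, eq_comm]
  · simp [strSymb]

theorem strSymb_replicate_blank {K i c : ℕ} :
    strSymb (List.replicate K (Symb.blank (q := q))) i c ↔ i < K ∧ c = q := by
  simp only [strSymb, List.getElem?_replicate]
  split_ifs with h
  · simp [h, Symb.code, eq_comm]
  · simp [h]

/-- Blanks stand exactly where the word has no letter, so the padding can be described without the
length of the word. -/
theorem strSymb_pad {K i c : ℕ} {w : List (Fin q)} (hi : i < K) :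
    strSymb (pad K w) i c ↔ (c < q ∧ (spell w)[i]? = some c) ∨
      (c = q ∧ ∀ c' < q, (spell w)[i]? ≠ some c') := by
  rw [pad, strSymb_append, List.length_map, strSymb_replicate_blank]
  rcases lt_or_ge i w.length with h | h
  · have h1 : strSymb (w.map Symb.letter) i c ↔ (w[i] : ℕ) = c := by
      simp [strSymb, h, Symb.code]
    rw [h1, spell_getElem?_of_lt h, Option.some.injEq]
    constructor
    · rintro (⟨-, rfl⟩ | ⟨h2, -⟩)
      · exact Or.inl ⟨w[i].2, rfl⟩
      · omega
    · rintro (⟨-, h2⟩ | ⟨-, h2⟩)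
      · exact Or.inl ⟨h, h2⟩
      · exact (h2 _ w[i].2 rfl).elim
  · constructor
    · rintro (⟨h2, -⟩ | ⟨-, -, rfl⟩)
      · omega
      · refine Or.inr ⟨rfl, fun c' hc' h2 => ?_⟩
        have := lt_of_spell h2 hc'
        omega
    · rintro (⟨hc, h2⟩ | ⟨rfl, -⟩)
      · have := lt_of_spell h2 hc
        omega
      · exact Or.inr ⟨h, by omega, rfl⟩

/-- A slot of length `2 * K + 2`. -/
def slotStr (K : ℕ) : Option (List (Fin q) × List (Fin q)) → List (Symb q)
  | some e => pad K e.1 ++ [.comma] ++ pad K e.2 ++ [.semi]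
  | none => List.replicate (2 * K + 1) .blank ++ [.semi]

theorem writesSlot_slotStr (K : ℕ) (e : Option (List (Fin q) × List (Fin q))) :
    WritesSlot (slotStr K e) e := by
  rcases e with _ | ⟨u, v⟩
  · exact ⟨_, rfl⟩
  · exact ⟨_, _, ⟨_, rfl⟩, ⟨_, rfl⟩, rfl⟩

theorem length_slotStr {K : ℕ} {e : Option (List (Fin q) × List (Fin q))}
    (h : ∀ u v, e = some (u, v) → u.length ≤ K ∧ v.length ≤ K) :
    (slotStr K e).length = 2 * K + 2 := by
  rcases e with _ | ⟨u, v⟩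
  · simp [slotStr]
  · obtain ⟨h1, h2⟩ := h u v rfl
    simp only [slotStr, List.length_append, length_pad h1, length_pad h2, List.length_singleton]
    omega

/-- The symbol `t` of a padded component of an entry. -/
def PadAt (q : ℕ) (R : ℕ → ℕ → ℕ → Prop) (d t c : ℕ) : Prop :=
  (c < q ∧ R d t c) ∨ (c = q ∧ ∀ c' < q, ¬ R d t c')

/-- The symbol `i` of a slot of length `2 * K + 2`. -/
def OutSlot (q K : ℕ) (R : ℕ → ℕ → ℕ → Prop) (i c : ℕ) : Prop :=
  (i < K ∧ PadAt q R 0 i c) ∨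
  (i = K ∧ (((∃ t < K + 1, R 0 t q) ∧ c = q + 1) ∨ (¬ (∃ t < K + 1, R 0 t q) ∧ c = q))) ∨
  ((K < i ∧ i < 2 * K + 1) ∧ PadAt q R 1 (i - (K + 1)) c) ∨ (i = 2 * K + 1 ∧ c = q + 2)

/-- Whether the slot is filled is read off the end marker of the first component, which decides
between a comma and a blank in the middle. All other symbols follow from the letters, and an empty
slot needs no separate case. -/
theorem outSlot_iff {K : ℕ} {R : ℕ → ℕ → ℕ → Prop} {e : Option (List (Fin q) × List (Fin q))}
    (h : ∀ u v, e = some (u, v) → u.length ≤ K ∧ v.length ≤ K)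
    (hR : ∀ d t c, c ≤ q →
      (R d t c ↔ ∃ u v, e = some (u, v) ∧ d < 2 ∧ (spell (side d u v))[t]? = some c))
    {i c : ℕ} : OutSlot q K R i c ↔ strSymb (slotStr K e) i c := by
  rcases e with _ | ⟨u, v⟩
  · have hn : ∀ d t c, c ≤ q → ¬ R d t c := fun d t c hc h => by
      obtain ⟨u, v, h1, -⟩ := (hR d t c hc).1 h
      simp at h1
    have hp : ∀ d t, PadAt q R d t c ↔ c = q := fun d t => by
      rw [PadAt]
      constructor
      · rintro (⟨hc, h⟩ | ⟨hc, -⟩)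
        · exact (hn _ _ _ hc.le h).elim
        · exact hc
      · exact fun hc => Or.inr ⟨hc, fun c' hc' => hn _ _ _ hc'.le⟩
    have ha : ¬ ∃ t < K + 1, R 0 t q := fun ⟨t, _, h⟩ => hn _ _ _ le_rfl h
    rw [OutSlot, hp, hp, slotStr, strSymb_append, strSymb_replicate_blank, strSymb_singleton,
      List.length_replicate, Symb.code]
    simp only [ha, false_and, not_false_eq_true, true_and, false_or]
    omega
  · obtain ⟨h1, h2⟩ := h u v rfl
    have hr : ∀ d < 2, ∀ t c, c ≤ q → (R d t c ↔ (spell (side d u v))[t]? = some c) := by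
      intro d hd t c hc
      rw [hR d t c hc]
      constructor
      · rintro ⟨u', v', he, -, h⟩
        obtain ⟨rfl, rfl⟩ : u = u' ∧ v = v' := by simpa using he
        exact h
      · exact fun h => ⟨u, v, rfl, hd, h⟩
    have hp : ∀ d < 2, ∀ t < K, PadAt q R d t c ↔ strSymb (pad K (side d u v)) t c := by
      intro d hd t ht
      rw [PadAt, strSymb_pad ht]
      refine or_congr (and_congr_right fun hc => hr d hd t c hc.le) (and_congr_right fun _ => ?_)
      exact forall₂_congr fun c' hc' => not_congr (hr d hd t c' hc'.le)
    have ha : ∃ t < K + 1, R 0 t q :=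
      ⟨u.length, by omega, (hr 0 (by omega) _ _ le_rfl).2 spell_length⟩
    rw [OutSlot, slotStr]
    simp only [strSymb_append, strSymb_singleton, List.length_append, length_pad h1, length_pad h2,
      List.length_singleton, Symb.code, ha, true_and, not_true_eq_false, false_and, or_false]
    constructor
    · rintro (⟨h3, h4⟩ | ⟨rfl, rfl⟩ | ⟨⟨h3, h3'⟩, h4⟩ | ⟨rfl, rfl⟩)
      · exact Or.inl ⟨by omega, Or.inl ⟨by omega, Or.inl ⟨h3, (hp 0 (by omega) _ h3).1 h4⟩⟩⟩
      · exact Or.inl ⟨by omega, Or.inl ⟨by omega, Or.inr ⟨le_rfl, by omega, rfl⟩⟩⟩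
      · exact Or.inl ⟨by omega, Or.inr ⟨by omega, (hp 1 (by omega) _ (by omega)).1 h4⟩⟩
      · exact Or.inr ⟨by omega, by omega, rfl⟩
    · rintro (⟨h3, ⟨h4, (⟨h5, h6⟩ | ⟨h5, h6, rfl⟩)⟩ | ⟨h4, h5⟩⟩ | ⟨h3, h4, rfl⟩)
      · exact Or.inl ⟨h5, (hp 0 (by omega) _ h5).2 h6⟩
      · exact Or.inr (Or.inl ⟨by omega, rfl⟩)
      · exact Or.inr (Or.inr (Or.inl ⟨by omega, (hp 1 (by omega) _ (by omega)).2 h5⟩))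
      · exact Or.inr (Or.inr (Or.inr ⟨by omega, rfl⟩))

theorem getElem?_flatMap_of_length {α β : Type} {g : α → List β} {w : ℕ} {l : List α}
    (h : ∀ x ∈ l, (g x).length = w) (i : ℕ) {j : ℕ} (hj : j < w) :
    (l.flatMap g)[i * w + j]? = (l[i]?).bind fun x => (g x)[j]? := by
  induction l generalizing i with
  | nil => simp
  | cons x l ih =>
    have hx := h x (by simp)
    rw [List.flatMap_cons]
    rcases i with _ | i
    · rw [List.getElem?_append_left (by omega)]
      simp
    · rw [List.getElem?_append_right (by rw [Nat.add_mul]; omega), List.getElem?_cons_succ,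
        ← ih (fun y hy => h y (by simp [hy])) i]
      congr 1
      rw [Nat.add_mul]
      omega

/-- The symbol number `p` of the output. -/
def OutTable (q : ℕ) (y : ℕ → Prop) (n p c : ℕ) : Prop :=
  (p < numSymb q n * (2 * (2 * numSymb q n) + 2) ∧
    OutSlot q (2 * numSymb q n) (relAt y n 0 (p / (2 * (2 * numSymb q n) + 2)))
      (p % (2 * (2 * numSymb q n) + 2)) c) ∨
  (p = numSymb q n * (2 * (2 * numSymb q n) + 2) ∧ c = q + 3)

/-- With slots of equal length, slot and offset are quotient and remainder of the position. This is
what blanks and empty slots are for: variable lengths would require sums of lengths. -/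
theorem strSymb_tableStr {t : List (Slot q)} {w : ℕ} (h : ∀ x ∈ t, x.1.length = w) (hw : 0 < w)
    {p c : ℕ} : strSymb (tableStr t) p c ↔
      (p < t.length * w ∧ ∃ x, t[p / w]? = some x ∧ strSymb x.1 (p % w) c) ∨
        (p = t.length * w ∧ c = q + 3) := by
  have hl : (t.flatMap Prod.fst).length = t.length * w := by
    rw [List.length_flatMap, List.map_congr_left h, List.map_const', List.sum_replicate, smul_eq_mul]
  rw [tableStr, strSymb_append, hl, strSymb_singleton, Symb.code]
  refine or_congr (and_congr_right fun hp => ?_) (by omega)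
  rw [strSymb, ← Nat.div_add_mod' p w, getElem?_flatMap_of_length h _ (Nat.mod_lt _ hw),
    Nat.div_add_mod']
  simp only [Option.bind_eq_some_iff, strSymb]
  constructor
  · rintro ⟨σ, ⟨x, h1, h2⟩, h3⟩
    exact ⟨x, h1, σ, h2, h3⟩
  · rintro ⟨x, h1, σ, h2, h3⟩
    exact ⟨σ, ⟨x, h1, h2⟩, h3⟩

open Classical in
/-- The entry with a given number, for a functional relation. -/
noncomputable def entryOf (E : ℕ → List (Fin q) → List (Fin q) → Prop) (a : ℕ) :
    Option (List (Fin q) × List (Fin q)) :=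
  if h : ∃ e : List (Fin q) × List (Fin q), E a e.1 e.2 then some h.choose else none

theorem entryOf_eq_some {E : ℕ → List (Fin q) → List (Fin q) → Prop}
    (hE : ∀ a u v u' v', E a u v → E a u' v' → u = u' ∧ v = v') {a : ℕ} {u v : List (Fin q)} :
    entryOf E a = some (u, v) ↔ E a u v := by
  rw [entryOf]
  split_ifs with h
  · have h1 := h.choose_spec
    constructor
    · intro h2
      rw [Option.some.injEq] at h2
      rwa [h2] at h1
    · intro h2
      obtain ⟨h3, h4⟩ := hE _ _ _ _ _ h1 h2
      exact congrArg some (Prod.ext h3 h4)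
  · exact ⟨fun h' => by simp at h', fun h' => (h ⟨(u, v), h'⟩).elim⟩

/-- The table that is put out. -/
noncomputable def outTable (N K : ℕ) (E : ℕ → List (Fin q) → List (Fin q) → Prop) : List (Slot q) :=
  (List.range N).map fun a => (slotStr K (entryOf E a), entryOf E a)

/-- There is a slot for every possible number; those without an entry are left empty and disappear
from the list. -/
theorem isTable_outTable {N K : ℕ} {E : ℕ → List (Fin q) → List (Fin q) → Prop}
    {f : EssIso (Fin q)} (hf : Lists E f) (hN : ∀ a u v, E a u v → a < N) :
    IsTable ((outTable N K E).map Prod.snd).reduceOption f := by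
  have h : ((outTable N K E).map Prod.snd).reduceOption = (List.range N).filterMap (entryOf E) := by
    rw [outTable, List.map_map, List.reduceOption, List.filterMap_map]
    rfl
  have hfun := hf.functional
  rw [isTable_iff, h]
  refine ⟨List.Nodup.filterMap ?_ List.nodup_range, fun u v => ?_⟩
  · rintro a a' ⟨u, v⟩ h1 h2
    exact hf.inj a a' u v ((entryOf_eq_some hfun).1 h1) ((entryOf_eq_some hfun).1 h2)
  · rw [List.mem_filterMap, ← hf.entry]
    refine exists_congr fun a => ?_
    rw [entryOf_eq_some hfun, List.mem_range]
    exact and_iff_right_of_imp (hN a u v)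

end Output

/-! ### The iteration that solves the composition problem -/

section Composition

variable {q k : ℕ} {m : ℕ → ℕ} {f1 f2 f3 : (Fin (k + 1) → ℕ) → ℕ}

theorem definable_padAt (hm : LF fun v : Fin 1 → ℕ => m (v 0)) {a t : (Fin (k + 1) → ℕ) → ℕ}
    (h1 : LF f1) (ha : LF a) (ht : LF t) (h3 : LF f3) (d : ℕ) :
    Definable m fun y v => PadAt q (relAt y (f1 v) 0 (a v)) d (t v) (f3 v) :=
  ((Definable.atom hm (LP.lt h3 (.const q))).and hm
    (definable_relAt hm h1 .zero ha (.const d) ht h3)).or hm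
    ((Definable.atom hm (LP.eq h3 (.const q))).and hm (Definable.all hm (.const q)
      ((definable_relAt hm h1.lift .zero ha.lift (.const d) ht.lift (.var 0)).not hm)))

theorem definable_outTable (hm : LF fun v : Fin 1 → ℕ => m (v 0)) (h1 : LF f1) (h2 : LF f2)
    (h3 : LF f3) : Definable m fun y v => OutTable q y (f1 v) (f2 v) (f3 v) := by
  have hN : LF fun v => numSymb q (f1 v) := LF.numSymb h1
  have hK : LF fun v => 2 * numSymb q (f1 v) := (LF.const 2).mul hN
  have hw : LF fun v => 2 * (2 * numSymb q (f1 v)) + 2 := ((LF.const 2).mul hK).add (.const 2)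
  have ha := h2.div hw
  have hi := h2.mod hw
  have act : Definable m fun y v => ∃ t < 2 * numSymb q (f1 v) + 1,
      relAt y (f1 v) 0 (f2 v / (2 * (2 * numSymb q (f1 v)) + 2)) 0 t q :=
    Definable.ex hm hK.succ (definable_relAt hm h1.lift .zero ha.lift .zero (.var 0) (.const q))
  refine ((Definable.atom hm (LP.lt h2 (hN.mul hw))).and hm
    (((Definable.atom hm (LP.lt hi hK)).and hm (definable_padAt hm h1 ha hi h3 0)).or hm
    (((Definable.atom hm (LP.eq hi hK)).and hm
      ((act.and hm (Definable.atom hm (LP.eq h3 (.const (q + 1))))).or hm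
        ((act.not hm).and hm (Definable.atom hm (LP.eq h3 (.const q)))))).or hm
    (((Definable.atom hm ((LP.lt hK hi).and (LP.lt hi ((LF.const 2).mul hK).succ))).and hm
      (definable_padAt hm h1 ha (hi.sub hK.succ) h3 1)).or hm
    (Definable.atom hm ((LP.eq hi ((LF.const 2).mul hK).succ).and
      (LP.eq h3 (.const (q + 2))))))))).or hm
    (Definable.atom hm ((LP.eq h2 (hN.mul hw)).and (LP.eq h3 (.const (q + 3)))))

/-- The first table is put into block `1`, the second one into block `0`. -/
def compBlock (p b : ℕ) : Prop := (p = 0 ∧ b = 1) ∨ (p ≠ 0 ∧ b = 0)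

/-- The length of the output, in symbols. -/
def outLen (q n : ℕ) : ℕ := numSymb q n * (2 * (2 * numSymb q n) + 2) + 1

/-- Positions of output symbols are used as components of tuples, so `bound` has to exceed them.
This needs a quadratic `bound` even for one composition. -/
theorem outLen_le (q n : ℕ) : outLen q n ≤ bound q n := by
  have h : numSymb q n ≤ n := Nat.div_le_self _ _
  rw [outLen, bound]
  nlinarith

open Classical in
/-- The output of the algorithm for the composition problem. -/
noncomputable def compOutput (q : ℕ) (x : List Bool) : List Bool :=
  (List.range (outLen q x.length * (q + 4))).map fun j =>
    decide (relAfter q compBlock (OutTable q) x.length (fun i => x.getD i false = true) 3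
      (j / (q + 4)) (j % (q + 4)) 0 0 (q + 1))

theorem getElem_compOutput {x : List Bool} {j : ℕ} (hj : j < (compOutput q x).length) :
    (compOutput q x)[j] = true ↔ relAfter q compBlock (OutTable q) x.length
      (fun i => x.getD i false = true) 3 (j / (q + 4)) (j % (q + 4)) 0 0 (q + 1) := by
  unfold compOutput at hj ⊢
  simp only [List.getElem_map, List.getElem_range, decide_eq_true_eq]

/-- Three rounds suffice: reading, composing, writing. Inputs that do not describe a pair need no
attention, since nothing is required of the output there. -/
theorem exists_outTable {φ ψ : EssIso (Fin q)} {x : List Bool} (h : Describes x [φ, ψ]) :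
    ∃ t : List (Slot q), SlotsOK t ∧ IsTable (t.map Prod.snd).reduceOption (ψ.comp φ) ∧
      (tableStr t).length = outLen q x.length ∧ ∀ p c, p ≤ bound q x.length → c ≤ bound q x.length →
        (relAfter q compBlock (OutTable q) x.length (fun i => x.getD i false = true) 3
          p c 0 0 (q + 1) ↔ strSymb (tableStr t) p c) := by
  obtain ⟨T, hT, rfl⟩ := describes_iff.1 h
  obtain ⟨t₁, t₂, rfl⟩ : ∃ t₁ t₂, T = [t₁, t₂] := by
    have := hT.length_eq
    exact List.length_eq_two.1 this
  have hl : ∀ t : List (Slot q), (tableStr t).length ≠ 0 := fun t => by simp [tableStr]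
  set s := [t₁, t₂].flatMap tableStr with hs
  have hsl : s.length = (tableStr t₁).length + (tableStr t₂).length := by simp [hs]
  have hl1 := hl t₁
  have hl2 := hl t₂
  set n := (toBits s).length with hn
  have hN : numSymb q n = s.length := numSymb_toBits s
  have hNn : s.length ≤ n := by rw [← hN]; exact Nat.div_le_self _ _
  have hiso : ∀ p, isoAt 0 [t₁, t₂] [φ, ψ] p =
      if p = 0 then some φ else if p = (tableStr t₁).length then some ψ else none := fun p => by
    simp [isoAt]
  -- The first isomorphism is put into the odd block because that is the one applied first. One
  -- level of composition leaves `ψ.comp φ` in block `0`.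
  obtain ⟨E, hE⟩ := exists_level (B := compBlock) (Out := OutTable q)
    (x := fun i => (toBits s).getD i false = true)
    (F := fun b => if b = 0 then some ψ else if b = 1 then some φ else none)
    hT hn (fun _ _ => Iff.rfl)
    (fun b f hf => by
      split_ifs at hf with h0 h1
      · refine ⟨(tableStr t₁).length, Or.inr ⟨hl1, h0⟩, by rw [hiso, if_neg hl1, if_pos rfl, hf], ?_⟩
        intro p' hp' hne
        rw [hiso] at hne
        by_contra hc
        rcases hp' with ⟨-, h⟩ | ⟨h, -⟩
        · omega
        · simp [h, hc] at hne
      · refine ⟨0, Or.inl ⟨rfl, h1⟩, by rw [hiso, if_pos rfl, hf], ?_⟩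
        rintro p' (⟨h, -⟩ | ⟨-, h⟩) -
        · exact h
        · exact (h0 h).elim)
    (fun b hb p hp => by
      split_ifs at hb with h0 h1
      rcases hp with ⟨-, h⟩ | ⟨-, h⟩
      · exact (h1 h).elim
      · exact (h0 h).elim)
    (fun p b b' h h' => by rw [compBlock] at h h'; omega)
    (fun p b hpb _ => by
      rw [← hs, hsl]
      rw [compBlock] at hpb
      omega) 1 (by rw [← hs, bound]; nlinarith)
  rw [← hs] at hE
  have hlist := hE.lists 0 (ψ.comp φ) rfl
  have hfun := hlist.functional
  have hb : ∀ a u v, entryOf (E 0) a = some (u, v) → a < s.length ∧ u.length ≤ 2 * s.length ∧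
      v.length ≤ 2 * s.length := fun a u v h =>
    (hE.bounds _ _ _ _ ((entryOf_eq_some hfun).1 h)).2
  have hlen : ∀ x ∈ outTable s.length (2 * s.length) (E 0), x.1.length = 2 * (2 * s.length) + 2 := by
    intro x hx
    obtain ⟨a, -, rfl⟩ := List.mem_map.1 hx
    exact length_slotStr fun u v h => (hb a u v h).2
  have htl : (outTable s.length (2 * s.length) (E 0)).length = s.length := by simp [outTable]
  refine ⟨outTable s.length (2 * s.length) (E 0), ?_, isTable_outTable hlist fun a u v h =>
    (hE.bounds _ _ _ _ h).2.1, ?_, fun p c hp hc => ?_⟩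
  · intro x hx
    obtain ⟨a, -, rfl⟩ := List.mem_map.1 hx
    exact writesSlot_slotStr _ _
  · rw [outLen, hN, tableStr, List.length_append, List.length_flatMap, List.map_congr_left hlen,
      List.map_const', List.sum_replicate, smul_eq_mul, htl]
    rfl
  · have hrel : relAt (joinInput n (fun i => (toBits s).getD i false = true)
        (iterRel (roundMap q compBlock (OutTable q)) (relSize q) n
          (fun i => (toBits s).getD i false = true) 2)) n =
        relAfter q compBlock (OutTable q) n (fun i => (toBits s).getD i false = true) 2 := by
      funext b a d i k
      exact propext relAt_joinInput
    rw [relAfter_out _ _ _ hp hc, OutTable, hrel, hN, strSymb_tableStr hlen (by omega), htl]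
    refine or_congr (and_congr_right fun hp' => ?_) Iff.rfl
    have hdiv : p / (2 * (2 * s.length) + 2) < s.length :=
      Nat.div_lt_of_lt_mul (by rwa [Nat.mul_comm])
    set a := p / (2 * (2 * s.length) + 2)
    rw [outSlot_iff (e := entryOf (E 0) a) (fun u v h => (hb a u v h).2)
      (fun d t c hc => by rw [hE.reads _ _ _ _ _ hc]; simp only [entryOf_eq_some hfun])]
    have hget : (outTable s.length (2 * s.length) (E 0))[a]? =
        some (slotStr (2 * s.length) (entryOf (E 0) a), entryOf (E 0) a) := by
      rw [outTable, List.getElem?_map, List.getElem?_range hdiv]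
      rfl
    rw [hget]
    simp

theorem compositionProblem_compOutput (q : ℕ) (x : List Bool) :
    CompositionProblem q x (compOutput q x) := by
  intro φ ψ h
  obtain ⟨t, h1, h2, h3, h4⟩ := exists_outTable h
  refine describes_iff.2 ⟨[t], .cons ⟨h1, h2⟩ .nil, ?_⟩
  rw [List.flatMap_singleton]
  have hl : (compOutput q x).length = (tableStr t).length * (q + 4) := by simp [compOutput, h3]
  refine List.ext_getElem (by rw [hl, length_toBits]) fun j hj hj' => ?_
  rw [hl] at hj
  have hp : j / (q + 4) < (tableStr t).length := Nat.div_lt_of_lt_mul (by rwa [Nat.mul_comm])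
  have hm : j % (q + 4) < q + 4 := Nat.mod_lt _ (by omega)
  have hout := outLen_le q x.length
  have h5 := getElem?_toBits (tableStr t) (j / (q + 4)) hm
  rw [Nat.div_add_mod', List.getElem?_eq_getElem hj', List.getElem?_eq_getElem hp, Option.map_some,
    Option.some.injEq] at h5
  rw [Bool.eq_iff_iff, getElem_compOutput, h5, decide_eq_true_iff,
    h4 _ _ (by omega) (by rw [bound]; omega), strSymb, List.getElem?_eq_getElem hp]
  simp [eq_comm]

theorem compositionProblem_inAC (q : ℕ) : InAC 0 (CompositionProblem q) := by
  have hm : LF fun v : Fin 1 → ℕ => v 0 + relSize q (v 0) := (LF.var 0).add LF.relSize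
  have hB : LP fun v : Fin 2 → ℕ => compBlock (v 0) (v 1) :=
    ((LP.eq (.var 0) .zero).and (LP.eq (.var 1) (.const 1))).or
      ((LP.eq (.var 0) .zero).not.and (LP.eq (.var 1) .zero))
  have hN : LF fun v : Fin 1 → ℕ => numSymb q (v 0) := LF.numSymb (.var 0)
  have ho : LF fun v : Fin 1 → ℕ => outLen q (v 0) :=
    (hN.mul (((LF.const 2).mul ((LF.const 2).mul hN)).add (.const 2))).succ
  have hidx : LF fun v : Fin 2 → ℕ =>
      tupleCode 5 ![v 1 / (q + 4), v 1 % (q + 4), 0, 0, q + 1] := by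
    refine (LF.tupleCode 5 (f := ![fun v : Fin 2 → ℕ => v 1 / (q + 4), fun v => v 1 % (q + 4),
      fun _ => 0, fun _ => 0, fun _ => q + 1]) ?_).congr fun v => ?_
    · intro i
      fin_cases i
      · exact (LF.var 1).div (.const _)
      · exact (LF.var 1).mod (.const _)
      · exact .zero
      · exact .zero
      · exact .const _
    · congr 1
      funext i
      fin_cases i <;> rfl
  refine inAC_of_iter (r := relSize q) (Φ := roundMap q compBlock (OutTable q)) LF.relSize
    (definable_roundMap (m := fun n => n + relSize q n) hm hB fun h1 h2 h3 =>
      definable_outTable (m := fun n => n + relSize q n) hm h1 h2 h3)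
    -- The iteration has `T + 1 = 3` rounds for every input length, hence constant depth.
    (T := fun _ => 2) (c := 2) (.const 2) (fun n => by omega)
    (o := fun n => outLen q n * (q + 4))
    (idx := fun _ j => tupleCode 5 ![j / (q + 4), j % (q + 4), 0, 0, q + 1])
    (ho.mul (.const _)) hidx (fun n j hj => tupleCode_lt fun i => ?_)
    (compositionProblem_compOutput q) (fun x => by simp [compOutput]) fun x j hj => ?_
  · have h1 := outLen_le q n
    have h2 : j / (q + 4) < outLen q n := Nat.div_lt_of_lt_mul (by rwa [Nat.mul_comm])
    have h3 : j % (q + 4) < q + 4 := Nat.mod_lt _ (by omega)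
    have h4 : q + 4 ≤ bound q n := by rw [bound]; omega
    fin_cases i
    · exact (h2.trans_le h1).le
    · exact (h3.trans_le h4).le
    · exact Nat.zero_le _
    · exact Nat.zero_le _
    · change q + 1 ≤ bound q n
      omega
  · exact getElem_compOutput hj

end Composition

end Thompson

theorem mainTheorem5 :
    (∀ q : ℕ, 2 ≤ q → Complexity.InAC 0 (Thompson.CompositionProblem q)) ∧
      Thompson.wordProblem ∈ Complexity.AC 1 ∧
      Thompson.wordProblem ∈ Complexity.DSpace (fun n => (Nat.log 2 n) ^ 2) :=
  ⟨fun q _ => Thompson.compositionProblem_inAC q, Thompson.wordProblem_mem_AC,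
    Thompson.wordProblem_mem_dspace⟩
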